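/- Let $M$ be a smooth manifold of dimension $m$ (Hausdorff, second countable) and let $A\to M$ be a smooth real (or complex) vector bundle of rank $n$. Suppose that $A$ and its dual $A^*$ each carry a Lie algebroid structure, with brackets $[\cdot,\cdot]$, $[\cdot,\cdot]_*$, anchors $a:A\to TM$, $a_*:A^*\to TM$ (with values in $TM\otimes\mathbb C$ and complex valued functions and forms in the complex case) and Lie algebroid differentials $d$ on $\Gamma(\wedge^\bullet A^*)$ and $d_*$ on $\Gamma(\wedge^\bullet A)$. The pair $(A,A^*)$ is a *Lie bialgebroid* if $d_*$ is a derivation of the Schouten bracket on $\Gamma(\wedge^\bullet A)$: $d_*[u,v]=[d_*u,v]+(-1)^{k-1}[u,d_*v]$ for all $u\in\Gamma(\wedge^kA)$, $v\in\Gamma(\wedge^lA)$, $k,l\ge 0$. The Lie algebroid $A^*$ acts on $\Gamma(\wedge^nA^*\otimes\wedge^mT^*M)$ by $$\mathcal L_\theta(\alpha_1\wedge\dots\wedge\alpha_n\otimes\mu)=\sum_{i=1}^n\alpha_1\wedge\dots\wedge[\theta,\alpha_i]_*\wedge\dots\wedge\alpha_n\otimes\mu+\alpha_1\wedge\dots\wedge\alpha_n\otimes\mathcal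 L_{a_*(\theta)}\mu ,$$ and $A$ acts on $\Gamma(\wedge^nA\otimes\wedge^mT^*M)$ in the same way. Suppose that the line bundle $\wedge^nA^*\otimes\wedge^mT^*M$ has a square root $\mathscr L$, that is, a line bundle with an isomorphism of $\mathscr L\otimes\mathscr L$ with it. Then there is a unique action $\nabla$ of $A^*$ on $\mathscr L$ with $\nabla_\theta l\otimes l'+l\otimes\nabla_\theta l'=\mathcal L_\theta(l\otimes l')$; let $\bar d_*:\Gamma(\wedge^kA\otimes\mathscr L)\to\Gamma(\wedge^{k+1}A\otimes\mathscr L)$ be its differential. Likewise $\wedge^nA\otimes\mathscr L$ is a square root of $\wedge^nA\otimes\wedge^mT^*M$, hence an $A$-module, with a differential $\bar d$ on $\Gamma(\wedge^kA^*\otimes\wedge^nA\otimes\mathscr L)$. Let $\Phi_k:\wedge^{n-k}A\otimes\mathscr L\to\wedge^kA^*\otimes(\wedge^nA\otimes\mathscr L)$ be the isomorphism $\Phi_k(u)(X_1,\dots,X_k)=X_1\wedge\dots\wedge X_k\wedge u$, and define $\bar\partial:\Gamma(\wedge^{n-k}A\otimes\mathscr L)\to\Gamma(\wedge^{n-k-1}A\otimes\mathscr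 L)$ by $\bar\partial=(-1)^k\,\Phi_{k+1}^{-1}\circ\bar d\circ\Phi_k$ (and $\bar\partial=0$ for $k=n$). Put $\mathcal D=\bar d_*+\bar\partial$ on $\Gamma(\wedge A\otimes\mathscr L)$. Let $\mathcal D_*$ be the operator on $\Gamma(\wedge A^*\otimes\mathscr L_*)$ obtained by exchanging $A$ and $A^*$, where $\mathscr L_*$ is a square root of $\wedge^nA\otimes\wedge^mT^*M$. Then $(A,A^*)$ is a Lie bialgebroid if and only if there is a smooth function $\varphi$ on $M$ such that $\mathcal D^2$ is multiplication by $\varphi$. Moreover, if $\mathcal D^2$ is multiplication by $\varphi$, then: 1. $\mathcal D_*^2$ is multiplication by the same function $\varphi$. 2. On every open set $U$ on which there are a volume form $s$ and sections $\Omega$ of $\wedge^nA^*$ and $V$ of $\wedge^nA$ with $\langle\Omega,V\rangle=1$, one has $$\varphi=\tfrac12\left(\tfrac12\langle\xi_0,X_0\rangle-\partial X_0\right),$$ where $X_0$ and $\xi_0$ are the sections of $A$ and $A^*$ determined on $U$ by $\mathcal L_\theta(\Omega\otimes s)=\langle X_0,\theta\rangle\,\Omega\otimes s$ for all $\theta\in\Gamma(A^*)$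 and $\mathcal L_X(V\otimes s)=\langle\xi_0,X\rangle\,V\otimes s$ for all $X\in\Gamma(A)$, and where $\partial X_0$ is the function with $\mathcal L_{X_0}\Omega=d\,\iota_{X_0}\Omega=-(\partial X_0)\,\Omega$. -/

import Mathlib

open scoped TensorProduct

namespace LieBialgd

noncomputable section

section Algebra

variable {R : Type*} [CommRing R] [Algebra ℝ R]
variable {E : Type*} [AddCommGroup E] [Module R E]
variable {E' : Type*} [AddCommGroup E'] [Module R E']
variable {N : Type*} [AddCommGroup N] [Module R N]
variable {L : Type*} [AddCommGroup L] [Module R L]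

/-- An additive endomorphism `δ` of the `R`-module `N` that is a derivation over the derivation
`D` of `R`: `δ (f • x) = D f • x + f • δ x`. -/
structure DerEnd (D : Derivation ℝ R R) (N : Type*) [AddCommGroup N] [Module R N]
    extends N →+ N where
  leibniz' : ∀ (f : R) (x : N), toFun (f • x) = D f • x + f • toFun x

namespace DerEnd

variable {D : Derivation ℝ R R}

instance : CoeFun (DerEnd D N) (fun _ => N → N) := ⟨fun δ => δ.toAddMonoidHom⟩

theorem leibniz (δ : DerEnd D N) (f : R) (x : N) : δ (f • x) = D f • x + f • δ x :=
  δ.leibniz' f x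

/-- A derivation of `R`, acting on the module `R`. -/
def self (D : Derivation ℝ R R) : DerEnd D R where
  toFun := D
  map_zero' := map_zero D
  map_add' := map_add D
  leibniz' f x := by simp [mul_comm, add_comm]

/-- The commutator with a vector field `D`, acting on vector fields. -/
def lie (D : Derivation ℝ R R) : DerEnd D (Derivation ℝ R R) where
  toFun X := ⁅D, X⁆
  map_zero' := lie_zero D
  map_add' := lie_add D
  leibniz' f X := by
    ext g
    simp [Derivation.commutator_apply]
    ring

theorem sum_update_add {k : ℕ} (δ : DerEnd D E) (ω : E [⋀^Fin k]→ₗ[R] N) (X : Fin k → E)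
    (i : Fin k) (x y : E) :
    ∑ j, ω (Function.update (Function.update X i (x + y)) j
        (δ (Function.update X i (x + y) j))) =
      ∑ j, ω (Function.update (Function.update X i x) j (δ (Function.update X i x j))) +
      ∑ j, ω (Function.update (Function.update X i y) j (δ (Function.update X i y j))) := by
  rw [← Finset.sum_add_distrib]
  refine Finset.sum_congr rfl fun j _ => ?_
  by_cases h : j = i
  · subst h; simp
  · simp only [Function.update_of_ne h, Function.update_comm (Ne.symm h), ω.map_update_add]

theorem sum_update_smul {k : ℕ} (δ : DerEnd D E) (ω : E [⋀^Fin k]→ₗ[R] N) (X : Fin k → E)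
    (i : Fin k) (f : R) (x : E) :
    ∑ j, ω (Function.update (Function.update X i (f • x)) j
        (δ (Function.update X i (f • x) j))) =
      D f • ω (Function.update X i x) +
      f • ∑ j, ω (Function.update (Function.update X i x) j (δ (Function.update X i x j))) := by
  rw [Finset.smul_sum, ← Finset.add_sum_erase _ _ (Finset.mem_univ i),
    ← Finset.add_sum_erase _ _ (Finset.mem_univ i), ← add_assoc]
  congr 1
  · simp [δ.leibniz]
  · refine Finset.sum_congr rfl fun j hj => ?_
    have h : j ≠ i := Finset.ne_of_mem_erase hj
    simp only [Function.update_of_ne h, Function.update_comm h.symm, ω.map_update_smul]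

/-- The Lie derivative of an `N`-valued alternating `k`-form on `E`, for given actions `δ` on `E`
and `ν` on `N`: `(L ω)(X₁, …, X_k) = ν (ω (X₁, …, X_k)) - ∑ⱼ ω (X₁, …, δ Xⱼ, …, X_k)`. -/
def altForm {k : ℕ} (δ : DerEnd D E) (ν : DerEnd D N) (ω : E [⋀^Fin k]→ₗ[R] N) :
    E [⋀^Fin k]→ₗ[R] N where
  toFun X := ν (ω X) - ∑ j, ω (Function.update X j (δ (X j)))
  map_update_add' := by
    intro inst X i x y
    obtain rfl : inst = instDecidableEqFin k := Subsingleton.elim _ _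
    rw [sum_update_add, ω.map_update_add, map_add]
    abel
  map_update_smul' := by
    intro inst X i f x
    obtain rfl : inst = instDecidableEqFin k := Subsingleton.elim _ _
    rw [sum_update_smul, ω.map_update_smul, ν.leibniz, smul_sub]
    abel
  map_eq_zero_of_eq' X i j hX hij := by
    rw [ω.map_eq_zero_of_eq X hX hij, map_zero, zero_sub, neg_eq_zero,
      ← Finset.add_sum_erase _ _ (Finset.mem_univ i),
      ← Finset.add_sum_erase _ _ (Finset.mem_erase.2 ⟨hij.symm, Finset.mem_univ j⟩),
      Finset.sum_eq_zero, add_zero]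
    · rw [← ω.map_swap_add (Function.update X j (δ (X j))) hij]
      congr 2
      ext a
      rcases eq_or_ne a i with rfl | ha
      · simp [hX]
      · rcases eq_or_ne a j with rfl | hb
        · simp [Function.update_of_ne hij.symm, Function.update_of_ne hij, hX]
        · simp [Equiv.swap_apply_of_ne_of_ne ha hb, Function.update_of_ne ha,
            Function.update_of_ne hb]
    · intro a ha
      have h1 : a ≠ j := (Finset.mem_erase.1 ha).1
      have h2 : a ≠ i := (Finset.mem_erase.1 (Finset.mem_erase.1 ha).2).1
      refine ω.map_eq_zero_of_eq _ ?_ hij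
      rw [Function.update_of_ne h1.symm, Function.update_of_ne h2.symm, hX]

/-- The Lie derivative of alternating forms, as an endomorphism over `D`. -/
def alt (k : ℕ) (δ : DerEnd D E) (ν : DerEnd D N) : DerEnd D (E [⋀^Fin k]→ₗ[R] N) where
  toFun := altForm δ ν
  map_zero' := by ext X; simp [altForm]
  map_add' ω η := by
    ext X
    simp [altForm, Finset.sum_add_distrib]
    abel
  leibniz' f ω := by
    ext X
    simp [altForm, ν.leibniz, smul_sub, Finset.smul_sum]
    abel

theorem alt_apply {k : ℕ} (δ : DerEnd D E) (ν : DerEnd D N) (ω : E [⋀^Fin k]→ₗ[R] N)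
    (X : Fin k → E) :
    δ.alt k ν ω X = ν (ω X) - ∑ j, ω (Function.update X j (δ (X j))) := rfl

/-- The action on `E'` dual to an action on `E`, for a perfect pairing `p` of `E` and `E'`:
`⟨X, δ' θ⟩ = D ⟨X, θ⟩ - ⟨δ X, θ⟩`. -/
def dual (p : E →ₗ[R] E' →ₗ[R] R) [p.IsPerfPair] (δ : DerEnd D E) : DerEnd D E' where
  toFun θ := p.flip.toPerfPair.symm
    { toFun := fun X => D (p X θ) - p (δ X) θ
      map_add' := fun X Y => by simp; abel
      map_smul' := fun f X => by simp [δ.leibniz]; ring }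
  map_zero' := by
    rw [LinearEquiv.symm_apply_eq]
    ext X; simp
  map_add' θ η := by
    rw [LinearEquiv.symm_apply_eq]
    ext X; simp; abel
  leibniz' f θ := by
    rw [LinearEquiv.symm_apply_eq]
    ext X; simp; ring

theorem pairing_dual (p : E →ₗ[R] E' →ₗ[R] R) [p.IsPerfPair] (δ : DerEnd D E) (X : E) (θ : E') :
    p X (δ.dual p θ) = D (p X θ) - p (δ X) θ := by
  simp [dual]

end DerEnd

/-- The module `Γ(∧ᵐ T*M)` of `m`-forms, `R` being the ring of smooth functions. -/
abbrev TopForm (R : Type*) [CommRing R] [Algebra ℝ R] (m : ℕ) :=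
  Derivation ℝ R R [⋀^Fin m]→ₗ[R] R

/-- The ordinary Lie derivative of `m`-forms along the vector field `D`. -/
def lieForm (m : ℕ) (D : Derivation ℝ R R) : DerEnd D (TopForm R m) :=
  (DerEnd.lie D).alt m (DerEnd.self D)

/-- A Lie algebroid structure, given on the module `E = Γ(A)` of sections over the ring `R` of smooth
functions; vector fields are derivations of `R`. Bilinearity over `ℝ` (over `ℂ` for complex `R`)
follows from the Leibniz rule, since derivations vanish on constants. -/
structure LieAlgebroid (R : Type*) [CommRing R] [Algebra ℝ R] (E : Type*) [AddCommGroup E]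
    [Module R E] where
  bracket : E →+ E →+ E
  anchor : E →ₗ[R] Derivation ℝ R R
  bracket_self : ∀ X, bracket X X = 0
  jacobi : ∀ X Y Z,
    bracket X (bracket Y Z) = bracket (bracket X Y) Z + bracket Y (bracket X Z)
  leibniz : ∀ X (f : R) Y, bracket X (f • Y) = anchor X f • Y + f • bracket X Y
  anchor_bracket : ∀ X Y, anchor (bracket X Y) = ⁅anchor X, anchor Y⁆

namespace LieAlgebroid

variable (𝔞 : LieAlgebroid R E)

/-- `[X, ·]` acting on sections. -/
def ad (X : E) : DerEnd (𝔞.anchor X) E where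
  toAddMonoidHom := 𝔞.bracket X
  leibniz' := 𝔞.leibniz X

@[simp] theorem ad_apply (X Y : E) : 𝔞.ad X Y = 𝔞.bracket X Y := rfl

theorem bracket_neg_symm (X Y : E) : 𝔞.bracket X Y = - 𝔞.bracket Y X := by
  have h := 𝔞.bracket_self (X + Y)
  simp only [map_add, AddMonoidHom.add_apply, 𝔞.bracket_self, zero_add, add_zero] at h
  exact eq_neg_of_add_eq_zero_right h

theorem bracket_smul_left (f : R) (X Y : E) :
    𝔞.bracket (f • X) Y = f • 𝔞.bracket X Y - 𝔞.anchor Y f • X := by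
  rw [bracket_neg_symm, 𝔞.leibniz, bracket_neg_symm 𝔞 X Y]
  simp
  abel

/-- An action of the Lie algebroid on the module `N`, linear over functions in the Lie algebroid
argument (a Lie algebroid connection). -/
structure Conn (N : Type*) [AddCommGroup N] [Module R N] where
  act : E →ₗ[R] N →+ N
  leibniz : ∀ X (f : R) (x : N), act X (f • x) = 𝔞.anchor X f • x + f • act X x

variable {𝔞}

/-- The action of one section. -/
def Conn.at (nabla : 𝔞.Conn N) (X : E) : DerEnd (𝔞.anchor X) N where
  toAddMonoidHom := nabla.act X
  leibniz' := nabla.leibniz X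

variable (𝔞) in
/-- The action on functions through the anchor. -/
def trivialConn : 𝔞.Conn R where
  act :=
    { toFun := fun X => (𝔞.anchor X : R →+ R)
      map_add' := fun X Y => by ext f; simp
      map_smul' := fun g X => by ext f; simp }
  leibniz X f x := by simp [mul_comm, add_comm]

/-- The Lie algebroid differential of `ω` evaluated on `X₀, …, X_k`:
`∑ᵢ (-1)ⁱ (∇_{Xᵢ} ω(…, X̂ᵢ, …) - ∑_{j > i} ω(…, X̂ᵢ, …, [Xᵢ, Xⱼ], …))`,
the bracket standing in the slot of `Xⱼ`; moving it to the first slot produces the usual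
`∑_{i<j} (-1)^{i+j} ω([Xᵢ, Xⱼ], …, X̂ᵢ, …, X̂ⱼ, …)`. -/
def diffFun {k : ℕ} (nabla : 𝔞.Conn N) (ω : E [⋀^Fin k]→ₗ[R] N) (X : Fin (k + 1) → E) : N :=
  ∑ i : Fin (k + 1), (-1 : ℤ) ^ (i : ℕ) •
    (nabla.act (X i) (ω (i.removeNth X)) -
      ∑ j : Fin k with i ≤ j.castSucc,
        ω (Function.update (i.removeNth X) j (𝔞.bracket (X i) (i.removeNth X j))))

/-- `ω` as an alternating map over `ℤ`. -/
def intAlt {k : ℕ} (ω : E [⋀^Fin k]→ₗ[R] N) : E [⋀^Fin k]→ₗ[ℤ] N where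
  toFun := ω
  map_update_add' := by
    intro inst X i x y
    obtain rfl : inst = instDecidableEqFin k := Subsingleton.elim _ _
    exact ω.map_update_add X i x y
  map_update_smul' := by
    intro inst X i c x
    obtain rfl : inst = instDecidableEqFin k := Subsingleton.elim _ _
    rw [← Int.cast_smul_eq_zsmul R, ω.map_update_smul, Int.cast_smul_eq_zsmul]
  map_eq_zero_of_eq' X i j h hij := ω.map_eq_zero_of_eq X h hij

/-- The Lie derivative of `N`-valued forms along a section `X`. -/
def lieAt {k : ℕ} (nabla : 𝔞.Conn N) (ω : E [⋀^Fin k]→ₗ[R] N) (X : E) : E [⋀^Fin k]→ₗ[R] N :=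
  (𝔞.ad X).alt k (nabla.at X) ω

theorem lieAt_apply {k : ℕ} (nabla : 𝔞.Conn N) (ω : E [⋀^Fin k]→ₗ[R] N) (X : E)
    (Y : Fin k → E) : lieAt nabla ω X Y =
      nabla.act X (ω Y) - ∑ j, ω (Function.update Y j (𝔞.bracket X (Y j))) := rfl

/-- Auxiliary: the alternating map over `ℤ` that is twice the differential. -/
def twiceDiff {k : ℕ} (nabla : 𝔞.Conn N) (ω : E [⋀^Fin k]→ₗ[R] N) : E [⋀^Fin (k + 1)]→ₗ[ℤ] N :=
  AlternatingMap.alternatizeUncurryFin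
    (AddMonoidHom.toIntLinearMap
      { toFun := fun X => (nabla.act X).toIntLinearMap.compAlternatingMap (intAlt ω) +
          intAlt (lieAt nabla ω X)
        map_zero' := by
          ext X
          simp [intAlt, lieAt_apply]
        map_add' := fun X Y => by
          ext Z
          simp [intAlt, lieAt_apply, Finset.sum_add_distrib]
          abel })

theorem twiceDiff_apply {k : ℕ} (nabla : 𝔞.Conn N) (ω : E [⋀^Fin k]→ₗ[R] N)
    (X : Fin (k + 1) → E) :
    twiceDiff nabla ω X = ∑ i : Fin (k + 1), (-1 : ℤ) ^ (i : ℕ) •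
      (nabla.act (X i) (ω (i.removeNth X)) +
        lieAt nabla ω (X i) (i.removeNth X)) := by
  rw [twiceDiff, AlternatingMap.alternatizeUncurryFin_apply]
  rfl

theorem update_removeNth_eq {R E N : Type*} [CommRing R] [AddCommGroup E] [Module R E]
    [AddCommGroup N] [Module R N] {k : ℕ} (ω : E [⋀^Fin (k + 1)]→ₗ[R] N) (Y : Fin (k + 1) → E)
    (j : Fin (k + 1)) (y : E) :
    ω (Function.update Y j y) = (-1 : ℤ) ^ (j : ℕ) • ω (Matrix.vecCons y (j.removeNth Y)) := by
  rw [← Fin.insertNth_removeNth, AlternatingMap.map_insertNth]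

theorem two_smul_diffFun {k : ℕ} (nabla : 𝔞.Conn N) (ω : E [⋀^Fin k]→ₗ[R] N)
    (X : Fin (k + 1) → E) : (2 : ℤ) • diffFun nabla ω X = twiceDiff nabla ω X := by
  have key : ∑ i : Fin (k + 1), ∑ j : Fin k, (if i ≤ j.castSucc then (-1 : ℤ) ^ (i : ℕ) •
        ω (Function.update (i.removeNth X) j (𝔞.bracket (X i) (i.removeNth X j))) else 0) =
      ∑ i : Fin (k + 1), ∑ j : Fin k, (if i ≤ j.castSucc then 0 else (-1 : ℤ) ^ (i : ℕ) •
        ω (Function.update (i.removeNth X) j (𝔞.bracket (X i) (i.removeNth X j)))) := by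
    rw [Fin.sum_sum_eq_sum_triangle_add, Fin.sum_sum_eq_sum_triangle_add]
    refine Finset.sum_congr rfl fun i _ => Finset.sum_congr rfl fun j hj => ?_
    rw [Finset.mem_Ici] at hj
    cases k with
    | zero => exact i.elim0
    | succ k =>
      have h1 : i.castSucc ≤ j.castSucc := by simpa using hj
      have h2 : ¬ (j.succ ≤ i.castSucc) := by
        simp only [Fin.le_def, Fin.val_succ, Fin.val_castSucc, not_le]
        have : (i : ℕ) ≤ j := hj
        omega
      rw [if_pos h1, if_neg h2, if_pos h1, if_neg h2, add_zero, zero_add]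
      have e1 : i.castSucc.removeNth X j = X j.succ := by
        simp [Fin.removeNth_apply, Fin.succAbove_of_le_castSucc, hj]
      have e2 : j.succ.removeNth X i = X i.castSucc := by
        simp [Fin.removeNth_apply, Fin.succAbove_of_castSucc_lt, hj]
      have e3 : j.removeNth (i.castSucc.removeNth X) = i.removeNth (j.succ.removeNth X) := by
        rw [Fin.removeNth_removeNth_eq_swap]
        simp [Fin.predAbove, not_lt.mpr hj, Fin.succAbove]
      rw [update_removeNth_eq, update_removeNth_eq, e1, e2, e3, smul_smul, smul_smul,
        bracket_neg_symm 𝔞 (X j.succ)]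
      have e4 (y : E) (Y : Fin k → E) :
          ω (Matrix.vecCons (-y) Y) = - ω (Matrix.vecCons y Y) := by
        have := ω.map_update_neg (Matrix.vecCons y Y) 0 y
        simpa [Matrix.vecCons] using this
      rw [e4, smul_neg, ← neg_smul]
      congr 1
      simp [pow_succ, mul_comm]
  have h3 (i : Fin (k + 1)) (F : Fin k → N) :
      ∑ j, F j = ∑ j with i ≤ j.castSucc, F j + ∑ j with ¬ i ≤ j.castSucc, F j :=
    (Finset.sum_filter_add_sum_filter_not _ _ _).symm
  rw [twiceDiff_apply, diffFun, Finset.smul_sum]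
  simp only [Finset.sum_ite, Finset.sum_const_zero, add_zero, zero_add] at key
  have key2 : ∑ i : Fin (k + 1), (-1 : ℤ) ^ (i : ℕ) • ((∑ j : Fin k with ¬ i ≤ j.castSucc,
        ω (Function.update (i.removeNth X) j (𝔞.bracket (X i) (i.removeNth X j)))) -
      ∑ j : Fin k with i ≤ j.castSucc,
        ω (Function.update (i.removeNth X) j (𝔞.bracket (X i) (i.removeNth X j)))) = 0 := by
    simp only [smul_sub, Finset.smul_sum, Finset.sum_sub_distrib]
    rw [key, sub_self]
  rw [← sub_eq_zero, ← key2, ← Finset.sum_sub_distrib, ← sub_eq_zero,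
    ← Finset.sum_sub_distrib]
  refine Finset.sum_eq_zero fun i _ => ?_
  rw [lieAt_apply, h3 i, smul_smul, mul_comm, ← smul_smul, ← smul_sub, ← smul_sub]
  refine (congrArg _ ?_).trans (smul_zero _)
  simp only [two_smul]
  abel

theorem eq_of_two_smul_eq (R : Type*) [CommRing R] [Algebra ℝ R] {N : Type*} [AddCommGroup N]
    [Module R N] {x y : N} (h : (2 : ℤ) • x = (2 : ℤ) • y) : x = y := by
  have h2 : (algebraMap ℝ R (1 / 2)) * ((2 : ℤ) : R) = 1 := by
    have : ((2 : ℤ) : R) = algebraMap ℝ R 2 := by rw [map_ofNat]; norm_num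
    rw [this, ← map_mul]
    norm_num
  rw [← one_smul R x, ← one_smul R y, ← h2, mul_smul, mul_smul, Int.cast_smul_eq_zsmul,
    Int.cast_smul_eq_zsmul, h]

theorem twiceDiff_cons_smul {k : ℕ} (nabla : 𝔞.Conn N) (ω : E [⋀^Fin k]→ₗ[R] N) (f : R) (y : E)
    (v : Fin k → E) :
    twiceDiff nabla ω (Fin.cons (f • y) v) = f • twiceDiff nabla ω (Fin.cons y v) := by
  have h0 (z : E) : (0 : Fin (k + 1)).removeNth (Fin.cons z v : Fin (k + 1) → E) = v := by
    ext i; simp [Fin.removeNth]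
  simp only [twiceDiff_apply, Fin.sum_univ_succ, Fin.cons_zero, Fin.cons_succ, h0]
  cases k with
  | zero =>
    simp [lieAt_apply]
  | succ k =>
    have hs (i : Fin (k + 1)) (z : E) :
        i.succ.removeNth (Fin.cons z v : Fin (k + 2) → E) = Fin.cons z (i.removeNth v) := by
      ext j
      refine Fin.cases ?_ (fun j => ?_) j <;> simp [Fin.removeNth]
    have hc (η : E [⋀^Fin (k + 1)]→ₗ[R] N) (w : Fin k → E) :
        η (Fin.cons (f • y) w) = f • η (Fin.cons y w) := by
      have := η.map_update_smul (Fin.cons y w) 0 f y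
      simpa using this
    simp only [hs, hc, nabla.leibniz]
    have h1 : lieAt nabla ω (f • y) v =
        f • lieAt nabla ω y v +
          ∑ j : Fin (k + 1), (-1 : ℤ) ^ (j : ℕ) • 𝔞.anchor (v j) f • ω (Fin.cons y (j.removeNth v)) := by
      simp only [lieAt_apply, 𝔞.bracket_smul_left, smul_sub, Finset.smul_sum]
      rw [sub_add, ← Finset.sum_sub_distrib]
      congr 1
      · simp
      · refine Finset.sum_congr rfl fun j _ => ?_
        rw [ω.map_update_sub, ω.map_update_smul, ω.map_update_smul, update_removeNth_eq ω v j y,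
          smul_comm (𝔞.anchor (v j) f)]
        rfl
    rw [h1]
    simp only [smul_add, Finset.smul_sum, Finset.sum_add_distrib, map_smul, Fin.val_zero, pow_zero, one_smul,
      AddMonoidHom.smul_apply, Fin.val_succ, pow_succ, mul_neg, mul_one, neg_smul,
      Finset.sum_neg_distrib, smul_neg, smul_comm f]
    abel

theorem twiceDiff_update_smul {k : ℕ} (nabla : 𝔞.Conn N) (ω : E [⋀^Fin k]→ₗ[R] N)
    (X : Fin (k + 1) → E) (i : Fin (k + 1)) (f : R) (y : E) :
    twiceDiff nabla ω (Function.update X i (f • y)) =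
      f • twiceDiff nabla ω (Function.update X i y) := by
  have h (z : E) : Function.update X i z =
      (Fin.cons z (Fin.tail (X ∘ Equiv.swap 0 i)) : Fin (k + 1) → E) ∘ Equiv.swap 0 i := by
    have h1 : (Fin.cons z (Fin.tail (X ∘ Equiv.swap 0 i)) : Fin (k + 1) → E) =
        Function.update (X ∘ Equiv.swap 0 i) 0 z := by
      refine funext fun j => ?_
      refine Fin.cases ?_ (fun j => ?_) j <;> simp [Fin.tail]
    rw [h1]
    ext j
    rcases eq_or_ne j i with rfl | hj
    · simp
    · rw [Function.comp_apply, Function.update_of_ne hj, Function.update_of_ne]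
      · simp
      · intro h
        exact hj (by simpa using congrArg (Equiv.swap 0 i) h)
  rw [h, h, AlternatingMap.map_perm, AlternatingMap.map_perm, twiceDiff_cons_smul, Units.smul_def,
    Units.smul_def, smul_comm]

/-- The Lie algebroid differential of forms with coefficients in `N`. -/
def diff {k : ℕ} (nabla : 𝔞.Conn N) (ω : E [⋀^Fin k]→ₗ[R] N) : E [⋀^Fin (k + 1)]→ₗ[R] N where
  toFun := diffFun nabla ω
  map_update_add' := by
    intro inst X i x y
    obtain rfl : inst = instDecidableEqFin (k + 1) := Subsingleton.elim _ _
    refine eq_of_two_smul_eq R ?_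
    simp only [smul_add, two_smul_diffFun, AlternatingMap.map_update_add]
  map_update_smul' := by
    intro inst X i f x
    obtain rfl : inst = instDecidableEqFin (k + 1) := Subsingleton.elim _ _
    refine eq_of_two_smul_eq R ?_
    rw [smul_comm, two_smul_diffFun, two_smul_diffFun, twiceDiff_update_smul]
  map_eq_zero_of_eq' X i j h hij := by
    refine eq_of_two_smul_eq R ?_
    rw [two_smul_diffFun, smul_zero, (twiceDiff nabla ω).map_eq_zero_of_eq X h hij]

end LieAlgebroid

/-! ### Multisections -/

/-- `Γ(∧A ⊗ 𝓛)`: families of `L`-valued alternating forms of all degrees on `E' = Γ(A*)`. -/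
abbrev Forms (R E' L : Type*) [CommRing R] [AddCommGroup E'] [Module R E'] [AddCommGroup L]
    [Module R L] := ∀ k : ℕ, E' [⋀^Fin k]→ₗ[R] L

/-- The exterior product of a scalar form and an `L`-valued form. -/
def wedge (R E' L : Type*) [CommRing R] [AddCommGroup E'] [Module R E'] [AddCommGroup L]
    [Module R L] (k l : ℕ) :
    (E' [⋀^Fin k]→ₗ[R] R) →ₗ[R] (E' [⋀^Fin l]→ₗ[R] L) →ₗ[R] (E' [⋀^Fin (k + l)]→ₗ[R] L) :=
  TensorProduct.curry
    ((AlternatingMap.domDomCongrₗ R finSumFinEquiv).toLinearMap ∘ₗ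
      LinearMap.compAlternatingMapₗ R (TensorProduct.lid R L).toLinearMap ∘ₗ
        AlternatingMap.domCoprod')

/-- Renaming a degree along an equality. -/
def degCast (R E' L : Type*) [CommRing R] [AddCommGroup E'] [Module R E'] [AddCommGroup L]
    [Module R L] {k l : ℕ} (h : k = l) :
    (E' [⋀^Fin k]→ₗ[R] L) ≃ₗ[R] (E' [⋀^Fin l]→ₗ[R] L) :=
  AlternatingMap.domDomCongrₗ R (finCongr h)

/-- The exterior product on `Γ(∧A)`. -/
def wedgeForms (u v : Forms R E' R) : Forms R E' R := fun d =>
  ∑ kl : Finset.HasAntidiagonal.antidiagonal d,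
    degCast R E' R (Finset.HasAntidiagonal.mem_antidiagonal.1 kl.2)
      (wedge R E' R kl.1.1 kl.1.2 (u kl.1.1) (v kl.1.2))

/-- The Lie algebroid differential on forms of all degrees. -/
def LieAlgebroid.dForms {𝔟 : LieAlgebroid R E'} (nabla : 𝔟.Conn L) (w : Forms R E' L) :
    Forms R E' L
  | 0 => 0
  | k + 1 => LieAlgebroid.diff nabla (w k)

/-- A form of degree `k`. -/
def homog (k : ℕ) (u : E' [⋀^Fin k]→ₗ[R] L) : Forms R E' L := Pi.single k u

/-- A function, as a form of degree `0`. -/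
def ofFun (E' : Type*) [AddCommGroup E'] [Module R E'] (f : R) : Forms R E' R :=
  homog 0 (AlternatingMap.constOfIsEmpty R E' (Fin 0) f)

/-- A section of `A`, as a form of degree `1` on `A*`. -/
def ofSec (p : E →ₗ[R] E' →ₗ[R] R) (X : E) : Forms R E' R :=
  homog 1 (AlternatingMap.ofSubsingleton R E' R (0 : Fin 1) (p X))

/-- `b` is the Schouten bracket on `Γ(∧A)`: the bracket of degree `-1` which extends the
Lie algebroid bracket and the anchor, is graded skew-symmetric and is a graded derivation of the
exterior product in each argument. -/
structure IsSchouten (p : E →ₗ[R] E' →ₗ[R] R) (𝔞 : LieAlgebroid R E)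
    (b : Forms R E' R →+ Forms R E' R →+ Forms R E' R) : Prop where
  degree : ∀ (k l j : ℕ) (u : E' [⋀^Fin k]→ₗ[R] R) (v : E' [⋀^Fin l]→ₗ[R] R),
    j + 1 ≠ k + l → b (homog k u) (homog l v) j = 0
  sec_fun : ∀ (X : E) (f : R), b (ofSec p X) (ofFun E' f) = ofFun E' (𝔞.anchor X f)
  sec_sec : ∀ X Y : E, b (ofSec p X) (ofSec p Y) = ofSec p (𝔞.bracket X Y)
  skew : ∀ (k l : ℕ) (u : E' [⋀^Fin k]→ₗ[R] R) (v : E' [⋀^Fin l]→ₗ[R] R),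
    b (homog k u) (homog l v) =
      -((-1 : ℤ) ^ ((k + 1) * (l + 1)) • b (homog l v) (homog k u))
  leibniz : ∀ (k l : ℕ) (u : E' [⋀^Fin k]→ₗ[R] R) (v : E' [⋀^Fin l]→ₗ[R] R) (w : Forms R E' R),
    b (homog k u) (wedgeForms (homog l v) w) =
      wedgeForms (b (homog k u) (homog l v)) w +
        (-1 : ℤ) ^ ((k + 1) * l) • wedgeForms (homog l v) (b (homog k u) w)

/-- The pair of Lie algebroids `(A, A*)` is a Lie bialgebroid: the differential `d_*` of `A*` is a
derivation of the Schouten bracket on `Γ(∧A)`. -/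
def IsLieBialgebroid (p : E →ₗ[R] E' →ₗ[R] R) (𝔞 : LieAlgebroid R E) (𝔟 : LieAlgebroid R E') :
    Prop :=
  ∃ b : Forms R E' R →+ Forms R E' R →+ Forms R E' R, IsSchouten p 𝔞 b ∧
    ∀ (k l : ℕ) (u : E' [⋀^Fin k]→ₗ[R] R) (v : E' [⋀^Fin l]→ₗ[R] R),
      LieAlgebroid.dForms 𝔟.trivialConn (b (homog k u) (homog l v)) =
        b (LieAlgebroid.dForms 𝔟.trivialConn (homog k u)) (homog l v) +
          (-1 : ℤ) ^ (k + 1) • b (homog k u) (LieAlgebroid.dForms 𝔟.trivialConn (homog l v))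

/-! ### The Dirac operator -/

/-- `X₁ ∧ ⋯ ∧ X_k ∈ Γ(∧ᵏA)`, as a form on `E'`: its value on `(θ₁, …, θ_k)` is the determinant
of the `⟨Xᵢ, θⱼ⟩`. -/
def wedgeSec (p : E →ₗ[R] E' →ₗ[R] R) (k : ℕ) : E [⋀^Fin k]→ₗ[R] (E' [⋀^Fin k]→ₗ[R] R) :=
  (exteriorPower.alternatingMapLinearEquiv (R := R) (M := E') (N := R)
    (n := k)).symm.toLinearMap.compAlternatingMap
      ((exteriorPower.alternatingMapToDual R E' k).compLinearMap p)

theorem wedgeSec_apply (p : E →ₗ[R] E' →ₗ[R] R) (k : ℕ) (X : Fin k → E) (θ : Fin k → E') :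
    wedgeSec p k X θ = Matrix.det (.of fun i j => p (X j) (θ i)) := by
  have h (f : (⋀[R]^k E') →ₗ[R] R) :
      (exteriorPower.alternatingMapLinearEquiv (R := R) (M := E') (N := R) (n := k)).symm f θ =
        f (exteriorPower.ιMulti R k θ) := by
    rw [← exteriorPower.alternatingMapLinearEquiv_apply_ιMulti, LinearEquiv.apply_symm_apply]
  exact (h _).trans (exteriorPower.alternatingMapToDual_apply_ιMulti _ _)

variable (p : E →ₗ[R] E' →ₗ[R] R) [p.IsPerfPair] (𝔞 : LieAlgebroid R E) (𝔟 : LieAlgebroid R E')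

/-- The action of `θ ∈ Γ(A*)` on `Γ(∧ⁿA* ⊗ ∧ᵐT*M)`, a section of this bundle being an alternating
form of degree `n` on `Γ(A)` with values in `m`-forms: `Γ(A*)` acts on itself by the bracket, on
`Γ(A)` dually, and on `m`-forms by the Lie derivative along the anchor. -/
def topAct (n m : ℕ) (θ : E') : DerEnd (𝔟.anchor θ) (E [⋀^Fin n]→ₗ[R] TopForm R m) :=
  ((𝔟.ad θ).dual p.flip).alt n (lieForm m (𝔟.anchor θ))

variable {n m : ℕ}

/-- `nabla` is the action of `A*` on a square root `𝓛` of `∧ⁿA* ⊗ ∧ᵐT*M`, `q` being the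
isomorphism of `𝓛 ⊗ 𝓛` with this line bundle. -/
def IsHalfAction (q : L ⊗[R] L ≃ₗ[R] E [⋀^Fin n]→ₗ[R] TopForm R m) (nabla : 𝔟.Conn L) : Prop :=
  ∀ (θ : E') (l l' : L),
    q (nabla.act θ l ⊗ₜ l' + l ⊗ₜ nabla.act θ l') = topAct p 𝔟 n m θ (q (l ⊗ₜ l'))

/-- `nabla` is the action of `A` on `∧ⁿA ⊗ 𝓛`, the square root of `∧ⁿA ⊗ ∧ᵐT*M` that is
determined by the square root `𝓛` of `∧ⁿA* ⊗ ∧ᵐT*M`. Here `q'` is the isomorphism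
`(∧ⁿA ⊗ 𝓛) ⊗ (∧ⁿA ⊗ 𝓛) ≅ ∧ⁿA ⊗ ∧ⁿA ⊗ ∧ⁿA* ⊗ ∧ᵐT*M ≅ ∧ⁿA ⊗ ∧ᵐT*M` that is induced by `q` and
the pairing of `∧ⁿA` with `∧ⁿA*`. -/
def IsCoHalfAction (q : L ⊗[R] L ≃ₗ[R] E [⋀^Fin n]→ₗ[R] TopForm R m)
    (nabla : 𝔞.Conn (E' [⋀^Fin n]→ₗ[R] L)) : Prop :=
  ∃ q' : (E' [⋀^Fin n]→ₗ[R] L) ⊗[R] (E' [⋀^Fin n]→ₗ[R] L) →ₗ[R]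
      E' [⋀^Fin n]→ₗ[R] TopForm R m,
    (∀ (l l' : E' [⋀^Fin n]→ₗ[R] L) (θ θ' : Fin n → E') (X : Fin n → E),
      q (l θ ⊗ₜ l' θ') X = Matrix.det (.of fun i j => p (X j) (θ' i)) • q' (l ⊗ₜ l') θ) ∧
    ∀ (X : E) (l l' : E' [⋀^Fin n]→ₗ[R] L),
      q' (nabla.act X l ⊗ₜ l' + l ⊗ₜ nabla.act X l') = topAct p.flip 𝔞 n m X (q' (l ⊗ₜ l'))

/-- The isomorphism `∧ʲA ⊗ 𝓛 ≅ ∧ᵏA* ⊗ (∧ⁿA ⊗ 𝓛)` for `k + j = n`, which sends `u` to the form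
`(X₁, …, X_k) ↦ X₁ ∧ ⋯ ∧ X_k ∧ u`. -/
def starMap {k j : ℕ} (h : k + j = n) (u : E' [⋀^Fin j]→ₗ[R] L) :
    E [⋀^Fin k]→ₗ[R] (E' [⋀^Fin n]→ₗ[R] L) :=
  ((degCast R E' L h).toLinearMap ∘ₗ (wedge R E' L k j).flip u).compAlternatingMap (wedgeSec p k)

open Classical in
/-- The differential `d̄_*` on `Γ(∧A ⊗ 𝓛)` of the `A*`-module `𝓛`. For a square root of the line
bundle `∧ⁿA* ⊗ ∧ᵐT*M` the action of `A*` on it exists and is unique. -/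
def bdees (q : L ⊗[R] L ≃ₗ[R] E [⋀^Fin n]→ₗ[R] TopForm R m) (w : Forms R E' L) : Forms R E' L :=
  if h : ∃ nabla : 𝔟.Conn L, IsHalfAction p 𝔟 q nabla then LieAlgebroid.dForms h.choose w else 0

open Classical in
/-- The operator `∂̄` on `Γ(∧A ⊗ 𝓛)`: the differential of the `A`-module `∧ⁿA ⊗ 𝓛`, transported
along the isomorphisms `starMap`, with the sign `(-1)ᵏ` on `∧ᵏA* ⊗ (∧ⁿA ⊗ 𝓛)`. In terms of local
frames this is `∂̄ = -∂ + ½ ι_{ξ₀}`. For a square root of the line bundle `∧ⁿA* ⊗ ∧ᵐT*M` the action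
of `A` on `∧ⁿA ⊗ 𝓛` exists and is unique, and `starMap` is bijective. -/
def bdel (q : L ⊗[R] L ≃ₗ[R] E [⋀^Fin n]→ₗ[R] TopForm R m) (w : Forms R E' L) : Forms R E' L :=
  fun j => if h : (∃ nabla : 𝔞.Conn (E' [⋀^Fin n]→ₗ[R] L), IsCoHalfAction p 𝔞 q nabla) ∧
      j + 1 ≤ n then
    (-1 : ℤ) ^ (n - (j + 1)) •
      Function.invFun (starMap p (L := L) (show n - (j + 1) + 1 + j = n by omega))
        (LieAlgebroid.diff h.1.choose
          (starMap p (show n - (j + 1) + (j + 1) = n by omega) (w (j + 1))))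
    else 0

/-- The operator `Ð = d̄_* + ∂̄` on `Γ(∧A ⊗ 𝓛)`. -/
def dirac (q : L ⊗[R] L ≃ₗ[R] E [⋀^Fin n]→ₗ[R] TopForm R m) (w : Forms R E' L) : Forms R E' L :=
  bdees p 𝔟 q w + bdel p 𝔞 q w

end Algebra

end

end LieBialgd

open scoped Manifold ContDiff Bundle Topology
open Bundle

namespace LieBialgd
noncomputable section
section Geometry

variable {𝕜 : Type*} [RCLike 𝕜] {m : ℕ} {M : Type*} [TopologicalSpace M]
  [ChartedSpace (EuclideanSpace ℝ (Fin m)) M]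

/-- Multiplication of the field `𝕜`, which is `ℝ` or `ℂ`, is smooth over `ℝ`. -/
instance contMDiffRing : ContMDiffRing 𝓘(ℝ, 𝕜) ∞ 𝕜 :=
  { instNormedSpaceLieAddGroup with
    contMDiff_mul := by
      have h : ContMDiff 𝓘(ℝ, 𝕜 × 𝕜) 𝓘(ℝ, 𝕜) ∞ fun p : 𝕜 × 𝕜 => p.1 * p.2 :=
        contDiff_mul.contMDiff
      rwa [modelWithCornersSelf_prod, ← chartedSpaceSelf_prod] at h }

variable (𝕜 m M) in
/-- The ring of smooth real or complex valued functions on `M`. -/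
abbrev Fn := C^∞⟮𝓡 m, M; 𝓘(ℝ, 𝕜), 𝕜⟯

variable {F : Type*} [NormedAddCommGroup F] [NormedSpace ℝ F] [NormedSpace 𝕜 F]
  [IsScalarTower ℝ 𝕜 F] {A : M → Type*} [TopologicalSpace (TotalSpace F A)]
  [∀ x, TopologicalSpace (A x)] [FiberBundle F A] [∀ x, AddCommGroup (A x)]
  [∀ x, Module ℝ (A x)] [∀ x, Module 𝕜 (A x)] [VectorBundle ℝ F A] [VectorBundle 𝕜 F A]
  

theorem triv_add (t : Trivialization F (TotalSpace.proj : TotalSpace F A → M))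
    [MemTrivializationAtlas t] {x : M} (hx : x ∈ t.baseSet) (v w : A x) :
    (t ⟨x, v + w⟩).2 = (t ⟨x, v⟩).2 + (t ⟨x, w⟩).2 := (t.linear ℝ hx).1 v w

variable (𝕜) in
theorem triv_smul (t : Trivialization F (TotalSpace.proj : TotalSpace F A → M))
    [MemTrivializationAtlas t] {x : M} (hx : x ∈ t.baseSet) (c : 𝕜) (v : A x) :
    (t ⟨x, c • v⟩).2 = c • (t ⟨x, v⟩).2 := (t.linear 𝕜 hx).2 c v

variable [IsManifold (𝓡 m) ∞ M] [ContMDiffVectorBundle ∞ F A (𝓡 m)]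

theorem contMDiff_smul_section (f : Fn 𝕜 m M) (s : Cₛ^∞⟮𝓡 m; F, A⟯) :
    ContMDiff (𝓡 m) ((𝓡 m).prod 𝓘(ℝ, F)) ∞ (fun x => TotalSpace.mk' F x (f x • s x)) := by
  intro x
  rw [contMDiffAt_section]
  have hs := (contMDiffAt_section x).1 (s.contMDiff x)
  have h : ContMDiffAt (𝓡 m) 𝓘(ℝ, F) ∞
      (fun y => f y • (trivializationAt F A x ⟨y, s y⟩).2) x :=
    ContDiff.comp_contMDiffAt (g := fun p : 𝕜 × F => p.1 • p.2) contDiff_smul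
      ((f.contMDiff x).prodMk_space hs)
  refine h.congr_of_eventuallyEq ?_
  filter_upwards [(trivializationAt F A x).open_baseSet.mem_nhds
    (mem_baseSet_trivializationAt F A x)] with y hy
  exact triv_smul 𝕜 _ hy _ _

/-- Smooth sections form a module over the ring of smooth functions, pointwise. -/
instance sectionModule : Module (Fn 𝕜 m M) Cₛ^∞⟮𝓡 m; F, A⟯ where
  smul f s := ⟨fun x => f x • s x, contMDiff_smul_section f s⟩
  one_smul s := by ext x; exact one_smul 𝕜 (s x)
  mul_smul f g s := by ext x; exact mul_smul (f x) (g x) (s x)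
  smul_zero f := by ext x; exact smul_zero (f x)
  smul_add f s t := by ext x; exact smul_add (f x) (s x) (t x)
  add_smul f g s := by ext x; exact add_smul (f x) (g x) (s x)
  zero_smul s := by ext x; exact zero_smul 𝕜 (s x)

theorem section_smul_apply (f : Fn 𝕜 m M) (s : Cₛ^∞⟮𝓡 m; F, A⟯) (x : M) :
    (f • s) x = f x • s x := rfl

theorem exists_bump [T2Space M] (x : M) {U : Set M} (hU : U ∈ 𝓝 x) :
    ∃ f : Fn 𝕜 m M, (∀ᶠ y in 𝓝 x, f y = 1) ∧ tsupport (fun y => f y) ⊆ U := by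
  obtain ⟨g, -, hg⟩ := ((SmoothBumpFunction.nhds_basis_tsupport (I := 𝓡 m) x).mem_iff).1 hU
  refine ⟨⟨fun y => ((g y : ℝ) : 𝕜), ?_⟩, ?_, ?_⟩
  · exact (ContDiff.contMDiff (RCLike.ofRealCLM (K := 𝕜)).contDiff).comp g.contMDiff
  · filter_upwards [g.eventuallyEq_one] with y hy
    change ((g y : ℝ) : 𝕜) = 1
    rw [hy]; simp
  · refine subset_trans (closure_mono ?_) hg
    intro y hy hy'
    refine hy ?_
    change ((g y : ℝ) : 𝕜) = 0
    rw [hy']; simp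

theorem contMDiff_bump_section (t : Trivialization F (TotalSpace.proj : TotalSpace F A → M))
    [MemTrivializationAtlas t] (f : Fn 𝕜 m M) (hf : tsupport (fun y => f y) ⊆ t.baseSet) (v : F) :
    ContMDiff (𝓡 m) ((𝓡 m).prod 𝓘(ℝ, F)) ∞
      (fun x => TotalSpace.mk' F x (f x • t.symm x v)) := by
  intro x
  by_cases hx : x ∈ t.baseSet
  · rw [t.contMDiffAt_section_iff hx]
    have h : ContMDiffAt (𝓡 m) 𝓘(ℝ, F) ∞ (fun y => f y • v) x :=
      ContDiff.comp_contMDiffAt (g := fun c : 𝕜 => c • v) (contDiff_id.smul contDiff_const)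
        (f.contMDiff x)
    refine h.congr_of_eventuallyEq ?_
    filter_upwards [t.open_baseSet.mem_nhds hx] with y hy
    rw [triv_smul 𝕜 t hy, t.apply_mk_symm hy]
  · have h0 : ∀ᶠ y in 𝓝 x, f y = 0 :=
      notMem_tsupport_iff_eventuallyEq.1 fun h => hx (hf h)
    refine ((contMDiff_zeroSection ℝ A).contMDiffAt (x := x)).congr_of_eventuallyEq ?_
    filter_upwards [h0] with y hy
    simp [hy, zeroSection]

theorem contMDiff_bump_coord {n : ℕ} {A : M → Type*} [TopologicalSpace (TotalSpace (Fin n → 𝕜) A)]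
    [∀ x, TopologicalSpace (A x)] [FiberBundle (Fin n → 𝕜) A] [∀ x, AddCommGroup (A x)]
    [∀ x, Module ℝ (A x)] [VectorBundle ℝ (Fin n → 𝕜) A]
    [ContMDiffVectorBundle ∞ (Fin n → 𝕜) A (𝓡 m)]
    (t : Trivialization (Fin n → 𝕜) (TotalSpace.proj : TotalSpace (Fin n → 𝕜) A → M))
    [MemTrivializationAtlas t] (f : Fn 𝕜 m M) (hf : tsupport (fun y => f y) ⊆ t.baseSet)
    (s : Cₛ^∞⟮𝓡 m; Fin n → 𝕜, A⟯) (i : Fin n) :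
    ContMDiff (𝓡 m) 𝓘(ℝ, 𝕜) ∞ (fun x => f x * (t ⟨x, s x⟩).2 i) := by
  intro x
  by_cases hx : x ∈ t.baseSet
  · have hs := (t.contMDiffAt_section_iff hx).1 (s.contMDiff x)
    exact ContDiff.comp_contMDiffAt (g := fun p : 𝕜 × (Fin n → 𝕜) => p.1 * p.2 i)
      (contDiff_fst.mul ((contDiff_apply ℝ 𝕜 i).comp contDiff_snd))
      ((f.contMDiff x).prodMk_space hs)
  · have h0 : ∀ᶠ y in 𝓝 x, f y = 0 :=
      notMem_tsupport_iff_eventuallyEq.1 fun h => hx (hf h)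
    refine (contMDiffAt_const (c := (0 : 𝕜))).congr_of_eventuallyEq ?_
    filter_upwards [h0] with y hy
    simp [hy]

end Geometry

section Frames

variable {𝕜 : Type*} [RCLike 𝕜] {m n : ℕ} {M : Type*} [TopologicalSpace M]
  [ChartedSpace (EuclideanSpace ℝ (Fin m)) M] [IsManifold (𝓡 m) ∞ M] [T2Space M]
  {A : M → Type*} [TopologicalSpace (TotalSpace (Fin n → 𝕜) A)]
  [∀ x, TopologicalSpace (A x)] [FiberBundle (Fin n → 𝕜) A] [∀ x, AddCommGroup (A x)]
  [∀ x, Module ℝ (A x)] [∀ x, Module 𝕜 (A x)] [VectorBundle ℝ (Fin n → 𝕜) A]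
  [VectorBundle 𝕜 (Fin n → 𝕜) A] [ContMDiffVectorBundle ∞ (Fin n → 𝕜) A (𝓡 m)]

theorem exists_frame (x : M) : ∃ (e : Fin n → Cₛ^∞⟮𝓡 m; Fin n → 𝕜, A⟯)
    (ε : Fin n → Module.Dual (Fn 𝕜 m M) Cₛ^∞⟮𝓡 m; Fin n → 𝕜, A⟯) (χ : Fn 𝕜 m M),
    (∀ᶠ y in 𝓝 x, χ y = 1) ∧ (∀ s, χ • s = ∑ i, ε i s • e i) ∧
      ∀ (s : Cₛ^∞⟮𝓡 m; Fin n → 𝕜, A⟯) y i, s y = 0 → ε i s y = 0 := by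
  let t := trivializationAt (Fin n → 𝕜) A x
  obtain ⟨f, hf1, hf⟩ := exists_bump (𝕜 := 𝕜) (m := m) x (t.open_baseSet.mem_nhds
    (mem_baseSet_trivializationAt (Fin n → 𝕜) A x))
  have hf0 {y : M} (hy : y ∉ t.baseSet) : f y = 0 :=
    image_eq_zero_of_notMem_tsupport fun h => hy (hf h)
  refine ⟨fun i => ⟨fun y => f y • t.symm y (Pi.single i 1), contMDiff_bump_section t f hf _⟩,
    fun i =>
      { toFun := fun s => ⟨fun y => f y * (t ⟨y, s y⟩).2 i, contMDiff_bump_coord t f hf s i⟩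
        map_add' := fun s s' => ?_
        map_smul' := fun g s => ?_ }, f * f, ?_, fun s => ?_, fun s y i h => ?_⟩
  · ext y
    change f y * (t ⟨y, s y + s' y⟩).2 i = f y * (t ⟨y, s y⟩).2 i + f y * (t ⟨y, s' y⟩).2 i
    by_cases hy : y ∈ t.baseSet
    · rw [triv_add t hy, Pi.add_apply, mul_add]
    · simp [hf0 hy]
  · ext y
    change f y * (t ⟨y, g y • s y⟩).2 i = g y * (f y * (t ⟨y, s y⟩).2 i)
    by_cases hy : y ∈ t.baseSet
    · rw [triv_smul 𝕜 t hy, Pi.smul_apply, smul_eq_mul]; ring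
    · simp [hf0 hy]
  · filter_upwards [hf1] with y hy
    change f y * f y = 1
    rw [hy, one_mul]
  · ext y
    have hsum (u : Fin n → Cₛ^∞⟮𝓡 m; Fin n → 𝕜, A⟯) : (∑ i, u i) y = ∑ i, u i y := by
      rw [← ContMDiffSection.coeAddHom_apply, map_sum, Finset.sum_apply]; rfl
    rw [hsum]
    change (f y * f y) • s y = ∑ i, (f y * (t ⟨y, s y⟩).2 i) • f y • t.symm y (Pi.single i 1)
    by_cases hy : y ∈ t.baseSet
    · let T := t.linearEquivAt 𝕜 y hy
      have hT (v : A y) : T v = (t ⟨y, v⟩).2 := rfl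
      apply T.injective
      rw [map_sum]
      simp only [map_smul]
      have h1 (i : Fin n) : T (t.symm y (Pi.single i 1)) = Pi.single i 1 := by
        rw [hT, t.apply_mk_symm hy]
      simp only [h1, ← hT]
      ext j
      simp [Finset.sum_apply, Pi.single_apply]
      ring
    · simp [hf0 hy]
  · change f y * (t ⟨y, s y⟩).2 i = 0
    by_cases hy : y ∈ t.baseSet
    · have : (t ⟨y, s y⟩).2 = 0 := by
        rw [h]; exact (t.linearEquivAt 𝕜 y hy).map_zero
      simp [this]
    · simp [hf0 hy]

theorem sum_section_apply {ι : Type*} [Fintype ι] (u : ι → Cₛ^∞⟮𝓡 m; Fin n → 𝕜, A⟯) (y : M) :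
    (∑ i, u i) y = ∑ i, u i y := by
  rw [← ContMDiffSection.coeAddHom_apply, map_sum, Finset.sum_apply]; rfl

theorem sum_fn_apply {ι : Type*} [Fintype ι] (u : ι → Fn 𝕜 m M) (y : M) :
    (∑ i, u i) y = ∑ i, u i y := by
  have h : (ContMDiffMap.coeFnRingHom (∑ i, u i) : M → 𝕜) y = ∑ i, u i y := by
    rw [map_sum, Finset.sum_apply]; rfl
  exact h

theorem dual_apply_eq_zero (θ : Module.Dual (Fn 𝕜 m M) Cₛ^∞⟮𝓡 m; Fin n → 𝕜, A⟯)
    (s : Cₛ^∞⟮𝓡 m; Fin n → 𝕜, A⟯) (y : M) (h : s y = 0) : θ s y = 0 := by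
  obtain ⟨e, ε, χ, h1, h2, h3⟩ := exists_frame (𝕜 := 𝕜) (n := n) (A := A) (m := m) y
  have h4 : (χ * θ s) y = (∑ i, ε i s * θ (e i)) y := by
    rw [← smul_eq_mul, ← map_smul, h2, map_sum]
    simp only [map_smul, smul_eq_mul]
  rw [sum_fn_apply] at h4
  change χ y * θ s y = ∑ i, ε i s y * θ (e i) y at h4
  rw [h1.self_of_nhds, one_mul] at h4
  rw [h4]
  exact Finset.sum_eq_zero fun i _ => by rw [h3 s y i h, zero_mul]

theorem section_apply_eq_of_dual (s s' : Cₛ^∞⟮𝓡 m; Fin n → 𝕜, A⟯) (y : M)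
    (h : ∀ θ : Module.Dual (Fn 𝕜 m M) Cₛ^∞⟮𝓡 m; Fin n → 𝕜, A⟯, θ s y = θ s' y) :
    s y = s' y := by
  obtain ⟨e, ε, χ, h1, h2, h3⟩ := exists_frame (𝕜 := 𝕜) (n := n) (A := A) (m := m) y
  have key (r : Cₛ^∞⟮𝓡 m; Fin n → 𝕜, A⟯) : r y = ∑ i, ε i r y • e i y := by
    have := congrArg (fun r' : Cₛ^∞⟮𝓡 m; Fin n → 𝕜, A⟯ => r' y) (h2 r)
    simp only [sum_section_apply, section_smul_apply, h1.self_of_nhds, one_smul] at this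
    exact this
  rw [key s, key s']
  exact Finset.sum_congr rfl fun i _ => by rw [h]

/-- The module of smooth sections is reflexive, so that it is in perfect duality with its dual
module, which is the module of smooth sections of the dual bundle. -/
instance sections_isReflexive : Module.IsReflexive (Fn 𝕜 m M) Cₛ^∞⟮𝓡 m; Fin n → 𝕜, A⟯ where
  bijective_dual_eval' := by
    constructor
    · intro s s' h
      ext y
      exact section_apply_eq_of_dual s s' y fun θ =>
        congrArg (fun f : Fn 𝕜 m M => f y) (LinearMap.congr_fun h θ)
    · intro Φ
      choose e ε χ h1 h2 h3 using exists_frame (𝕜 := 𝕜) (n := n) (A := A) (m := m)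
      let σ (x : M) : Cₛ^∞⟮𝓡 m; Fin n → 𝕜, A⟯ := ∑ i, Φ (ε x i) • e x i
      have hσ (x : M) (θ : Module.Dual (Fn 𝕜 m M) Cₛ^∞⟮𝓡 m; Fin n → 𝕜, A⟯) :
          θ (σ x) = χ x * Φ θ := by
        have h4 : χ x • θ = ∑ i, θ (e x i) • ε x i := by
          ext1 s
          simp only [LinearMap.smul_apply, LinearMap.sum_apply]
          rw [← map_smul, h2, map_sum]
          simp only [map_smul, smul_eq_mul, mul_comm]
        rw [← smul_eq_mul, ← map_smul, h4, map_sum, map_sum]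
        simp only [map_smul, smul_eq_mul, mul_comm]
      have hy (y : M) (θ : Module.Dual (Fn 𝕜 m M) Cₛ^∞⟮𝓡 m; Fin n → 𝕜, A⟯) :
          θ (σ y) y = Φ θ y := by
        rw [hσ]
        change χ y y * Φ θ y = Φ θ y
        rw [(h1 y).self_of_nhds, one_mul]
      have hx (x : M) : ∀ᶠ y in 𝓝 x, σ y y = σ x y := by
        filter_upwards [h1 x] with y hχ
        refine section_apply_eq_of_dual _ _ y fun θ => ?_
        rw [hy, hσ]
        change Φ θ y = χ x y * Φ θ y
        rw [hχ, one_mul]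
      let s : Cₛ^∞⟮𝓡 m; Fin n → 𝕜, A⟯ := ⟨fun y => σ y y, fun x => by
        refine ((σ x).contMDiff x).congr_of_eventuallyEq ?_
        filter_upwards [hx x] with y h
        rw [h]⟩
      refine ⟨s, ?_⟩
      ext θ y
      have h5 : θ (s - σ y) y = 0 := by
        refine dual_apply_eq_zero θ _ y ?_
        rw [ContMDiffSection.coe_sub, Pi.sub_apply]
        exact sub_self _
      rw [map_sub] at h5
      have h6 : θ s y = θ (σ y) y := sub_eq_zero.1 h5
      exact h6.trans (hy y θ)

end Frames

section Statement

variable {𝕜 : Type*} [RCLike 𝕜] {m n : ℕ} {M : Type*} [TopologicalSpace M]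
  [ChartedSpace (EuclideanSpace ℝ (Fin m)) M]

/-- `Ω ⊗ s` for an alternating form `Ω` on `E` and an `m`-form `s` on `M`. -/
def tensorForm {R E : Type*} [CommRing R] [Algebra ℝ R] [AddCommGroup E] [Module R E] {n m : ℕ}
    (Ω : E [⋀^Fin n]→ₗ[R] R) (s : TopForm R m) : E [⋀^Fin n]→ₗ[R] TopForm R m :=
  (LinearMap.toSpanSingleton R (TopForm R m) s).compAlternatingMap Ω

/-- On the open set `U`: `s` is a volume form, `Ω` and `V` are frames of `∧ⁿA*` and `∧ⁿA` with
`⟨Ω, V⟩ = 1`, the sections `X₀` of `A` and `ξ₀` of `A*` are the modular cocycles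
`L_θ (Ω ⊗ s) = ⟨X₀, θ⟩ Ω ⊗ s` and `L_X (V ⊗ s) = ⟨ξ₀, X⟩ V ⊗ s`, and `g = ∂X₀`, the operator `∂`
dual to the differential of `A` with respect to `Ω`, so that `L_{X₀} Ω = d ι_{X₀} Ω = -(∂X₀) Ω`.
All sections are global ones, and the relations are required at the points of `U`. -/
structure IsModularData {E E' : Type*} [AddCommGroup E] [Module (Fn 𝕜 m M) E] [AddCommGroup E']
    [Module (Fn 𝕜 m M) E'] (p : E →ₗ[Fn 𝕜 m M] E' →ₗ[Fn 𝕜 m M] Fn 𝕜 m M) [p.IsPerfPair]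
    (𝔞 : LieAlgebroid (Fn 𝕜 m M) E) (𝔟 : LieAlgebroid (Fn 𝕜 m M) E') (U : Set M)
    (Ω : E [⋀^Fin n]→ₗ[Fn 𝕜 m M] Fn 𝕜 m M) (V : E' [⋀^Fin n]→ₗ[Fn 𝕜 m M] Fn 𝕜 m M)
    (s : TopForm (Fn 𝕜 m M) m) (X₀ : E) (ξ₀ : E') (g : Fn 𝕜 m M) : Prop where
  isOpen : IsOpen U
  volume : ∀ x ∈ U, ∃ D, s D x ≠ 0
  dual : ∀ x ∈ U, ∀ X θ,
    (V θ * Ω X) x = (Matrix.det (.of fun i j => p (X j) (θ i)) : Fn 𝕜 m M) x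
  modular : ∀ x ∈ U, ∀ θ X D,
    topAct p 𝔟 n m θ (tensorForm Ω s) X D x = (p X₀ θ • tensorForm Ω s) X D x
  modular_star : ∀ x ∈ U, ∀ X θ D,
    topAct p.flip 𝔞 n m X (tensorForm V s) θ D x = (p X ξ₀ • tensorForm V s) θ D x
  del : ∀ x ∈ U, ∀ X,
    (𝔞.ad X₀).alt n (DerEnd.self (𝔞.anchor X₀)) Ω X x = (-(g • Ω)) X x

end Statement

end

end LieBialgd

open scoped TensorProduct Manifold ContDiff
open Bundle LieBialgd

set_option linter.unusedSectionVars false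

namespace LieBialgd
noncomputable section

/-! ### The exterior product and the contraction of its first argument -/

section Wedge
variable {R P W : Type*} [CommRing R] [AddCommGroup P] [Module R P] [AddCommGroup W] [Module R W]

/-! The theorem is a computation with graded commutators of operators on Γ(∧A ⊗ 𝓛). Write e_X and
ι_θ for the exterior product with a section X of A and the interior product with a section θ of A*,
write d = d̄_*, let [ , ] be commutators and { , } anticommutators. Both actions on the square roots
are flat, so d² = 0 and ∂̄² = 0 (`LieAlgebroid.dOp_dOp`, `Regular.delOp_delOp`), and the square of
the Dirac operator is Δ = {d, ∂̄} (`Regular.laplace`). The commutators with the generators are [d,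
f] = e_{d_* f}, {d, e_X} = d_*X ∧, {d, ι_θ} = L_θ, [∂̄, f] = ι_{df} and {∂̄, e_X} = L_X. The last
one is Cartan's formula for A, carried over by the star isomorphism (`Regular.delOp_mul_outer`).

Let (A, A*) be a Lie bialgebroid. Then [Δ, f] = L_{d_* f} + L_{df} is an infinitesimal automorphism
that is trivial on functions and on A, and it vanishes because such an automorphism acts on 𝓛 by
minus half of its trace (`InfAut.trace`). The double commutator {[Δ, e_X], e_Y} is the exterior
product with d_*[X,Y] − L_X d_*Y + L_Y d_*X, hence zero. It remains to see that G = [Δ, e_X] kills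
the sections of 𝓛. The operator {G, ι_θ} is an infinitesimal automorphism β plus [{∂̄, ι_θ}, d_*X
∧], and the vanishing of the previous commutators makes β linear over functions with a known matrix.
On 𝓛 it contributes minus half of a trace, and the second term contributes plus half of the same
trace (`Regular.laplace_comm_outer_cst`). The cancellation is the reason for twisting by a square
root. So Δ commutes with functions and exterior products and acts on 𝓛 by a function φ; therefore Δ
= φ (`Regular.laplace_eq_smul`).

Conversely, ∂̄ generates the Schouten bracket: up to sign, the double graded commutator of ∂̄ with
two exterior products is the exterior product with the bracket (`Regular.exists_derivedOp_homog`,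
`Regular.isSchouten_bracket`). If Δ is a function it commutes with exterior products, and the graded
Jacobi identity turns this into the derivation property of d_* (`Regular.isLieBialgebroid`).

If Δ = φ, then Δ also commutes with the ι_θ, and the Jacobi identity gives the compatibility
conditions for the exchanged pair (`Regular.compatible_flip`). By the first part the square of 𝒟_*
is a function φ'. Locally, choose frames l₀ of 𝓛 and l₀' of 𝓛_* with squares that correspond up to a
constant. An infinitesimal automorphism has the same eigenvalue on l₀' as on e₁ ∧ ⋯ ∧ eₙ ⊗ l₀
(`germ_alt_top`). With ξ₀ the modular section of l₀', the operator 2Δ on the top form and twice the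
square of 𝒟_* on l₀' are both L_{ξ₀}, whence φ = φ' (`Regular.laplace_germ_eq`).

For the explicit formula let l have a square that is a constant multiple of Ω ⊗ s. Then 2dl = X₀ ⊗ l
and 2φl = ∂̄(X₀ ⊗ l) = L_{X₀} l, so 4φ is the eigenvalue of L_{X₀} on Ω ⊗ s, which is ⟨ξ₀, X₀⟩ −
2∂X₀ (`germ_lie_tensorForm`, `Regular.laplace_germ_modular`).

All local arguments are made with global sections: multiplication by functions that equal 1 near a
point replaces restriction to a neighbourhood. The algebra is done over any ring with a family 𝒳 of
multiplicative sets of such functions (`Regular`), and the manifold enters only at the end. -/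

theorem factorial_smul_wedge_apply (k l : ℕ) (u : P [⋀^Fin k]→ₗ[R] R) (w : P [⋀^Fin l]→ₗ[R] W)
    (v : Fin (k + l) → P) :
    (k.factorial * l.factorial) • wedge R P W k l u w v =
      ∑ σ : Equiv.Perm (Fin (k + l)), Equiv.Perm.sign σ •
        (u fun i => v (σ (Fin.castAdd l i))) • w fun j => v (σ (Fin.natAdd k j)) := by
  have h := MultilinearMap.domCoprod_alternization_eq u w
  rw [Fintype.card_fin, Fintype.card_fin] at h
  have h2 := congrArg (fun a => TensorProduct.lid R W (a (v ∘ finSumFinEquiv))) h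
  simp only [MultilinearMap.alternatization_apply, map_sum] at h2
  have h3 : (k.factorial * l.factorial) • wedge R P W k l u w v = TensorProduct.lid R W
      (((k.factorial * l.factorial) • u.domCoprod w) (v ∘ finSumFinEquiv)) := by
    rw [AlternatingMap.smul_apply, map_nsmul]
    rfl
  rw [h3, ← h2]
  refine Fintype.sum_equiv (Equiv.permCongr finSumFinEquiv) _ _ fun σ => ?_
  rw [Equiv.Perm.sign_permCongr, Units.smul_def, Units.smul_def, map_zsmul]
  congr 1
  simp only [MultilinearMap.domDomCongr_apply, MultilinearMap.domCoprod_apply]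
  rw [AlternatingMap.coe_multilinearMap, AlternatingMap.coe_multilinearMap, TensorProduct.lid_tmul]
  simp [Equiv.permCongr_apply]

/-- Permutations are sorted by the position i in which θ ends up; what is left is a permutation of
the other arguments. -/
theorem sum_perm_cons {N : ℕ} (F : (Fin (N + 1) → P) → W) (θ : P) (v : Fin N → P) :
    ∑ σ : Equiv.Perm (Fin (N + 1)), Equiv.Perm.sign σ • F ((Fin.cons θ v : Fin (N + 1) → P) ∘ σ) =
      ∑ τ : Equiv.Perm (Fin N), Equiv.Perm.sign τ • ∑ i : Fin (N + 1),
        Equiv.Perm.sign (Equiv.swap 0 i) •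
          F ((Fin.cons θ (v ∘ τ) : Fin (N + 1) → P) ∘ Equiv.swap 0 i) := by
  simp only [Finset.smul_sum]
  rw [Finset.sum_comm, ← Finset.sum_product', Finset.univ_product_univ]
  -- `decomposeFin` writes a permutation with the transposition on the left. The two inversions put
  -- it on the right, where it acts on positions.
  refine (Equiv.sum_comp ((Equiv.prodCongr (Equiv.refl _) (Equiv.inv _)).trans
    (Equiv.Perm.decomposeFin.symm.trans (Equiv.inv _))) _).symm.trans ?_
  refine Finset.sum_congr rfl fun x _ => ?_
  obtain ⟨i, τ⟩ := x
  have h1 : ((Fin.cons θ v : Fin (N + 1) → P) ∘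
      ⇑((Equiv.Perm.decomposeFin.symm (i, τ⁻¹))⁻¹ : Equiv.Perm (Fin (N + 1)))) =
      (Fin.cons θ (v ∘ τ) : Fin (N + 1) → P) ∘ Equiv.swap 0 i := by
    have : (Fin.cons θ v : Fin (N + 1) → P) = ((Fin.cons θ (v ∘ τ) : Fin (N + 1) → P) ∘
        Equiv.swap 0 i) ∘ (Equiv.Perm.decomposeFin.symm (i, τ⁻¹)) := by
      funext j
      refine Fin.cases ?_ (fun j => ?_) j
      · simp
      · simp [Equiv.Perm.decomposeFin_symm_apply_succ]
    conv_lhs => rw [this]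
    funext j
    simp
  simp only [Equiv.trans_apply, Equiv.prodCongr_apply, Prod.map, Equiv.refl_apply, Equiv.inv_apply]
  rw [h1, Equiv.Perm.sign_inv, Equiv.Perm.decomposeFin.symm_sign, Equiv.Perm.sign_inv, smul_smul]
  congr 1
  rw [mul_comm]
  congr 1
  by_cases h : i = 0
  · simp [h]
  · rw [if_neg h, Equiv.Perm.sign_swap (Ne.symm h)]

theorem nsmul_cancel (R : Type*) [CommRing R] [Algebra ℝ R] {W : Type*} [AddCommGroup W]
    [Module R W] {k : ℕ} (hk : k ≠ 0) {x y : W} (h : k • x = k • y) : x = y := by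
  have h2 : (algebraMap ℝ R (1 / k)) * (k : R) = 1 := by
    rw [← map_natCast (algebraMap ℝ R), ← map_mul, one_div_mul_cancel (Nat.cast_ne_zero.2 hk),
      map_one]
  rw [← one_smul R x, ← one_smul R y, ← h2, mul_smul, mul_smul, Nat.cast_smul_eq_nsmul,
    Nat.cast_smul_eq_nsmul, h]

variable [Algebra ℝ R]

theorem wedge_zero_right_apply (k : ℕ) (u : P [⋀^Fin k]→ₗ[R] R) (w : P [⋀^Fin 0]→ₗ[R] W)
    (v : Fin k → P) : wedge R P W k 0 u w v = u v • w Fin.elim0 := by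
  refine nsmul_cancel R (k.factorial_ne_zero) ?_
  have h := factorial_smul_wedge_apply k 0 u w v
  rw [Nat.factorial_zero, mul_one] at h
  rw [h]
  have h1 (σ : Equiv.Perm (Fin k)) : Equiv.Perm.sign σ •
      ((u fun i => v (σ (Fin.castAdd 0 i))) • w fun j => v (σ (Fin.natAdd k j))) =
        u v • w Fin.elim0 := by
    have h2 : (u fun i => v (σ (Fin.castAdd 0 i))) = Equiv.Perm.sign σ • u v := u.map_perm v σ
    rw [h2, smul_assoc, smul_smul, Int.units_mul_self, one_smul]
    congr 2
    exact Subsingleton.elim _ _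
  refine (Finset.sum_congr rfl fun σ _ => h1 σ).trans ?_
  rw [Finset.sum_const, Finset.card_univ, Fintype.card_perm, Fintype.card_fin]

theorem wedge_zero_left_apply (l : ℕ) (u : P [⋀^Fin 0]→ₗ[R] R) (w : P [⋀^Fin l]→ₗ[R] W)
    (v : Fin (0 + l) → P) :
    wedge R P W 0 l u w v = u Fin.elim0 • w (fun i => v (Fin.natAdd 0 i)) := by
  refine nsmul_cancel R (l.factorial_ne_zero) ?_
  have h := factorial_smul_wedge_apply 0 l u w v
  rw [Nat.factorial_zero, one_mul] at h
  rw [h]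
  have h1 (σ : Equiv.Perm (Fin (0 + l))) : Equiv.Perm.sign σ •
      ((u fun i => v (σ (Fin.castAdd l i))) • w fun j => v (σ (Fin.natAdd 0 j))) =
        u Fin.elim0 • w (fun i => v (Fin.natAdd 0 i)) := by
    have e : l = 0 + l := (zero_add l).symm
    have h2 := w.map_perm (fun i => v (Fin.natAdd 0 i)) ((finCongr e).symm.permCongr σ)
    have h3 : (fun i => v (Fin.natAdd 0 i)) ∘ ((finCongr e).symm.permCongr σ) =
        fun j => v (σ (Fin.natAdd 0 j)) := by
      funext j
      simp only [Function.comp, Equiv.permCongr_apply, Equiv.symm_symm]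
      congr 1
      have (a : Fin (0 + l)) : Fin.natAdd 0 ((finCongr e).symm a) = a := by ext; simp
      rw [this]
      congr 1
      ext; simp
    rw [h3, Equiv.Perm.sign_permCongr] at h2
    rw [h2, smul_comm (u _), smul_smul, Int.units_mul_self, one_smul]
    congr 2
    exact Subsingleton.elim _ _
  refine (Finset.sum_congr rfl fun σ _ => h1 σ).trans ?_
  rw [Finset.sum_const, Finset.card_univ, Fintype.card_perm, Fintype.card_fin, zero_add]

theorem map_comp_swap_of {ι : Type*} [DecidableEq ι] {N : Type*} [AddCommGroup N]
    [Module R N] [Fintype ι] (f : P [⋀^ι]→ₗ[R] N) (x : ι → P) (i j : ι) :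
    Equiv.Perm.sign (Equiv.swap i j) • f (x ∘ Equiv.swap i j) = f x := by
  rw [f.map_perm, smul_smul, Int.units_mul_self, one_smul]

/-- Contraction is an antiderivation of the exterior product. After multiplication by the factorials
the product is a sum over all permutations, and θ lands either in one of the k + 1 slots of u or in
one of the l + 1 slots of w. All slots of one factor contribute equally, and their numbers are the
quotients of the factorials on the two sides. -/
theorem wedge_cons_apply (k l : ℕ) (u : P [⋀^Fin (k + 1)]→ₗ[R] R)
    (w : P [⋀^Fin (l + 1)]→ₗ[R] W) (θ : P) (v : Fin (k + 1 + l) → P) :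
    wedge R P W (k + 1) (l + 1) u w (Fin.cons θ v : Fin (k + 1 + l + 1) → P) =
      wedge R P W k (l + 1) (u.curryLeft θ) w
          (fun i => v (Fin.cast (by omega) i)) +
        (-1 : ℤ) ^ (k + 1) • wedge R P W (k + 1) l u (w.curryLeft θ) v := by
  refine nsmul_cancel R (k := (k + 1).factorial * (l + 1).factorial) (by positivity) ?_
  have h := factorial_smul_wedge_apply (k + 1) (l + 1) u w (Fin.cons θ v : Fin (k + 1 + l + 1) → P)
  rw [h]
  let F : (Fin (k + 1 + l + 1) → P) → W := fun x =>
    (u fun i => x (Fin.castAdd (l + 1) i)) • w fun j => x (Fin.natAdd (k + 1) j)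
  refine (sum_perm_cons F θ v).trans ?_
  have inl_inj : Function.Injective (Fin.castAdd (l + 1) : Fin (k + 1) → Fin (k + 1 + (l + 1))) :=
    Fin.castAdd_injective _ _
  have inr_inj : Function.Injective (Fin.natAdd (k + 1) : Fin (l + 1) → Fin (k + 1 + (l + 1))) :=
    Fin.natAdd_injective _ _
  have ne (i : Fin (k + 1)) (j : Fin (l + 1)) : Fin.castAdd (l + 1) i ≠ Fin.natAdd (k + 1) j := by
    intro h
    have := congrArg Fin.val h
    simp only [Fin.val_castAdd, Fin.val_natAdd] at this
    omega
  have h1 (x : Fin (k + 1 + l + 1) → P) (i : Fin (k + 1)) :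
      Equiv.Perm.sign (Equiv.swap 0 (Fin.castAdd (l + 1) i)) •
        F (x ∘ Equiv.swap 0 (Fin.castAdd (l + 1) i)) = F x := by
    have h0 : (0 : Fin (k + 1 + l + 1)) = Fin.castAdd (l + 1) (0 : Fin (k + 1)) := rfl
    have e1 : (fun i' => (x ∘ Equiv.swap 0 (Fin.castAdd (l + 1) i)) (Fin.castAdd (l + 1) i')) =
        (fun i' => x (Fin.castAdd (l + 1) i')) ∘ Equiv.swap 0 i := by
      funext i'
      simp only [Function.comp]
      rw [h0, ← inl_inj.swap_apply]
    have e2 : (fun j => (x ∘ Equiv.swap 0 (Fin.castAdd (l + 1) i)) (Fin.natAdd (k + 1) j)) =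
        fun j => x (Fin.natAdd (k + 1) j) := by
      funext j
      simp only [Function.comp]
      rw [h0, Equiv.swap_apply_of_ne_of_ne (ne _ _).symm (ne _ _).symm]
    have e3 : Equiv.Perm.sign (Equiv.swap (0 : Fin (k + 1 + l + 1)) (Fin.castAdd (l + 1) i)) =
        Equiv.Perm.sign (Equiv.swap 0 i) := by
      rw [Equiv.Perm.sign_swap', Equiv.Perm.sign_swap', h0]
      simp only [inl_inj.eq_iff]
    change _ • ((u _) • (w _)) = (u _) • (w _)
    rw [e1, e2, e3, ← smul_assoc, map_comp_swap_of]
  -- The first slot of w: the transposition gives −1, and the argument that was displaced to the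
  -- first slot of u moves past k others to its last slot, which gives (−1)^k.
  have h2' : ∑ τ : Equiv.Perm (Fin (k + 1 + l)), Equiv.Perm.sign τ •
      Equiv.Perm.sign (Equiv.swap 0 (Fin.natAdd (k + 1) (0 : Fin (l + 1)))) •
        F ((Fin.cons θ (v ∘ τ) : Fin (k + 1 + l + 1) → P) ∘
          Equiv.swap 0 (Fin.natAdd (k + 1) (0 : Fin (l + 1)))) =
      (-1 : ℤ) ^ (k + 1) • ∑ τ : Equiv.Perm (Fin (k + 1 + l)), Equiv.Perm.sign τ •
        (u fun i => v (τ (Fin.castAdd l i))) •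
          w.curryLeft θ (fun j => v (τ (Fin.natAdd (k + 1) j))) := by
    rw [Finset.smul_sum]
    refine Finset.sum_congr rfl fun τ _ => ?_
    rw [smul_comm ((-1 : ℤ) ^ (k + 1))]
    congr 1
    rw [Equiv.Perm.sign_swap (show (0 : Fin (k + 1 + l + 1)) ≠ _ from ne 0 0)]
    have e1 : (fun i' => ((Fin.cons θ (v ∘ τ) : Fin (k + 1 + l + 1) → P) ∘
        Equiv.swap 0 (Fin.natAdd (k + 1) (0 : Fin (l + 1)))) (Fin.castAdd (l + 1) i')) =
        (Fin.cons (v (τ (Fin.castAdd l (Fin.last k))))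
          (fun i => v (τ (Fin.castAdd l (Fin.castSucc i)))) : Fin (k + 1) → P) := by
      funext i'
      refine Fin.cases ?_ (fun i' => ?_) i'
      · have : (Fin.castAdd (l + 1) (0 : Fin (k + 1))) = (0 : Fin (k + 1 + l + 1)) := rfl
        simp only [Function.comp, this, Equiv.swap_apply_left, Fin.cons_zero]
        have : (Fin.natAdd (k + 1) (0 : Fin (l + 1))) = (Fin.castAdd l (Fin.last k)).succ := by
          ext; simp
        rw [this, Fin.cons_succ]
        rfl
      · have e : (Fin.castAdd (l + 1) i'.succ) =
            ((Fin.castAdd l (Fin.castSucc i')).succ : Fin (k + 1 + l + 1)) := by ext; simp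
        simp only [Function.comp]
        rw [Equiv.swap_apply_of_ne_of_ne _ (ne _ _), e, Fin.cons_succ, Fin.cons_succ]
        · rfl
        · rw [e]
          exact Fin.succ_ne_zero _
    have e2 : (fun j => ((Fin.cons θ (v ∘ τ) : Fin (k + 1 + l + 1) → P) ∘
        Equiv.swap 0 (Fin.natAdd (k + 1) (0 : Fin (l + 1)))) (Fin.natAdd (k + 1) j)) =
        (Fin.cons θ fun j => v (τ (Fin.natAdd (k + 1) j)) : Fin (l + 1) → P) := by
      funext j
      refine Fin.cases ?_ (fun j => ?_) j
      · simp only [Function.comp, Equiv.swap_apply_right, Fin.cons_zero]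
      · have e : (Fin.natAdd (k + 1) j.succ) =
            ((Fin.natAdd (k + 1) j).succ : Fin (k + 1 + l + 1)) := by ext; simp; omega
        simp only [Function.comp]
        rw [Equiv.swap_apply_of_ne_of_ne _ (inr_inj.ne (Fin.succ_ne_zero _)), e, Fin.cons_succ,
          Fin.cons_succ, Function.comp]
        rw [e]
        exact Fin.succ_ne_zero _
    have e3 : u (Fin.cons (v (τ (Fin.castAdd l (Fin.last k))))
          (fun i => v (τ (Fin.castAdd l (Fin.castSucc i)))) : Fin (k + 1) → P) =
        (-1 : ℤ) ^ k • u fun i => v (τ (Fin.castAdd l i)) := by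
      have := u.neg_one_pow_smul_map_insertNth (Fin.last k) (v (τ (Fin.castAdd l (Fin.last k))))
        (fun i => v (τ (Fin.castAdd l (Fin.castSucc i))))
      rw [Fin.val_last] at this
      change u (Matrix.vecCons _ _) = _
      rw [← this]
      congr 2
      rw [Fin.insertNth_last']
      funext i
      refine Fin.lastCases ?_ (fun i => ?_) i <;> simp
    change _ • ((u _) • (w _)) = _
    rw [e1, e2, e3, pow_succ, mul_neg_one, neg_smul, smul_assoc, Units.smul_def]
    simp [Matrix.vecCons]
  have h2 (j : Fin (l + 1)) : ∑ τ : Equiv.Perm (Fin (k + 1 + l)), Equiv.Perm.sign τ •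
      Equiv.Perm.sign (Equiv.swap 0 (Fin.natAdd (k + 1) j)) •
        F ((Fin.cons θ (v ∘ τ) : Fin (k + 1 + l + 1) → P) ∘ Equiv.swap 0 (Fin.natAdd (k + 1) j)) =
      (-1 : ℤ) ^ (k + 1) • ∑ τ : Equiv.Perm (Fin (k + 1 + l)), Equiv.Perm.sign τ •
        (u fun i => v (τ (Fin.castAdd l i))) •
          w.curryLeft θ (fun j => v (τ (Fin.natAdd (k + 1) j))) := by
    refine Fin.cases h2' (fun j => ?_) j
    rw [← h2']
    let a : Fin (k + 1 + l) := Fin.castAdd l (Fin.last k)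
    let b : Fin (k + 1 + l) := Fin.natAdd (k + 1) j
    have hab : a ≠ b := by
      intro h
      have := congrArg Fin.val h
      simp only [a, b, Fin.val_castAdd, Fin.val_natAdd, Fin.val_last] at this
      omega
    have ea : Fin.natAdd (k + 1) (0 : Fin (l + 1)) = a.succ := by ext; simp [a]
    have eb : Fin.natAdd (k + 1) j.succ = b.succ := by ext; simp [b]; omega
    -- The other slots of w reduce to the first one: multiplying τ by the transposition (a b)
    -- changes its sign, and so does the exchange of two arguments of w.
    refine Fintype.sum_equiv (Equiv.mulRight (Equiv.swap a b)) _ _ fun τ => ?_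
    rw [Equiv.coe_mulRight, map_mul, Equiv.Perm.sign_swap hab, eb, ea,
      Equiv.Perm.sign_swap (Fin.succ_ne_zero _).symm,
      Equiv.Perm.sign_swap (Fin.succ_ne_zero _).symm, mul_neg_one, Units.neg_smul]
    have e1 : (Fin.cons θ (v ∘ ⇑(τ * Equiv.swap a b)) : Fin (k + 1 + l + 1) → P) ∘
        Equiv.swap 0 a.succ =
        ((Fin.cons θ (v ∘ τ) : Fin (k + 1 + l + 1) → P) ∘ Equiv.swap 0 b.succ) ∘
          Equiv.swap a.succ b.succ := by
      have e2 : (Fin.cons θ (v ∘ ⇑(τ * Equiv.swap a b)) : Fin (k + 1 + l + 1) → P) =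
          (Fin.cons θ (v ∘ τ) : Fin (k + 1 + l + 1) → P) ∘ Equiv.swap a.succ b.succ := by
        funext i
        refine Fin.cases ?_ (fun i => ?_) i
        · simp only [Function.comp]
          rw [Equiv.swap_apply_of_ne_of_ne (Fin.succ_ne_zero _).symm (Fin.succ_ne_zero _).symm]
          rfl
        · simp only [Function.comp]
          rw [(Fin.succ_injective _).swap_apply, Fin.cons_succ, Fin.cons_succ]
          rfl
      rw [e2, Function.comp_assoc, Function.comp_assoc, ← Equiv.Perm.coe_mul,
        ← Equiv.Perm.coe_mul]
      congr 2
      rw [Equiv.mul_swap_eq_swap_mul, Equiv.swap_apply_left,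
        Equiv.swap_apply_of_ne_of_ne (Fin.succ_ne_zero _).symm (Fin.succ_ne_zero _).symm]
    rw [e1]
    have e3 (x : Fin (k + 1 + l + 1) → P) : F (x ∘ Equiv.swap a.succ b.succ) = - F x := by
      have f1 : (fun i' => (x ∘ Equiv.swap a.succ b.succ) (Fin.castAdd (l + 1) i')) =
          (fun i' => x (Fin.castAdd (l + 1) i')) := by
        funext i'
        simp only [Function.comp]
        rw [← ea, ← eb, Equiv.swap_apply_of_ne_of_ne (ne _ _) (ne _ _)]
      have f2 : (fun j' => (x ∘ Equiv.swap a.succ b.succ) (Fin.natAdd (k + 1) j')) =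
          (fun j' => x (Fin.natAdd (k + 1) j')) ∘ Equiv.swap 0 j.succ := by
        funext i'
        simp only [Function.comp]
        rw [← ea, ← eb, ← inr_inj.swap_apply]
      change (u _) • (w _) = -((u _) • (w _))
      rw [f1, f2, w.map_swap _ (Fin.succ_ne_zero _).symm, smul_neg]
    rw [e3]
    simp
  have h3 : ∑ τ : Equiv.Perm (Fin (k + 1 + l)), Equiv.Perm.sign τ •
      F (Fin.cons θ (v ∘ τ) : Fin (k + 1 + l + 1) → P) =
      (k.factorial * (l + 1).factorial) • wedge R P W k (l + 1) (u.curryLeft θ) w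
          (fun i => v (Fin.cast (by omega) i)) := by
    rw [factorial_smul_wedge_apply]
    have e : k + 1 + l = k + (l + 1) := by omega
    refine Fintype.sum_equiv ((finCongr e).permCongr) _ _ fun τ => ?_
    rw [Equiv.Perm.sign_permCongr]
    congr 1
    change (u _) • (w _) = _
    congr 1
    · rw [AlternatingMap.curryLeft_apply_apply]
      congr 1
      funext i
      refine Fin.cases rfl (fun i => ?_) i
      have e : (Fin.castAdd (l + 1) i.succ) =
            ((Fin.castAdd l (Fin.castSucc i)).succ : Fin (k + 1 + l + 1)) := by ext; simp
      rw [e, Fin.cons_succ]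
      rfl
    · congr 1
      funext j
      have e : (Fin.natAdd (k + 1) j) =
        ((Fin.cast (by omega) (Fin.natAdd k j) : Fin (k + 1 + l)).succ :
          Fin (k + 1 + l + 1)) := by ext; simp; omega
      rw [e, Fin.cons_succ]
      rfl
  have h4 := factorial_smul_wedge_apply (k + 1) l u (w.curryLeft θ) v
  have h5 (f : Fin (k + 1 + l + 1) → W) : ∑ i, f i =
      ∑ i : Fin (k + 1), f (Fin.castAdd (l + 1) i) + ∑ j : Fin (l + 1), f (Fin.natAdd (k + 1) j) :=
    Fin.sum_univ_add (a := k + 1) (b := l + 1) f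
  simp only [h5, smul_add, Finset.sum_add_distrib, h1, Finset.sum_const, Finset.card_univ,
    Fintype.card_fin]
  congr 1
  · simp only [smul_comm (_ : ℤˣ) (k + 1), ← Finset.smul_sum]
    rw [h3, smul_smul, Nat.factorial_succ k, mul_assoc]
  · simp only [Finset.smul_sum] at h2 ⊢
    rw [Finset.sum_comm]
    simp only [h2]
    rw [Finset.sum_const, Finset.card_univ, Fintype.card_fin, ← Finset.smul_sum, ← h4,
      smul_comm (l + 1), smul_smul, smul_comm _ ((-1 : ℤ) ^ (k + 1)), Nat.factorial_succ l]
    congr 2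
    ring

end Wedge

/-! ### Interior and exterior products and parity as operators on forms of all degrees -/

section Operators
variable {R : Type*} [CommRing R] {P : Type*} [AddCommGroup P] [Module R P]
  {W : Type*} [AddCommGroup W] [Module R W]

variable (R P W) in
/-- Additive operators on forms of all degrees. -/
abbrev Op := Module.End ℤ (Forms R P W)

/-- Multiplication by a function. -/
abbrev mulOp (f : R) : Op R P W := Module.toModuleEnd ℤ (S := R) (Forms R P W) f

theorem mulOp_apply (f : R) (w : Forms R P W) : mulOp f w = f • w := rfl

/-- The interior product with `θ`. -/
def inner (θ : P) : Op R P W where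
  toFun w k := (w (k + 1)).curryLeft θ
  map_add' _ _ := rfl
  map_smul' _ _ := rfl

theorem inner_apply (θ : P) (w : Forms R P W) (k : ℕ) :
    inner θ w k = (w (k + 1)).curryLeft θ := rfl

theorem inner_apply_apply (θ : P) (w : Forms R P W) (k : ℕ) (v : Fin k → P) :
    inner θ w k v = w (k + 1) (Fin.cons θ v : Fin (k + 1) → P) := rfl

theorem inner_smul (θ : P) (f : R) (w : Forms R P W) : inner θ (f • w) = f • inner θ w := rfl

theorem inner_add_left (θ η : P) : (inner (θ + η) : Op R P W) = inner θ + inner η := by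
  refine LinearMap.ext fun w => funext fun k => ?_
  exact map_add (w (k + 1)).curryLeft θ η

theorem inner_smul_left (f : R) (θ : P) (w : Forms R P W) : inner (f • θ) w = f • inner θ w := by
  ext k : 1
  exact map_smul (w (k + 1)).curryLeft f θ

theorem inner_zero_left : (inner 0 : Op R P W) = 0 := by
  refine LinearMap.ext fun w => funext fun k => ?_
  exact map_zero (w (k + 1)).curryLeft

theorem inner_neg_left (θ : P) : (inner (-θ) : Op R P W) = -inner θ := by
  refine LinearMap.ext fun w => funext fun k => ?_
  exact map_neg (w (k + 1)).curryLeft θ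

theorem inner_sub_left (θ η : P) : (inner (θ - η) : Op R P W) = inner θ - inner η := by
  rw [sub_eq_add_neg, inner_add_left, inner_neg_left, sub_eq_add_neg]

theorem component_succ_ext {w w' : Forms R P W} {k : ℕ} (h : ∀ θ, inner θ w k = inner θ w' k) :
    w (k + 1) = w' (k + 1) := by
  ext v
  have := congrArg (fun a => a (Fin.tail v)) (h (v 0))
  simpa [inner_apply_apply, Fin.cons_self_tail] using this

theorem forms_ext_inner {w w' : Forms R P W} (h0 : w 0 = w' 0) (h : ∀ θ, inner θ w = inner θ w') :
    w = w' := by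
  ext k : 1
  cases k with
  | zero => exact h0
  | succ k => exact component_succ_ext fun θ => congrFun (h θ) k

/-- An operator that commutes or anticommutes with interior products and has no component of
degree `0` vanishes. -/
theorem op_eq_zero_of_inner {T : Op R P W} (h0 : ∀ w, T w 0 = 0) (ε : ℤ)
    (h : ∀ θ, inner θ * T = ε • (T * inner θ)) : T = 0 := by
  have key (k : ℕ) : ∀ w, T w k = 0 := by
    induction k with
    | zero => exact h0
    | succ k ih =>
      intro w
      refine component_succ_ext (w' := 0) fun θ => ?_
      have h1 : inner θ (T w) = ε • T (inner θ w) := DFunLike.congr_fun (h θ) w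
      rw [h1, Pi.smul_apply, ih, smul_zero]
      rfl
  refine LinearMap.ext fun w => funext fun k => ?_
  exact key k w

theorem inner_inner (θ η : P) : (inner θ * inner η : Op R P W) = -(inner η * inner θ) := by
  refine LinearMap.ext fun w => funext fun k => ?_
  have h := (w (k + 2)).curryLeft_same (θ + η)
  simp only [map_add, AlternatingMap.curryLeft_add, LinearMap.add_apply,
    AlternatingMap.curryLeft_same, zero_add, add_zero] at h
  exact eq_neg_of_add_eq_zero_left h

/-- The exterior product with a `1`-form `α`. -/
def outer (α : P →ₗ[R] R) : Op R P W where
  toFun w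
    | 0 => 0
    | k + 1 => AlternatingMap.alternatizeUncurryFin (α.smulRight (w k))
  map_add' w w' := by
    ext k v
    cases k <;> simp [AlternatingMap.alternatizeUncurryFin_apply, Finset.sum_add_distrib]
  map_smul' a w := by
    ext k v
    cases k
    · simp
    · simp only [AlternatingMap.alternatizeUncurryFin_apply, Pi.smul_apply, eq_intCast, Int.cast_id,
        AlternatingMap.smul_apply, LinearMap.smulRight_apply, Finset.smul_sum]
      exact Finset.sum_congr rfl fun i _ => by rw [smul_comm a, smul_comm a]

theorem outer_zero_apply (α : P →ₗ[R] R) (w : Forms R P W) : outer α w 0 = 0 := rfl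

theorem outer_succ_apply (α : P →ₗ[R] R) (w : Forms R P W) (k : ℕ) (v : Fin (k + 1) → P) :
    outer α w (k + 1) v = ∑ i : Fin (k + 1), (-1 : ℤ) ^ (i : ℕ) • α (v i) • w k (i.removeNth v) := by
  change AlternatingMap.alternatizeUncurryFin (α.smulRight (w k)) v = _
  rw [AlternatingMap.alternatizeUncurryFin_apply]
  rfl

theorem removeNth_zero_cons {P : Type*} {k : ℕ} (z : P) (v : Fin k → P) :
    (0 : Fin (k + 1)).removeNth (Fin.cons z v : Fin (k + 1) → P) = v := by
  ext i; simp [Fin.removeNth]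

theorem removeNth_succ_cons {P : Type*} {k : ℕ} (i : Fin (k + 1)) (z : P) (v : Fin (k + 1) → P) :
    i.succ.removeNth (Fin.cons z v : Fin (k + 2) → P) = Fin.cons z (i.removeNth v) := by
  ext j
  refine Fin.cases ?_ (fun j => ?_) j <;> simp [Fin.removeNth]

/-- The Clifford relation. The summand i = 0 of the alternating sum gives the scalar, the others the
exterior product of the contraction. -/
theorem inner_outer (θ : P) (α : P →ₗ[R] R) :
    (inner θ * outer α : Op R P W) = mulOp (α θ) - outer α * inner θ := by
  rw [eq_sub_iff_add_eq]
  refine LinearMap.ext fun w => funext fun k => AlternatingMap.ext fun v => ?_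
  change inner θ (outer α w) k v + outer α (inner θ w) k v = α θ • w k v
  rw [inner_apply_apply, outer_succ_apply, Fin.sum_univ_succ, Fin.cons_zero, removeNth_zero_cons]
  cases k with
  | zero => simp [outer_zero_apply]
  | succ k =>
    rw [outer_succ_apply]
    simp only [Fin.cons_succ, removeNth_succ_cons, inner_apply_apply, Fin.val_succ, pow_succ,
      mul_neg_one, neg_smul, Finset.sum_neg_distrib]
    simp

theorem outer_mul_inner (θ : P) (α : P →ₗ[R] R) :
    (outer α * inner θ : Op R P W) = mulOp (α θ) - inner θ * outer α := by
  rw [inner_outer]; abel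

theorem outer_smul (α : P →ₗ[R] R) (f : R) (w : Forms R P W) :
    outer α (f • w) = f • outer α w := by
  ext k v
  cases k with
  | zero => simp [outer_zero_apply]
  | succ k =>
    simp only [outer_succ_apply, Finset.smul_sum, Pi.smul_apply, AlternatingMap.smul_apply]
    exact Finset.sum_congr rfl fun i _ => by rw [smul_comm f, smul_comm f]

theorem outer_add_left (α β : P →ₗ[R] R) :
    (outer (α + β) : Op R P W) = outer α + outer β := by
  refine LinearMap.ext fun w => funext fun k => AlternatingMap.ext fun v => ?_
  change outer (α + β) w k v = outer α w k v + outer β w k v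
  cases k with
  | zero => simp [outer_zero_apply]
  | succ k => simp [outer_succ_apply, add_smul, Finset.sum_add_distrib]

theorem outer_smul_left (f : R) (α : P →ₗ[R] R) (w : Forms R P W) :
    outer (f • α) w = f • outer α w := by
  ext k v
  cases k with
  | zero => simp [outer_zero_apply]
  | succ k =>
    simp only [outer_succ_apply, Finset.smul_sum, Pi.smul_apply, AlternatingMap.smul_apply,
      LinearMap.smul_apply, smul_eq_mul]
    exact Finset.sum_congr rfl fun i _ => by rw [smul_comm f, mul_smul]

theorem homog_same (k : ℕ) (u : P [⋀^Fin k]→ₗ[R] W) : homog k u k = u := Pi.single_eq_same _ _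

theorem homog_of_ne {k l : ℕ} (h : l ≠ k) (u : P [⋀^Fin k]→ₗ[R] W) : homog k u l = 0 :=
  Pi.single_eq_of_ne h _

theorem homog_add (k : ℕ) (u v : P [⋀^Fin k]→ₗ[R] W) : homog k (u + v) = homog k u + homog k v :=
  Pi.single_add _ _ _

theorem homog_smul (k : ℕ) (f : R) (u : P [⋀^Fin k]→ₗ[R] W) : homog k (f • u) = f • homog k u :=
  Pi.single_smul _ _ _

theorem homog_zero (k : ℕ) : homog k (0 : P [⋀^Fin k]→ₗ[R] W) = 0 := Pi.single_zero _

theorem inner_homog_zero (θ : P) (u : P [⋀^Fin 0]→ₗ[R] W) : inner θ (homog 0 u) = 0 := by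
  ext k : 1
  rw [inner_apply, homog_of_ne (Nat.succ_ne_zero k)]
  rfl

theorem inner_homog_succ (θ : P) (k : ℕ) (u : P [⋀^Fin (k + 1)]→ₗ[R] W) :
    inner θ (homog (k + 1) u) = homog k (u.curryLeft θ) := by
  ext l : 1
  rw [inner_apply]
  rcases eq_or_ne l k with rfl | h
  · rw [homog_same, homog_same]
  · rw [homog_of_ne h, homog_of_ne (by omega)]
    rfl

theorem outer_homog (α : P →ₗ[R] R) (k : ℕ) (u : P [⋀^Fin k]→ₗ[R] W) :
    outer α (homog k u) = homog (k + 1) (outer α (homog k u) (k + 1)) := by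
  ext l : 1
  rcases eq_or_ne l (k + 1) with rfl | h
  · rw [homog_same]
  · rw [homog_of_ne h]
    cases l with
    | zero => rfl
    | succ l =>
      ext v
      rw [outer_succ_apply, homog_of_ne (by omega)]
      simp

/-- The parity automorphism. -/
def par : Op R P W where
  toFun w k := (-1 : ℤ) ^ k • w k
  map_add' w w' := by ext k : 1; simp
  map_smul' a w := by ext k : 1; simp [smul_comm a]

theorem par_apply (w : Forms R P W) (k : ℕ) : par w k = (-1 : ℤ) ^ k • w k := rfl

theorem par_par : (par * par : Op R P W) = 1 := by
  refine LinearMap.ext fun w => funext fun k => ?_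
  change (-1 : ℤ) ^ k • (-1 : ℤ) ^ k • w k = w k
  rw [smul_smul, ← pow_add, Even.neg_one_pow ⟨k, rfl⟩, one_smul]

theorem par_homog (k : ℕ) (u : P [⋀^Fin k]→ₗ[R] W) :
    par (homog k u) = (-1 : ℤ) ^ k • homog k u := by
  ext l : 1
  rw [par_apply, Pi.smul_apply]
  rcases eq_or_ne l k with rfl | h
  · rfl
  · rw [homog_of_ne h, smul_zero, smul_zero]

theorem inner_par (θ : P) : (inner θ * par : Op R P W) = -(par * inner θ) := by
  refine LinearMap.ext fun w => funext fun k => ?_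
  change (((-1 : ℤ) ^ (k + 1) • w (k + 1)).curryLeft θ) = -((-1 : ℤ) ^ k • (w (k + 1)).curryLeft θ)
  rw [pow_succ, mul_neg_one, neg_smul]
  rfl

end Operators

/-! ### The exterior product in all degrees -/

section TotalWedge
variable {R : Type*} [CommRing R] {P : Type*} [AddCommGroup P] [Module R P]
  {W : Type*} [AddCommGroup W] [Module R W]

theorem sum_alt_apply {ι : Type*} (s : Finset ι) {k : ℕ} (g : ι → P [⋀^Fin k]→ₗ[R] W)
    (v : Fin k → P) : (∑ i ∈ s, g i) v = ∑ i ∈ s, g i v :=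
  map_sum (⟨⟨fun a => a v, rfl⟩, fun _ _ => rfl⟩ : (P [⋀^Fin k]→ₗ[R] W) →+ W) g s

/-- The component in degree `d` of the product of forms of degrees `k` and `l`. -/
def wedgePart (d k l : ℕ) (u : P [⋀^Fin k]→ₗ[R] R) (w : P [⋀^Fin l]→ₗ[R] W) :
    P [⋀^Fin d]→ₗ[R] W :=
  if h : k + l = d then degCast R P W h (wedge R P W k l u w) else 0

theorem wedgePart_apply {d k l : ℕ} (h : k + l = d) (u : P [⋀^Fin k]→ₗ[R] R)
    (w : P [⋀^Fin l]→ₗ[R] W) (v : Fin d → P) :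
    wedgePart d k l u w v = wedge R P W k l u w (fun i => v (Fin.cast h i)) := by
  rw [wedgePart, dif_pos h]
  rfl

/-- The exterior product of scalar forms and `W`-valued forms. -/
def wedgeAct : Forms R P R →ₗ[R] Forms R P W →ₗ[R] Forms R P W :=
  LinearMap.mk₂ R (fun u w d => ∑ kl : Finset.HasAntidiagonal.antidiagonal d,
    degCast R P W (Finset.HasAntidiagonal.mem_antidiagonal.1 kl.2)
      (wedge R P W kl.1.1 kl.1.2 (u kl.1.1) (w kl.1.2)))
    (fun u u' w => by ext d : 1; simp [Finset.sum_add_distrib])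
    (fun f u w => by ext d : 1; simp [Finset.smul_sum])
    (fun u w w' => by ext d : 1; simp [Finset.sum_add_distrib])
    (fun f u w => by ext d : 1; simp [Finset.smul_sum])

theorem wedgeForms_eq [Algebra ℝ R] (u v : Forms R P R) : wedgeForms u v = wedgeAct u v := rfl

theorem wedgeAct_apply (u : Forms R P R) (w : Forms R P W) (d : ℕ) :
    wedgeAct u w d = ∑ kl ∈ Finset.HasAntidiagonal.antidiagonal d, wedgePart d kl.1 kl.2 (u kl.1) (w kl.2) := by
  rw [← Finset.sum_coe_sort (Finset.HasAntidiagonal.antidiagonal d)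
    (fun kl : ℕ × ℕ => wedgePart d kl.1 kl.2 (u kl.1) (w kl.2))]
  change ∑ kl : Finset.HasAntidiagonal.antidiagonal d,
    degCast R P W (Finset.HasAntidiagonal.mem_antidiagonal.1 kl.2)
      (wedge R P W kl.1.1 kl.1.2 (u kl.1.1) (w kl.1.2)) = _
  refine Finset.sum_congr rfl fun kl _ => ?_
  rw [wedgePart, dif_pos (Finset.HasAntidiagonal.mem_antidiagonal.1 kl.2)]

variable [Algebra ℝ R]

theorem wedgeAct_zero_apply (u : Forms R P R) (w : Forms R P W) :
    wedgeAct u w 0 = u 0 Fin.elim0 • w 0 := by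
  ext v
  rw [wedgeAct_apply, Finset.Nat.antidiagonal_zero, Finset.sum_singleton, wedgePart_apply (add_zero 0),
    wedge_zero_right_apply, AlternatingMap.smul_apply]
  congr 2 <;> exact Subsingleton.elim _ _

/-- The antiderivation rule, bidegree by bidegree. Factors of degree zero have to be treated apart
because they have no contraction. -/
theorem inner_wedgeAct (θ : P) (u : Forms R P R) (w : Forms R P W) :
    inner θ (wedgeAct u w) = wedgeAct (inner θ u) w + wedgeAct (par u) (inner θ w) := by
  ext d v
  rw [inner_apply_apply, Pi.add_apply, AlternatingMap.add_apply]
  rw [wedgeAct_apply, wedgeAct_apply, wedgeAct_apply, sum_alt_apply, sum_alt_apply, sum_alt_apply]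
  -- The two terms of the rule, indexed by the bidegree before contraction and zero where the
  -- contracted factor has degree 0, so that the sums over antidiagonals can be shifted by one.
  let A : ℕ × ℕ → W := fun kl => match kl.1 with
    | 0 => 0
    | k + 1 => wedgePart d k kl.2 (inner θ u k) (w kl.2) v
  let B : ℕ × ℕ → W := fun kl => match kl.2 with
    | 0 => 0
    | l + 1 => wedgePart d kl.1 l (par u kl.1) (inner θ w l) v
  have key (kl : ℕ × ℕ) (h : kl ∈ Finset.HasAntidiagonal.antidiagonal (d + 1)) :
      wedgePart (d + 1) kl.1 kl.2 (u kl.1) (w kl.2) (Fin.cons θ v : Fin (d + 1) → P) =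
        A kl + B kl := by
    rw [Finset.HasAntidiagonal.mem_antidiagonal] at h
    obtain ⟨k, l⟩ := kl
    dsimp only at h ⊢
    rw [wedgePart_apply h]
    match k, l, h with
    | 0, 0, h => omega
    | k + 1, 0, h =>
      obtain rfl : k = d := by omega
      change _ = wedgePart k k 0 (inner θ u k) (w 0) v + 0
      rw [add_zero (wedgePart _ _ _ _ _ _), wedgePart_apply (add_zero k), wedge_zero_right_apply,
        wedge_zero_right_apply]
      rfl
    | 0, l + 1, h =>
      obtain rfl : l = d := by omega
      change _ = 0 + wedgePart l 0 l (par u 0) (inner θ w l) v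
      rw [zero_add (wedgePart _ _ _ _ _ _), wedgePart_apply (zero_add l), wedge_zero_left_apply,
        wedge_zero_left_apply, par_apply, pow_zero, one_smul, inner_apply_apply]
      congr 2
      funext i
      refine Fin.cases ?_ (fun i => ?_) i
      · have : Fin.cast h (Fin.natAdd 0 (0 : Fin (l + 1))) = 0 := by ext; simp
        rw [this]; rfl
      · have : Fin.cast h (Fin.natAdd 0 i.succ) = i.succ := by ext; simp
        rw [this, Fin.cons_succ, Fin.cons_succ]
        congr 1
        ext; simp
    | k + 1, l + 1, h =>
      obtain rfl : k + 1 + l = d := by omega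
      change _ = wedgePart (k + 1 + l) k (l + 1) (inner θ u k) (w (l + 1)) v +
        wedgePart (k + 1 + l) (k + 1) l (par u (k + 1)) (inner θ w l) v
      rw [wedgePart_apply (by omega), wedgePart_apply rfl, par_apply, map_zsmul,
        LinearMap.smul_apply, AlternatingMap.smul_apply]
      exact wedge_cons_apply k l (u (k + 1)) (w (l + 1)) θ v
  rw [Finset.sum_congr rfl key, Finset.sum_add_distrib, Finset.Nat.sum_antidiagonal_succ,
    Finset.Nat.sum_antidiagonal_succ' (f := B)]
  simp [A, B]

/-- The exterior product with `u` as an operator. -/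
def wedgeOp (u : Forms R P R) : Op R P W := (wedgeAct u).toAddMonoidHom.toIntLinearMap

theorem wedgeOp_apply (u : Forms R P R) (w : Forms R P W) : wedgeOp u w = wedgeAct u w := rfl

theorem inner_mul_wedgeOp (θ : P) (u : Forms R P R) :
    (inner θ * wedgeOp u : Op R P W) = wedgeOp (inner θ u) + wedgeOp (par u) * inner θ := by
  refine LinearMap.ext fun w => ?_
  exact inner_wedgeAct θ u w

theorem wedgeOp_add (u v : Forms R P R) : (wedgeOp (u + v) : Op R P W) = wedgeOp u + wedgeOp v := by
  refine LinearMap.ext fun w => ?_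
  change wedgeAct (u + v) w = wedgeAct u w + wedgeAct v w
  rw [map_add, LinearMap.add_apply]

theorem wedgeOp_zsmul (a : ℤ) (u : Forms R P R) :
    (wedgeOp (a • u) : Op R P W) = a • wedgeOp u := by
  refine LinearMap.ext fun w => ?_
  rw [wedgeOp_apply, map_zsmul]
  rfl

theorem wedgeOp_neg (u : Forms R P R) : (wedgeOp (-u) : Op R P W) = -wedgeOp u := by
  refine LinearMap.ext fun w => ?_
  rw [wedgeOp_apply, map_neg]
  rfl

theorem wedgeOp_sub (u v : Forms R P R) : (wedgeOp (u - v) : Op R P W) = wedgeOp u - wedgeOp v := by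
  rw [sub_eq_add_neg, wedgeOp_add, wedgeOp_neg, sub_eq_add_neg]

theorem wedgeOp_zero : (wedgeOp 0 : Op R P W) = 0 := by
  refine LinearMap.ext fun w => ?_
  rw [wedgeOp_apply, map_zero]
  rfl

theorem wedgeOp_apply_smul (f : R) (u : Forms R P R) (w : Forms R P W) :
    wedgeOp u (f • w) = f • wedgeOp u w := by simp [wedgeOp_apply]

/-- A form of positive degree is determined by its contractions, and both sides contract by the
antiderivation rule. Induction on the degree therefore proves this, and in the same way
associativity, graded commutativity and the Leibniz rules below, without any return to permutations.
-/
theorem par_wedgeAct (u : Forms R P R) (w : Forms R P W) :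
    par (wedgeAct u w) = wedgeAct (par u) (par w) := by
  have key (k : ℕ) : ∀ (u : Forms R P R) (w : Forms R P W),
      par (wedgeAct u w) k = wedgeAct (par u) (par w) k := by
    induction k with
    | zero =>
      intro u w
      rw [par_apply, wedgeAct_zero_apply, wedgeAct_zero_apply, par_apply, par_apply]
      simp
    | succ k ih =>
      intro u w
      refine component_succ_ext fun θ => ?_
      have h (w : Forms R P W) : inner θ (par w) = -par (inner θ w) :=
        DFunLike.congr_fun (inner_par θ) w
      have h' (w : Forms R P R) : inner θ (par w) = -par (inner θ w) :=
        DFunLike.congr_fun (inner_par θ) w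
      rw [h, inner_wedgeAct, inner_wedgeAct, h, h', map_add]
      simp only [Pi.neg_apply, Pi.add_apply, map_neg, LinearMap.neg_apply, ih]
      abel
  ext k : 1
  exact key k u w

theorem wedgeAct_assoc (u v : Forms R P R) (w : Forms R P W) :
    wedgeAct (wedgeAct u v) w = wedgeAct u (wedgeAct v w) := by
  have key (k : ℕ) : ∀ (u v : Forms R P R) (w : Forms R P W),
      wedgeAct (wedgeAct u v) w k = wedgeAct u (wedgeAct v w) k := by
    induction k with
    | zero =>
      intro u v w
      simp only [wedgeAct_zero_apply, AlternatingMap.smul_apply, smul_smul, smul_eq_mul]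
    | succ k ih =>
      intro u v w
      refine component_succ_ext fun θ => ?_
      simp only [inner_wedgeAct, map_add, par_wedgeAct, Pi.add_apply, ih, LinearMap.add_apply]
      abel
  ext k : 1
  exact key k u v w

theorem wedgeOp_mul (u v : Forms R P R) :
    (wedgeOp u * wedgeOp v : Op R P W) = wedgeOp (wedgeAct u v) := by
  refine LinearMap.ext fun w => ?_
  exact (wedgeAct_assoc u v w).symm

theorem wedgeAct_homog_comm (k l : ℕ) (u : P [⋀^Fin k]→ₗ[R] R) (v : P [⋀^Fin l]→ₗ[R] R)
    (w : Forms R P W) : wedgeAct (homog k u) (wedgeAct (homog l v) w) =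
      (-1 : ℤ) ^ (k * l) • wedgeAct (homog l v) (wedgeAct (homog k u) w) := by
  have key (d : ℕ) : ∀ (k l : ℕ) (u : P [⋀^Fin k]→ₗ[R] R) (v : P [⋀^Fin l]→ₗ[R] R)
      (w : Forms R P W), wedgeAct (homog k u) (wedgeAct (homog l v) w) d =
        ((-1 : ℤ) ^ (k * l) • wedgeAct (homog l v) (wedgeAct (homog k u) w)) d := by
    induction d with
    | zero =>
      intro k l u v w
      rw [Pi.smul_apply]
      simp only [wedgeAct_zero_apply]
      rcases Nat.eq_zero_or_pos k with rfl | hk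
      · rw [zero_mul, pow_zero, one_smul, smul_comm]
      · rw [homog_of_ne hk.ne]
        simp
    | succ d ih =>
      intro k l u v w
      refine component_succ_ext fun θ => ?_
      rw [map_zsmul]
      simp only [inner_wedgeAct, map_add, par_homog, map_zsmul, Pi.add_apply, Pi.smul_apply,
        LinearMap.smul_apply, smul_add]
      cases k with
      | zero =>
        cases l with
        | zero =>
          simp only [inner_homog_zero, map_zero, LinearMap.zero_apply, Pi.zero_apply]
          rw [ih]; simp
        | succ l =>
          simp only [inner_homog_zero, map_zero, LinearMap.zero_apply, Pi.zero_apply,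
            inner_homog_succ]
          rw [ih, ih]
          simp
      | succ k =>
        cases l with
        | zero =>
          simp only [inner_homog_zero, map_zero, LinearMap.zero_apply, Pi.zero_apply,
            inner_homog_succ]
          rw [ih, ih]
          simp
        | succ l =>
          simp only [inner_homog_succ]
          rw [ih k, ih (k + 1) l, ih (k + 1) (l + 1)]
          simp only [Pi.smul_apply, smul_smul]
          rcases Nat.even_or_odd k with hk | hk <;> rcases Nat.even_or_odd l with hl | hl <;>
            simp [pow_add, pow_mul, hk.neg_one_pow, hl.neg_one_pow, mul_add, add_mul] <;> abel
  ext d : 1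
  exact key d k l u v w

theorem wedgeOp_homog_comm (k l : ℕ) (u : P [⋀^Fin k]→ₗ[R] R) (v : P [⋀^Fin l]→ₗ[R] R) :
    (wedgeOp (homog k u) * wedgeOp (homog l v) : Op R P W) =
      (-1 : ℤ) ^ (k * l) • (wedgeOp (homog l v) * wedgeOp (homog k u)) := by
  refine LinearMap.ext fun w => ?_
  exact wedgeAct_homog_comm k l u v w

theorem wedgeOp_ofFun (f : R) : (wedgeOp (ofFun P f) : Op R P W) = mulOp f := by
  rw [← sub_eq_zero]
  refine op_eq_zero_of_inner (fun w => ?_) 1 fun θ => ?_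
  · change wedgeAct (ofFun P f) w 0 - f • w 0 = 0
    rw [wedgeAct_zero_apply, ofFun, homog_same, AlternatingMap.constOfIsEmpty_apply]
    exact sub_self _
  · rw [mul_sub, inner_mul_wedgeOp, ofFun, inner_homog_zero, wedgeOp_zero, par_homog, pow_zero,
      one_smul, one_smul, zero_add, sub_mul]
    rfl

/-- A `1`-form as an element of `Forms`. -/
def ofCovec (α : P →ₗ[R] R) : Forms R P R :=
  homog 1 (AlternatingMap.ofSubsingleton R P R (0 : Fin 1) α)

theorem inner_ofCovec (θ : P) (α : P →ₗ[R] R) : inner θ (ofCovec α) = ofFun P (α θ) := by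
  rw [ofCovec, inner_homog_succ, ofFun]
  congr 1

theorem wedgeOp_ofCovec (α : P →ₗ[R] R) : (wedgeOp (ofCovec α) : Op R P W) = outer α := by
  rw [← sub_eq_zero]
  refine op_eq_zero_of_inner (fun w => ?_) (-1) fun θ => ?_
  · change wedgeAct (ofCovec α) w 0 - 0 = 0
    rw [wedgeAct_zero_apply, ofCovec, homog_of_ne (by norm_num)]
    simp
  · rw [mul_sub, inner_mul_wedgeOp, inner_ofCovec, wedgeOp_ofFun, inner_outer, ofCovec, par_homog,
      wedgeOp_zsmul]
    rw [pow_one, neg_one_smul ℤ, neg_one_smul ℤ, sub_mul, neg_mul]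
    abel

end TotalWedge

/-! ### Lie derivatives -/

section LieOperators
variable {R : Type*} [CommRing R] [Algebra ℝ R] {P : Type*} [AddCommGroup P] [Module R P]
  {W : Type*} [AddCommGroup W] [Module R W] {D : Derivation ℝ R R}

/-- The Lie derivative of forms of all degrees. -/
def lieOp (δ : DerEnd D P) (ν : DerEnd D W) : Op R P W where
  toFun w k := δ.alt k ν (w k)
  map_add' w w' := by ext k : 1; exact map_add (δ.alt k ν).toAddMonoidHom _ _
  map_smul' a w := by ext k : 1; exact map_zsmul (δ.alt k ν).toAddMonoidHom _ _

theorem lieOp_apply (δ : DerEnd D P) (ν : DerEnd D W) (w : Forms R P W) (k : ℕ) :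
    lieOp δ ν w k = δ.alt k ν (w k) := rfl

theorem lieOp_apply_apply (δ : DerEnd D P) (ν : DerEnd D W) (w : Forms R P W) (k : ℕ)
    (v : Fin k → P) :
    lieOp δ ν w k v = ν (w k v) - ∑ j, w k (Function.update v j (δ (v j))) := rfl

theorem lieOp_zero_apply (δ : DerEnd D P) (ν : DerEnd D W) (w : Forms R P W) (v : Fin 0 → P) :
    lieOp δ ν w 0 v = ν (w 0 v) := by
  simp [lieOp_apply_apply]

theorem update_cons_succ {P : Type*} {k : ℕ} (x : P) (v : Fin k → P) (j : Fin k) (y : P) :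
    Function.update (Fin.cons x v : Fin (k + 1) → P) j.succ y =
      Fin.cons x (Function.update v j y) :=
  (Fin.cons_update (α := fun _ => P) x v j y).symm

theorem update_cons_zero {P : Type*} {k : ℕ} (x : P) (v : Fin k → P) (y : P) :
    Function.update (Fin.cons x v : Fin (k + 1) → P) 0 y = Fin.cons y v :=
  Fin.update_cons_zero (α := fun _ => P) x v y

theorem inner_mul_lieOp (θ : P) (δ : DerEnd D P) (ν : DerEnd D W) :
    inner θ * lieOp δ ν = lieOp δ ν * inner θ - inner (δ θ) := by
  refine LinearMap.ext fun w => funext fun k => AlternatingMap.ext fun v => ?_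
  change lieOp δ ν w (k + 1) (Fin.cons θ v : Fin (k + 1) → P) =
    lieOp δ ν (inner θ w) k v - inner (δ θ) w k v
  rw [lieOp_apply_apply, lieOp_apply_apply, Fin.sum_univ_succ]
  simp only [inner_apply_apply, Fin.cons_zero, Fin.cons_succ, update_cons_succ, update_cons_zero]
  abel

theorem lieOp_mul_inner (θ : P) (δ : DerEnd D P) (ν : DerEnd D W) :
    lieOp δ ν * inner θ = inner θ * lieOp δ ν + inner (δ θ) := by
  rw [inner_mul_lieOp, sub_add_cancel]

theorem lieOp_mul_mulOp (δ : DerEnd D P) (ν : DerEnd D W) (f : R) :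
    lieOp δ ν * mulOp f = mulOp f * lieOp δ ν + mulOp (D f) := by
  refine LinearMap.ext fun w => funext fun k => ?_
  change δ.alt k ν (f • w k) = f • δ.alt k ν (w k) + D f • w k
  rw [DerEnd.leibniz, add_comm]

theorem lieOp_par (δ : DerEnd D P) (ν : DerEnd D W) : lieOp δ ν * par = par * lieOp δ ν := by
  refine LinearMap.ext fun w => funext fun k => ?_
  exact map_zsmul (δ.alt k ν).toAddMonoidHom _ _

theorem lieOp_wedgeAct (δ : DerEnd D P) (ν : DerEnd D W) (u : Forms R P R) (w : Forms R P W) :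
    lieOp δ ν (wedgeAct u w) =
      wedgeAct (lieOp δ (DerEnd.self D) u) w + wedgeAct u (lieOp δ ν w) := by
  have key (k : ℕ) : ∀ (u : Forms R P R) (w : Forms R P W), lieOp δ ν (wedgeAct u w) k =
      wedgeAct (lieOp δ (DerEnd.self D) u) w k + wedgeAct u (lieOp δ ν w) k := by
    induction k with
    | zero =>
      intro u w
      rw [lieOp_apply]
      simp only [wedgeAct_zero_apply]
      rw [DerEnd.leibniz, lieOp_zero_apply]
      rfl
    | succ k ih =>
      intro u w
      change _ = (wedgeAct (lieOp δ (DerEnd.self D) u) w + wedgeAct u (lieOp δ ν w)) (k + 1)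
      refine component_succ_ext fun θ => ?_
      have h (w : Forms R P W) : inner θ (lieOp δ ν w) = lieOp δ ν (inner θ w) - inner (δ θ) w :=
        LinearMap.congr_fun (inner_mul_lieOp θ δ ν) w
      have h' : inner θ (lieOp δ (DerEnd.self D) u) =
          lieOp δ (DerEnd.self D) (inner θ u) - inner (δ θ) u :=
        LinearMap.congr_fun (inner_mul_lieOp θ δ (DerEnd.self D)) u
      have h'' : lieOp δ (DerEnd.self D) (par u) = par (lieOp δ (DerEnd.self D) u) :=
        LinearMap.congr_fun (lieOp_par δ (DerEnd.self D)) u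
      rw [h, map_add, inner_wedgeAct, inner_wedgeAct, inner_wedgeAct, inner_wedgeAct, h, h']
      simp only [map_add, map_sub, Pi.add_apply, Pi.sub_apply, ih, LinearMap.sub_apply, h'']
      abel
  ext k : 1
  exact key k u w

theorem lieOp_mul_wedgeOp (δ : DerEnd D P) (ν : DerEnd D W) (u : Forms R P R) :
    lieOp δ ν * wedgeOp u = wedgeOp u * lieOp δ ν + wedgeOp (lieOp δ (DerEnd.self D) u) := by
  refine LinearMap.ext fun w => ?_
  rw [add_comm]
  exact lieOp_wedgeAct δ ν u w

/-- The Lie derivative of a covector. -/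
def DerEnd.covec (δ : DerEnd D P) (α : P →ₗ[R] R) : P →ₗ[R] R where
  toFun θ := D (α θ) - α (δ θ)
  map_add' θ η := by simp; abel
  map_smul' f θ := by simp [δ.leibniz]; ring

theorem DerEnd.covec_apply (δ : DerEnd D P) (α : P →ₗ[R] R) (θ : P) :
    δ.covec α θ = D (α θ) - α (δ θ) := rfl

theorem lieOp_ofCovec (δ : DerEnd D P) (α : P →ₗ[R] R) :
    lieOp δ (DerEnd.self D) (ofCovec α) = ofCovec (δ.covec α) := by
  refine forms_ext_inner ?_ fun θ => ?_
  · rw [lieOp_apply, ofCovec, homog_of_ne (by norm_num), ofCovec, homog_of_ne (by norm_num)]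
    exact map_zero (δ.alt 0 (DerEnd.self D)).toAddMonoidHom
  · have h : inner θ (lieOp δ (DerEnd.self D) (ofCovec α)) =
        lieOp δ (DerEnd.self D) (inner θ (ofCovec α)) - inner (δ θ) (ofCovec α) :=
      LinearMap.congr_fun (inner_mul_lieOp θ δ (DerEnd.self D)) _
    rw [h, inner_ofCovec, inner_ofCovec, inner_ofCovec]
    ext k v
    cases k with
    | zero =>
      change lieOp _ _ _ 0 v - ofFun P (α (δ θ)) 0 v = _
      rw [lieOp_zero_apply]
      rfl
    | succ k =>
      have h0 (f : R) : ofFun P f (k + 1) = 0 := homog_of_ne (by omega) _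
      change δ.alt (k + 1) _ (ofFun P (α θ) (k + 1)) v - ofFun P (α (δ θ)) (k + 1) v =
        ofFun P _ (k + 1) v
      rw [h0, h0, h0]
      have := map_zero (δ.alt (k + 1) (DerEnd.self D)).toAddMonoidHom
      rw [this]
      simp

theorem lieOp_mul_outer (δ : DerEnd D P) (ν : DerEnd D W) (α : P →ₗ[R] R) :
    lieOp δ ν * outer α = outer α * lieOp δ ν + outer (δ.covec α) := by
  rw [← wedgeOp_ofCovec, lieOp_mul_wedgeOp, lieOp_ofCovec, wedgeOp_ofCovec,
    wedgeOp_ofCovec]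

theorem lieOp_homog (δ : DerEnd D P) (ν : DerEnd D W) (k : ℕ) (u : P [⋀^Fin k]→ₗ[R] W) :
    lieOp δ ν (homog k u) = homog k (δ.alt k ν u) := by
  ext l : 1
  rw [lieOp_apply]
  rcases eq_or_ne l k with rfl | h
  · rw [homog_same, homog_same]
  · rw [homog_of_ne h, homog_of_ne h]
    exact map_zero (δ.alt l ν).toAddMonoidHom

end LieOperators

/-! ### Cartan calculus of a Lie algebroid with coefficients -/

namespace LieAlgebroid

variable {R : Type*} [CommRing R] [Algebra ℝ R] {P : Type*} [AddCommGroup P] [Module R P]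
  {W : Type*} [AddCommGroup W] [Module R W] {𝔞 : LieAlgebroid R P}

/-- The Lie derivative along `θ` of forms with coefficients in a module with connection. -/
abbrev lieConn (nabla : 𝔞.Conn W) (θ : P) : Op R P W := lieOp (𝔞.ad θ) (nabla.at θ)

/-- Cartan's formula ι_θ d = L_θ − d ι_θ. As the bracket stands in the slot of its second entry, the
summand i = 0 of the differential is the whole Lie derivative, and the remaining summands are those
of the differential of the contraction with opposite sign. -/
theorem diff_cons {k : ℕ} (nabla : 𝔞.Conn W) (ρ : P [⋀^Fin (k + 1)]→ₗ[R] W) (θ : P)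
    (v : Fin (k + 1) → P) : diff nabla ρ (Fin.cons θ v : Fin (k + 2) → P) =
      lieAt nabla ρ θ v - diff nabla (ρ.curryLeft θ) v := by
  change diffFun nabla ρ (Fin.cons θ v : Fin (k + 2) → P) = _ - diffFun nabla (ρ.curryLeft θ) v
  rw [diffFun, Fin.sum_univ_succ, lieAt_apply, sub_eq_add_neg _ (diffFun _ _ _)]
  congr 1
  · simp only [Fin.cons_zero, removeNth_zero_cons, Fin.val_zero, pow_zero, one_smul, Fin.zero_le,
      Finset.filter_true]
  · rw [diffFun, ← Finset.sum_neg_distrib]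
    refine Finset.sum_congr rfl fun i _ => ?_
    rw [Fin.val_succ, pow_succ, mul_neg_one, neg_smul, Fin.cons_succ, removeNth_succ_cons]
    congr 3
    rw [Finset.sum_filter, Finset.sum_filter, Fin.sum_univ_succ, if_neg (by simp),
      zero_add]
    refine Finset.sum_congr rfl fun j _ => ?_
    have h : i.succ ≤ j.succ.castSucc ↔ i ≤ j.castSucc := by simp [Fin.le_def]
    simp only [h, Fin.cons_succ, update_cons_succ]
    rfl

theorem diff_zero_cons (nabla : 𝔞.Conn W) (ρ : P [⋀^Fin 0]→ₗ[R] W) (θ : P)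
    (v : Fin 0 → P) : diff nabla ρ (Fin.cons θ v : Fin 1 → P) = lieAt nabla ρ θ v := by
  change diffFun nabla ρ (Fin.cons θ v : Fin 1 → P) = _
  rw [diffFun, lieAt_apply]
  simp

theorem diff_add {k : ℕ} (nabla : 𝔞.Conn W) (ρ η : P [⋀^Fin k]→ₗ[R] W) :
    diff nabla (ρ + η) = diff nabla ρ + diff nabla η := by
  ext v
  change diffFun nabla (ρ + η) v = diffFun nabla ρ v + diffFun nabla η v
  simp only [diffFun, AlternatingMap.add_apply, map_add, ← Finset.sum_add_distrib, ← smul_add]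
  refine Finset.sum_congr rfl fun i _ => ?_
  congr 1
  rw [Finset.sum_add_distrib]
  abel

/-- The differential on forms of one degree, as an additive map. -/
def diffHom {k : ℕ} (nabla : 𝔞.Conn W) : (P [⋀^Fin k]→ₗ[R] W) →+ (P [⋀^Fin (k + 1)]→ₗ[R] W) :=
  AddMonoidHom.mk' (diff nabla) (diff_add nabla)

/-- The differential as an operator. -/
def dOp (nabla : 𝔞.Conn W) : Op R P W :=
  AddMonoidHom.toIntLinearMap (AddMonoidHom.mk' (dForms nabla) (fun w w' => by
    ext k : 1
    cases k with
    | zero => exact (add_zero (0 : P [⋀^Fin 0]→ₗ[R] W)).symm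
    | succ k => exact diff_add nabla (w k) (w' k)))

theorem dOp_zero_apply (nabla : 𝔞.Conn W) (w : Forms R P W) : dOp nabla w 0 = 0 := rfl

theorem dOp_succ_apply (nabla : 𝔞.Conn W) (w : Forms R P W) (k : ℕ) :
    dOp nabla w (k + 1) = diff nabla (w k) := rfl

theorem inner_mul_dOp (nabla : 𝔞.Conn W) (θ : P) :
    inner θ * dOp nabla = lieConn nabla θ - dOp nabla * inner θ := by
  refine LinearMap.ext fun w => funext fun k => AlternatingMap.ext fun v => ?_
  cases k with
  | zero =>
    exact (diff_zero_cons nabla (w 0) θ v).trans (sub_zero (lieAt nabla (w 0) θ v)).symm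
  | succ k => exact diff_cons nabla (w (k + 1)) θ v

theorem dOp_mul_inner (nabla : 𝔞.Conn W) (θ : P) :
    dOp nabla * inner θ = lieConn nabla θ - inner θ * dOp nabla := by
  rw [inner_mul_dOp]; abel

theorem dOp_par (nabla : 𝔞.Conn W) : dOp nabla * par = -(par * dOp nabla) := by
  rw [eq_neg_iff_add_eq_zero]
  refine op_eq_zero_of_inner (fun w => ?_) 1 fun θ => ?_
  · change (0 : P [⋀^Fin 0]→ₗ[R] W) + (-1 : ℤ) ^ 0 • 0 = 0
    simp
  · rw [mul_add, ← mul_assoc, ← mul_assoc, inner_mul_dOp, inner_par, neg_mul, sub_mul, mul_assoc,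
      mul_assoc, inner_par, inner_mul_dOp, lieOp_par, one_smul, add_mul, mul_assoc, mul_assoc]
    simp only [mul_neg, mul_sub]
    abel

/-- Under contraction Cartan's formula replaces d by a Lie derivative, which is a derivation, and by
the differential of a form of smaller degree, so the induction closes. -/
theorem dOp_wedgeAct (nabla : 𝔞.Conn W) (u : Forms R P R) (w : Forms R P W) :
    dOp nabla (wedgeAct u w) =
      wedgeAct (dOp 𝔞.trivialConn u) w + wedgeAct (par u) (dOp nabla w) := by
  have key (k : ℕ) : ∀ (u : Forms R P R) (w : Forms R P W), dOp nabla (wedgeAct u w) k =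
      wedgeAct (dOp 𝔞.trivialConn u) w k + wedgeAct (par u) (dOp nabla w) k := by
    induction k with
    | zero =>
      intro u w
      rw [wedgeAct_zero_apply, wedgeAct_zero_apply, dOp_zero_apply, dOp_zero_apply, dOp_zero_apply]
      simp
    | succ k ih =>
      intro u w
      change _ = (wedgeAct (dOp 𝔞.trivialConn u) w + wedgeAct (par u) (dOp nabla w)) (k + 1)
      refine component_succ_ext fun θ => ?_
      have h (w : Forms R P W) : inner θ (dOp nabla w) = lieConn nabla θ w - dOp nabla (inner θ w) :=
        LinearMap.congr_fun (inner_mul_dOp nabla θ) w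
      have h1 : inner θ (dOp 𝔞.trivialConn u) =
          lieConn 𝔞.trivialConn θ u - dOp 𝔞.trivialConn (inner θ u) :=
        LinearMap.congr_fun (inner_mul_dOp 𝔞.trivialConn θ) u
      have h2 : dOp 𝔞.trivialConn (par u) = - par (dOp 𝔞.trivialConn u) :=
        LinearMap.congr_fun (dOp_par 𝔞.trivialConn) u
      have h3 : inner θ (par u) = - par (inner θ u) := LinearMap.congr_fun (inner_par θ) u
      have h4 (u : Forms R P R) : par (par u) = u := LinearMap.congr_fun par_par u
      have h5 : lieConn nabla θ (wedgeAct u w) =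
          wedgeAct (lieConn 𝔞.trivialConn θ u) w + wedgeAct u (lieConn nabla θ w) :=
        lieOp_wedgeAct _ _ u w
      rw [h, map_add, inner_wedgeAct, inner_wedgeAct, inner_wedgeAct, h, h1, h3, h4, h5]
      simp only [map_add, map_sub, map_neg, Pi.add_apply, Pi.sub_apply, Pi.neg_apply, ih,
        LinearMap.sub_apply, LinearMap.neg_apply, h2, h4]
      abel
  ext k : 1
  exact key k u w

theorem dOp_mul_wedgeOp (nabla : 𝔞.Conn W) (u : Forms R P R) :
    dOp nabla * wedgeOp u = wedgeOp (dOp 𝔞.trivialConn u) + wedgeOp (par u) * dOp nabla := by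
  refine LinearMap.ext fun w => ?_
  exact dOp_wedgeAct nabla u w

variable (𝔞) in
/-- The differential of a function as a covector. -/
def dFun (f : R) : P →ₗ[R] R where
  toFun θ := 𝔞.anchor θ f
  map_add' θ η := by simp
  map_smul' g θ := by simp

theorem dFun_apply (f : R) (θ : P) : 𝔞.dFun f θ = 𝔞.anchor θ f := rfl

theorem dOp_ofFun (f : R) : dOp 𝔞.trivialConn (ofFun P f) = ofCovec (𝔞.dFun f) := by
  refine forms_ext_inner ?_ fun θ => ?_
  · rw [dOp_zero_apply, ofCovec, homog_of_ne (by norm_num)]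
  · have h : inner θ (dOp 𝔞.trivialConn (ofFun P f)) = lieConn 𝔞.trivialConn θ (ofFun P f) -
        dOp 𝔞.trivialConn (inner θ (ofFun P f)) :=
      LinearMap.congr_fun (inner_mul_dOp 𝔞.trivialConn θ) _
    rw [h, inner_ofCovec, ofFun, inner_homog_zero, map_zero, sub_zero, lieOp_homog, ofFun]
    congr 1
    ext v
    rw [DerEnd.alt_apply]
    simp
    rfl

theorem dOp_mul_mulOp (nabla : 𝔞.Conn W) (f : R) :
    dOp nabla * mulOp f = mulOp f * dOp nabla + outer (𝔞.dFun f) := by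
  rw [← wedgeOp_ofFun, dOp_mul_wedgeOp, dOp_ofFun, wedgeOp_ofCovec, ofFun, par_homog, pow_zero,
    one_smul, add_comm]

/-- A connection without curvature. -/
def Conn.IsFlat (nabla : 𝔞.Conn W) : Prop :=
  ∀ θ η x, nabla.act (𝔞.bracket θ η) x = nabla.act θ (nabla.act η x) - nabla.act η (nabla.act θ x)

/-- In degree zero this is flatness. By the Jacobi identity the difference of the two sides commutes
with contractions, which reduces every degree to degree zero. -/
theorem lieConn_bracket {nabla : 𝔞.Conn W} (h : nabla.IsFlat) (θ η : P) :
    lieConn nabla (𝔞.bracket θ η) =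
      lieConn nabla θ * lieConn nabla η - lieConn nabla η * lieConn nabla θ := by
  rw [← sub_eq_zero]
  refine op_eq_zero_of_inner (fun w => AlternatingMap.ext fun v => ?_) 1 fun ζ => ?_
  · change lieConn nabla (𝔞.bracket θ η) w 0 v - (lieConn nabla θ (lieConn nabla η w) 0 v -
      lieConn nabla η (lieConn nabla θ w) 0 v) = 0
    rw [lieOp_zero_apply, lieOp_zero_apply, lieOp_zero_apply, lieOp_zero_apply, lieOp_zero_apply]
    exact sub_eq_zero.2 (h θ η (w 0 v))
  · have h1 := 𝔞.jacobi θ η ζ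
    have h2 : inner (𝔞.bracket θ (𝔞.bracket η ζ)) =
        inner (𝔞.bracket (𝔞.bracket θ η) ζ) + (inner (𝔞.bracket η (𝔞.bracket θ ζ)) : Op R P W) := by
      rw [h1, inner_add_left]
    simp only [mul_sub, sub_mul, one_smul, ← mul_assoc, inner_mul_lieOp]
    simp only [mul_assoc, inner_mul_lieOp, ad_apply, h2, mul_sub]
    abel

theorem lieConn_comm_dOp {nabla : 𝔞.Conn W} (h : nabla.IsFlat) (θ : P) :
    lieConn nabla θ * dOp nabla = dOp nabla * lieConn nabla θ := by
  rw [← sub_eq_zero]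
  refine op_eq_zero_of_inner (fun w => AlternatingMap.ext fun v => ?_) (-1) fun ζ => ?_
  · change lieConn nabla θ (dOp nabla w) 0 v - 0 = 0
    rw [lieOp_zero_apply, dOp_zero_apply, AlternatingMap.zero_apply, map_zero, sub_zero]
  · have h2 := lieConn_bracket h θ ζ
    simp only [mul_sub, sub_mul, ← mul_assoc, inner_mul_lieOp, inner_mul_dOp]
    simp only [mul_assoc, inner_mul_lieOp, inner_mul_dOp, ad_apply, h2, mul_sub, neg_one_smul]
    abel

/-- Cartan's formula and [L_θ, d] = 0 show that d² commutes with contractions, and d² has no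
component of degree 0. -/
theorem dOp_dOp {nabla : 𝔞.Conn W} (h : nabla.IsFlat) : dOp nabla * dOp nabla = 0 := by
  refine op_eq_zero_of_inner (fun w => rfl) 1 fun ζ => ?_
  rw [← mul_assoc, inner_mul_dOp, sub_mul, mul_assoc, inner_mul_dOp, mul_sub,
    lieConn_comm_dOp h, one_smul, mul_assoc]
  abel

end LieAlgebroid

/-! ### Localization by functions that are one near a point -/

section Locality
variable {R : Type*} [CommRing R] {I : Type*} (𝒳 : I → Submonoid R)

/-- For every element `c` of `𝒳 i` there is one that absorbs it, as it holds for functions that are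
equal to `1` near a point. -/
def Absorbing : Prop := ∀ i, ∀ c ∈ 𝒳 i, ∃ c' ∈ 𝒳 i, c' * c = c'

/-- Elements of `W` that vanish locally vanish. -/
def Separated (W : Type*) [AddCommGroup W] [Module R W] : Prop :=
  ∀ w : W, (∀ i, ∃ c ∈ 𝒳 i, c • w = 0) → w = 0

/-- Local elements of `W` can be glued. -/
def Gluing (W : Type*) [AddCommGroup W] [Module R W] : Prop :=
  ∀ (c : I → R) (v : I → W), (∀ i, c i ∈ 𝒳 i) → (∀ i j, (c i * c j) • v i = (c i * c j) • v j) →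
    ∃ w : W, ∀ i, c i • w = c i • v i

variable {𝒳} {P : Type*} [AddCommGroup P] [Module R P] {W : Type*} [AddCommGroup W] [Module R W]
  {T : Type*} [AddCommGroup T] [Module R T]

theorem Separated.eq (h : Separated 𝒳 W) {w w' : W} (hw : ∀ i, ∃ c ∈ 𝒳 i, c • w = c • w') :
    w = w' := by
  refine sub_eq_zero.1 (h _ fun i => ?_)
  obtain ⟨c, hc, e⟩ := hw i
  exact ⟨c, hc, by rw [smul_sub, e, sub_self]⟩

theorem Separated.of_injective (h : Separated 𝒳 W) (f : T →ₗ[R] W) (hf : Function.Injective f) :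
    Separated 𝒳 T := fun t ht => by
  refine hf ((h _ fun i => ?_).trans (map_zero f).symm)
  obtain ⟨c, hc, e⟩ := ht i
  exact ⟨c, hc, by rw [← map_smul, e, map_zero]⟩

theorem Separated.pi {X : Type*} (h : Separated 𝒳 W) : Separated 𝒳 (X → W) := fun w hw => by
  ext x
  refine h _ fun i => ?_
  obtain ⟨c, hc, e⟩ := hw i
  exact ⟨c, hc, congrFun e x⟩

theorem Separated.alt (h : Separated 𝒳 W) (k : ℕ) : Separated 𝒳 (P [⋀^Fin k]→ₗ[R] W) :=
  Separated.of_injective (W := (Fin k → P) → W) h.pi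
    { toFun := fun ρ => ρ, map_add' := fun _ _ => rfl, map_smul' := fun _ _ => rfl }
    DFunLike.coe_injective

theorem Separated.forms (h : Separated 𝒳 W) : Separated 𝒳 (Forms R P W) := fun w hw => by
  ext k : 1
  refine h.alt k _ fun i => ?_
  obtain ⟨c, hc, e⟩ := hw i
  exact ⟨c, hc, congrFun e k⟩

theorem Gluing.pi {X : Type*} (h : Gluing 𝒳 W) : Gluing 𝒳 (X → W) := fun c v hc hv => by
  choose w hw using fun x => h c (fun i => v i x) hc fun i j => congrFun (hv i j) x
  exact ⟨w, fun i => funext fun x => hw x i⟩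

/-- The values are glued argument by argument; multilinearity and alternation are local conditions
and hold by separatedness. -/
theorem Gluing.alt (h : Gluing 𝒳 W) (hs : Separated 𝒳 W) (k : ℕ) :
    Gluing 𝒳 (P [⋀^Fin k]→ₗ[R] W) := fun c v hc hv => by
  choose w hw using fun x => h c (fun i => v i x) hc fun i j => DFunLike.congr_fun (hv i j) x
  refine ⟨⟨⟨w, ?_, ?_⟩, ?_⟩, fun i => AlternatingMap.ext fun x => hw x i⟩
  · intro inst x j a b
    obtain rfl : inst = instDecidableEqFin k := Subsingleton.elim _ _
    refine hs.eq fun i => ⟨c i, hc i, ?_⟩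
    rw [smul_add, hw, hw, hw, (v i).map_update_add, smul_add]
  · intro inst x j f a
    obtain rfl : inst = instDecidableEqFin k := Subsingleton.elim _ _
    refine hs.eq fun i => ⟨c i, hc i, ?_⟩
    rw [smul_comm, hw, hw, (v i).map_update_smul, smul_comm]
  · intro x a b hx hab
    refine hs _ fun i => ⟨c i, hc i, ?_⟩
    change c i • w x = 0
    rw [hw, (v i).map_eq_zero_of_eq x hx hab, smul_zero]

/-- A linear system with unique solutions that is solvable locally is solvable. -/
theorem mem_range_of_local (h𝒳 : Absorbing 𝒳) (hW : Gluing 𝒳 W) (hT : Separated 𝒳 T)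
    (Ψ : W →ₗ[R] T) (hΨ : Function.Injective Ψ) (t : T)
    (ht : ∀ i, ∃ c ∈ 𝒳 i, ∃ w, Ψ w = c • t) : ∃ w, Ψ w = t := by
  choose c hc v hv using ht
  choose c' hc' e using fun i => h𝒳 i (c i) (hc i)
  -- By uniqueness c j • v i = c i • v j, since Ψ sends both to c i • c j • t. The absorbing
  -- functions c' then remove c i and c j.
  obtain ⟨w, hw⟩ := hW c' v hc' fun i j => by
    have h1 : c j • v i = c i • v j := hΨ (by simp only [map_smul, hv, smul_comm (c i)])
    have h2 : (c' i * c' j) • v i = (c' i * c' j) • c j • v i := by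
      rw [smul_smul, mul_assoc, e]
    have h3 : (c' i * c' j) • v j = (c' i * c' j) • c i • v j := by
      rw [smul_smul, mul_right_comm, e]
    rw [h2, h3, h1]
  refine ⟨w, hT.eq fun i => ⟨c' i, hc' i, ?_⟩⟩
  rw [← map_smul, hw, map_smul, hv, smul_smul, e]

/-- Derivations are local operators: differentiate c • (x − y) = 0 and multiply by c'. The term with
D c disappears because c' kills x − y. -/
theorem DerEnd.smul_eq_of_smul_eq [Algebra ℝ R] {D : Derivation ℝ R R} (δ : DerEnd D W) {c c' : R}
    (hc : c' * c = c') {x y : W} (h : c • x = c • y) : c' • δ x = c' • δ y := by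
  rw [← sub_eq_zero, ← smul_sub] at h ⊢
  have h1 : c' • (x - y) = 0 := by rw [← hc, mul_smul, h, smul_zero]
  have h2 := δ.leibniz c (x - y)
  rw [h, map_zero] at h2
  have h3 := congrArg (c' • ·) h2
  simp only [smul_zero, smul_add, smul_smul, hc] at h3
  rw [mul_comm, mul_smul, h1, smul_zero, zero_add] at h3
  rw [← map_sub]
  exact h3.symm

/-- Pigeonhole: cut off, all k arguments are combinations of n < k elements, and every term of the
multilinear expansion repeats an argument. Each argument needs its own factor c. -/
theorem alt_eq_zero_of_generators (hW : Separated 𝒳 W) {n k : ℕ} (hk : n < k)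
    (hP : ∀ i, ∃ c ∈ 𝒳 i, ∃ ε : Fin n → P, ∀ θ, ∃ t : Fin n → R, c • θ = ∑ a, t a • ε a)
    (ρ : P [⋀^Fin k]→ₗ[R] W) : ρ = 0 := by
  refine hW.alt k _ fun i => ?_
  obtain ⟨c, hc, ε, hε⟩ := hP i
  choose t ht using hε
  refine ⟨c ^ k, pow_mem hc k, AlternatingMap.ext fun v => ?_⟩
  have h1 : c ^ k • ρ v = ρ fun j => c • v j := by
    have := ρ.toMultilinearMap.map_smul_univ (fun _ => c) v
    simp only [Finset.prod_const, Finset.card_univ, Fintype.card_fin] at this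
    exact this.symm
  rw [AlternatingMap.smul_apply, h1, AlternatingMap.zero_apply]
  simp only [ht]
  have h2 := ρ.toMultilinearMap.map_sum (fun (j : Fin k) (a : Fin n) => t (v j) a • ε a)
  refine h2.trans (Finset.sum_eq_zero fun σ _ => ?_)
  refine (ρ.toMultilinearMap.map_smul_univ (fun j => t (v j) (σ j)) fun j => ε (σ j)).trans ?_
  have h3 : ¬ Function.Injective σ := fun h => by
    have := Fintype.card_le_of_injective σ h
    simp only [Fintype.card_fin] at this
    omega
  have h4 : ρ (fun j => ε (σ j)) = 0 := by
    rw [Function.Injective] at h3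
    push Not at h3
    obtain ⟨a, b, hab, hne⟩ := h3
    exact ρ.map_eq_zero_of_eq _ (by rw [hab]) hne
  change _ • ρ (fun j => ε (σ j)) = 0
  rw [h4, smul_zero]

theorem update_eq_smul_cons {k : ℕ} (ρ : P [⋀^Fin (k + 1)]→ₗ[R] W) (v : Fin (k + 1) → P)
    (j : Fin (k + 1)) (y : P) :
    ρ (Function.update v j y) =
      (-1 : ℤ) ^ (j : ℕ) • ρ (Fin.cons y (j.removeNth v) : Fin (k + 1) → P) :=
  LieAlgebroid.update_removeNth_eq ρ v j y

/-- If there are no forms of degree greater than `n`, then `α ∧ ρ = 0` for forms of degree `n`. -/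
theorem top_identity {n : ℕ} (h0 : ∀ ρ : P [⋀^Fin (n + 1)]→ₗ[R] W, ρ = 0)
    (ρ : P [⋀^Fin n]→ₗ[R] W) (α : P →ₗ[R] R) (x : P) (v : Fin n → P) :
    α x • ρ v = ∑ j, α (v j) • ρ (Function.update v j x) := by
  have h := h0 (outer α (homog n ρ) (n + 1))
  have h1 := DFunLike.congr_fun h (Fin.cons x v : Fin (n + 1) → P)
  rw [outer_succ_apply, Fin.sum_univ_succ, Fin.cons_zero, removeNth_zero_cons, homog_same] at h1
  simp only [Fin.val_zero, pow_zero, one_smul, AlternatingMap.zero_apply] at h1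
  rw [eq_neg_of_add_eq_zero_left h1, ← Finset.sum_neg_distrib]
  refine Finset.sum_congr rfl fun j _ => ?_
  cases n with
  | zero => exact j.elim0
  | succ n =>
    rw [update_eq_smul_cons, removeNth_succ_cons, Fin.cons_succ, Fin.val_succ, pow_succ,
      mul_neg_one, neg_smul, neg_neg, smul_comm]

end Locality

/-! ### Local dual frames -/

section Frames
variable {R : Type*} [CommRing R] {E E' : Type*} [AddCommGroup E] [Module R E] [AddCommGroup E']
  [Module R E'] (p : E →ₗ[R] E' →ₗ[R] R) {n : ℕ}

/-- `e` and `ε` are dual frames where `c` is invertible. -/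
structure IsFrame (c : R) (e : Fin n → E) (ε : Fin n → E') : Prop where
  left : ∀ X, c • X = c • ∑ a, p X (ε a) • e a
  right : ∀ θ, c • θ = c • ∑ a, p (e a) θ • ε a
  dual : ∀ a b, c * p (e a) (ε b) = if a = b then c else 0

variable {p} in
theorem IsFrame.flip {c : R} {e : Fin n → E} {ε : Fin n → E'} (h : IsFrame p c e ε) :
    IsFrame p.flip c ε e :=
  ⟨h.right, h.left, fun a b => by simpa [eq_comm] using h.dual b a⟩

variable {I : Type*} (𝒳 : I → Submonoid R)

variable (n) in
/-- Dual frames with `n` elements exist locally. -/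
def HasFrames : Prop := ∀ i, ∃ c ∈ 𝒳 i, ∃ (e : Fin n → E) (ε : Fin n → E'), IsFrame p c e ε

variable {p 𝒳}

theorem HasFrames.flip (h : HasFrames p n 𝒳) : HasFrames p.flip n 𝒳 := fun i => by
  obtain ⟨c, hc, e, ε, hf⟩ := h i
  exact ⟨c, hc, ε, e, hf.flip⟩

variable {W : Type*} [AddCommGroup W] [Module R W]

theorem HasFrames.alt_eq_zero (h : HasFrames p n 𝒳) (hW : Separated 𝒳 W) {k : ℕ} (hk : n < k)
    (ρ : E' [⋀^Fin k]→ₗ[R] W) : ρ = 0 := by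
  refine alt_eq_zero_of_generators hW hk (fun i => ?_) ρ
  obtain ⟨c, hc, e, ε, hf⟩ := h i
  refine ⟨c, hc, ε, fun θ => ⟨fun a => c * p (e a) θ, ?_⟩⟩
  rw [hf.right, Finset.smul_sum]
  simp only [mul_smul]

theorem HasFrames.top_identity (h : HasFrames p n 𝒳) (hW : Separated 𝒳 W)
    (ρ : E' [⋀^Fin n]→ₗ[R] W) (α : E' →ₗ[R] R) (x : E') (v : Fin n → E') :
    α x • ρ v = ∑ j, α (v j) • ρ (Function.update v j x) :=
  LieBialgd.top_identity (fun ρ => h.alt_eq_zero hW n.lt_succ_self ρ) ρ α x v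

/-- Euler's formula. The sum is the alternatization of the curried form, expanded in the frame, and
the alternatization of a curried form of degree k is k times the form. -/
theorem IsFrame.sum_outer_inner {c : R} {e : Fin n → E} {ε : Fin n → E'} (h : IsFrame p c e ε)
    (w : Forms R E' W) (k : ℕ) :
    c • (∑ a, outer (p (e a)) (inner (ε a) w)) k = c • k • w k := by
  rw [Finset.sum_apply]
  cases k with
  | zero =>
    simp only [outer_zero_apply, Finset.sum_const_zero, zero_smul]
  | succ k =>
    have h1 (a : Fin n) : outer (p (e a)) (inner (ε a) w) (k + 1) =
        AlternatingMap.alternatizeUncurryFinLM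
          ((p (e a)).smulRight ((w (k + 1)).curryLeft (ε a))) := rfl
    have h2 : c • ∑ a, (p (e a)).smulRight ((w (k + 1)).curryLeft (ε a)) =
        c • (w (k + 1)).curryLeft := by
      refine LinearMap.ext fun θ => ?_
      rw [LinearMap.smul_apply, LinearMap.smul_apply, LinearMap.sum_apply,
        ← map_smul (w (k + 1)).curryLeft, h.right θ, map_smul, map_sum]
      simp only [LinearMap.smulRight_apply, map_smul]
    simp only [h1]
    rw [← map_sum, ← map_smul, h2, map_smul]
    congr 1
    exact AlternatingMap.alternatizeUncurryFin_curryLeft (w (k + 1))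

/-- Euler's formula and the Clifford relation, the scalars ⟨e_a, ε_a⟩ adding up to n. -/
theorem IsFrame.sum_inner_outer {c : R} {e : Fin n → E} {ε : Fin n → E'} (h : IsFrame p c e ε)
    (w : Forms R E' W) (k : ℕ) :
    c • (∑ a, inner (ε a) (outer (p (e a)) w)) k = c • ((n : ℤ) - k) • w k := by
  have h1 (a : Fin n) : inner (ε a) (outer (p (e a)) w) =
      p (e a) (ε a) • w - outer (p (e a)) (inner (ε a) w) :=
    LinearMap.congr_fun (inner_outer (ε a) (p (e a))) w
  simp only [h1]
  rw [Finset.sum_sub_distrib, Pi.sub_apply, smul_sub, h.sum_outer_inner, sub_smul, smul_sub,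
    natCast_zsmul, natCast_zsmul]
  congr 1
  rw [← Finset.sum_smul, Pi.smul_apply, smul_smul, Finset.mul_sum]
  simp only [h.dual, if_true]
  rw [Finset.sum_const, Finset.card_univ, Fintype.card_fin, smul_assoc, smul_comm]

variable [Algebra ℝ R]

theorem zsmul_cancel (R : Type*) [CommRing R] [Algebra ℝ R] {W : Type*} [AddCommGroup W]
    [Module R W] {k : ℤ} (hk : k ≠ 0) {x y : W} (h : k • x = k • y) : x = y := by
  have h2 : (algebraMap ℝ R (1 / k)) * (k : R) = 1 := by
    rw [← map_intCast (algebraMap ℝ R), ← map_mul, one_div_mul_cancel (Int.cast_ne_zero.2 hk),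
      map_one]
  rw [← one_smul R x, ← one_smul R y, ← h2, mul_smul, mul_smul, Int.cast_smul_eq_zsmul,
    Int.cast_smul_eq_zsmul, h]

/-- A form of degree less than `n` is determined by its products with sections. -/
theorem HasFrames.component_eq_zero (h : HasFrames p n 𝒳) (hW : Separated 𝒳 W)
    {w : Forms R E' W} {j : ℕ} (hj : j < n) (hw : ∀ X, outer (p X) w (j + 1) = 0) : w j = 0 := by
  refine hW.alt j _ fun i => ?_
  obtain ⟨c, hc, e, ε, hf⟩ := h i
  refine ⟨c, hc, ?_⟩
  have h1 := hf.sum_inner_outer w j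
  rw [Finset.sum_apply] at h1
  simp only [inner_apply, hw, AlternatingMap.curryLeft_zero, LinearMap.zero_apply,
    Finset.sum_const_zero, smul_zero] at h1
  rw [smul_comm] at h1
  refine zsmul_cancel R (k := (n : ℤ) - j) (by omega) ?_
  rw [← h1, smul_zero]

/-- An operator that commutes or anticommutes with exterior products and has no components in the
degrees `≥ n` vanishes. -/
theorem HasFrames.op_eq_zero_of_outer (h : HasFrames p n 𝒳) (hW : Separated 𝒳 W)
    {T : Op R E' W} (h0 : ∀ w, ∀ j ≥ n, T w j = 0) (s : ℤ)
    (hT : ∀ X, outer (p X) * T = s • (T * outer (p X))) : T = 0 := by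
  have key (d : ℕ) : ∀ j, n ≤ j + d → ∀ w, T w j = 0 := by
    induction d with
    | zero => exact fun j hj w => h0 w j hj
    | succ d ih =>
      intro j hj w
      rcases lt_or_ge j n with hjn | hjn
      · refine h.component_eq_zero hW hjn fun X => ?_
        have h1 : outer (p X) (T w) = s • T (outer (p X) w) := LinearMap.congr_fun (hT X) w
        rw [h1, Pi.smul_apply, ih _ (by omega), smul_zero]
      · exact h0 w j hjn
  refine LinearMap.ext fun w => funext fun j => key n j (by omega) w

theorem HasFrames.eq_sum_homog (h : HasFrames p n 𝒳) (hW : Separated 𝒳 W) (w : Forms R E' W) :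
    w = ∑ k ∈ Finset.range (n + 1), homog k (w k) := by
  ext j : 1
  rw [Finset.sum_apply]
  rcases lt_or_ge n j with hj | hj
  · rw [h.alt_eq_zero hW hj (w j), Finset.sum_eq_zero]
    intro k hk
    rw [Finset.mem_range] at hk
    rw [homog_of_ne (by omega)]
  · rw [Finset.sum_eq_single j (fun k _ hk => homog_of_ne hk.symm _) fun hj' =>
      absurd (Finset.mem_range.2 (by omega)) hj', homog_same]

/-- A tensorial operator that commutes or anticommutes with exterior products and vanishes on forms
of degree `0` vanishes. -/
theorem HasFrames.op_eq_zero (h : HasFrames p n 𝒳) (hW : Separated 𝒳 W)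
    {T : Op R E' W} (hlin : ∀ (f : R) w, T (f • w) = f • T w) (h0 : ∀ u, T (homog 0 u) = 0) (s : ℤ)
    (hT : ∀ X, T * outer (p X) = s • (outer (p X) * T)) : T = 0 := by
  have key (k : ℕ) : ∀ u, T (homog k u) = 0 := by
    induction k with
    | zero => exact h0
    | succ k ih =>
      intro u
      refine hW.forms _ fun i => ?_
      obtain ⟨c, hc, e, ε, hf⟩ := h i
      refine ⟨c, hc, ?_⟩
      -- Euler's formula writes (k + 1) u locally as a sum of exterior products of sections with
      -- forms of degree k, to which the induction hypothesis applies.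
      have h1 : c • ∑ a, outer (p (e a)) (inner (ε a) (homog (k + 1) u)) =
          c • (k + 1) • homog (k + 1) u := by
        ext j : 1
        rcases eq_or_ne j (k + 1) with rfl | hj
        · exact hf.sum_outer_inner _ _
        · change c • (∑ a, outer (p (e a)) (inner (ε a) (homog (k + 1) u))) j =
            c • (k + 1) • homog (k + 1) u j
          rw [hf.sum_outer_inner, homog_of_ne hj]
          simp
      have h2 : (k + 1) • c • T (homog (k + 1) u) = 0 := by
        rw [smul_comm, ← map_nsmul, ← hlin, ← h1, hlin, map_sum]
        refine (congrArg _ (Finset.sum_eq_zero fun a _ => ?_)).trans (smul_zero c)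
        have h3 : T (outer (p (e a)) (inner (ε a) (homog (k + 1) u))) =
            s • outer (p (e a)) (T (inner (ε a) (homog (k + 1) u))) :=
          LinearMap.congr_fun (hT (e a)) _
        rw [h3, inner_homog_succ, ih, map_zero, smul_zero]
      exact nsmul_cancel R (k.succ_ne_zero) (h2.trans (smul_zero _).symm)
  refine LinearMap.ext fun w => ?_
  rw [h.eq_sum_homog hW w, map_sum]
  exact Finset.sum_eq_zero fun k _ => key k _

end Frames

/-! ### The star isomorphism -/

section Star
variable {R : Type*} [CommRing R] [Algebra ℝ R] {E E' : Type*} [AddCommGroup E] [Module R E]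
  [AddCommGroup E'] [Module R E'] {p : E →ₗ[R] E' →ₗ[R] R} {n : ℕ}
  {W : Type*} [AddCommGroup W] [Module R W] {I : Type*} {𝒳 : I → Submonoid R}

theorem outer_eq_wedgeAct (α : E' →ₗ[R] R) (w : Forms R E' W) :
    outer α w = wedgeAct (ofCovec α) w := LinearMap.congr_fun (wedgeOp_ofCovec α).symm w

theorem homog_wedgeSec_zero (X : Fin 0 → E) : homog 0 (wedgeSec p 0 X) = ofFun E' 1 := by
  rw [ofFun]
  congr 1
  ext v
  rw [wedgeSec_apply]
  simp

/-- Laplace expansion of the determinant along its first column. -/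
theorem homog_wedgeSec_cons {k : ℕ} (X : E) (v : Fin k → E) :
    homog (k + 1) (wedgeSec p (k + 1) (Fin.cons X v : Fin (k + 1) → E)) =
      outer (p X) (homog k (wedgeSec p k v)) := by
  rw [outer_homog]
  congr 1
  ext θ
  rw [wedgeSec_apply, outer_succ_apply, homog_same, Matrix.det_succ_column_zero]
  refine Finset.sum_congr rfl fun i _ => ?_
  rw [wedgeSec_apply, smul_eq_mul, zsmul_eq_mul, mul_assoc]
  push_cast
  congr 2

theorem wedgeOp_wedgeSec_cons {k : ℕ} (X : E) (v : Fin k → E) :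
    (wedgeOp (homog (k + 1) (wedgeSec p (k + 1) (Fin.cons X v : Fin (k + 1) → E))) : Op R E' W) =
      (-1 : ℤ) ^ k • (wedgeOp (homog k (wedgeSec p k v)) * outer (p X)) := by
  rw [homog_wedgeSec_cons, outer_eq_wedgeAct, ← wedgeOp_mul, ofCovec, wedgeOp_homog_comm, one_mul,
    ← wedgeOp_ofCovec]
  rfl

theorem starMap_apply {k j : ℕ} (h : k + j = n) (u : E' [⋀^Fin j]→ₗ[R] W) (X : Fin k → E) :
    starMap p h u X = wedgeAct (homog k (wedgeSec p k X)) (homog j u) n := by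
  rw [wedgeAct_apply, Finset.sum_eq_single (k, j)]
  · rw [homog_same, homog_same, wedgePart, dif_pos h]
    rfl
  · intro kl hkl hne
    rw [Finset.HasAntidiagonal.mem_antidiagonal] at hkl
    have h1 : kl.1 ≠ k := fun h1 => hne (Prod.ext h1 (by omega))
    rw [homog_of_ne h1, wedgePart, dif_pos hkl, map_zero, LinearMap.zero_apply, map_zero]
  · exact fun h1 => absurd (Finset.HasAntidiagonal.mem_antidiagonal.2 h) h1

/-- Moving X past v₁ ∧ ⋯ ∧ v_k towards u costs (−1)^k. So the star turns contraction by X into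
exterior multiplication by X, and all its properties follow from this by induction on k. -/
theorem starMap_cons {k j : ℕ} (h' : k + 1 + j = n) (h : k + (j + 1) = n)
    (u : E' [⋀^Fin j]→ₗ[R] W) (X : E) (v : Fin k → E) :
    starMap p h' u (Fin.cons X v : Fin (k + 1) → E) =
      (-1 : ℤ) ^ k • starMap p h (outer (p X) (homog j u) (j + 1)) v := by
  rw [starMap_apply, starMap_apply, ← outer_homog]
  exact congrFun (LinearMap.congr_fun (wedgeOp_wedgeSec_cons (W := W) X v) (homog j u)) n

theorem starMap_curryLeft {k j : ℕ} (h' : k + 1 + j = n) (h : k + (j + 1) = n)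
    (u : E' [⋀^Fin j]→ₗ[R] W) (X : E) :
    (starMap p h' u).curryLeft X =
      (-1 : ℤ) ^ k • starMap p h (outer (p X) (homog j u) (j + 1)) := by
  ext1 v
  exact starMap_cons h' h u X v

theorem starMap_zero_apply (h : 0 + n = n) (u : E' [⋀^Fin n]→ₗ[R] W) (v : Fin 0 → E) :
    starMap p h u v = u := by
  have h1 : wedgeAct (ofFun E' 1) (homog n u) = homog n u := by
    have := LinearMap.congr_fun (wedgeOp_ofFun (P := E') (W := W) 1) (homog n u)
    exact this.trans (one_smul R _)
  rw [starMap_apply, homog_wedgeSec_zero, h1, homog_same]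

variable (p) in
/-- `starMap` as a linear map. -/
def starLin {k j : ℕ} (h : k + j = n) :
    (E' [⋀^Fin j]→ₗ[R] W) →ₗ[R] (E [⋀^Fin k]→ₗ[R] (E' [⋀^Fin n]→ₗ[R] W)) where
  toFun := starMap p h
  map_add' u v := by
    ext1 X
    rw [AlternatingMap.add_apply, starMap_apply, starMap_apply, starMap_apply, homog_add, map_add,
      Pi.add_apply]
  map_smul' f u := by
    ext1 X
    rw [AlternatingMap.smul_apply, starMap_apply, starMap_apply, homog_smul, map_smul,
      Pi.smul_apply]
    rfl

theorem starMap_zsmul {k j : ℕ} (h : k + j = n) (a : ℤ) (u : E' [⋀^Fin j]→ₗ[R] W) :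
    starMap p h (a • u) = a • starMap p h u := map_zsmul (starLin p h) a u

/-- If the star of u vanishes, so do its contractions, hence by induction all the products X ∧ u; a
form of degree less than n with this property is zero. -/
theorem starLin_injective (hf : HasFrames p n 𝒳) (hW : Separated 𝒳 W) :
    ∀ {k j : ℕ} (h : k + j = n), Function.Injective (starLin p (W := W) h) := by
  intro k
  induction k with
  | zero =>
    intro j h
    obtain rfl : j = n := by omega
    intro u v huv
    have := DFunLike.congr_fun huv Fin.elim0
    exact (starMap_zero_apply h u _).symm.trans (this.trans (starMap_zero_apply h v _))
  | succ k ih =>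
    intro j h
    rw [injective_iff_map_eq_zero]
    intro u hu
    have h1 : u = homog j u j := (homog_same j u).symm
    rw [h1]
    refine hf.component_eq_zero hW (by omega) fun X => ?_
    have h' : k + (j + 1) = n := by omega
    refine ih h' ?_
    have h2 := congrArg (fun ρ => ρ.curryLeft X) hu
    have h3 : (starMap p h u).curryLeft X = 0 := h2
    rw [starMap_curryLeft h h'] at h3
    rw [map_zero]
    change starMap p h' _ = 0
    have h4 := congrArg ((-1 : ℤ) ^ k • ·) h3
    simp only [smul_smul, ← pow_add, Even.neg_one_pow ⟨k, rfl⟩, one_smul, smul_zero] at h4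
    exact h4

/-- Induction on k. The contraction of ρ by X is the star of a unique u(X), which is linear in X,
and X ∧ u(Y) is antisymmetric because ρ is alternating. Such a u is of the form X ↦ X ∧ y up to a
constant; y is found in a local frame, and by injectivity the local solutions glue. -/
theorem starLin_surjective (h𝒳 : Absorbing 𝒳) (hf : HasFrames p n 𝒳) (hW : Separated 𝒳 W)
    (hG : Gluing 𝒳 W) :
    ∀ {k j : ℕ} (h : k + j = n), Function.Surjective (starLin p (W := W) h) := by
  intro k
  induction k with
  | zero =>
    intro j h ρ
    obtain rfl : j = n := by omega
    refine ⟨ρ Fin.elim0, AlternatingMap.ext fun v => ?_⟩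
    refine (starMap_zero_apply h _ _).trans ?_
    congr 1
    exact Subsingleton.elim _ _
  | succ k ih =>
    intro j h ρ
    have h' : k + (j + 1) = n := by omega
    let e := LinearEquiv.ofBijective (starLin p (W := W) h') ⟨starLin_injective hf hW h', ih h'⟩
    let u : E →ₗ[R] (E' [⋀^Fin (j + 1)]→ₗ[R] W) := e.symm.toLinearMap ∘ₗ ρ.curryLeft
    have hu (X : E) : starMap p h' (u X) = ρ.curryLeft X := e.apply_symm_apply (ρ.curryLeft X)
    have anti (X Y : E) : outer (p X) (homog (j + 1) (u Y)) (j + 2) =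
        - outer (p Y) (homog (j + 1) (u X)) (j + 2) := by
      cases k with
      | zero =>
        rw [hf.alt_eq_zero hW (by omega) (outer (p X) (homog (j + 1) (u Y)) (j + 2)),
          hf.alt_eq_zero hW (by omega) (outer (p Y) (homog (j + 1) (u X)) (j + 2)), neg_zero]
      | succ k =>
        have h'' : k + (j + 2) = n := by omega
        have h1 (X Y : E) : starMap p h'' (outer (p X) (homog (j + 1) (u Y)) (j + 2)) =
            (-1 : ℤ) ^ k • ((ρ.curryLeft Y).curryLeft X) := by
          rw [← hu, starMap_curryLeft h' h'', smul_smul, ← pow_add, Even.neg_one_pow ⟨k, rfl⟩,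
            one_smul]
        refine starLin_injective hf hW h'' ?_
        rw [map_neg]
        change starMap p h'' _ = - starMap p h'' _
        rw [h1, h1]
        have h2 := congrFun (LinearMap.congr_fun (inner_inner X Y) (homog (k + 2) ρ)) k
        simp only [Module.End.mul_apply, LinearMap.neg_apply, inner_homog_succ, Pi.neg_apply,
          homog_same] at h2
        rw [h2]
        ext1 v
        exact smul_neg ((-1 : ℤ) ^ k) ((ρ.curryLeft X).curryLeft Y v)
    refine mem_range_of_local h𝒳 (hG.alt hW j) ((hW.alt n).alt (k + 1)) _
      (starLin_injective hf hW h) ρ fun i => ?_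
    obtain ⟨c, hc, b, β, hfr⟩ := hf i
    -- The Clifford relation and the antisymmetry turn X ∧ y into u(X) plus ∑ ι_{β_a}(b_a ∧ u(X)).
    -- The degree of u(X) being j + 1, this is 1 + (n − j − 1) = n − j times u(X).
    let y : E' [⋀^Fin j]→ₗ[R] W := ∑ a, (u (b a)).curryLeft (β a)
    have hy (X : E) : c • outer (p X) (homog j y) (j + 1) = c • ((n : ℤ) - j) • u X := by
      have h1 : homog j y = ∑ a, inner (β a) (homog (j + 1) (u (b a))) := by
        simp only [inner_homog_succ]
        exact map_sum (⟨⟨homog j, homog_zero j⟩, homog_add j⟩ : _ →+ Forms R E' W) _ _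
      have h2 (a : Fin n) : outer (p X) (inner (β a) (homog (j + 1) (u (b a)))) =
          p X (β a) • homog (j + 1) (u (b a)) +
            inner (β a) (outer (p (b a)) (homog (j + 1) (u X))) := by
        have := LinearMap.congr_fun (outer_mul_inner (W := W) (β a) (p X))
          (homog (j + 1) (u (b a)))
        refine this.trans ?_
        change _ - inner (β a) (outer (p X) (homog (j + 1) (u (b a)))) = _
        have h7 : outer (p X) (homog (j + 1) (u (b a))) =
            - outer (p (b a)) (homog (j + 1) (u X)) := by
          rw [outer_homog (p X), outer_homog (p (b a)), anti]
          exact Pi.single_neg _ _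
        rw [h7, map_neg, sub_neg_eq_add]
        rfl
      rw [h1, map_sum]
      simp only [h2, Finset.sum_add_distrib]
      rw [Pi.add_apply, smul_add, hfr.sum_inner_outer, homog_same, Finset.sum_apply]
      simp only [Pi.smul_apply, homog_same]
      have h3 : c • ∑ a, p X (β a) • u (b a) = c • u X := by
        rw [← map_smul, hfr.left, map_smul, map_sum]
        simp only [map_smul]
      rw [h3, ← smul_add]
      congr 1
      push_cast
      rw [sub_smul, sub_smul, add_smul, one_smul]
      abel
    -- The inverse of the factor n − j in `hy`, nonzero as j < n, and of the sign (−1)^k in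
    -- `starMap_cons`.
    let r : R := algebraMap ℝ R (1 / ((n : ℝ) - j)) * ((-1 : ℤ) ^ k : ℤ)
    refine ⟨c, hc, r • c • y, AlternatingMap.ext fun v => ?_⟩
    have hv : v = (Fin.cons (v 0) (Fin.tail v) : Fin (k + 1) → E) := (Fin.cons_self_tail v).symm
    rw [hv]
    rw [map_smul, map_smul, AlternatingMap.smul_apply, AlternatingMap.smul_apply]
    change r • c • starMap p h y _ = _
    rw [starMap_cons h h', smul_comm c]
    have h4 : c • starMap p h' (outer (p (v 0)) (homog j y) (j + 1)) =
        ((n : ℤ) - j) • c • ρ.curryLeft (v 0) := by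
      have := congrArg (starLin p h') (hy (v 0))
      rw [map_smul, map_smul, map_zsmul] at this
      refine this.trans ?_
      change c • ((n : ℤ) - j) • starMap p h' (u (v 0)) = _
      rw [hu, smul_comm]
    have h5 := DFunLike.congr_fun h4 (Fin.tail v)
    simp only [AlternatingMap.smul_apply, AlternatingMap.curryLeft_apply_apply] at h5
    rw [h5]
    have h6 : r * ((-1 : ℤ) ^ k : ℤ) * (((n : ℤ) - j : ℤ) : R) = 1 := by
      have e1 : (((-1 : ℤ) ^ k : ℤ) : R) * ((-1 : ℤ) ^ k : ℤ) = 1 := by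
        push_cast
        rw [← pow_add, Even.neg_one_pow ⟨k, rfl⟩]
      have e2 : algebraMap ℝ R (1 / ((n : ℝ) - j)) * (((n : ℤ) - j : ℤ) : R) = 1 := by
        rw [← map_intCast (algebraMap ℝ R), ← map_mul]
        have e3 : (((n : ℤ) - j : ℤ) : ℝ) = (n : ℝ) - j := by push_cast; ring
        rw [e3]
        have : ((n : ℝ) - j) ≠ 0 := by
          rw [sub_ne_zero]
          exact_mod_cast (show n ≠ j by omega)
        rw [one_div_mul_cancel this, map_one]
      calc r * ((-1 : ℤ) ^ k : ℤ) * (((n : ℤ) - j : ℤ) : R)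
          = (algebraMap ℝ R (1 / ((n : ℝ) - j)) * (((n : ℤ) - j : ℤ) : R)) *
            ((((-1 : ℤ) ^ k : ℤ) : R) * ((-1 : ℤ) ^ k : ℤ)) := by simp only [r]; ring
        _ = 1 := by rw [e1, e2, one_mul]
    rw [← Int.cast_smul_eq_zsmul R, ← Int.cast_smul_eq_zsmul R, smul_smul, smul_smul, h6, one_smul]
    rfl

end Star

/-! ### Square roots of a line bundle -/

section Half
variable {R : Type*} [CommRing R] {I : Type*} (𝒳 : I → Submonoid R)
  (L : Type*) [AddCommGroup L] [Module R L]

/-- `L` is locally free of rank one. -/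
def IsLine : Prop := ∀ i, ∃ c ∈ 𝒳 i, ∃ (l₀ : L) (ev : L →ₗ[R] R),
  (∀ l, c • l = c • ev l • l₀) ∧ c * ev l₀ = c

variable {𝒳 L}

/-- The product of two linear forms on `L`, on `L ⊗ L`. -/
def evTwo (ev : L →ₗ[R] R) : L ⊗[R] L →ₗ[R] R :=
  LinearMap.mul' R R ∘ₗ TensorProduct.map ev ev

theorem evTwo_tmul (ev : L →ₗ[R] R) (l l' : L) : evTwo ev (l ⊗ₜ l') = ev l * ev l' := by
  simp [evTwo]

theorem smul_eq_evTwo {c : R} {l₀ : L} {ev : L →ₗ[R] R} (h : ∀ l, c • l = c • ev l • l₀)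
    (t : L ⊗[R] L) : (c * c) • t = (c * c) • evTwo ev t • (l₀ ⊗ₜ l₀) := by
  induction t using TensorProduct.induction_on with
  | zero => simp
  | add x y hx hy => rw [smul_add, hx, hy, map_add, add_smul, smul_add]
  | tmul l l' =>
    have h1 : (c * c) • (l ⊗ₜ[R] l') = (c • l) ⊗ₜ (c • l') := by
      rw [TensorProduct.smul_tmul_smul]
    rw [h1, h l, h l', TensorProduct.smul_tmul_smul, TensorProduct.smul_tmul_smul, evTwo_tmul]

theorem IsLine.eq_zero_of_tmul (hL : IsLine 𝒳 L) (hs : Separated 𝒳 L) {x : L}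
    (h : ∀ l : L, x ⊗ₜ[R] l = 0) : x = 0 := by
  refine hs _ fun i => ?_
  obtain ⟨c, hc, l₀, ev, h1, h2⟩ := hL i
  refine ⟨c, hc, ?_⟩
  have h3 := congrArg (evTwo ev) (h l₀)
  rw [evTwo_tmul, map_zero] at h3
  rw [h1, smul_smul, ← h2, mul_right_comm, mul_assoc, h3, mul_zero, zero_smul]

variable [Algebra ℝ R]

/-- For l = l' = l₀ the relation says 2 t(l₀) = 0, and then for l' = l₀ it says t(l) = 0. The map t
is arbitrary, so this gives uniqueness of actions on a square root before they are known to be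
additive. -/
theorem IsLine.eq_zero_of_half (hL : IsLine 𝒳 L) (hs : Separated 𝒳 L) {t : L → L}
    (h : ∀ l l' : L, t l ⊗ₜ[R] l' + l ⊗ₜ t l' = 0) : t = 0 := by
  refine hs.pi _ fun i => ?_
  obtain ⟨c, hc, l₀, ev, h1, h2⟩ := hL i
  refine ⟨c, hc, funext fun l => ?_⟩
  have h3 (l l' : L) : ev (t l) * ev l' + ev l * ev (t l') = 0 := by
    have := congrArg (evTwo ev) (h l l')
    rwa [map_add, evTwo_tmul, evTwo_tmul, map_zero] at this
  have h4 : c * ev (t l₀) = 0 := by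
    refine LieAlgebroid.eq_of_two_smul_eq R ?_
    rw [smul_zero, ← mul_zero c, ← h3 l₀ l₀, mul_add, mul_left_comm, h2, ← mul_assoc, h2,
      zsmul_eq_mul]
    push_cast
    ring
  have h5 : c * ev (t l) = 0 := by
    have := congrArg (c * ·) (h3 l l₀)
    simp only [mul_add, mul_zero] at this
    rwa [mul_left_comm c (ev l), h4, mul_zero, add_zero, mul_left_comm, h2, mul_comm] at this
  change c • t l = 0
  rw [h1, smul_smul, h5, zero_smul]

/-- A derivation of `L ⊗ L` is induced by one of `L`. -/
theorem IsLine.exists_half (hL : IsLine 𝒳 L) (hs : Separated 𝒳 L) (h𝒳 : Absorbing 𝒳)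
    (hG : Gluing 𝒳 L) {D : Derivation ℝ R R} {T : Type*} [AddCommGroup T] [Module R T]
    (hT : Separated 𝒳 T) (q : L ⊗[R] L ≃ₗ[R] T) (𝓛 : DerEnd D T) :
    ∃ δ : DerEnd D L, ∀ l l', q (δ l ⊗ₜ l' + l ⊗ₜ δ l') = 𝓛 (q (l ⊗ₜ l')) := by
  have hs2 : Separated 𝒳 (L ⊗[R] L) := hT.of_injective q.toLinearMap q.injective
  -- The equation for δ is a linear system for a bare map L → L. It has at most one solution, so
  -- local solutions suffice.
  let Ψ : (L → L) →ₗ[R] (L × L → L ⊗[R] L) :=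
    { toFun := fun t x => t x.1 ⊗ₜ x.2 + x.1 ⊗ₜ t x.2
      map_add' := fun t t' => by
        funext x; simp only [Pi.add_apply, TensorProduct.add_tmul, TensorProduct.tmul_add]; abel
      map_smul' := fun f t => by
        funext x
        simp only [Pi.smul_apply, TensorProduct.tmul_smul, smul_add, RingHom.id_apply,
          TensorProduct.smul_tmul'] }
  have hΨ : Function.Injective Ψ := by
    rw [injective_iff_map_eq_zero]
    exact fun t ht => hL.eq_zero_of_half hs fun l l' => congrFun ht (l, l')
  have key : ∃ t, Ψ t = fun x => q.symm (𝓛 (q (x.1 ⊗ₜ x.2))) := by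
    refine mem_range_of_local h𝒳 hG.pi hs2.pi Ψ hΨ _ fun i => ?_
    obtain ⟨c, hc, l₀, ev, h1, h2⟩ := hL i
    obtain ⟨c', hc', hcc⟩ := h𝒳 i (c * c) (mul_mem hc hc)
    -- The local solution is h l₀ ↦ (D h + ½ κ h) l₀, where κ is the eigenvalue of the given
    -- derivation on l₀ ⊗ l₀.
    let κ : R := evTwo ev (q.symm (𝓛 (q (l₀ ⊗ₜ l₀))))
    let a : L → R := fun l => D (ev l) + algebraMap ℝ R (1 / 2) * (ev l * κ)
    have ha (l l' : L) : a l * ev l' + ev l * a l' = D (ev l * ev l') + ev l * ev l' * κ := by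
      have h12 : algebraMap ℝ R (1 / 2) + algebraMap ℝ R (1 / 2) = 1 := by
        rw [← map_add, add_halves, map_one]
      simp only [a, Derivation.leibniz, smul_eq_mul]
      linear_combination (ev l * ev l' * κ) * h12
    refine ⟨c', hc', fun l => c' • a l • l₀, funext fun x => ?_⟩
    obtain ⟨l, l'⟩ := x
    have h3 (t : L ⊗[R] L) : c' • t = c' • evTwo ev t • (l₀ ⊗ₜ[R] l₀) := by
      rw [← hcc, mul_smul, smul_eq_evTwo h1, ← mul_smul]
    have h4 : c' • 𝓛 (q (l ⊗ₜ l')) = c' • 𝓛 (q ((ev l * ev l') • (l₀ ⊗ₜ l₀))) := by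
      refine 𝓛.smul_eq_of_smul_eq hcc ?_
      rw [← map_smul, ← map_smul, smul_eq_evTwo h1, evTwo_tmul]
    have h6 : c' * (ev l₀ * ev l₀) = c' := by
      rw [← hcc, mul_assoc, mul_mul_mul_comm, h2]
    have h7 : c' * (c * c) * ev l₀ = c' := by rw [mul_assoc, mul_assoc, h2, hcc]
    have h8 : c' * ev l₀ = c' := by rw [← hcc, h7, hcc]
    change (c' • a l • l₀) ⊗ₜ[R] l' + l ⊗ₜ (c' • a l' • l₀) = c' • q.symm (𝓛 (q (l ⊗ₜ l')))
    rw [← map_smul, h4, map_smul, map_smul, 𝓛.leibniz, map_add, map_smul, map_smul,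
      q.symm_apply_apply]
    rw [TensorProduct.tmul_smul, ← TensorProduct.smul_tmul', TensorProduct.tmul_smul,
      ← TensorProduct.smul_tmul', smul_add, smul_comm c' (ev l * ev l'),
      h3 (q.symm _), smul_comm c' (a l), smul_comm c' (a l'), h3 (l₀ ⊗ₜ l'), h3 (l ⊗ₜ l₀),
      evTwo_tmul, evTwo_tmul]
    simp only [smul_smul, ← add_smul]
    congr 1
    change a l * (c' * (ev l₀ * ev l')) + a l' * (c' * (ev l * ev l₀)) = c' * D (ev l * ev l') +
      ev l * ev l' * (c' * κ)
    linear_combination c' * ha l l' + (a l * ev l' + a l' * ev l) * h8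
  obtain ⟨δ, hδ⟩ := key
  have hδ' (l l' : L) : δ l ⊗ₜ[R] l' + l ⊗ₜ δ l' = q.symm (𝓛 (q (l ⊗ₜ l'))) := congrFun hδ (l, l')
  have hδ'' (l l' : L) : δ l ⊗ₜ[R] l' = q.symm (𝓛 (q (l ⊗ₜ l'))) - l ⊗ₜ δ l' :=
    eq_sub_of_add_eq (hδ' l l')
  -- Additivity and the Leibniz rule hold after tensoring with any l, by the equation that defines
  -- δ, and an element whose tensor products with all l vanish is zero.
  refine ⟨⟨AddMonoidHom.mk' δ fun x y => ?_, fun f x => ?_⟩, fun l l' => ?_⟩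
  · refine sub_eq_zero.1 (hL.eq_zero_of_tmul hs fun l => ?_)
    rw [TensorProduct.sub_tmul, TensorProduct.add_tmul, hδ'', hδ'', hδ'', TensorProduct.add_tmul,
      TensorProduct.add_tmul, map_add, map_add, map_add]
    abel
  · change δ (f • x) = D f • x + f • δ x
    refine sub_eq_zero.1 (hL.eq_zero_of_tmul hs fun l => ?_)
    rw [TensorProduct.sub_tmul, TensorProduct.add_tmul, hδ'']
    simp only [← TensorProduct.smul_tmul']
    rw [hδ'', map_smul, 𝓛.leibniz, map_add, map_smul, map_smul,
      q.symm_apply_apply, smul_sub]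
    abel
  · change q (δ l ⊗ₜ[R] l' + l ⊗ₜ δ l') = _
    rw [hδ', q.apply_symm_apply]

/-- A tensorial endomorphism of `L` is the multiplication by a function. -/
theorem IsLine.exists_smul (hL : IsLine 𝒳 L) (hs : Separated 𝒳 L) (h𝒳 : Absorbing 𝒳)
    (hsR : Separated 𝒳 R) (hG : Gluing 𝒳 R) {g : L → L} (hg : ∀ (f : R) l, g (f • l) = f • g l) :
    ∃ φ : R, ∀ l, g l = φ • l := by
  let Ψ : R →ₗ[R] (L → L) :=
    { toFun := fun f l => f • l
      map_add' := fun f f' => funext fun l => add_smul f f' l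
      map_smul' := fun f f' => funext fun l => mul_smul f f' l }
  obtain ⟨φ, hφ⟩ : ∃ φ, Ψ φ = g := by
    refine mem_range_of_local h𝒳 hG hs.pi Ψ ?_ g fun i => ?_
    · rw [injective_iff_map_eq_zero]
      intro f hf
      refine hsR _ fun i => ?_
      obtain ⟨c, hc, l₀, ev, h1, h2⟩ := hL i
      refine ⟨c, hc, ?_⟩
      have h3 : f • l₀ = 0 := congrFun hf l₀
      have h4 := congrArg ev h3
      rw [map_smul, map_zero, smul_eq_mul] at h4
      rw [smul_eq_mul, ← h2, mul_assoc, mul_comm (ev l₀), h4, mul_zero]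
    · obtain ⟨c, hc, l₀, ev, h1, h2⟩ := hL i
      refine ⟨c * c, mul_mem hc hc, (c * c) * ev (g l₀), funext fun l => ?_⟩
      change ((c * c) * ev (g l₀)) • l = (c * c) • g l
      have h3 : c • g l = (c * ev l) • g l₀ := by
        rw [← hg, h1, smul_smul, hg]
      rw [mul_smul c c (g l), h3, smul_comm, h1 (g l₀), mul_comm (c * c) (ev _), mul_smul (ev _),
        mul_smul c c l, h1 l]
      simp only [smul_smul]
      congr 1
      ring
  exact ⟨φ, fun l => (congrFun hφ l).symm⟩

theorem IsLine.eq_of_smul_eq (hL : IsLine 𝒳 L) (hsR : Separated 𝒳 R) {f g : R}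
    (h : ∀ l : L, f • l = g • l) : f = g := by
  refine hsR.eq fun i => ?_
  obtain ⟨c, hc, l₀, ev, h1, h2⟩ := hL i
  refine ⟨c, hc, ?_⟩
  have h4 := congrArg ev (h l₀)
  rw [map_smul, map_smul, smul_eq_mul, smul_eq_mul] at h4
  rw [smul_eq_mul, smul_eq_mul, ← h2]
  linear_combination c * h4

end Half

/-! ### Forms of top degree in a frame -/

section FrameExpansion
variable {R : Type*} [CommRing R] [Algebra ℝ R] {E E' : Type*} [AddCommGroup E] [Module R E] [AddCommGroup E']
  [Module R E'] {p : E →ₗ[R] E' →ₗ[R] R} {n : ℕ} {W : Type*} [AddCommGroup W] [Module R W]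

/-- The value of a form of top degree in terms of a frame. -/
theorem alt_sum_smul (ρ : E' [⋀^Fin n]→ₗ[R] W) (A : Matrix (Fin n) (Fin n) R) (ε : Fin n → E') :
    (ρ fun i => ∑ a, A i a • ε a) = A.det • ρ ε := by
  have h2 := ρ.toMultilinearMap.map_sum (fun (j : Fin n) (a : Fin n) => A j a • ε a)
  refine h2.trans ?_
  have h3 (σ : Fin n → Fin n) : ρ.toMultilinearMap (fun j => A j (σ j) • ε (σ j)) =
      (∏ j, A j (σ j)) • ρ (ε ∘ σ) :=
    ρ.toMultilinearMap.map_smul_univ (fun j => A j (σ j)) fun j => ε (σ j)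
  simp only [h3]
  have h4 : ∑ σ : Fin n → Fin n, (∏ j, A j (σ j)) • ρ (ε ∘ σ) =
      ∑ σ : Equiv.Perm (Fin n), (∏ j, A j (σ j)) • ρ (ε ∘ σ) := by
    symm
    refine Finset.sum_of_injOn (fun σ : Equiv.Perm (Fin n) => (σ : Fin n → Fin n))
      (fun _ _ _ _ h => DFunLike.coe_injective h) (by simp) (fun σ _ hσ => ?_) (fun _ _ => rfl)
    have h5 : ¬ Function.Injective σ := fun h => hσ
      ⟨Equiv.ofBijective σ (Finite.injective_iff_bijective.1 h), by simp, rfl⟩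
    rw [Function.Injective] at h5
    push Not at h5
    obtain ⟨a, b, hab, hne⟩ := h5
    rw [ρ.map_eq_zero_of_eq _ (by simp [hab]) hne, smul_zero]
  rw [h4, ← Matrix.det_transpose, Matrix.det_apply, Finset.sum_smul]
  refine Finset.sum_congr rfl fun σ _ => ?_
  rw [AlternatingMap.map_perm, smul_comm, smul_assoc]
  rfl

theorem IsFrame.alt_apply {c : R} {e : Fin n → E} {ε : Fin n → E'} (h : IsFrame p c e ε)
    (ρ : E' [⋀^Fin n]→ₗ[R] W) (θ : Fin n → E') :
    c ^ n • ρ θ = c ^ n • wedgeSec p n e θ • ρ ε := by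
  have h1 (v : Fin n → E') : c ^ n • ρ v = ρ fun j => c • v j := by
    have := ρ.toMultilinearMap.map_smul_univ (fun _ => c) v
    simp only [Finset.prod_const, Finset.card_univ, Fintype.card_fin] at this
    exact this.symm
  rw [h1, funext fun j => h.right (θ j), ← h1, wedgeSec_apply]
  congr 1
  exact alt_sum_smul ρ (.of fun i a => p (e a) (θ i)) ε

theorem IsFrame.wedgeSec_eq {c : R} {e : Fin n → E} {ε : Fin n → E'} (h : IsFrame p c e ε) :
    c ^ n * wedgeSec p n e ε = c ^ n := by
  rw [wedgeSec_apply]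
  have h2 : c ^ n * Matrix.det (.of fun i j => p (e j) (ε i)) =
      Matrix.det (c • (.of fun i j => p (e j) (ε i) : Matrix (Fin n) (Fin n) R)) := by
    rw [Matrix.det_smul, Fintype.card_fin]
  rw [h2]
  have h3 : c • (.of fun i j => p (e j) (ε i) : Matrix (Fin n) (Fin n) R) =
      c • (1 : Matrix (Fin n) (Fin n) R) := by
    ext i j
    simp only [Matrix.smul_apply, Matrix.of_apply, smul_eq_mul, h.dual, Matrix.one_apply]
    simp [eq_comm]
  rw [h3, Matrix.det_smul, Fintype.card_fin, Matrix.det_one, mul_one]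

theorem wedgeSec_flip (X : Fin n → E) (θ : Fin n → E') :
    wedgeSec p n X θ = wedgeSec p.flip n θ X := by
  rw [wedgeSec_apply, wedgeSec_apply, ← Matrix.det_transpose]
  rfl

end FrameExpansion

/-! ### Sums, commutators and multiples of Lie derivatives -/

section LieOperatorAlgebra
variable {R : Type*} [CommRing R] [Algebra ℝ R] {P : Type*} [AddCommGroup P] [Module R P]
  {W : Type*} [AddCommGroup W] [Module R W] {D₁ D₂ D₃ : Derivation ℝ R R}

theorem lieOp_bracket {δ₁ : DerEnd D₁ P} {δ₂ : DerEnd D₂ P} {δ₃ : DerEnd D₃ P}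
    {ν₁ : DerEnd D₁ W} {ν₂ : DerEnd D₂ W} {ν₃ : DerEnd D₃ W}
    (hδ : ∀ x, δ₃ x = δ₁ (δ₂ x) - δ₂ (δ₁ x)) (hν : ∀ x, ν₃ x = ν₁ (ν₂ x) - ν₂ (ν₁ x)) :
    lieOp δ₃ ν₃ = lieOp δ₁ ν₁ * lieOp δ₂ ν₂ - lieOp δ₂ ν₂ * lieOp δ₁ ν₁ := by
  rw [← sub_eq_zero]
  refine op_eq_zero_of_inner (fun w => AlternatingMap.ext fun v => ?_) 1 fun ζ => ?_
  · change lieOp δ₃ ν₃ w 0 v - (lieOp δ₁ ν₁ (lieOp δ₂ ν₂ w) 0 v -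
      lieOp δ₂ ν₂ (lieOp δ₁ ν₁ w) 0 v) = 0
    simp only [lieOp_zero_apply, hν, sub_self]
  · simp only [mul_sub, sub_mul, one_smul, inner_mul_lieOp, ← mul_assoc]
    simp only [mul_sub, mul_assoc, inner_mul_lieOp]
    rw [hδ, inner_sub_left]
    abel

theorem lieOp_add_left {δ₁ : DerEnd D₁ P} {δ₂ : DerEnd D₂ P} {δ₃ : DerEnd D₃ P}
    {ν₁ : DerEnd D₁ W} {ν₂ : DerEnd D₂ W} {ν₃ : DerEnd D₃ W}
    (hδ : ∀ x, δ₃ x = δ₁ x + δ₂ x) (hν : ∀ x, ν₃ x = ν₁ x + ν₂ x) :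
    lieOp δ₃ ν₃ = lieOp δ₁ ν₁ + lieOp δ₂ ν₂ := by
  refine LinearMap.ext fun w => funext fun k => AlternatingMap.ext fun v => ?_
  change lieOp δ₃ ν₃ w k v = lieOp δ₁ ν₁ w k v + lieOp δ₂ ν₂ w k v
  simp only [lieOp_apply_apply, hδ, hν, AlternatingMap.map_update_add, Finset.sum_add_distrib]
  abel

theorem alt_bracket {δ₁ : DerEnd D₁ P} {δ₂ : DerEnd D₂ P} {δ₃ : DerEnd D₃ P}
    {ν₁ : DerEnd D₁ W} {ν₂ : DerEnd D₂ W} {ν₃ : DerEnd D₃ W}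
    (hδ : ∀ x, δ₃ x = δ₁ (δ₂ x) - δ₂ (δ₁ x)) (hν : ∀ x, ν₃ x = ν₁ (ν₂ x) - ν₂ (ν₁ x)) {k : ℕ}
    (ρ : P [⋀^Fin k]→ₗ[R] W) :
    δ₃.alt k ν₃ ρ = δ₁.alt k ν₁ (δ₂.alt k ν₂ ρ) - δ₂.alt k ν₂ (δ₁.alt k ν₁ ρ) := by
  have h := congrFun (LinearMap.congr_fun (lieOp_bracket hδ hν) (homog k ρ)) k
  simpa only [lieOp_homog, homog_same, LinearMap.sub_apply, Module.End.mul_apply,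
    Pi.sub_apply] using h

theorem alt_add_left {δ₁ : DerEnd D₁ P} {δ₂ : DerEnd D₂ P} {δ₃ : DerEnd D₃ P}
    {ν₁ : DerEnd D₁ W} {ν₂ : DerEnd D₂ W} {ν₃ : DerEnd D₃ W}
    (hδ : ∀ x, δ₃ x = δ₁ x + δ₂ x) (hν : ∀ x, ν₃ x = ν₁ x + ν₂ x) {k : ℕ}
    (ρ : P [⋀^Fin k]→ₗ[R] W) :
    δ₃.alt k ν₃ ρ = δ₁.alt k ν₁ ρ + δ₂.alt k ν₂ ρ := by
  have h := congrFun (LinearMap.congr_fun (lieOp_add_left hδ hν) (homog k ρ)) k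
  simpa only [lieOp_homog, homog_same, LinearMap.add_apply, Pi.add_apply] using h

/-- The Lie derivative of a form of top degree for a multiple of an action. -/
theorem alt_smul_left {n : ℕ} {δ₁ : DerEnd D₁ P} {δ₂ : DerEnd D₂ P} {ν₁ : DerEnd D₁ W}
    {ν₂ : DerEnd D₂ W} {f g : R} {α : P → R} {x : P} {ρ : P [⋀^Fin n]→ₗ[R] W}
    (hρ : ∀ v : Fin n → P, α x • ρ v = ∑ j, α (v j) • ρ (Function.update v j x))
    (hδ : ∀ y, δ₂ y = f • δ₁ y + α y • x) (hν : ∀ y, ν₂ y = f • ν₁ y + g • y) :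
    δ₂.alt n ν₂ ρ = f • δ₁.alt n ν₁ ρ + (g - α x) • ρ := by
  ext v
  rw [AlternatingMap.add_apply, AlternatingMap.smul_apply, AlternatingMap.smul_apply,
    DerEnd.alt_apply, DerEnd.alt_apply, hν, sub_smul, hρ]
  simp only [hδ, AlternatingMap.map_update_add, AlternatingMap.map_update_smul,
    Finset.sum_add_distrib, smul_sub, Finset.smul_sum]
  abel

theorem lieForm_add (m : ℕ) (D D' : Derivation ℝ R R) (μ : TopForm R m) :
    lieForm m (D + D') μ = lieForm m D μ + lieForm m D' μ :=
  alt_add_left (fun x => add_lie D D' x) (fun _ => rfl) μ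

theorem lieForm_bracket (m : ℕ) (D D' : Derivation ℝ R R) (μ : TopForm R m) :
    lieForm m ⁅D, D'⁆ μ = lieForm m D (lieForm m D' μ) - lieForm m D' (lieForm m D μ) :=
  alt_bracket (δ₁ := DerEnd.lie D) (δ₂ := DerEnd.lie D') (δ₃ := DerEnd.lie ⁅D, D'⁆)
    (ν₁ := DerEnd.self D) (ν₂ := DerEnd.self D') (ν₃ := DerEnd.self ⁅D, D'⁆)
    (fun x => lie_lie D D' x) (fun x => Derivation.commutator_apply x) μ

/-- L_{fD} μ = f L_D μ + df ∧ ι_D μ, and the hypothesis says that df ∧ ι_D μ = D f • μ, as it is for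
a form of top degree. -/
theorem lieForm_smul {m : ℕ} (D : Derivation ℝ R R) (f : R) {μ : TopForm R m}
    (hμ : ∀ Y, D f • μ Y = ∑ j, Y j f • μ (Function.update Y j D)) :
    lieForm m (f • D) μ = f • lieForm m D μ + D f • μ := by
  have h := alt_smul_left (δ₁ := DerEnd.lie D) (δ₂ := DerEnd.lie (f • D)) (ν₁ := DerEnd.self D)
    (ν₂ := DerEnd.self (f • D)) (f := f) (g := 0) (α := fun Y => - Y f) (x := D) (ρ := μ)
    (fun v => by simp only [neg_smul, hμ, Finset.sum_neg_distrib])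
    (fun Y => by
      refine Derivation.ext fun g => ?_
      change ⁅f • D, Y⁆ g = (f • ⁅D, Y⁆ + (-Y f) • D) g
      simp [Derivation.commutator_apply]
      ring)
    (fun y => by
      rw [zero_smul, add_zero]
      rfl)
  rw [zero_sub, neg_neg] at h
  exact h

end LieOperatorAlgebra

/-! ### The coadjoint action on the dual module -/

section Dual
variable {R : Type*} [CommRing R] [Algebra ℝ R] {E E' : Type*} [AddCommGroup E] [Module R E]
  [AddCommGroup E'] [Module R E'] (p : E →ₗ[R] E' →ₗ[R] R) [p.IsPerfPair]

variable {p} in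
theorem pairing_ext {θ η : E'} (h : ∀ X, p X θ = p X η) : θ = η :=
  p.flip.toPerfPair.injective (LinearMap.ext h)

namespace LieAlgebroid
variable (𝔞 : LieAlgebroid R E)

/-- The differential of a function as a section of the dual bundle. -/
def grad (f : R) : E' := p.flip.toPerfPair.symm (𝔞.dFun f)

theorem pairing_grad (f : R) (X : E) : p X (𝔞.grad p f) = 𝔞.anchor X f := by
  rw [grad, LinearMap.apply_toPerfPair_flip]
  rfl

/-- The Lie derivative of sections of the dual bundle. -/
abbrev coad (X : E) : DerEnd (𝔞.anchor X) E' := (𝔞.ad X).dual p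

theorem pairing_coad (X Y : E) (θ : E') :
    p Y (𝔞.coad p X θ) = 𝔞.anchor X (p Y θ) - p (𝔞.bracket X Y) θ :=
  DerEnd.pairing_dual p (𝔞.ad X) Y θ

theorem coad_add (X Y : E) (θ : E') : 𝔞.coad p (X + Y) θ = 𝔞.coad p X θ + 𝔞.coad p Y θ := by
  refine pairing_ext (p := p) fun Z => ?_
  simp only [map_add, pairing_coad, Derivation.add_apply, AddMonoidHom.add_apply,
    LinearMap.add_apply]
  abel

theorem coad_smul (f : R) (X : E) (θ : E') :
    𝔞.coad p (f • X) θ = f • 𝔞.coad p X θ + p X θ • 𝔞.grad p f := by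
  refine pairing_ext (p := p) fun Z => ?_
  rw [pairing_coad, bracket_smul_left]
  simp only [map_add, map_sub, map_smul, pairing_coad, Derivation.smul_apply,
    LinearMap.sub_apply, LinearMap.smul_apply, pairing_grad, smul_eq_mul]
  ring

theorem coad_bracket (X Y : E) (θ : E') : 𝔞.coad p (𝔞.bracket X Y) θ =
    𝔞.coad p X (𝔞.coad p Y θ) - 𝔞.coad p Y (𝔞.coad p X θ) := by
  refine pairing_ext (p := p) fun Z => ?_
  have h1 := 𝔞.jacobi X Y Z
  have h2 : p (𝔞.bracket (𝔞.bracket X Y) Z) θ =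
      p (𝔞.bracket X (𝔞.bracket Y Z)) θ - p (𝔞.bracket Y (𝔞.bracket X Z)) θ := by
    rw [h1, map_add, LinearMap.add_apply, add_sub_cancel_right]
  simp only [map_sub, pairing_coad, 𝔞.anchor_bracket, Derivation.commutator_apply, h2]
  abel

/-- The action of a section on itself through the pairing. -/
theorem covec_coad (X Y : E) : (𝔞.coad p X).covec (p Y) = p (𝔞.bracket X Y) := by
  ext θ
  rw [DerEnd.covec_apply, pairing_coad, sub_sub_cancel]

theorem lieOp_mul_outer_coad {W : Type*} [AddCommGroup W] [Module R W] (X Y : E)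
    (ν : DerEnd (𝔞.anchor X) W) : lieOp (𝔞.coad p X) ν * outer (p Y) =
      outer (p Y) * lieOp (𝔞.coad p X) ν + outer (p (𝔞.bracket X Y)) := by
  rw [lieOp_mul_outer, covec_coad]

/-- The Lie derivative of `Y₁ ∧ ⋯ ∧ Y_k`. -/
theorem alt_wedgeSec {k : ℕ} (X : E) (Y : Fin k → E) :
    (𝔞.coad p X).alt k (DerEnd.self (𝔞.anchor X)) (wedgeSec p k Y) =
      ∑ j, wedgeSec p k (Function.update Y j (𝔞.bracket X (Y j))) := by
  have key : ∀ (k : ℕ) (Y : Fin k → E),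
      lieOp (𝔞.coad p X) (DerEnd.self (𝔞.anchor X)) (homog k (wedgeSec p k Y)) =
        ∑ j, homog k (wedgeSec p k (Function.update Y j (𝔞.bracket X (Y j)))) := by
    intro k
    induction k with
    | zero =>
      intro Y
      rw [lieOp_homog, Finset.univ_eq_empty, Finset.sum_empty]
      refine (congrArg _ (AlternatingMap.ext fun v => ?_)).trans (homog_zero 0)
      rw [DerEnd.alt_apply, wedgeSec_apply, Finset.univ_eq_empty, Finset.sum_empty, sub_zero,
        Matrix.det_isEmpty]
      exact (𝔞.anchor X).map_one_eq_zero
    | succ k ih =>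
      intro Y
      rw [← Fin.cons_self_tail Y, homog_wedgeSec_cons, Fin.sum_univ_succ]
      simp only [update_cons_succ, update_cons_zero, Fin.cons_zero, Fin.cons_succ,
        homog_wedgeSec_cons]
      have := LinearMap.congr_fun (𝔞.lieOp_mul_outer_coad p X (Y 0) (DerEnd.self (𝔞.anchor X)))
        (homog k (wedgeSec p k (Fin.tail Y)))
      refine this.trans ?_
      change outer (p (Y 0)) (lieOp _ _ (homog k (wedgeSec p k (Fin.tail Y)))) + _ = _
      rw [ih, map_sum, add_comm]
  have h := congrFun (key k Y) k
  rw [lieOp_homog, homog_same, Finset.sum_apply] at h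
  simpa only [homog_same] using h

end LieAlgebroid
end Dual

section AltMapSub
variable {R : Type*} [CommRing R] {V E W : Type*} [AddCommGroup V] [Module R V] [AddCommGroup E]
  [Module R E] [AddCommGroup W] [Module R W]

theorem alt_linearMap_sub {n : ℕ} (q : V →ₗ[R] E [⋀^Fin n]→ₗ[R] W) (x y : V) :
    q x - q y = q (x - y) := by
  rw [sub_eq_add_neg x y, map_add, ← neg_one_smul R y, map_smul]
  ext v
  rw [AlternatingMap.sub_apply, AlternatingMap.add_apply, AlternatingMap.smul_apply, neg_one_smul,
    sub_eq_add_neg]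

theorem alt_map_sub {n : ℕ} (q : V ≃ₗ[R] E [⋀^Fin n]→ₗ[R] W) (x y : V) :
    q x - q y = q (x - y) := alt_linearMap_sub q.toLinearMap x y

end AltMapSub

/-! ### The actions on the square roots -/

section Connections
variable {R : Type*} [CommRing R] [Algebra ℝ R] {E E' : Type*} [AddCommGroup E] [Module R E]
  [AddCommGroup E'] [Module R E'] (p : E →ₗ[R] E' →ₗ[R] R)
  {I : Type*} (n m : ℕ) (𝒳 : I → Submonoid R) (L : Type*) [AddCommGroup L] [Module R L]

/-- The local properties of the modules of sections of a vector bundle of rank `n`, its dual and a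
line bundle over a manifold of dimension `m`. -/
structure Regular : Prop where
  absorbing : Absorbing 𝒳
  frames : HasFrames p n 𝒳
  sepFun : Separated 𝒳 R
  glueFun : Gluing 𝒳 R
  sep : Separated 𝒳 L
  glue : Gluing 𝒳 L
  line : IsLine 𝒳 L
  top : ∀ (μ : TopForm R m) (D : Derivation ℝ R R) (f : R) (Y : Fin m → Derivation ℝ R R),
    D f • μ Y = ∑ j, Y j f • μ (Function.update Y j D)

variable {p n m 𝒳 L}

theorem Regular.sepTop (H : Regular p n m 𝒳 L) : Separated 𝒳 (TopForm R m) := H.sepFun.alt m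

theorem Regular.half_unique (H : Regular p n m 𝒳 L) {T : Type*} [AddCommMonoid T] [Module R T]
    (q : L ⊗[R] L ≃ₗ[R] T) {δ δ' : L → L}
    (h : ∀ l l', q (δ l ⊗ₜ l' + l ⊗ₜ δ l') = q (δ' l ⊗ₜ l' + l ⊗ₜ δ' l')) (l : L) :
    δ l = δ' l := by
  refine sub_eq_zero.1 (congrFun (H.line.eq_zero_of_half H.sep (t := fun l => δ l - δ' l) ?_) l)
  intro l l'
  have h1 := q.injective (h l l')
  rw [TensorProduct.sub_tmul, TensorProduct.tmul_sub, sub_add_sub_comm, h1, sub_self]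

variable [p.IsPerfPair]

section TopAct
variable (H : Regular p n m 𝒳 L) (𝔟 : LieAlgebroid R E')
include H

theorem Regular.topAct_add (θ η : E') (ρ : E [⋀^Fin n]→ₗ[R] TopForm R m) :
    topAct p 𝔟 n m (θ + η) ρ = topAct p 𝔟 n m θ ρ + topAct p 𝔟 n m η ρ :=
  alt_add_left (fun X => 𝔟.coad_add p.flip θ η X) (fun μ => by rw [map_add, lieForm_add]) ρ

/-- Here the combination of ∧ⁿA* with ∧ᵐT*M is needed: replacing θ by fθ produces the extra term
−a_*(θ)f on the first factor and +a_*(θ)f on the second, both by the identity for forms of top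
degree. -/
theorem Regular.topAct_smul (f : R) (θ : E') (ρ : E [⋀^Fin n]→ₗ[R] TopForm R m) :
    topAct p 𝔟 n m (f • θ) ρ = f • topAct p 𝔟 n m θ ρ := by
  have h := alt_smul_left (ρ := ρ) (α := p.flip θ) (x := 𝔟.grad p.flip f)
    (δ₁ := 𝔟.coad p.flip θ) (δ₂ := 𝔟.coad p.flip (f • θ)) (f := f) (g := 𝔟.anchor θ f)
    (ν₁ := lieForm m (𝔟.anchor θ)) (ν₂ := lieForm m (𝔟.anchor (f • θ)))
    (fun v => H.frames.flip.top_identity H.sepTop ρ (p.flip θ) (𝔟.grad p.flip f) v)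
    (fun X => 𝔟.coad_smul p.flip f θ X)
    (fun μ => by rw [map_smul]; exact lieForm_smul _ _ fun Y => H.top μ _ f Y)
  rw [𝔟.pairing_grad p.flip, sub_self, zero_smul, add_zero] at h
  exact h

theorem Regular.topAct_bracket (θ η : E') (ρ : E [⋀^Fin n]→ₗ[R] TopForm R m) :
    topAct p 𝔟 n m (𝔟.bracket θ η) ρ =
      topAct p 𝔟 n m θ (topAct p 𝔟 n m η ρ) - topAct p 𝔟 n m η (topAct p 𝔟 n m θ ρ) :=
  alt_bracket (fun X => 𝔟.coad_bracket p.flip θ η X)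
    (fun μ => by rw [𝔟.anchor_bracket, lieForm_bracket]) ρ

end TopAct

section HalfConn
variable (H : Regular p n m 𝒳 L) (𝔟 : LieAlgebroid R E')
  (q : L ⊗[R] L ≃ₗ[R] E [⋀^Fin n]→ₗ[R] TopForm R m)
include H

/-- The square root is taken for each θ separately; uniqueness makes it linear in θ. -/
theorem Regular.exists_halfConn : ∃ nabla : 𝔟.Conn L, IsHalfAction p 𝔟 q nabla := by
  choose δ hδ using fun θ => H.line.exists_half H.sep H.absorbing H.glue (H.sepTop.alt n) q
    (topAct p 𝔟 n m θ)
  refine ⟨⟨⟨⟨fun θ => (δ θ).toAddMonoidHom, fun θ η => ?_⟩, fun f θ => ?_⟩,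
    fun θ f l => (δ θ).leibniz f l⟩, hδ⟩
  · refine AddMonoidHom.ext fun l => ?_
    refine H.half_unique q (δ' := fun l => δ θ l + δ η l) (fun l l' => ?_) l
    rw [hδ, H.topAct_add, ← hδ, ← hδ, ← map_add]
    congr 1
    simp only [TensorProduct.add_tmul, TensorProduct.tmul_add]
    abel
  · refine AddMonoidHom.ext fun l => ?_
    refine H.half_unique q (δ' := fun l => f • δ θ l) (fun l l' => ?_) l
    rw [hδ, H.topAct_smul, ← hδ, ← map_smul]
    congr 1
    simp only [TensorProduct.tmul_smul, smul_add, TensorProduct.smul_tmul']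

variable {𝔟 q}

theorem Regular.halfConn_unique {nabla nabla' : 𝔟.Conn L} (h : IsHalfAction p 𝔟 q nabla)
    (h' : IsHalfAction p 𝔟 q nabla') : nabla = nabla' := by
  obtain ⟨a, ha⟩ := nabla
  obtain ⟨a', ha'⟩ := nabla'
  congr 1
  refine LinearMap.ext fun θ => AddMonoidHom.ext fun l => ?_
  exact H.half_unique q (fun l l' => (h θ l l').trans (h' θ l l').symm) l

/-- Both sides induce the same derivation of the square, by the Jacobi identity there, so they agree
on the root. -/
theorem Regular.halfConn_isFlat {nabla : 𝔟.Conn L} (h : IsHalfAction p 𝔟 q nabla) :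
    nabla.IsFlat := by
  intro θ η l
  refine H.half_unique q (δ' := fun l => nabla.act θ (nabla.act η l) -
    nabla.act η (nabla.act θ l)) (fun l l' => ?_) l
  have h1 (θ η : E') : topAct p 𝔟 n m θ (topAct p 𝔟 n m η (q (l ⊗ₜ l'))) =
      q (nabla.act θ (nabla.act η l) ⊗ₜ l' + nabla.act η l ⊗ₜ nabla.act θ l' +
        (nabla.act θ l ⊗ₜ nabla.act η l' + l ⊗ₜ nabla.act θ (nabla.act η l'))) := by
    rw [← h η, map_add, map_add, ← h θ, ← h θ, ← map_add]
  rw [h, H.topAct_bracket, h1, h1, alt_map_sub q]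
  congr 1
  simp only [TensorProduct.sub_tmul, TensorProduct.tmul_sub]
  abel

end HalfConn

section HalfLie
variable (H : Regular p n m 𝒳 L) (𝔞 : LieAlgebroid R E)
  (q : L ⊗[R] L ≃ₗ[R] E [⋀^Fin n]→ₗ[R] TopForm R m)

/-- The Lie derivative along a section of `A` of the sections of the square root of
`∧ⁿA* ⊗ ∧ᵐT*M`. -/
def Regular.halfLie (X : E) : DerEnd (𝔞.anchor X) L :=
  (H.line.exists_half H.sep H.absorbing H.glue (H.sepTop.alt n) q
    ((𝔞.ad X).alt n (lieForm m (𝔞.anchor X)))).choose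

theorem Regular.halfLie_spec (X : E) (l l' : L) :
    q (H.halfLie 𝔞 q X l ⊗ₜ l' + l ⊗ₜ H.halfLie 𝔞 q X l') =
      (𝔞.ad X).alt n (lieForm m (𝔞.anchor X)) (q (l ⊗ₜ l')) :=
  (H.line.exists_half H.sep H.absorbing H.glue (H.sepTop.alt n) q
    ((𝔞.ad X).alt n (lieForm m (𝔞.anchor X)))).choose_spec l l'

theorem Regular.halfLie_add (X Y : E) (l : L) :
    H.halfLie 𝔞 q (X + Y) l = H.halfLie 𝔞 q X l + H.halfLie 𝔞 q Y l := by
  refine H.half_unique q (δ' := fun l => H.halfLie 𝔞 q X l + H.halfLie 𝔞 q Y l) (fun l l' => ?_) l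
  have h1 : (𝔞.ad (X + Y)).alt n (lieForm m (𝔞.anchor (X + Y))) (q (l ⊗ₜ l')) =
      (𝔞.ad X).alt n (lieForm m (𝔞.anchor X)) (q (l ⊗ₜ l')) +
      (𝔞.ad Y).alt n (lieForm m (𝔞.anchor Y)) (q (l ⊗ₜ l')) :=
    alt_add_left (fun Z => by simp) (fun μ => by rw [map_add, lieForm_add]) _
  rw [H.halfLie_spec, h1, ← H.halfLie_spec, ← H.halfLie_spec, ← map_add]
  congr 1
  simp only [TensorProduct.add_tmul, TensorProduct.tmul_add]
  abel

/-- For A itself the two extra terms on ∧ⁿA* ⊗ ∧ᵐT*M have the same sign and add up to 2 a(X)f, half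
of which is left on the root. So this is not a connection, in contrast to the action of A*. -/
theorem Regular.halfLie_smul (f : R) (X : E) (l : L) :
    H.halfLie 𝔞 q (f • X) l = f • H.halfLie 𝔞 q X l + 𝔞.anchor X f • l := by
  refine H.half_unique q (δ' := fun l => f • H.halfLie 𝔞 q X l + 𝔞.anchor X f • l)
    (fun l l' => ?_) l
  have h1 := alt_smul_left (ρ := q (l ⊗ₜ l')) (α := ⇑(-𝔞.dFun f)) (x := X)
    (δ₁ := 𝔞.ad X) (δ₂ := 𝔞.ad (f • X)) (f := f) (g := 𝔞.anchor X f)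
    (ν₁ := lieForm m (𝔞.anchor X)) (ν₂ := lieForm m (𝔞.anchor (f • X)))
    (fun v => H.frames.flip.top_identity H.sepTop (q (l ⊗ₜ l')) (-𝔞.dFun f) X v)
    (fun Y => by
      rw [LieAlgebroid.ad_apply, LieAlgebroid.ad_apply, 𝔞.bracket_smul_left, sub_eq_add_neg,
        ← neg_smul]
      rfl)
    (fun μ => by rw [map_smul]; exact lieForm_smul _ _ fun Y => H.top μ _ f Y)
  rw [H.halfLie_spec, h1, ← H.halfLie_spec, ← map_smul, ← map_smul, ← map_add]
  congr 1
  rw [LinearMap.neg_apply, LieAlgebroid.dFun_apply, sub_neg_eq_add, add_smul]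
  simp only [TensorProduct.add_tmul, TensorProduct.tmul_add, TensorProduct.tmul_smul, smul_add,
    ← TensorProduct.smul_tmul']
  abel

theorem Regular.halfLie_bracket (X Y : E) (l : L) :
    H.halfLie 𝔞 q (𝔞.bracket X Y) l =
      H.halfLie 𝔞 q X (H.halfLie 𝔞 q Y l) - H.halfLie 𝔞 q Y (H.halfLie 𝔞 q X l) := by
  refine H.half_unique q (δ' := fun l => H.halfLie 𝔞 q X (H.halfLie 𝔞 q Y l) -
    H.halfLie 𝔞 q Y (H.halfLie 𝔞 q X l)) (fun l l' => ?_) l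
  have h1 : (𝔞.ad (𝔞.bracket X Y)).alt n (lieForm m (𝔞.anchor (𝔞.bracket X Y))) (q (l ⊗ₜ l')) =
      (𝔞.ad X).alt n (lieForm m (𝔞.anchor X))
        ((𝔞.ad Y).alt n (lieForm m (𝔞.anchor Y)) (q (l ⊗ₜ l'))) -
      (𝔞.ad Y).alt n (lieForm m (𝔞.anchor Y))
        ((𝔞.ad X).alt n (lieForm m (𝔞.anchor X)) (q (l ⊗ₜ l'))) :=
    alt_bracket (fun Z => by simp [𝔞.jacobi X Y Z])
      (fun μ => by rw [𝔞.anchor_bracket, lieForm_bracket]) _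
  have h2 (X Y : E) : (𝔞.ad X).alt n (lieForm m (𝔞.anchor X))
        ((𝔞.ad Y).alt n (lieForm m (𝔞.anchor Y)) (q (l ⊗ₜ l'))) =
      q (H.halfLie 𝔞 q X (H.halfLie 𝔞 q Y l) ⊗ₜ l' +
          H.halfLie 𝔞 q Y l ⊗ₜ H.halfLie 𝔞 q X l' +
        (H.halfLie 𝔞 q X l ⊗ₜ H.halfLie 𝔞 q Y l' +
          l ⊗ₜ H.halfLie 𝔞 q X (H.halfLie 𝔞 q Y l'))) := by
    rw [← H.halfLie_spec 𝔞 q Y, map_add, map_add, ← H.halfLie_spec, ← H.halfLie_spec, ← map_add]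
  rw [H.halfLie_spec, h1, h2, h2, alt_map_sub q]
  congr 1
  simp only [TensorProduct.sub_tmul, TensorProduct.tmul_sub]
  abel

/-- The Lie derivative of `∧A ⊗ 𝓛` along a section of `A`. -/
abbrev Regular.lieSec (X : E) : Op R E' L := lieOp (𝔞.coad p X) (H.halfLie 𝔞 q X)

theorem Regular.lieSec_bracket (X Y : E) : H.lieSec 𝔞 q (𝔞.bracket X Y) =
    H.lieSec 𝔞 q X * H.lieSec 𝔞 q Y - H.lieSec 𝔞 q Y * H.lieSec 𝔞 q X :=
  lieOp_bracket (fun θ => 𝔞.coad_bracket p X Y θ) (fun l => H.halfLie_bracket 𝔞 q X Y l)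

theorem Regular.lieSec_mul_outer (X Y : E) : H.lieSec 𝔞 q X * outer (p Y) =
    outer (p Y) * H.lieSec 𝔞 q X + outer (p (𝔞.bracket X Y)) :=
  𝔞.lieOp_mul_outer_coad p X Y _

/-- The action of `A` on `∧ⁿA ⊗ 𝓛`. -/
def Regular.coHalfConn : 𝔞.Conn (E' [⋀^Fin n]→ₗ[R] L) where
  act :=
    { toFun := fun X => ((𝔞.coad p X).alt n (H.halfLie 𝔞 q X)).toAddMonoidHom
      map_add' := fun X Y => AddMonoidHom.ext fun ρ =>
        alt_add_left (fun θ => 𝔞.coad_add p X Y θ) (fun l => H.halfLie_add 𝔞 q X Y l) ρ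
      map_smul' := fun f X => AddMonoidHom.ext fun ρ => by
        -- The term a(X)f of `halfLie_smul` cancels against the one from ∧ⁿA, so that ∧ⁿA ⊗ 𝓛 does
        -- carry a connection.
        have h := alt_smul_left (ρ := ρ) (α := p X) (x := 𝔞.grad p f)
          (fun v => H.frames.top_identity H.sep ρ (p X) (𝔞.grad p f) v)
          (fun θ => 𝔞.coad_smul p f X θ) (fun l => H.halfLie_smul 𝔞 q f X l)
        rw [𝔞.pairing_grad p, sub_self, zero_smul, add_zero] at h
        exact h }
  leibniz X f ρ := ((𝔞.coad p X).alt n (H.halfLie 𝔞 q X)).leibniz f ρ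

theorem Regular.coHalfConn_apply (X : E) (ρ : E' [⋀^Fin n]→ₗ[R] L) :
    (H.coHalfConn 𝔞 q).act X ρ = (𝔞.coad p X).alt n (H.halfLie 𝔞 q X) ρ := rfl

end HalfLie

end Connections

/-! ### The A-module ∧ⁿA ⊗ 𝓛 -/

section CoHalf
variable {R : Type*} [CommRing R] [Algebra ℝ R] {E E' : Type*} [AddCommGroup E] [Module R E]
  [AddCommGroup E'] [Module R E'] {p : E →ₗ[R] E' →ₗ[R] R}
  {I : Type*} {n m : ℕ} {𝒳 : I → Submonoid R} {L : Type*} [AddCommGroup L] [Module R L]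

theorem HasFrames.eq_zero_of_wedgeSec_smul (hf : HasFrames p n 𝒳) {W : Type*} [AddCommGroup W]
    [Module R W] (hW : Separated 𝒳 W) {w : W} (h : ∀ X θ, wedgeSec p n X θ • w = 0) : w = 0 := by
  refine hW _ fun i => ?_
  obtain ⟨c, hc, e, ε, hfr⟩ := hf i
  exact ⟨c ^ n, pow_mem hc n, by rw [← hfr.wedgeSec_eq, mul_smul, h, smul_zero]⟩

/-- The product of sections of `∧ⁿA ⊗ 𝓛` as a section of `∧ⁿA ⊗ ∧ᵐT*M`. -/
theorem Regular.exists_coSquare (H : Regular p n m 𝒳 L)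
    (q : L ⊗[R] L ≃ₗ[R] E [⋀^Fin n]→ₗ[R] TopForm R m) (l l' : E' [⋀^Fin n]→ₗ[R] L) :
    ∃ μ : E' [⋀^Fin n]→ₗ[R] TopForm R m, ∀ θ θ' X,
      q (l θ ⊗ₜ l' θ') X = wedgeSec p n X θ' • μ θ := by
  let Ψ : (E' [⋀^Fin n]→ₗ[R] TopForm R m) →ₗ[R]
      ((Fin n → E') × (Fin n → E') × (Fin n → E) → TopForm R m) :=
    { toFun := fun μ x => wedgeSec p n x.2.2 x.2.1 • μ x.1
      map_add' := fun μ μ' => funext fun x => smul_add _ _ _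
      map_smul' := fun f μ => funext fun x => smul_comm _ _ _ }
  obtain ⟨μ, hμ⟩ : ∃ μ, Ψ μ = fun x => q (l x.1 ⊗ₜ l' x.2.1) x.2.2 := by
    refine mem_range_of_local H.absorbing ((H.glueFun.alt H.sepFun m).alt H.sepTop n)
      H.sepTop.pi Ψ ?_ _ fun i => ?_
    · rw [injective_iff_map_eq_zero]
      refine fun μ hμ => AlternatingMap.ext fun θ => ?_
      exact H.frames.eq_zero_of_wedgeSec_smul H.sepTop fun X θ' => congrFun hμ (θ, θ', X)
    · obtain ⟨c, hc, e, ε, hfr⟩ := H.frames i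
      let Λ : L →ₗ[R] TopForm R m :=
        { toFun := fun y => q (y ⊗ₜ l' ε) e
          map_add' := fun y y' => by rw [TensorProduct.add_tmul, map_add]; rfl
          map_smul' := fun f y => by rw [← TensorProduct.smul_tmul', map_smul]; rfl }
      refine ⟨c ^ n, pow_mem hc n, (c ^ n) • Λ.compAlternatingMap l, funext fun x => ?_⟩
      obtain ⟨θ, θ', X⟩ := x
      change wedgeSec p n X θ' • c ^ n • q (l θ ⊗ₜ l' ε) e = c ^ n • q (l θ ⊗ₜ l' θ') X
      have h1 := hfr.flip.alt_apply (q (l θ ⊗ₜ l' θ')) X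
      have h2 := hfr.alt_apply l' θ'
      have h3 := hfr.alt_apply (wedgeSec p n X) θ'
      have h4 : c ^ n • q (l θ ⊗ₜ l' θ') e = (c ^ n * wedgeSec p n e θ') • q (l θ ⊗ₜ l' ε) e := by
        have : c ^ n • (l θ ⊗ₜ[R] l' θ') = (c ^ n * wedgeSec p n e θ') • (l θ ⊗ₜ[R] l' ε) := by
          rw [← TensorProduct.tmul_smul, h2, smul_smul, TensorProduct.tmul_smul]
        have := congrArg (fun t => q t e) this
        simpa only [map_smul, AlternatingMap.smul_apply] using this
      rw [h1, smul_comm (c ^ n), h4, smul_smul, smul_smul, ← wedgeSec_flip]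
      congr 1
      simp only [smul_eq_mul] at h3
      linear_combination h3
  exact ⟨μ, fun θ θ' X => (congrFun hμ (θ, θ', X)).symm⟩

variable [p.IsPerfPair] (H : Regular p n m 𝒳 L) (𝔞 : LieAlgebroid R E)
  (q : L ⊗[R] L ≃ₗ[R] E [⋀^Fin n]→ₗ[R] TopForm R m)

/-- Up to the pairing of ∧ⁿA with ∧ⁿA*, the product q' is q. The Leibniz rule for q' then follows
from the one for q, as that pairing is invariant under Lie derivatives. -/
theorem Regular.coHalfConn_isCoHalfAction : IsCoHalfAction p 𝔞 q (H.coHalfConn 𝔞 q) := by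
  choose μ hμ using fun l l' => H.exists_coSquare q l l'
  have hext {ν ν' : E' [⋀^Fin n]→ₗ[R] TopForm R m}
      (h : ∀ θ θ' X, wedgeSec p n X θ' • ν θ = wedgeSec p n X θ' • ν' θ) : ν = ν' := by
    refine AlternatingMap.ext fun θ => sub_eq_zero.1 ?_
    refine H.frames.eq_zero_of_wedgeSec_smul H.sepTop fun X θ' => ?_
    rw [smul_sub, h, sub_self]
  let q' : (E' [⋀^Fin n]→ₗ[R] L) ⊗[R] (E' [⋀^Fin n]→ₗ[R] L) →ₗ[R]
      E' [⋀^Fin n]→ₗ[R] TopForm R m := TensorProduct.lift (LinearMap.mk₂ R μ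
    (fun l₁ l₂ l' => hext fun θ θ' X => by
      rw [AlternatingMap.add_apply, smul_add, ← hμ, ← hμ, ← hμ, AlternatingMap.add_apply,
        TensorProduct.add_tmul, map_add]; rfl)
    (fun f l l' => hext fun θ θ' X => by
      rw [AlternatingMap.smul_apply, smul_comm, ← hμ, ← hμ, AlternatingMap.smul_apply,
        ← TensorProduct.smul_tmul', map_smul]; rfl)
    (fun l l₁ l₂ => hext fun θ θ' X => by
      rw [AlternatingMap.add_apply, smul_add, ← hμ, ← hμ, ← hμ, AlternatingMap.add_apply,
        TensorProduct.tmul_add, map_add]; rfl)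
    (fun f l l' => hext fun θ θ' X => by
      rw [AlternatingMap.smul_apply, smul_comm, ← hμ, ← hμ, AlternatingMap.smul_apply,
        TensorProduct.tmul_smul, map_smul]; rfl))
  have hq' (l l' : E' [⋀^Fin n]→ₗ[R] L) : q' (l ⊗ₜ l') = μ l l' := by
    simp [q']
  refine ⟨q', fun l l' θ θ' X => ?_, fun X l l' => hext fun θ θ' Y => ?_⟩
  · rw [hq', hμ, wedgeSec_apply]
  · rw [map_add, hq', hq', hq', AlternatingMap.add_apply, smul_add, ← hμ, ← hμ]
    -- Invariance of the determinant pairing of Y with θ'.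
    have key : 𝔞.anchor X (wedgeSec p n Y θ') =
        ∑ j, wedgeSec p n (Function.update Y j (𝔞.bracket X (Y j))) θ' +
          ∑ j, wedgeSec p n Y (Function.update θ' j (𝔞.coad p X (θ' j))) := by
      have := DFunLike.congr_fun (𝔞.alt_wedgeSec p X Y) θ'
      rw [DerEnd.alt_apply, sub_eq_iff_eq_add, sum_alt_apply] at this
      exact this
    have h1 : topAct p.flip 𝔞 n m X (μ l l') θ = lieForm m (𝔞.anchor X) (μ l l' θ) -
        ∑ j, μ l l' (Function.update θ j (𝔞.coad p X (θ j))) := rfl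
    have h2 := DFunLike.congr_fun (H.halfLie_spec 𝔞 q X (l θ) (l' θ')) Y
    rw [DerEnd.alt_apply, map_add, AlternatingMap.add_apply, hμ] at h2
    simp only [hμ, LieAlgebroid.ad_apply] at h2
    have h3 : q ((H.coHalfConn 𝔞 q).act X l θ ⊗ₜ l' θ') Y =
        q (H.halfLie 𝔞 q X (l θ) ⊗ₜ l' θ') Y -
          ∑ j, wedgeSec p n Y θ' • μ l l' (Function.update θ j (𝔞.coad p X (θ j))) := by
      simp only [← hμ]
      rw [H.coHalfConn_apply, DerEnd.alt_apply, TensorProduct.sub_tmul, TensorProduct.sum_tmul,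
        ← alt_map_sub, map_sum, AlternatingMap.sub_apply, sum_alt_apply]
    have h4 : q (l θ ⊗ₜ (H.coHalfConn 𝔞 q).act X l' θ') Y =
        q (l θ ⊗ₜ H.halfLie 𝔞 q X (l' θ')) Y -
          ∑ j, wedgeSec p n Y (Function.update θ' j (𝔞.coad p X (θ' j))) • μ l l' θ := by
      simp only [← hμ]
      rw [H.coHalfConn_apply, DerEnd.alt_apply, TensorProduct.tmul_sub, TensorProduct.tmul_sum,
        ← alt_map_sub, map_sum, AlternatingMap.sub_apply, sum_alt_apply]
    rw [h1, h3, h4, sub_add_sub_comm, h2, (lieForm m (𝔞.anchor X)).leibniz, key, smul_sub,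
      Finset.smul_sum, ← Finset.sum_smul, ← Finset.sum_smul, add_smul]
    abel

variable {𝔞 q}

include H in
-- The values of q' times determinants are prescribed, and locally some determinant is invertible;
-- so q' is determined. The rest is the uniqueness argument for square roots, with e₁ ∧ ⋯ ∧ eₙ ⊗ l₀
-- as local frame.
theorem Regular.coHalfConn_unique {nabla nabla' : 𝔞.Conn (E' [⋀^Fin n]→ₗ[R] L)}
    (h : IsCoHalfAction p 𝔞 q nabla) (h' : IsCoHalfAction p 𝔞 q nabla') : nabla = nabla' := by
  obtain ⟨q₁, h₁, h₁'⟩ := h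
  obtain ⟨q₂, h₂, h₂'⟩ := h'
  have hq : q₁ = q₂ := by
    refine TensorProduct.ext' fun l l' => AlternatingMap.ext fun θ => sub_eq_zero.1 ?_
    refine H.frames.eq_zero_of_wedgeSec_smul H.sepTop fun X θ' => ?_
    rw [smul_sub, wedgeSec_apply, ← h₁, ← h₂, sub_self]
  subst hq
  have key (X : E) (l : E' [⋀^Fin n]→ₗ[R] L) : nabla.act X l = nabla'.act X l := by
    let t : (E' [⋀^Fin n]→ₗ[R] L) → (E' [⋀^Fin n]→ₗ[R] L) := fun l => nabla.act X l - nabla'.act X l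
    have ht (l l' : E' [⋀^Fin n]→ₗ[R] L) (θ θ' : Fin n → E') :
        t l θ ⊗ₜ[R] l' θ' + l θ ⊗ₜ t l' θ' = 0 := by
      have h1 : q₁ (t l ⊗ₜ l' + l ⊗ₜ t l') = 0 := by
        have := (h₁' X l l').trans (h₂' X l l').symm
        rw [← sub_eq_zero, alt_linearMap_sub] at this
        rw [← this]
        congr 1
        simp only [t, TensorProduct.sub_tmul, TensorProduct.tmul_sub]
        abel
      refine q.injective (AlternatingMap.ext fun Y => ?_)
      rw [map_add, AlternatingMap.add_apply, h₁, h₁, ← smul_add, ← AlternatingMap.add_apply,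
        ← map_add, h1, map_zero]
      exact smul_zero _
    have ht0 : t l = 0 := by
      refine H.sep.alt n _ fun i => ?_
      obtain ⟨c, hc, e, ε, hfr⟩ := H.frames i
      obtain ⟨c', hc', l₀, ev, h3, h4⟩ := H.line i
      -- The local frame e₁ ∧ ⋯ ∧ eₙ ⊗ l₀ of ∧ⁿA ⊗ 𝓛.
      let l₁ : E' [⋀^Fin n]→ₗ[R] L :=
        (LinearMap.toSpanSingleton R L l₀).compAlternatingMap (wedgeSec p n e)
      have hl₁ : c ^ n • l₁ ε = c ^ n • l₀ := by
        change c ^ n • wedgeSec p n e ε • l₀ = _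
        rw [smul_smul, hfr.wedgeSec_eq]
      have h5 (l l' : E' [⋀^Fin n]→ₗ[R] L) :
          ev (t l ε) * ev (l' ε) + ev (l ε) * ev (t l' ε) = 0 := by
        have := congrArg (evTwo ev) (ht l l' ε ε)
        rwa [map_add, evTwo_tmul, evTwo_tmul, map_zero] at this
      have h6 : c ^ n * ev (l₁ ε) = c ^ n * ev l₀ := by
        have := congrArg ev hl₁
        simpa using this
      have h7 : c ^ n * c' * ev (l₁ ε) = c ^ n * c' := by
        linear_combination c' * h6 + c ^ n * h4
      have h8 : c ^ n * c' * ev (t l₁ ε) = 0 := by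
        refine LieAlgebroid.eq_of_two_smul_eq R ?_
        rw [zsmul_eq_mul, smul_zero]
        push_cast
        linear_combination (c ^ n * c') * h5 l₁ l₁ - 2 * ev (t l₁ ε) * h7
      have h9 : c ^ n * c' * ev (t l ε) = 0 := by
        linear_combination (c ^ n * c') * h5 l l₁ - ev (t l ε) * h7 - ev (l ε) * h8
      refine ⟨c ^ n * c', mul_mem (pow_mem hc n) hc', AlternatingMap.ext fun θ => ?_⟩
      rw [AlternatingMap.smul_apply, mul_comm, mul_smul, hfr.alt_apply, ← mul_smul, smul_comm,
        mul_comm, mul_smul, h3, smul_smul, smul_smul, smul_smul, mul_assoc, mul_assoc,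
        ← mul_assoc (c ^ n), h9, mul_zero, zero_smul]
      rfl
    exact sub_eq_zero.1 ht0
  obtain ⟨a, ha⟩ := nabla
  obtain ⟨a', ha'⟩ := nabla'
  congr 1
  exact LinearMap.ext fun X => AddMonoidHom.ext fun l => key X l

end CoHalf

/-! ### The operator ∂̄ and its commutators -/

section DelOp
variable {R : Type*} [CommRing R] [Algebra ℝ R] {E E' : Type*} [AddCommGroup E] [Module R E]
  [AddCommGroup E'] [Module R E'] {p : E →ₗ[R] E' →ₗ[R] R}
  {I : Type*} {n m : ℕ} {𝒳 : I → Submonoid R} {L : Type*} [AddCommGroup L] [Module R L]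
  [p.IsPerfPair] (H : Regular p n m 𝒳 L) (𝔞 : LieAlgebroid R E)
  (q : L ⊗[R] L ≃ₗ[R] E [⋀^Fin n]→ₗ[R] TopForm R m)

include H in
-- The choices in the definition of `bdel` are harmless: the action exists and is unique, and the
-- star is surjective, so the inverse function is a true preimage.
theorem Regular.starMap_bdel {k j : ℕ} (h' : k + 1 + j = n) (h : k + (j + 1) = n)
    (w : Forms R E' L) : starMap p h' (bdel p 𝔞 q w j) =
      (-1 : ℤ) ^ k • LieAlgebroid.diff (H.coHalfConn 𝔞 q) (starMap p h (w (j + 1))) := by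
  obtain rfl : k = n - (j + 1) := by omega
  have hex : ∃ nabla : 𝔞.Conn (E' [⋀^Fin n]→ₗ[R] L), IsCoHalfAction p 𝔞 q nabla :=
    ⟨_, H.coHalfConn_isCoHalfAction 𝔞 q⟩
  rw [bdel, dif_pos ⟨hex, by omega⟩, starMap_zsmul,
    H.coHalfConn_unique (Exists.choose_spec _) (H.coHalfConn_isCoHalfAction 𝔞 q)]
  congr 1
  exact Function.invFun_eq (starLin_surjective H.absorbing H.frames H.sep H.glue h' _)

theorem bdel_of_le {j : ℕ} (h : n ≤ j) (w : Forms R E' L) : bdel p 𝔞 q w j = 0 := by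
  rw [bdel, dif_neg fun h' => by omega]

/-- The operator `∂̄`. -/
def Regular.delOp : Op R E' L := AddMonoidHom.toIntLinearMap (AddMonoidHom.mk' (bdel p 𝔞 q)
  fun w w' => by
    ext j : 1
    rcases lt_or_ge j n with hj | hj
    · obtain ⟨k, h'⟩ : ∃ k, k + 1 + j = n := ⟨n - (j + 1), by omega⟩
      have h : k + (j + 1) = n := by omega
      refine starLin_injective H.frames H.sep h' ?_
      rw [Pi.add_apply, map_add]
      change starMap p h' _ = starMap p h' _ + starMap p h' _
      rw [H.starMap_bdel 𝔞 q h' h, H.starMap_bdel 𝔞 q h' h, H.starMap_bdel 𝔞 q h' h]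
      have h1 : starMap p h ((w + w') (j + 1)) =
        starMap p h (w (j + 1)) + starMap p h (w' (j + 1)) := map_add (starLin p h) _ _
      rw [h1, LieAlgebroid.diff_add]
      ext1 v
      exact smul_add ((-1 : ℤ) ^ k) _ _
    · rw [Pi.add_apply, bdel_of_le 𝔞 q hj, bdel_of_le 𝔞 q hj, bdel_of_le 𝔞 q hj, add_zero])

theorem Regular.delOp_apply (w : Forms R E' L) : H.delOp 𝔞 q w = bdel p 𝔞 q w := rfl

theorem Regular.delOp_of_le {j : ℕ} (h : n ≤ j) (w : Forms R E' L) : H.delOp 𝔞 q w j = 0 :=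
  bdel_of_le 𝔞 q h w

theorem Regular.starMap_delOp {k j : ℕ} (h' : k + 1 + j = n) (h : k + (j + 1) = n)
    (w : Forms R E' L) : starMap p h' (H.delOp 𝔞 q w j) =
      (-1 : ℤ) ^ k • LieAlgebroid.diff (H.coHalfConn 𝔞 q) (starMap p h (w (j + 1))) :=
  H.starMap_bdel 𝔞 q h' h w

/-- The Lie derivative is a derivation of the product Y₁ ∧ ⋯ ∧ Y_k ∧ w, and its action on the
factors Y is what the Lie derivative of forms on A subtracts. -/
theorem Regular.starMap_lieSec {k j : ℕ} (h : k + j = n) (X : E) (w : Forms R E' L) :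
    starMap p h (H.lieSec 𝔞 q X w j) =
      (𝔞.ad X).alt k ((H.coHalfConn 𝔞 q).at X) (starMap p h (w j)) := by
  ext1 Y
  have h1 : (𝔞.ad X).alt k ((H.coHalfConn 𝔞 q).at X) (starMap p h (w j)) Y =
      (𝔞.coad p X).alt n (H.halfLie 𝔞 q X) (starMap p h (w j) Y) -
        ∑ i, starMap p h (w j) (Function.update Y i (𝔞.bracket X (Y i))) := rfl
  have h2 : (𝔞.coad p X).alt n (H.halfLie 𝔞 q X) (starMap p h (w j) Y) =
      H.lieSec 𝔞 q X (wedgeAct (homog k (wedgeSec p k Y)) (homog j (w j))) n := by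
    rw [lieOp_apply, starMap_apply]
  rw [h1, h2, lieOp_wedgeAct, lieOp_homog, lieOp_homog, 𝔞.alt_wedgeSec p]
  have h3 : homog k (∑ i, wedgeSec p k (Function.update Y i (𝔞.bracket X (Y i)))) =
      ∑ i, homog k (wedgeSec p k (Function.update Y i (𝔞.bracket X (Y i)))) :=
    map_sum (⟨⟨homog k, homog_zero k⟩, homog_add k⟩ : _ →+ Forms R E' R) _ _
  rw [h3, map_sum, LinearMap.sum_apply, Pi.add_apply, Finset.sum_apply]
  simp only [starMap_apply]
  rw [add_sub_cancel_left]
  rfl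

/-- The anticommutator of `∂̄` and the exterior product with `X` is the Lie derivative. -/
theorem Regular.delOp_mul_outer (X : E) :
    H.delOp 𝔞 q * outer (p X) = H.lieSec 𝔞 q X - outer (p X) * H.delOp 𝔞 q := by
  rw [eq_sub_iff_add_eq]
  refine LinearMap.ext fun w => funext fun j => ?_
  change H.delOp 𝔞 q (outer (p X) w) j + outer (p X) (H.delOp 𝔞 q w) j = H.lieSec 𝔞 q X w j
  rcases lt_or_ge n j with hj | hj
  · rw [H.frames.alt_eq_zero H.sep hj (H.lieSec 𝔞 q X w j),
      H.frames.alt_eq_zero H.sep hj (H.delOp 𝔞 q (outer (p X) w) j),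
      H.frames.alt_eq_zero H.sep hj (outer (p X) (H.delOp 𝔞 q w) j), add_zero]
  obtain ⟨k, h⟩ : ∃ k, k + j = n := ⟨n - j, by omega⟩
  refine starLin_injective H.frames H.sep h ?_
  rw [map_add]
  change starMap p h _ + starMap p h _ = starMap p h _
  rw [H.starMap_lieSec]
  have sq (k : ℕ) : (-1 : ℤ) ^ k * (-1) ^ k = 1 := by
    rw [← pow_add, Even.neg_one_pow ⟨k, rfl⟩]
  have hhom (v : Forms R E' L) (j : ℕ) :
      outer (p X) (homog j (v j)) (j + 1) = outer (p X) v (j + 1) := by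
    refine AlternatingMap.ext fun θ => ?_
    rw [outer_succ_apply, outer_succ_apply, homog_same]
  -- The star turns e_X into ι_X and ∂̄ into the differential, with a sign (−1)^k in both places,
  -- and the signs cancel; this is the purpose of the sign in the definition of ∂̄. The claim
  -- becomes Cartan's formula for A. The extreme degrees, where one of the terms vanishes, are
  -- treated apart.
  have hA : starMap p h (H.delOp 𝔞 q (outer (p X) w) j) =
      LieAlgebroid.dOp (H.coHalfConn 𝔞 q) (inner X (homog k (starMap p h (w j)))) k := by
    cases k with
    | zero =>
      rw [H.delOp_of_le 𝔞 q (by omega)]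
      exact map_zero (starLin p h)
    | succ k =>
      have h' : k + (j + 1) = n := by omega
      rw [H.starMap_delOp 𝔞 q h h', inner_homog_succ, starMap_curryLeft h h',
        LieAlgebroid.dOp_succ_apply, homog_same, hhom]
      exact (map_zsmul (LieAlgebroid.diffHom (H.coHalfConn 𝔞 q)) _ _).symm
  have hB : starMap p h (outer (p X) (H.delOp 𝔞 q w) j) =
      inner X (LieAlgebroid.dOp (H.coHalfConn 𝔞 q) (homog k (starMap p h (w j)))) k := by
    rw [inner_apply, LieAlgebroid.dOp_succ_apply, homog_same]
    cases j with
    | zero =>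
      rw [outer_zero_apply, H.frames.flip.alt_eq_zero (H.sep.alt n) (by omega)
        (LieAlgebroid.diff (H.coHalfConn 𝔞 q) (starMap p h (w 0)))]
      exact map_zero (starLin p h)
    | succ j =>
      have h' : k + 1 + j = n := by omega
      rw [← hhom]
      have h1 := starMap_curryLeft (p := p) h' h (H.delOp 𝔞 q w j) X
      rw [H.starMap_delOp 𝔞 q h' h] at h1
      have h2 := congrArg ((-1 : ℤ) ^ k • ·) h1
      simp only [smul_smul, sq, one_smul] at h2
      rw [← h2]
      ext1 v
      change (-1 : ℤ) ^ k • (-1 : ℤ) ^ k • LieAlgebroid.diff (H.coHalfConn 𝔞 q)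
        (starMap p h (w (j + 1))) _ = _
      rw [smul_smul, sq, one_smul]
      rfl
  rw [hA, hB]
  have := congrFun (LinearMap.congr_fun (LieAlgebroid.inner_mul_dOp (H.coHalfConn 𝔞 q) X)
    (homog k (starMap p h (w j)))) k
  change inner X (LieAlgebroid.dOp (H.coHalfConn 𝔞 q) (homog k (starMap p h (w j)))) k =
    LieAlgebroid.lieConn (H.coHalfConn 𝔞 q) X (homog k (starMap p h (w j))) k -
      LieAlgebroid.dOp (H.coHalfConn 𝔞 q) (inner X (homog k (starMap p h (w j)))) k at this
  rw [this, add_sub_cancel, lieOp_apply, homog_same]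

theorem Regular.outer_mul_delOp (X : E) :
    outer (p X) * H.delOp 𝔞 q = H.lieSec 𝔞 q X - H.delOp 𝔞 q * outer (p X) := by
  rw [H.delOp_mul_outer, sub_sub_cancel]

theorem outer_mul_mulOp {P W : Type*} [AddCommGroup P] [Module R P] [AddCommGroup W] [Module R W]
    (α : P →ₗ[R] R) (f : R) : (outer α * mulOp f : Op R P W) = mulOp f * outer α :=
  LinearMap.ext fun w => outer_smul α f w

theorem inner_mul_mulOp {P W : Type*} [AddCommGroup P] [Module R P] [AddCommGroup W] [Module R W]
    (θ : P) (f : R) : (inner θ * mulOp f : Op R P W) = mulOp f * inner θ :=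
  LinearMap.ext fun w => inner_smul θ f w

/-- For ∂̄ exterior products play the role that contractions have for d: an operator without
components in degrees ≥ n is determined by its commutators with the e_X, by descending induction on
the degree. -/
theorem Regular.delOp_mul_mulOp (f : R) :
    H.delOp 𝔞 q * mulOp f = mulOp f * H.delOp 𝔞 q + inner (𝔞.grad p f) := by
  rw [← sub_eq_zero]
  refine H.frames.op_eq_zero_of_outer H.sep (fun w j hj => ?_) (-1) fun X => ?_
  · change H.delOp 𝔞 q (f • w) j - (f • H.delOp 𝔞 q w j + inner (𝔞.grad p f) w j) = 0
    rw [H.delOp_of_le 𝔞 q hj, H.delOp_of_le 𝔞 q hj, inner_apply,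
      H.frames.alt_eq_zero H.sep (by omega : n < j + 1) (w (j + 1))]
    simp
  · simp only [mul_sub, sub_mul, mul_add, add_mul, neg_smul, one_smul]
    rw [← mul_assoc, H.outer_mul_delOp, ← mul_assoc, outer_mul_mulOp, mul_assoc (mulOp f),
      H.outer_mul_delOp, mul_assoc (H.delOp 𝔞 q), ← outer_mul_mulOp, outer_mul_inner,
      𝔞.pairing_grad p, sub_mul, lieOp_mul_mulOp]
    simp only [mul_sub, mul_assoc]
    abel

theorem Regular.lieSec_comm_delOp (X : E) :
    H.lieSec 𝔞 q X * H.delOp 𝔞 q = H.delOp 𝔞 q * H.lieSec 𝔞 q X := by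
  rw [← sub_eq_zero]
  refine H.frames.op_eq_zero_of_outer H.sep (fun w j hj => ?_) (-1) fun Y => ?_
  · change H.lieSec 𝔞 q X (H.delOp 𝔞 q w) j - H.delOp 𝔞 q (H.lieSec 𝔞 q X w) j = 0
    rw [H.delOp_of_le 𝔞 q hj, lieOp_apply, H.delOp_of_le 𝔞 q hj, sub_zero]
    exact map_zero (DerEnd.alt j _ _).toAddMonoidHom
  · have h1 := H.lieSec_mul_outer 𝔞 q X Y
    have h2 := H.delOp_mul_outer 𝔞 q Y
    have h3 := H.delOp_mul_outer 𝔞 q (𝔞.bracket X Y)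
    have h4 := H.lieSec_bracket 𝔞 q X Y
    have h5 : outer (p Y) * (H.lieSec 𝔞 q X * H.delOp 𝔞 q) =
        H.lieSec 𝔞 q X * (H.lieSec 𝔞 q Y - H.delOp 𝔞 q * outer (p Y)) -
          outer (p (𝔞.bracket X Y)) * H.delOp 𝔞 q := by
      rw [h2, sub_sub_cancel, ← mul_assoc, ← mul_assoc, h1, add_mul, add_sub_cancel_right]
    have h6 : outer (p Y) * (H.delOp 𝔞 q * H.lieSec 𝔞 q X) =
        H.lieSec 𝔞 q Y * H.lieSec 𝔞 q X -
          H.delOp 𝔞 q * (H.lieSec 𝔞 q X * outer (p Y) - outer (p (𝔞.bracket X Y))) := by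
      rw [h1, add_sub_cancel_right, ← mul_assoc, ← mul_assoc, h2]
      noncomm_ring
    rw [mul_sub, h5, h6, mul_sub (H.delOp 𝔞 q), h3, h4]
    simp only [mul_sub, sub_mul, mul_assoc, neg_smul, one_smul]
    abel

/-- The mirror image of the proof for d: ∂̄² commutes with exterior products because ∂̄ commutes
with L_X = {∂̄, e_X}. -/
theorem Regular.delOp_delOp : H.delOp 𝔞 q * H.delOp 𝔞 q = 0 := by
  refine H.frames.op_eq_zero_of_outer H.sep (fun w j hj => H.delOp_of_le 𝔞 q hj _) 1 fun X => ?_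
  rw [← mul_assoc, H.outer_mul_delOp, sub_mul, mul_assoc, H.outer_mul_delOp, mul_sub,
    H.lieSec_comm_delOp, one_smul, mul_assoc]
  abel

end DelOp

/-! ### Infinitesimal automorphisms -/

section InfAut
variable {R : Type*} [CommRing R] [Algebra ℝ R] {E E' : Type*} [AddCommGroup E] [Module R E]
  [AddCommGroup E'] [Module R E'] {p : E →ₗ[R] E' →ₗ[R] R}
  {I : Type*} {n m : ℕ} {𝒳 : I → Submonoid R} {L : Type*} [AddCommGroup L] [Module R L]
  {N : Type*} [AddCommGroup N] [Module R N]

/-- The sum of endomorphisms over derivations. -/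
def DerEnd.add {D D' : Derivation ℝ R R} (δ : DerEnd D N) (δ' : DerEnd D' N) :
    DerEnd (D + D') N where
  toAddMonoidHom := δ.toAddMonoidHom + δ'.toAddMonoidHom
  leibniz' f x := by
    change δ (f • x) + δ' (f • x) = (D f + D' f) • x + f • (δ x + δ' x)
    rw [δ.leibniz, δ'.leibniz, add_smul, smul_add]
    abel

/-- The negative of an endomorphism over a derivation. -/
def DerEnd.neg {D : Derivation ℝ R R} (δ : DerEnd D N) : DerEnd (-D) N where
  toAddMonoidHom := -δ.toAddMonoidHom
  leibniz' f x := by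
    change -δ (f • x) = (-D f) • x + f • (-δ x)
    rw [δ.leibniz, neg_smul, smul_neg]
    abel

/-- The commutator of endomorphisms over derivations. -/
def DerEnd.comm {D D' : Derivation ℝ R R} (δ : DerEnd D N) (δ' : DerEnd D' N) :
    DerEnd ⁅D, D'⁆ N where
  toAddMonoidHom := δ.toAddMonoidHom.comp δ'.toAddMonoidHom -
    δ'.toAddMonoidHom.comp δ.toAddMonoidHom
  leibniz' f x := by
    change δ (δ' (f • x)) - δ' (δ (f • x)) = ⁅D, D'⁆ f • x + f • (δ (δ' x) - δ' (δ x))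
    rw [δ.leibniz, δ'.leibniz, map_add, map_add, δ.leibniz, δ'.leibniz, δ.leibniz, δ'.leibniz,
      Derivation.commutator_apply, sub_smul, smul_sub]
    abel

variable (p) in
/-- An infinitesimal automorphism of a vector bundle and a square root of
`∧ⁿA* ⊗ ∧ᵐT*M`. -/
structure InfAut (q : L ⊗[R] L ≃ₗ[R] E [⋀^Fin n]→ₗ[R] TopForm R m) where
  D : Derivation ℝ R R
  onE : DerEnd D E
  onE' : DerEnd D E'
  onL : DerEnd D L
  pairing : ∀ X θ, D (p X θ) = p (onE X) θ + p X (onE' θ)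
  half : ∀ l l', q (onL l ⊗ₜ l' + l ⊗ₜ onL l') = onE.alt n (lieForm m D) (q (l ⊗ₜ l'))

namespace InfAut
variable {q : L ⊗[R] L ≃ₗ[R] E [⋀^Fin n]→ₗ[R] TopForm R m}

/-- The Lie derivative of `𝓛`-valued multisections. -/
def op (a : InfAut p q) : Op R E' L := lieOp a.onE' a.onL

theorem op_mul_outer (a : InfAut p q) (X : E) :
    a.op * outer (p X) = outer (p X) * a.op + outer (p (a.onE X)) := by
  have h : a.onE'.covec (p X) = p (a.onE X) := by
    ext θ
    rw [DerEnd.covec_apply, a.pairing, add_sub_cancel_right]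
  rw [op, lieOp_mul_outer, h]

theorem op_mul_mulOp (a : InfAut p q) (f : R) :
    a.op * mulOp f = mulOp f * a.op + mulOp (a.D f) := lieOp_mul_mulOp a.onE' a.onL f

/-- The sum of infinitesimal automorphisms. -/
def add (a b : InfAut p q) : InfAut p q where
  D := a.D + b.D
  onE := a.onE.add b.onE
  onE' := a.onE'.add b.onE'
  onL := a.onL.add b.onL
  pairing X θ := by
    change a.D (p X θ) + b.D (p X θ) = p (a.onE X + b.onE X) θ + p X (a.onE' θ + b.onE' θ)
    rw [a.pairing, b.pairing, map_add, map_add, LinearMap.add_apply]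
    abel
  half l l' := by
    have h : (a.onE.add b.onE).alt n (lieForm m (a.D + b.D)) (q (l ⊗ₜ l')) =
        a.onE.alt n (lieForm m a.D) (q (l ⊗ₜ l')) + b.onE.alt n (lieForm m b.D) (q (l ⊗ₜ l')) :=
      alt_add_left (fun _ => rfl) (fun μ => lieForm_add m a.D b.D μ) _
    change q ((a.onL l + b.onL l) ⊗ₜ l' + l ⊗ₜ (a.onL l' + b.onL l')) = _
    rw [h, ← a.half, ← b.half, ← map_add]
    congr 1
    simp only [TensorProduct.add_tmul, TensorProduct.tmul_add]
    abel

theorem add_op (a b : InfAut p q) : (a.add b).op = a.op + b.op :=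
  lieOp_add_left (fun _ => rfl) (fun _ => rfl)

/-- The commutator of infinitesimal automorphisms. -/
def comm (a b : InfAut p q) : InfAut p q where
  D := ⁅a.D, b.D⁆
  onE := a.onE.comm b.onE
  onE' := a.onE'.comm b.onE'
  onL := a.onL.comm b.onL
  pairing X θ := by
    change ⁅a.D, b.D⁆ (p X θ) = p (a.onE (b.onE X) - b.onE (a.onE X)) θ +
      p X (a.onE' (b.onE' θ) - b.onE' (a.onE' θ))
    rw [Derivation.commutator_apply, a.pairing, b.pairing, map_add, map_add, a.pairing, b.pairing,
      a.pairing, b.pairing, map_sub, map_sub, LinearMap.sub_apply]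
    abel
  half l l' := by
    have h : (a.onE.comm b.onE).alt n (lieForm m ⁅a.D, b.D⁆) (q (l ⊗ₜ l')) =
        a.onE.alt n (lieForm m a.D) (b.onE.alt n (lieForm m b.D) (q (l ⊗ₜ l'))) -
        b.onE.alt n (lieForm m b.D) (a.onE.alt n (lieForm m a.D) (q (l ⊗ₜ l'))) :=
      alt_bracket (fun _ => rfl) (fun μ => lieForm_bracket m a.D b.D μ) _
    have h2 (a b : InfAut p q) : a.onE.alt n (lieForm m a.D)
          (b.onE.alt n (lieForm m b.D) (q (l ⊗ₜ l'))) =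
        q (a.onL (b.onL l) ⊗ₜ l' + b.onL l ⊗ₜ a.onL l' +
          (a.onL l ⊗ₜ b.onL l' + l ⊗ₜ a.onL (b.onL l'))) := by
      rw [← b.half, map_add, map_add, ← a.half, ← a.half, ← map_add]
    change q ((a.onL (b.onL l) - b.onL (a.onL l)) ⊗ₜ l' +
      l ⊗ₜ (a.onL (b.onL l') - b.onL (a.onL l'))) = _
    rw [h, h2, h2, alt_map_sub q]
    congr 1
    simp only [TensorProduct.sub_tmul, TensorProduct.tmul_sub]
    abel

theorem comm_op (a b : InfAut p q) : (a.comm b).op = a.op * b.op - b.op * a.op :=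
  lieOp_bracket (fun _ => rfl) (fun _ => rfl)

theorem lieForm_neg (D : Derivation ℝ R R) (μ : TopForm R m) :
    lieForm m (-D) μ = -lieForm m D μ := by
  have h := lieForm_add m (-D) D μ
  have h0 : lieForm m (0 : Derivation ℝ R R) μ = 0 := by
    have := lieForm_add m (0 : Derivation ℝ R R) 0 μ
    rw [add_zero] at this
    exact left_eq_add.1 this
  rw [neg_add_cancel, h0] at h
  exact eq_neg_of_add_eq_zero_left h.symm

/-- The negative of an infinitesimal automorphism. -/
def neg (a : InfAut p q) : InfAut p q where
  D := -a.D
  onE := a.onE.neg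
  onE' := a.onE'.neg
  onL := a.onL.neg
  pairing X θ := by
    change -a.D (p X θ) = p (-a.onE X) θ + p X (-a.onE' θ)
    rw [a.pairing, map_neg, map_neg, LinearMap.neg_apply]
    abel
  half l l' := by
    change q ((-a.onL l) ⊗ₜ l' + l ⊗ₜ (-a.onL l')) = _
    rw [TensorProduct.neg_tmul, TensorProduct.tmul_neg, ← neg_add, ← neg_one_smul R, map_smul,
      a.half]
    ext1 Y
    rw [AlternatingMap.smul_apply, DerEnd.alt_apply, DerEnd.alt_apply, lieForm_neg, neg_one_smul,
      neg_sub]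
    have h (j : Fin n) : (q (l ⊗ₜ[R] l')) (Function.update Y j (a.onE.neg (Y j))) =
        -(q (l ⊗ₜ[R] l')) (Function.update Y j (a.onE (Y j))) :=
      AlternatingMap.map_update_neg _ _ _ _
    simp only [h, Finset.sum_neg_distrib]
    abel

theorem neg_op (a : InfAut p q) : a.neg.op = -a.op := by
  have h : a.neg.op + a.op = 0 := by
    refine LinearMap.ext fun w => funext fun k => AlternatingMap.ext fun v => ?_
    change (-a.onL (w k v) - ∑ j, w k (Function.update v j (-a.onE' (v j)))) +
      (a.onL (w k v) - ∑ j, w k (Function.update v j (a.onE' (v j)))) = 0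
    simp only [AlternatingMap.map_update_neg, Finset.sum_neg_distrib]
    abel
  exact eq_neg_of_add_eq_zero_left h

/-- The action on `𝓛` of an infinitesimal automorphism over the identity is minus one half of its
trace. -/
theorem trace (H : Regular p n m 𝒳 L) {a : InfAut p q} (hD : ∀ f, a.D f = 0) {c : R} {e : Fin n → E}
    {ε : Fin n → E'} (hf : IsFrame p c e ε) (l : L) :
    c • ((2 : ℤ) • a.onL l + (∑ i, p (a.onE (e i)) (ε i)) • l) = 0 := by
  set s := ∑ i, p (a.onE (e i)) (ε i) with hs
  have hlin (f : R) (X : E) : a.onE (f • X) = f • a.onE X := by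
    rw [a.onE.leibniz, hD, zero_smul, zero_add]
  let α (i : Fin n) : E →ₗ[R] R :=
    { toFun := fun X => p (a.onE X) (ε i)
      map_add' := fun X Y => by rw [map_add, map_add, LinearMap.add_apply]
      map_smul' := fun f X => by rw [hlin, map_smul]; rfl }
  have htr (ρ : E [⋀^Fin n]→ₗ[R] TopForm R m) (Y : Fin n → E) :
      c • ∑ j, ρ (Function.update Y j (a.onE (Y j))) = c • s • ρ Y := by
    rw [hs, Finset.sum_smul, Finset.smul_sum, Finset.smul_sum]
    -- The top degree identity for the covector X ↦ ⟨a X, ε_i⟩ and the section e_i. Summed over i,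
    -- the right side becomes the insertion of a into the slots of ρ and the left side the trace.
    have h1 (i : Fin n) : p (a.onE (e i)) (ε i) • ρ Y =
        ∑ j, p (a.onE (Y j)) (ε i) • ρ (Function.update Y j (e i)) :=
      H.frames.flip.top_identity H.sepTop ρ (α i) (e i) Y
    simp only [h1, Finset.smul_sum]
    rw [Finset.sum_comm]
    refine Finset.sum_congr rfl fun j _ => ?_
    rw [← AlternatingMap.map_update_smul, hf.left, AlternatingMap.map_update_smul,
      AlternatingMap.map_update_sum, Finset.smul_sum]
    simp only [AlternatingMap.map_update_smul]
  have h0 : ∀ μ : TopForm R m, lieForm m a.D μ = 0 := by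
    intro μ
    have := lieForm_add m (0 : Derivation ℝ R R) 0 μ
    rw [add_zero] at this
    rw [show a.D = 0 from Derivation.ext hD]
    exact left_eq_add.1 this
  -- The defect 2a + tr on 𝓛 acts as zero on squares, so it vanishes by uniqueness of half actions.
  have h2 : (fun l : L => c • ((2 : ℤ) • a.onL l + s • l)) = 0 := by
    refine funext fun l => H.half_unique q (δ := fun l => c • ((2 : ℤ) • a.onL l + s • l))
      (δ' := fun _ => 0) (fun l l' => ?_) l
    have h3 : (c • ((2 : ℤ) • a.onL l + s • l)) ⊗ₜ[R] l' + l ⊗ₜ (c • ((2 : ℤ) • a.onL l' + s • l'))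
        = (2 : ℤ) • c • ((a.onL l ⊗ₜ[R] l' + l ⊗ₜ a.onL l') + s • (l ⊗ₜ l')) := by
      simp only [TensorProduct.tmul_smul, ← TensorProduct.smul_tmul', TensorProduct.add_tmul,
        TensorProduct.tmul_add, smul_add, two_smul]
      abel
    rw [h3, TensorProduct.zero_tmul, TensorProduct.tmul_zero, add_zero, map_zero, map_zsmul,
      map_smul, map_add, a.half, map_smul]
    ext1 Y
    change (2 : ℤ) • c • ((lieForm m a.D (q (l ⊗ₜ l') Y) -
      ∑ j, q (l ⊗ₜ l') (Function.update Y j (a.onE (Y j)))) + s • q (l ⊗ₜ l') Y) = 0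
    rw [h0, smul_add, smul_sub, htr, smul_zero, zero_sub, neg_add_cancel, smul_zero]
  exact congrFun h2 l

/-- An infinitesimal automorphism that is trivial on functions and on `A` is trivial. -/
theorem op_eq_zero (H : Regular p n m 𝒳 L) {a : InfAut p q} (hD : ∀ f, a.D f = 0)
    (hE : ∀ X, a.onE X = 0) : a.op = 0 := by
  have hL (l : L) : a.onL l = 0 := by
    refine H.sep _ fun i => ?_
    obtain ⟨c, hc, e, ε, hf⟩ := H.frames i
    refine ⟨c, hc, LieAlgebroid.eq_of_two_smul_eq R ?_⟩
    have := trace H hD hf l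
    simpa [hE, smul_comm c] using this
  refine H.frames.op_eq_zero H.sep (fun f w => ?_) (fun u => ?_) 1 fun X => ?_
  · have := LinearMap.congr_fun (a.op_mul_mulOp f) w
    refine this.trans ?_
    change f • a.op w + a.D f • w = _
    rw [hD, zero_smul, add_zero]
  · rw [op, lieOp_homog]
    refine (congrArg _ (AlternatingMap.ext fun v => ?_)).trans (homog_zero 0)
    rw [DerEnd.alt_apply, hL, Finset.univ_eq_empty, Finset.sum_empty, sub_zero]
    rfl
  · rw [op_mul_outer, hE, map_zero, one_smul]
    have : (outer (0 : E' →ₗ[R] R) : Op R E' L) = 0 :=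
      LinearMap.ext fun w => by
        have := outer_smul_left (0 : R) (0 : E' →ₗ[R] R) w
        rwa [zero_smul, zero_smul] at this
    rw [this, add_zero]

end InfAut

section Basic
variable [p.IsPerfPair] (H : Regular p n m 𝒳 L) (𝔞 : LieAlgebroid R E) (𝔟 : LieAlgebroid R E')
  {q : L ⊗[R] L ≃ₗ[R] E [⋀^Fin n]→ₗ[R] TopForm R m}

variable (q) in
/-- The infinitesimal automorphism given by a section of `A`. -/
def Regular.secAut (X : E) : InfAut p q where
  D := 𝔞.anchor X
  onE := 𝔞.ad X
  onE' := 𝔞.coad p X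
  onL := H.halfLie 𝔞 q X
  pairing Y θ := by
    rw [LieAlgebroid.ad_apply, 𝔞.pairing_coad p, add_sub_cancel]
  half l l' := H.halfLie_spec 𝔞 q X l l'

theorem Regular.secAut_op (X : E) : (H.secAut 𝔞 q X).op = H.lieSec 𝔞 q X := rfl

variable {𝔟}

/-- The infinitesimal automorphism given by a section of the dual of `A`. -/
def dualAut {nabla : 𝔟.Conn L} (h : IsHalfAction p 𝔟 q nabla) (θ : E') : InfAut p q where
  D := 𝔟.anchor θ
  onE := 𝔟.coad p.flip θ
  onE' := 𝔟.ad θ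
  onL := nabla.at θ
  pairing Y η := by
    have := 𝔟.pairing_coad p.flip θ η Y
    change p _ η = 𝔟.anchor θ (p Y η) - p Y (𝔟.bracket θ η) at this
    rw [this, LieAlgebroid.ad_apply, sub_add_cancel]
  half l l' := h θ l l'

theorem dualAut_op {nabla : 𝔟.Conn L} (h : IsHalfAction p 𝔟 q nabla) (θ : E') :
    (dualAut h θ).op = LieAlgebroid.lieConn nabla θ := rfl

end Basic

end InfAut

/-! ### Jacobi identities in an associative ring, for the computation of Δ -/

section RingIdentities
variable {A : Type*} [Ring A]

/-- In these identities d and D are the two differentials, f a function, e and y exterior products,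
i an interior product; the hypotheses give names to the inner commutators. Each identity is an
instance of the graded Jacobi identity. -/
theorem anticomm_comm_fun {d D f e i : A} (h₁ : D * f = f * D + i) (h₂ : d * f = f * d + e) :
    (d * D + D * d) * f = f * (d * D + D * d) + ((D * e + e * D) + (d * i + i * d)) := by
  linear_combination (norm := noncomm_ring) d * h₁ + h₂ * D + D * h₂ + h₁ * d

theorem anticomm_comm_odd {d D e L U : A} (h₁ : D * e = L - e * D) (h₂ : d * e = U - e * d) :
    (d * D + D * d) * e - e * (d * D + D * d) = (d * L - L * d) + (D * U - U * D) := by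
  linear_combination (norm := noncomm_ring) d * h₁ - h₂ * D + D * h₂ - h₁ * d

theorem comm_anticomm_odd {d D L U y K V z Z S₁ S₂ : A} (hL : L * y = y * L + z)
    (hdy : d * y = V - y * d) (hdz : d * z = Z - z * d) (hLV : L * V = V * L + S₁)
    (hU : U * y = y * U) (hDy : D * y = K - y * D) (hKU : K * U = U * K + S₂) :
    ((d * L - L * d) + (D * U - U * D)) * y + y * ((d * L - L * d) + (D * U - U * D)) =
      Z - S₁ + S₂ := by
  linear_combination (norm := noncomm_ring) d * hL + hdy * L + hdz - L * hdy - hLV + hL * d +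
    D * hU + hDy * U - U * hDy + hU * D + hKU

theorem comm_anticomm_inner {d D L U i j T J Q W K : A} (hL : L * i = i * L + j)
    (hdi : d * i = T - i * d) (hdj : d * j = J - j * d) (hDi : D * i + i * D = Q)
    (hiU : i * U = W + U * i) (hDW : D * W = K - W * D) :
    ((d * L - L * d) + (D * U - U * D)) * i + i * ((d * L - L * d) + (D * U - U * D)) =
      (T * L - L * T + J - K) + (Q * U - U * Q) := by
  linear_combination (norm := noncomm_ring) d * hL + hdi * L + hdj - L * hdi + hL * d - D * hiU +
    hDi * U - hDW - U * hDi - hiU * D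

theorem anticomm_inner_comm_outer {D i y c K k t : A} (h₁ : i * y = c - y * i)
    (h₂ : D * y = K - y * D) (hDc : D * c = c * D + k) (hKi : K * i = i * K + t) :
    (D * i + i * D) * y = y * (D * i + i * D) + (k - t) := by
  linear_combination (norm := noncomm_ring) D * h₁ + hDc - h₂ * i - hKi + i * h₂ - h₁ * D

theorem anticomm_inner_comm_fun {D i f g : A} (h₁ : D * f = f * D + g) (h₂ : i * f = f * i)
    (h₃ : g * i = -(i * g)) : (D * i + i * D) * f = f * (D * i + i * D) := by
  linear_combination (norm := noncomm_ring) D * h₂ + h₁ * i + i * h₁ + h₂ * D + h₃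

theorem anticomm_comm_of_anticomm {G i y c : A} (h₁ : i * y = c - y * i) (h₂ : G * y = -(y * G))
    (h₃ : G * c = c * G) : (G * i + i * G) * y = y * (G * i + i * G) := by
  linear_combination (norm := noncomm_ring) G * h₁ - h₂ * i + h₃ + i * h₂ - h₁ * G

theorem comm_even_comm {Q U y t w : A} (h₁ : Q * y = y * Q + t) (h₂ : U * y = y * U)
    (h₃ : t * U = w + U * t) : (Q * U - U * Q) * y = y * (Q * U - U * Q) + w := by
  linear_combination (norm := noncomm_ring) Q * h₂ + h₁ * U - U * h₁ - h₂ * Q + h₃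

end RingIdentities

/-! ### Sections of the line bundle as forms of degree zero -/

section Basics
variable {R : Type*} [CommRing R] {P W : Type*} [AddCommGroup P] [Module R P]
  [AddCommGroup W] [Module R W]

variable (R P) in
/-- An element of `W` as a form of degree `0`. -/
def cst (l : W) : Forms R P W :=
  homog 0 (AlternatingMap.constOfIsEmpty R P (Fin 0) l)

theorem cst_zero_apply (l : W) (v : Fin 0 → P) : cst R P l 0 v = l := by
  rw [cst, homog_same]
  rfl

theorem cst_of_ne {k : ℕ} (hk : k ≠ 0) (l : W) : cst R P l k = 0 := homog_of_ne hk _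

theorem homog_zero_eq_cst (u : P [⋀^Fin 0]→ₗ[R] W) : homog 0 u = cst R P (u Fin.elim0) := by
  rw [cst]
  congr 1
  ext v
  rw [Subsingleton.elim v Fin.elim0]
  rfl

theorem cst_smul (f : R) (l : W) : cst R P (f • l) = f • cst R P l := by
  rw [cst, cst, ← homog_smul]
  rfl

theorem cst_add (l l' : W) : cst R P (l + l') = cst R P l + cst R P l' := by
  rw [cst, cst, cst, ← homog_add]
  rfl

theorem cst_injective : Function.Injective (cst R P : W → Forms R P W) := fun l l' h => by
  rw [← cst_zero_apply (R := R) (P := P) l Fin.elim0, h, cst_zero_apply]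

theorem eq_cst {w : Forms R P W} (h : ∀ k, w (k + 1) = 0) : w = cst R P (w 0 Fin.elim0) := by
  rw [← homog_zero_eq_cst]
  ext k : 1
  cases k with
  | zero => rw [homog_same]
  | succ k => rw [h, homog_of_ne k.succ_ne_zero]

theorem inner_cst (θ : P) (l : W) : inner θ (cst R P l) = 0 := inner_homog_zero θ _

theorem inner_outer_cst (θ : P) (α : P →ₗ[R] R) (l : W) :
    inner θ (outer α (cst R P l)) = α θ • cst R P l := by
  have := LinearMap.congr_fun (inner_outer (W := W) θ α) (cst R P l)
  refine this.trans ?_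
  change α θ • cst R P l - outer α (inner θ (cst R P l)) = _
  rw [inner_cst, map_zero, sub_zero]

theorem outer_zero_left : (outer (0 : P →ₗ[R] R) : Op R P W) = 0 :=
  LinearMap.ext fun w => by
    have := outer_smul_left (0 : R) (0 : P →ₗ[R] R) w
    rwa [zero_smul, zero_smul] at this

theorem cst_op_lieOp [Algebra ℝ R] {D : Derivation ℝ R R} (δ : DerEnd D P) (ν : DerEnd D W)
    (l : W) : lieOp δ ν (cst R P l) = cst R P (ν l) := by
  rw [cst, cst, lieOp_homog]
  congr 1
  ext v
  rw [DerEnd.alt_apply, Finset.univ_eq_empty, Finset.sum_empty, sub_zero]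
  rfl

theorem ofCovec_add (α β : P →ₗ[R] R) : ofCovec (α + β) = ofCovec α + ofCovec β := by
  rw [ofCovec, ofCovec, ofCovec, ← homog_add]
  rfl

theorem ofCovec_sub (α β : P →ₗ[R] R) : ofCovec (α - β) = ofCovec α - ofCovec β := by
  rw [eq_sub_iff_add_eq, ← ofCovec_add, sub_add_cancel]

theorem ofCovec_injective : Function.Injective (ofCovec : (P →ₗ[R] R) → Forms R P R) :=
  fun α β h => by
    ext θ
    have h1 := congrFun h 1
    rw [ofCovec, ofCovec, homog_same, homog_same] at h1
    exact DFunLike.congr_fun h1 fun _ => θ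

end Basics

/-! ### The Lie bialgebroid condition on functions and sections -/

section DualDifferential
variable {R : Type*} [CommRing R] [Algebra ℝ R] {E E' : Type*} [AddCommGroup E] [Module R E]
  [AddCommGroup E'] [Module R E'] (p : E →ₗ[R] E' →ₗ[R] R)
  [p.IsPerfPair] (𝔟 : LieAlgebroid R E')

/-- The differential of a section of `A` for the Lie algebroid structure of the dual bundle. -/
def dSec (X : E) : Forms R E' R := LieAlgebroid.dOp 𝔟.trivialConn (ofSec p X)

/-- The interior product of `θ` and the differential of `X`. -/
def dSecInner (X : E) (θ : E') : E := 𝔟.coad p.flip θ X - 𝔟.grad p.flip (p X θ)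

theorem pairing_grad_flip (f : R) : p (𝔟.grad p.flip f) = 𝔟.dFun f := by
  ext θ
  exact 𝔟.pairing_grad p.flip f θ

theorem covec_ad (θ : E') (X : E) : (𝔟.ad θ).covec (p X) = p (𝔟.coad p.flip θ X) := by
  ext η
  exact (𝔟.pairing_coad p.flip θ η X).symm

theorem inner_dSec (X : E) (θ : E') : inner θ (dSec p 𝔟 X) = ofSec p (dSecInner p 𝔟 X θ) := by
  have h := LinearMap.congr_fun (LieAlgebroid.inner_mul_dOp 𝔟.trivialConn θ) (ofSec p X)
  refine h.trans ?_
  have h1 : LieAlgebroid.lieConn 𝔟.trivialConn θ (ofSec p X) =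
      ofCovec ((𝔟.ad θ).covec (p X)) := lieOp_ofCovec (𝔟.ad θ) (p X)
  change LieAlgebroid.lieConn 𝔟.trivialConn θ (ofSec p X) -
    LieAlgebroid.dOp 𝔟.trivialConn (inner θ (ofCovec (p X))) = _
  rw [h1, inner_ofCovec, LieAlgebroid.dOp_ofFun, covec_ad, ← pairing_grad_flip p]
  rw [← ofCovec_sub, ← map_sub]
  rfl

end DualDifferential

section Conditions
variable {R : Type*} [CommRing R] [Algebra ℝ R] {E E' : Type*} [AddCommGroup E] [Module R E]
  [AddCommGroup E'] [Module R E'] (p : E →ₗ[R] E' →ₗ[R] R)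
  [p.IsPerfPair] (𝔞 : LieAlgebroid R E) (𝔟 : LieAlgebroid R E')

/-- The compatibility of the brackets of `A` and of its dual, in terms of functions and sections. -/
structure Compatible : Prop where
  fun_fun : ∀ f g, 𝔞.anchor (𝔟.grad p.flip f) g + 𝔟.anchor (𝔞.grad p f) g = 0
  fun_sec : ∀ f X, 𝔞.bracket (𝔟.grad p.flip f) X + 𝔟.coad p.flip (𝔞.grad p f) X = 0
  sec_sec : ∀ X Y, dSec p 𝔟 (𝔞.bracket X Y) =
    lieOp (𝔞.coad p X) (DerEnd.self (𝔞.anchor X)) (dSec p 𝔟 Y) -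
      lieOp (𝔞.coad p Y) (DerEnd.self (𝔞.anchor Y)) (dSec p 𝔟 X)

theorem dSec_eq_homog (X : E) : dSec p 𝔟 X = homog 2 (dSec p 𝔟 X 2) := by
  ext k : 1
  rcases eq_or_ne k 2 with rfl | hk
  · rw [homog_same]
  · rw [homog_of_ne hk]
    cases k with
    | zero => rfl
    | succ k =>
      rw [dSec, LieAlgebroid.dOp_succ_apply, ofSec, homog_of_ne (by omega)]
      exact map_zero (LieAlgebroid.diffHom 𝔟.trivialConn)

variable {L : Type*} [AddCommGroup L] [Module R L]

theorem inner_mul_wedgeOp_dSec (X : E) (θ : E') :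
    (inner θ * wedgeOp (dSec p 𝔟 X) : Op R E' L) =
      outer (p (dSecInner p 𝔟 X θ)) + wedgeOp (dSec p 𝔟 X) * inner θ := by
  have h : par (dSec p 𝔟 X) = dSec p 𝔟 X := by
    rw [dSec_eq_homog, par_homog]
    norm_num
  rw [inner_mul_wedgeOp, inner_dSec, h]
  congr 1
  exact wedgeOp_ofCovec _

theorem wedgeOp_dSec_mul_outer (X : E) (α : E' →ₗ[R] R) :
    (wedgeOp (dSec p 𝔟 X) * outer α : Op R E' L) = outer α * wedgeOp (dSec p 𝔟 X) := by
  rw [dSec_eq_homog, ← wedgeOp_ofCovec, ofCovec, wedgeOp_homog_comm]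
  norm_num

variable {𝔟}

theorem dOp_mul_outer_sec (nabla : 𝔟.Conn L) (X : E) :
    LieAlgebroid.dOp nabla * outer (p X) =
      wedgeOp (dSec p 𝔟 X) - outer (p X) * LieAlgebroid.dOp nabla := by
  rw [← wedgeOp_ofCovec, LieAlgebroid.dOp_mul_wedgeOp, ofCovec, par_homog, pow_one, neg_smul,
    one_smul, wedgeOp_neg, neg_mul, ← sub_eq_add_neg]
  rfl

theorem dSecInner_skew (X : E) (θ η : E') :
    p (dSecInner p 𝔟 X θ) η = - p (dSecInner p 𝔟 X η) θ := by
  have h := LinearMap.congr_fun (inner_inner (W := R) η θ) (dSec p 𝔟 X)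
  have h1 (θ η : E') : inner η (inner θ (dSec p 𝔟 X)) = ofFun E' (p (dSecInner p 𝔟 X θ) η) := by
    rw [inner_dSec]
    exact inner_ofCovec η _
  change inner η (inner θ (dSec p 𝔟 X)) = - inner θ (inner η (dSec p 𝔟 X)) at h
  rw [h1, h1] at h
  have h2 := DFunLike.congr_fun (congrFun h 0) Fin.elim0
  rw [Pi.neg_apply, ofFun, homog_same, ofFun, homog_same] at h2
  exact h2

theorem wedgeAct_outer (α : E' →ₗ[R] R) (u : Forms R E' R) (w : Forms R E' L) :
    wedgeAct (outer α u) w = outer α (wedgeAct u w) := by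
  rw [outer_eq_wedgeAct, wedgeAct_assoc, ← outer_eq_wedgeAct]

variable {p} in
-- Euler's formula for the form d_*X, which has degree 2.
theorem IsFrame.two_smul_wedgeOp_dSec {n : ℕ} {c : R} {e : Fin n → E} {ε : Fin n → E'}
    (hf : IsFrame p c e ε) (X : E) (w : Forms R E' L) :
    (2 : ℤ) • c • wedgeOp (dSec p 𝔟 X) w = c • ∑ i, outer (p (e i))
      (outer (p (dSecInner p 𝔟 X (ε i))) w) := by
  have h5 : (2 : ℤ) • c • dSec p 𝔟 X = c • ∑ i, outer (p (e i))
      (ofSec p (dSecInner p 𝔟 X (ε i))) := by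
    simp only [← inner_dSec]
    ext k : 1
    change _ = c • (∑ i, outer (p (e i)) (inner (ε i) (dSec p 𝔟 X))) k
    rw [hf.sum_outer_inner]
    change (2 : ℤ) • c • dSec p 𝔟 X k = _
    rcases eq_or_ne k 2 with rfl | hk
    · rw [smul_comm, ofNat_zsmul]
    · rw [dSec_eq_homog, homog_of_ne hk, smul_zero, smul_zero, smul_zero, smul_zero]
  have h7 := congrArg (fun u => wedgeAct u w) h5
  simp only [map_smul, map_zsmul, LinearMap.smul_apply, map_sum, LinearMap.sum_apply,
    wedgeAct_outer] at h7
  refine h7.trans ?_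
  congr 1
  refine Finset.sum_congr rfl fun i _ => congrArg _ ?_
  exact (outer_eq_wedgeAct _ _).symm

end Conditions

/-! ### A Lie bialgebroid has a scalar Δ -/

section Laplacian
variable {R : Type*} [CommRing R] [Algebra ℝ R] {E E' : Type*} [AddCommGroup E] [Module R E]
  [AddCommGroup E'] [Module R E'] {p : E →ₗ[R] E' →ₗ[R] R}
  {I : Type*} {n m : ℕ} {𝒳 : I → Submonoid R} {L : Type*} [AddCommGroup L] [Module R L]
  [p.IsPerfPair] (H : Regular p n m 𝒳 L) (𝔞 : LieAlgebroid R E) {𝔟 : LieAlgebroid R E'}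
  (q : L ⊗[R] L ≃ₗ[R] E [⋀^Fin n]→ₗ[R] TopForm R m)

theorem Regular.delOp_congr {w w' : Forms R E' L} {j : ℕ} (h : w (j + 1) = w' (j + 1)) :
    H.delOp 𝔞 q w j = H.delOp 𝔞 q w' j := by
  rw [H.delOp_apply, H.delOp_apply, bdel, bdel, h]

theorem Regular.delOp_eq_zero {w : Forms R E' L} {j : ℕ} (h : w (j + 1) = 0) :
    H.delOp 𝔞 q w j = 0 := by
  rw [H.delOp_congr 𝔞 q (w' := 0) h, map_zero]
  rfl

theorem Regular.delOp_cst (l : L) : H.delOp 𝔞 q (cst R E' l) = 0 :=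
  funext fun j => H.delOp_eq_zero 𝔞 q (cst_of_ne j.succ_ne_zero l)

/-- The square of the Dirac operator. -/
def Regular.laplace (nabla : 𝔟.Conn L) : Op R E' L :=
  LieAlgebroid.dOp nabla * H.delOp 𝔞 q + H.delOp 𝔞 q * LieAlgebroid.dOp nabla

variable {q} {nabla : 𝔟.Conn L} (hn : IsHalfAction p 𝔟 q nabla)

/-- The commutator of the square of the Dirac operator and a function. -/
def Regular.funAut (f : R) : InfAut p q :=
  (H.secAut 𝔞 q (𝔟.grad p.flip f)).add (dualAut hn (𝔞.grad p f))

/-- [Δ, f] = {∂̄, e_{d_* f}} + {d, ι_{df}}, and both anticommutators are Lie derivatives. -/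
theorem Regular.laplace_mul_mulOp (f : R) : H.laplace 𝔞 q nabla * mulOp f =
    mulOp f * H.laplace 𝔞 q nabla + (H.funAut 𝔞 hn f).op := by
  have h₁ := H.delOp_mul_mulOp 𝔞 q f
  have h₂ := LieAlgebroid.dOp_mul_mulOp nabla f
  rw [← pairing_grad_flip p] at h₂
  rw [laplace, anticomm_comm_fun h₁ h₂, H.delOp_mul_outer, LieAlgebroid.dOp_mul_inner, funAut,
    InfAut.add_op, H.secAut_op, dualAut_op]
  congr 1
  abel

/-- The commutator of the square of the Dirac operator and the exterior product with `X`. -/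
theorem Regular.laplace_comm_outer (X : E) : H.laplace 𝔞 q nabla * outer (p X) -
      outer (p X) * H.laplace 𝔞 q nabla =
    (LieAlgebroid.dOp nabla * H.lieSec 𝔞 q X - H.lieSec 𝔞 q X * LieAlgebroid.dOp nabla) +
      (H.delOp 𝔞 q * wedgeOp (dSec p 𝔟 X) - wedgeOp (dSec p 𝔟 X) * H.delOp 𝔞 q) :=
  anticomm_comm_odd (H.delOp_mul_outer 𝔞 q X) (dOp_mul_outer_sec p nabla X)

/-- All operators that differentiate cancel; what survives is the exterior product with the defect
of d_* as a derivation of the bracket of two sections. -/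
theorem Regular.laplace_comm_outer_outer (X Y : E) :
    (H.laplace 𝔞 q nabla * outer (p X) - outer (p X) * H.laplace 𝔞 q nabla) * outer (p Y) +
      outer (p Y) *
        (H.laplace 𝔞 q nabla * outer (p X) - outer (p X) * H.laplace 𝔞 q nabla) =
    wedgeOp (dSec p 𝔟 (𝔞.bracket X Y)) -
      wedgeOp (lieOp (𝔞.coad p X) (DerEnd.self (𝔞.anchor X)) (dSec p 𝔟 Y)) +
      wedgeOp (lieOp (𝔞.coad p Y) (DerEnd.self (𝔞.anchor Y)) (dSec p 𝔟 X)) := by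
  rw [H.laplace_comm_outer]
  exact comm_anticomm_odd (H.lieSec_mul_outer 𝔞 q X Y) (dOp_mul_outer_sec p nabla Y)
    (dOp_mul_outer_sec p nabla _) (lieOp_mul_wedgeOp _ _ _) (wedgeOp_dSec_mul_outer p 𝔟 X (p Y))
    (H.delOp_mul_outer 𝔞 q Y) (lieOp_mul_wedgeOp _ _ _)

variable (q) in
/-- The anticommutator of `∂̄` and an interior product. -/
def Regular.contr (θ : E') : Op R E' L := H.delOp 𝔞 q * inner θ + inner θ * H.delOp 𝔞 q

variable (p) in
/-- Minus the interior product of `Y` and the differential of `θ`. -/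
def innerD (θ : E') (Y : E) : E' := 𝔞.grad p (p Y θ) - 𝔞.coad p Y θ

/-- The operator {∂̄, ι_θ} is linear over functions, kills degree zero, and has contractions as its
commutators with exterior products: up to sign it is the contraction with the 2-form dθ. -/
theorem Regular.contr_mul_outer (θ : E') (Y : E) : H.contr 𝔞 q θ * outer (p Y) =
    outer (p Y) * H.contr 𝔞 q θ + inner (innerD p 𝔞 θ Y) := by
  rw [innerD, inner_sub_left]
  exact anticomm_inner_comm_outer (inner_outer θ (p Y)) (H.delOp_mul_outer 𝔞 q Y)
    (H.delOp_mul_mulOp 𝔞 q _) (lieOp_mul_inner _ _ _)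

theorem Regular.contr_mul_mulOp (θ : E') (f : R) :
    H.contr 𝔞 q θ * mulOp f = mulOp f * H.contr 𝔞 q θ :=
  anticomm_inner_comm_fun (H.delOp_mul_mulOp 𝔞 q f) (inner_mul_mulOp θ f) (inner_inner _ _)

theorem Regular.contr_cst (θ : E') (l : L) : H.contr 𝔞 q θ (cst R E' l) = 0 := by
  change H.delOp 𝔞 q (inner θ (cst R E' l)) + inner θ (H.delOp 𝔞 q (cst R E' l)) = 0
  rw [inner_cst, H.delOp_cst, map_zero, map_zero, add_zero]

theorem Regular.contr_smul (θ : E') (f : R) (w : Forms R E' L) :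
    H.contr 𝔞 q θ (f • w) = f • H.contr 𝔞 q θ w :=
  LinearMap.congr_fun (H.contr_mul_mulOp 𝔞 (q := q) θ f) w

theorem Regular.contr_outer (θ : E') (Y : E) (w : Forms R E' L) : H.contr 𝔞 q θ (outer (p Y) w) =
    outer (p Y) (H.contr 𝔞 q θ w) + inner (innerD p 𝔞 θ Y) w :=
  LinearMap.congr_fun (H.contr_mul_outer 𝔞 (q := q) θ Y) w

/-- The full contraction of d_*X with dθ, written as a trace over a local frame. The factor 2 is the
degree of d_*X in Euler's formula. -/
theorem Regular.contr_wedgeOp_dSec_cst {c : R} {e : Fin n → E} {ε : Fin n → E'}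
    (hf : IsFrame p c e ε) (X : E) (θ : E') (l : L) :
    (2 : ℤ) • c • H.contr 𝔞 q θ (wedgeOp (dSec p 𝔟 X) (cst R E' l)) =
      c • (∑ i, p (dSecInner p 𝔟 X (ε i)) (innerD p 𝔞 θ (e i))) • cst R E' l := by
  have h6 := hf.two_smul_wedgeOp_dSec (𝔟 := 𝔟) X (cst R E' l)
  rw [← H.contr_smul, ← map_zsmul, h6, H.contr_smul, map_sum, Finset.sum_smul]
  congr 1
  refine Finset.sum_congr rfl fun i _ => ?_
  rw [H.contr_outer, H.contr_outer, H.contr_cst, map_zero, zero_add, inner_cst, map_zero, zero_add,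
    inner_outer_cst]

/-- The first order part of the anticommutator of `[Ð², X]` and `ι_θ`. -/
def Regular.mixedAut (X : E) (θ : E') : InfAut p q :=
  (((dualAut hn θ).comm (H.secAut 𝔞 q X)).add (dualAut hn (𝔞.coad p X θ))).add
    (H.secAut 𝔞 q (dSecInner p 𝔟 X θ)).neg

/-- By the Jacobi identity the first order terms are Lie derivatives and commutators of such, that
is, one infinitesimal automorphism. The remaining two terms are linear over functions. -/
theorem Regular.laplace_comm_outer_inner (X : E) (θ : E') :
    (H.laplace 𝔞 q nabla * outer (p X) - outer (p X) * H.laplace 𝔞 q nabla) * inner θ +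
      inner θ * (H.laplace 𝔞 q nabla * outer (p X) - outer (p X) * H.laplace 𝔞 q nabla) =
    (H.mixedAut 𝔞 hn X θ).op + (H.contr 𝔞 q θ * wedgeOp (dSec p 𝔟 X) -
      wedgeOp (dSec p 𝔟 X) * H.contr 𝔞 q θ) := by
  rw [H.laplace_comm_outer]
  have h := comm_anticomm_inner (d := LieAlgebroid.dOp nabla) (D := H.delOp 𝔞 q)
    (lieOp_mul_inner θ (𝔞.coad p X) (H.halfLie 𝔞 q X)) (LieAlgebroid.dOp_mul_inner nabla θ)
    (LieAlgebroid.dOp_mul_inner nabla _) (rfl : _ = H.contr 𝔞 q θ)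
    (inner_mul_wedgeOp_dSec p 𝔟 X θ) (H.delOp_mul_outer 𝔞 q _)
  rw [h, mixedAut, InfAut.add_op, InfAut.add_op, InfAut.comm_op, InfAut.neg_op, H.secAut_op,
    H.secAut_op, dualAut_op, dualAut_op, ← sub_eq_add_neg]

theorem Regular.outer_eq_zero (H : Regular p n m 𝒳 L) {α : E' →ₗ[R] R}
    (h : (outer α : Op R E' L) = 0) : α = 0 := by
  ext θ
  refine H.line.eq_of_smul_eq H.sepFun fun l => ?_
  refine cst_injective (R := R) (P := E') ?_
  rw [cst_smul, ← inner_outer_cst, h, LinearMap.zero_apply, LinearMap.zero_apply, zero_smul, map_zero]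
  exact (homog_zero 0).symm

theorem Regular.sec_eq_zero (H : Regular p n m 𝒳 L) {X : E}
    (h : (outer (p X) : Op R E' L) = 0) : X = 0 :=
  p.toPerfPair.injective ((H.outer_eq_zero h).trans (map_zero _).symm)

theorem Regular.mulOp_eq_zero (H : Regular p n m 𝒳 L) {f : R}
    (h : (mulOp f : Op R E' L) = 0) : f = 0 := by
  refine H.line.eq_of_smul_eq H.sepFun fun l => ?_
  refine cst_injective (R := R) (P := E') ?_
  rw [cst_smul, zero_smul]
  exact (LinearMap.congr_fun h (cst R E' l)).trans (homog_zero 0).symm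

section Scalar
variable (hC : Compatible p 𝔞 𝔟)
include H hC hn

theorem Regular.laplace_comm_mulOp (f : R) :
    H.laplace 𝔞 q nabla * mulOp f = mulOp f * H.laplace 𝔞 q nabla := by
  rw [H.laplace_mul_mulOp 𝔞 hn, InfAut.op_eq_zero H (hC.fun_fun f) (hC.fun_sec f), add_zero]

/-- Locally, with the compatibility conditions already used for G = [Δ, e_X], the value ι_θ G l is
{G, ι_θ} l, a multiple of l. Its two contributions are −½ and +½ times the same trace. -/
theorem Regular.laplace_comm_outer_cst (X : E) (l : L) :
    (H.laplace 𝔞 q nabla * outer (p X) - outer (p X) * H.laplace 𝔞 q nabla : Op R E' L)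
      (cst R E' l) = 0 := by
  set G := H.laplace 𝔞 q nabla * outer (p X) - outer (p X) * H.laplace 𝔞 q nabla with hG
  have hGf (f : R) : G * mulOp f = mulOp f * G := by
    have h1 := H.laplace_comm_mulOp 𝔞 hn hC f
    have h2 := outer_mul_mulOp (W := L) (p X) f
    rw [hG]
    linear_combination (norm := noncomm_ring) H.laplace 𝔞 q nabla * h2 + h1 * outer (p X) -
      outer (p X) * h1 - h2 * H.laplace 𝔞 q nabla
  have hGy (Y : E) : G * outer (p Y) = -(outer (p Y) * G) := by
    rw [eq_neg_iff_add_eq_zero, hG, H.laplace_comm_outer_outer, hC.sec_sec, wedgeOp_sub]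
    abel
  refine forms_ext_inner ?_ fun θ => ?_
  · have h1 : G (cst R E' l) = H.laplace 𝔞 q nabla (outer (p X) (cst R E' l)) -
      outer (p X) (H.laplace 𝔞 q nabla (cst R E' l)) := rfl
    rw [h1, Pi.sub_apply, outer_zero_apply, sub_zero]
    -- There is no component of degree 0: d has none, and d(X ⊗ l) has no component of degree 1 that
    -- ∂̄ could lower.
    change LieAlgebroid.dOp nabla (H.delOp 𝔞 q (outer (p X) (cst R E' l))) 0 +
      H.delOp 𝔞 q (LieAlgebroid.dOp nabla (outer (p X) (cst R E' l))) 0 = 0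
    rw [LieAlgebroid.dOp_zero_apply, zero_add]
    refine H.delOp_eq_zero 𝔞 q ?_
    rw [LieAlgebroid.dOp_succ_apply, outer_zero_apply]
    exact map_zero (LieAlgebroid.diffHom nabla)
  · rw [map_zero]
    -- Since G commutes with functions and anticommutes with exterior products, A commutes with
    -- functions and with exterior products.
    set A := G * inner θ + inner θ * G with hA
    set β := H.mixedAut 𝔞 hn X θ with hβ
    set U : Op R E' L := wedgeOp (dSec p 𝔟 X) with hU
    have hAβ : A = β.op + (H.contr 𝔞 q θ * U - U * H.contr 𝔞 q θ) :=
      H.laplace_comm_outer_inner 𝔞 hn X θ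
    have hUf (f : R) : U * mulOp f = mulOp f * U := by
      refine LinearMap.ext fun w => ?_
      have h := wedgeOp_apply_smul f (dSec p 𝔟 X) w
      rw [← hU] at h
      exact h
    have hAf (f : R) : A * mulOp f = mulOp f * A := by
      have h1 := inner_mul_mulOp (W := L) θ f
      rw [hA]
      linear_combination (norm := noncomm_ring) G * h1 + hGf f * inner θ + inner θ * hGf f + h1 * G
    -- A and the zeroth order terms are linear over functions, hence so is β.
    have hβD (f : R) : β.D f = 0 := by
      refine H.mulOp_eq_zero ?_
      have h1 := β.op_mul_mulOp f
      have h2 := H.contr_mul_mulOp 𝔞 (q := q) θ f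
      have h3 := hAf f
      rw [hAβ] at h3
      linear_combination (norm := noncomm_ring) h3 - h1 - H.contr 𝔞 q θ * hUf f - h2 * U +
        U * h2 + hUf f * H.contr 𝔞 q θ
    -- The commutators of both sides of `hAβ` with e_Y: that of A vanishes, and that of the zeroth
    -- order terms is an exterior product with a contraction of d_*X. So β is known on A.
    have hβE (Y : E) : β.onE Y = - dSecInner p 𝔟 X (innerD p 𝔞 θ Y) := by
      rw [eq_neg_iff_add_eq_zero]
      refine H.sec_eq_zero ?_
      rw [map_add, outer_add_left]
      have h1 := β.op_mul_outer Y
      have h2 := comm_even_comm (H.contr_mul_outer 𝔞 (q := q) θ Y)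
        (wedgeOp_dSec_mul_outer p 𝔟 X (p Y)) (inner_mul_wedgeOp_dSec p 𝔟 X (innerD p 𝔞 θ Y))
      have h3 := anticomm_comm_of_anticomm (inner_outer θ (p Y)) (hGy Y) (hGf _)
      rw [← hA, hAβ] at h3
      linear_combination (norm := noncomm_ring) h3 - h1 - h2
    have key : A (cst R E' l) = 0 := by
      refine H.sep.forms _ fun i => ?_
      obtain ⟨c, hc, e, ε, hf⟩ := H.frames i
      refine ⟨c, hc, LieAlgebroid.eq_of_two_smul_eq R ?_⟩
      rw [smul_zero]
      -- On 𝓛, an automorphism over the identity acts by minus half of its trace on A.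
      have h1 : (2 : ℤ) • c • β.op (cst R E' l) =
          -(c • (∑ i, p (β.onE (e i)) (ε i)) • cst R E' l) := by
        have h2 := InfAut.trace H hβD hf l
        have h3 := congrArg (cst R E') h2
        have h4 : β.op (cst R E' l) = cst R E' (β.onL l) := cst_op_lieOp _ _ l
        rw [eq_neg_iff_add_eq_zero, h4, smul_comm (2 : ℤ) c, ← Int.cast_smul_eq_zsmul R, ← cst_smul,
          ← cst_smul, ← cst_smul, ← cst_smul, ← cst_add, Int.cast_smul_eq_zsmul, ← smul_add, h2]
        exact homog_zero 0
      have h8 := H.contr_wedgeOp_dSec_cst 𝔞 (q := q) (𝔟 := 𝔟) hf X θ l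
      rw [← hU] at h8
      rw [hAβ]
      change (2 : ℤ) • c • (β.op (cst R E' l) + (H.contr 𝔞 q θ (U (cst R E' l)) -
        U (H.contr 𝔞 q θ (cst R E' l)))) = 0
      rw [H.contr_cst, map_zero, sub_zero, smul_add, smul_add, h1, h8]
      simp only [hβE, map_neg, LinearMap.neg_apply]
      rw [neg_add_eq_zero]
      -- The trace of β and the contraction of d_*X with dθ are the same sum, by the skew symmetry
      -- of d_*X.
      congr 2
      refine Finset.sum_congr rfl fun i _ => ?_
      rw [dSecInner_skew, neg_neg]
    have h9 : A (cst R E' l) = G (inner θ (cst R E' l)) + inner θ (G (cst R E' l)) := rfl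
    rw [inner_cst, map_zero, zero_add, key] at h9
    exact h9.symm

/-- A tensorial operator that commutes or anticommutes with exterior products vanishes if it kills
𝓛. This is applied first to [Δ, e_X] and then to Δ − φ, where φ is the function by which Δ acts on
𝓛. -/
theorem Regular.laplace_eq_smul : ∃ φ : R, ∀ w, H.laplace 𝔞 q nabla w = φ • w := by
  have hΔf (f : R) (w : Forms R E' L) :
      H.laplace 𝔞 q nabla (f • w) = f • H.laplace 𝔞 q nabla w :=
    LinearMap.congr_fun (H.laplace_comm_mulOp 𝔞 hn hC f) w
  have hΔe (X : E) : H.laplace 𝔞 q nabla * outer (p X) = outer (p X) * H.laplace 𝔞 q nabla := by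
    rw [← sub_eq_zero]
    refine H.frames.op_eq_zero H.sep (fun f w => ?_) (fun u => ?_) (-1) fun Y => ?_
    · change H.laplace 𝔞 q nabla (outer (p X) (f • w)) - outer (p X) (H.laplace 𝔞 q nabla (f • w)) =
        f • (H.laplace 𝔞 q nabla (outer (p X) w) - outer (p X) (H.laplace 𝔞 q nabla w))
      rw [outer_smul, hΔf, hΔf, outer_smul, smul_sub]
    · rw [homog_zero_eq_cst]
      exact H.laplace_comm_outer_cst 𝔞 hn hC X _
    · rw [neg_smul, one_smul, eq_neg_iff_add_eq_zero, H.laplace_comm_outer_outer, hC.sec_sec,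
        wedgeOp_sub]
      abel
  -- Δ preserves degree 0, because ∂̄ kills it and d l has degree 1 only.
  have hΔc (l : L) : H.laplace 𝔞 q nabla (cst R E' l) =
      cst R E' (H.laplace 𝔞 q nabla (cst R E' l) 0 Fin.elim0) := by
    refine eq_cst fun k => ?_
    change LieAlgebroid.dOp nabla (H.delOp 𝔞 q (cst R E' l)) (k + 1) +
      H.delOp 𝔞 q (LieAlgebroid.dOp nabla (cst R E' l)) (k + 1) = 0
    rw [H.delOp_cst, map_zero, Pi.zero_apply, zero_add]
    refine H.delOp_eq_zero 𝔞 q ?_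
    rw [LieAlgebroid.dOp_succ_apply, cst_of_ne k.succ_ne_zero]
    exact map_zero (LieAlgebroid.diffHom nabla)
  obtain ⟨φ, hφ⟩ := H.line.exists_smul H.sep H.absorbing H.sepFun H.glueFun
    (g := fun l => H.laplace 𝔞 q nabla (cst R E' l) 0 Fin.elim0) fun f l => by
      rw [cst_smul, hΔf]
      rfl
  refine ⟨φ, fun w => ?_⟩
  have h : H.laplace 𝔞 q nabla - mulOp φ = 0 := by
    refine H.frames.op_eq_zero H.sep (fun f w => ?_) (fun u => ?_) 1 fun Y => ?_
    · change H.laplace 𝔞 q nabla (f • w) - φ • f • w = f • (H.laplace 𝔞 q nabla w - φ • w)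
      rw [hΔf, smul_sub, smul_comm]
    · change H.laplace 𝔞 q nabla (homog 0 u) - φ • homog 0 u = 0
      rw [homog_zero_eq_cst, hΔc, hφ, cst_smul, sub_self]
    · rw [sub_mul, hΔe, mul_sub, outer_mul_mulOp, one_smul]
  exact sub_eq_zero.1 (LinearMap.congr_fun h w)

end Scalar

end Laplacian

/-! ### The Schouten bracket with functions and sections -/

section SchoutenBracket
variable {R : Type*} [CommRing R] [Algebra ℝ R] {E E' : Type*} [AddCommGroup E] [Module R E]
  [AddCommGroup E'] [Module R E'] {p : E →ₗ[R] E' →ₗ[R] R}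
  {I : Type*} {n : ℕ} {𝒳 : I → Submonoid R}
  [p.IsPerfPair] {𝔞 : LieAlgebroid R E} {𝔟 : LieAlgebroid R E'}
  {b : Forms R E' R →+ Forms R E' R →+ Forms R E' R}

theorem homog_zero_eq_ofFun (u : E' [⋀^Fin 0]→ₗ[R] R) : homog 0 u = ofFun E' (u Fin.elim0) :=
  homog_zero_eq_cst u

theorem wedgeAct_ofFun (f : R) (w : Forms R E' R) : wedgeAct (ofFun E' f) w = f • w :=
  LinearMap.congr_fun (wedgeOp_ofFun f) w

theorem ofFun_injective : Function.Injective (ofFun (R := R) E') := cst_injective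

theorem ofSec_injective : Function.Injective (ofSec p) := fun _ _ h =>
  p.toPerfPair.injective (ofCovec_injective h)

theorem lieOp_smul_apply {D : Derivation ℝ R R} (δ : DerEnd D E') (ν : DerEnd D R) (f : R)
    (w : Forms R E' R) : lieOp δ ν (f • w) = f • lieOp δ ν w + D f • w :=
  LinearMap.congr_fun (lieOp_mul_mulOp δ ν f) w

/-- The axioms fix the bracket with X on functions and sections, and both sides are derivations of
the exterior product. Their difference is tensorial and commutes with exterior products, so it
vanishes. -/
theorem IsSchouten.sec_left (hb : IsSchouten p 𝔞 b) (hF : HasFrames p n 𝒳) (hR : Separated 𝒳 R)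
    (X : E) (w : Forms R E' R) :
    b (ofSec p X) w = lieOp (𝔞.coad p X) (DerEnd.self (𝔞.anchor X)) w := by
  have key : ((b (ofSec p X)).toIntLinearMap -
      lieOp (𝔞.coad p X) (DerEnd.self (𝔞.anchor X)) : Op R E' R) = 0 := by
    refine hF.op_eq_zero hR (fun f w => ?_) (fun u => ?_) 1 fun Y => LinearMap.ext fun w => ?_
    · change b (ofSec p X) (f • w) - lieOp _ _ (f • w) = f • (b (ofSec p X) w - lieOp _ _ w)
      have h := hb.leibniz 1 0 (AlternatingMap.ofSubsingleton R E' R (0 : Fin 1) (p X))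
        (AlternatingMap.constOfIsEmpty R E' (Fin 0) f) w
      change b (ofSec p X) (wedgeAct (ofFun E' f) w) = wedgeAct (b (ofSec p X) (ofFun E' f)) w +
        (-1 : ℤ) ^ (2 * 0) • wedgeAct (ofFun E' f) (b (ofSec p X) w) at h
      rw [hb.sec_fun, wedgeAct_ofFun, wedgeAct_ofFun, wedgeAct_ofFun, mul_zero, pow_zero,
        one_smul] at h
      rw [h, lieOp_smul_apply, smul_sub]
      abel
    · change b (ofSec p X) (homog 0 u) - lieOp _ _ (homog 0 u) = 0
      rw [homog_zero_eq_ofFun, hb.sec_fun, sub_eq_zero]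
      exact (cst_op_lieOp (W := R) (𝔞.coad p X) (DerEnd.self (𝔞.anchor X)) _).symm
    · change b (ofSec p X) (outer (p Y) w) - lieOp _ _ (outer (p Y) w) =
        (1 : ℤ) • outer (p Y) (b (ofSec p X) w - lieOp _ _ w)
      have h := hb.leibniz 1 1 (AlternatingMap.ofSubsingleton R E' R (0 : Fin 1) (p X))
        (AlternatingMap.ofSubsingleton R E' R (0 : Fin 1) (p Y)) w
      change b (ofSec p X) (wedgeAct (ofCovec (p Y)) w) =
        wedgeAct (b (ofSec p X) (ofSec p Y)) w +
        (-1 : ℤ) ^ (2 * 1) • wedgeAct (ofCovec (p Y)) (b (ofSec p X) w) at h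
      rw [← outer_eq_wedgeAct, hb.sec_sec] at h
      have h1 : lieOp (𝔞.coad p X) (DerEnd.self (𝔞.anchor X)) (outer (p Y) w) =
          outer (p Y) (lieOp (𝔞.coad p X) (DerEnd.self (𝔞.anchor X)) w) +
          outer (p (𝔞.bracket X Y)) w :=
        LinearMap.congr_fun (𝔞.lieOp_mul_outer_coad p X Y (DerEnd.self (𝔞.anchor X))) w
      have h2 : wedgeAct (ofSec p (𝔞.bracket X Y)) w = outer (p (𝔞.bracket X Y)) w :=
        (outer_eq_wedgeAct _ _).symm
      rw [h, h1, h2, ← outer_eq_wedgeAct, mul_one, neg_one_sq, one_smul, one_smul, map_sub]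
      abel
  have h := LinearMap.congr_fun key w
  change b (ofSec p X) w - lieOp _ _ w = 0 at h
  exact sub_eq_zero.1 h

/-- The same argument; the value on sections comes from skew symmetry, and two functions have
bracket zero for reasons of degree. -/
theorem IsSchouten.fun_left (hb : IsSchouten p 𝔞 b) (hF : HasFrames p n 𝒳) (hR : Separated 𝒳 R)
    (f : R) (w : Forms R E' R) : b (ofFun E' f) w = - inner (𝔞.grad p f) w := by
  have hff (g : R) : b (ofFun E' f) (ofFun E' g) = 0 :=
    funext fun j => hb.degree 0 0 j _ _ (by omega)
  have key : ((b (ofFun E' f)).toIntLinearMap + inner (𝔞.grad p f) : Op R E' R) = 0 := by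
    refine hF.op_eq_zero hR (fun g w => ?_) (fun u => ?_) (-1) fun Y => LinearMap.ext fun w => ?_
    · change b (ofFun E' f) (g • w) + inner _ (g • w) = g • (b (ofFun E' f) w + inner _ w)
      have h := hb.leibniz 0 0 (AlternatingMap.constOfIsEmpty R E' (Fin 0) f)
        (AlternatingMap.constOfIsEmpty R E' (Fin 0) g) w
      change b (ofFun E' f) (wedgeAct (ofFun E' g) w) = wedgeAct (b (ofFun E' f) (ofFun E' g)) w +
        (-1 : ℤ) ^ (1 * 0) • wedgeAct (ofFun E' g) (b (ofFun E' f) w) at h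
      rw [hff, wedgeAct_ofFun, wedgeAct_ofFun, mul_zero, pow_zero,
        one_smul, map_zero, LinearMap.zero_apply, zero_add] at h
      rw [h, inner_smul, smul_add]
    · change b (ofFun E' f) (homog 0 u) + inner _ (homog 0 u) = 0
      rw [homog_zero_eq_ofFun, hff, zero_add]
      exact inner_cst (W := R) _ _
    · change b (ofFun E' f) (outer (p Y) w) + inner _ (outer (p Y) w) =
        (-1 : ℤ) • outer (p Y) (b (ofFun E' f) w + inner _ w)
      have h := hb.leibniz 0 1 (AlternatingMap.constOfIsEmpty R E' (Fin 0) f)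
        (AlternatingMap.ofSubsingleton R E' R (0 : Fin 1) (p Y)) w
      have hs := hb.skew 0 1 (AlternatingMap.constOfIsEmpty R E' (Fin 0) f)
        (AlternatingMap.ofSubsingleton R E' R (0 : Fin 1) (p Y))
      change b (ofFun E' f) (ofSec p Y) = -((-1 : ℤ) ^ (1 * 2) • b (ofSec p Y) (ofFun E' f)) at hs
      change b (ofFun E' f) (wedgeAct (ofCovec (p Y)) w) =
        wedgeAct (b (ofFun E' f) (ofSec p Y)) w +
        (-1 : ℤ) ^ (1 * 1) • wedgeAct (ofCovec (p Y)) (b (ofFun E' f) w) at h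
      rw [hs, hb.sec_fun, ← outer_eq_wedgeAct, ← outer_eq_wedgeAct, one_mul, neg_one_sq, one_smul,
        mul_one, pow_one, map_neg, LinearMap.neg_apply, wedgeAct_ofFun] at h
      have h1 : inner (𝔞.grad p f) (outer (p Y) w) = p Y (𝔞.grad p f) • w -
          outer (p Y) (inner (𝔞.grad p f) w) := LinearMap.congr_fun (inner_outer _ _) w
      rw [h, h1, 𝔞.pairing_grad p, map_add, smul_add, neg_one_smul, neg_one_smul]
      abel
  have h := LinearMap.congr_fun key w
  change b (ofFun E' f) w + inner _ w = 0 at h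
  exact eq_neg_of_add_eq_zero_left h

theorem dOp_ofFun_eq_ofSec (f : R) :
    LieAlgebroid.dOp 𝔟.trivialConn (ofFun E' f) = ofSec p (𝔟.grad p.flip f) := by
  rw [LieAlgebroid.dOp_ofFun, ← pairing_grad_flip p]
  rfl

/-- The three conditions are the derivation property for two functions, for a function and a
section, and for two sections, with the brackets made explicit. -/
theorem compatible_of_isLieBialgebroid (hF : HasFrames p n 𝒳) (hR : Separated 𝒳 R)
    (h : IsLieBialgebroid p 𝔞 𝔟) : Compatible p 𝔞 𝔟 := by
  obtain ⟨b, hb, hd⟩ := h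
  have inner_sec (θ : E') (X : E) : inner θ (ofSec p X) = ofFun E' (p X θ) := inner_ofCovec θ _
  refine ⟨fun f g => ?_, fun f X => ?_, fun X Y => ?_⟩
  · have h : LieAlgebroid.dOp 𝔟.trivialConn (b (ofFun E' f) (ofFun E' g)) =
        b (LieAlgebroid.dOp 𝔟.trivialConn (ofFun E' f)) (ofFun E' g) +
          (-1 : ℤ) ^ 1 • b (ofFun E' f) (LieAlgebroid.dOp 𝔟.trivialConn (ofFun E' g)) :=
      hd 0 0 _ _
    have h0 : inner (𝔞.grad p f) (ofFun E' g) = 0 := inner_cst (W := R) _ _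
    rw [dOp_ofFun_eq_ofSec (p := p), dOp_ofFun_eq_ofSec (p := p), hb.fun_left hF hR,
      hb.fun_left hF hR, hb.sec_fun, h0, neg_zero, map_zero, inner_sec, pow_one, neg_smul, one_smul,
      neg_neg] at h
    have h1 : p (𝔟.grad p.flip g) (𝔞.grad p f) = 𝔟.anchor (𝔞.grad p f) g :=
      𝔟.pairing_grad p.flip g _
    rw [h1] at h
    refine ofFun_injective (E' := E') ?_
    have h2 := cst_add (R := R) (P := E') (𝔞.anchor (𝔟.grad p.flip f) g)
      (𝔟.anchor (𝔞.grad p f) g)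
    exact (h2.trans h.symm).trans (homog_zero 0).symm
  · have h : LieAlgebroid.dOp 𝔟.trivialConn (b (ofFun E' f) (ofSec p X)) =
        b (LieAlgebroid.dOp 𝔟.trivialConn (ofFun E' f)) (ofSec p X) +
          (-1 : ℤ) ^ 1 • b (ofFun E' f) (dSec p 𝔟 X) :=
      hd 0 1 _ _
    rw [dOp_ofFun_eq_ofSec (p := p), hb.fun_left hF hR,
      hb.fun_left hF hR, hb.sec_sec, inner_sec, 𝔞.pairing_grad p, inner_dSec, map_neg,
      dOp_ofFun_eq_ofSec (p := p), pow_one, neg_smul, one_smul,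
      neg_neg, eq_comm, ← sub_eq_zero, sub_neg_eq_add] at h
    have h1 (X Y : E) : ofSec p X + ofSec p Y = ofSec p (X + Y) := by
      refine (ofCovec_add (p X) (p Y)).symm.trans ?_
      rw [← map_add]
      rfl
    rw [h1, h1, dSecInner, 𝔞.pairing_grad p, ← add_sub_assoc, sub_add_cancel] at h
    refine ofSec_injective (p := p) (h.trans ?_)
    exact (congrArg (homog 1) (by ext; simp)).trans (homog_zero 1) |>.symm
  · have h : dSec p 𝔟 (𝔞.bracket X Y) = b (dSec p 𝔟 X) (ofSec p Y) +
          (-1 : ℤ) ^ 2 • b (ofSec p X) (dSec p 𝔟 Y) := by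
      have h := hd 1 1 (AlternatingMap.ofSubsingleton R E' R (0 : Fin 1) (p X))
        (AlternatingMap.ofSubsingleton R E' R (0 : Fin 1) (p Y))
      change LieAlgebroid.dOp 𝔟.trivialConn (b (ofSec p X) (ofSec p Y)) = _ at h
      rw [hb.sec_sec] at h
      exact h
    have hs : b (dSec p 𝔟 X) (ofSec p Y) = -((-1 : ℤ) ^ (3 * 2) • b (ofSec p Y) (dSec p 𝔟 X)) := by
      rw [dSec_eq_homog p 𝔟 X]
      exact hb.skew 2 1 _ _
    rw [h, hs, hb.sec_left hF hR, hb.sec_left hF hR]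
    norm_num
    abel

end SchoutenBracket

/-! ### Jacobi identities with signs, for the derived bracket -/

section RingIdentities
variable {A : Type*} [Ring A]

/-- Here s, t, r stand for the signs (−1)^k, (−1)^l, (−1)^{kl} of forms u, v of degrees k, l. Once
they are fixed to be ±1, each case is an identity in a free associative ring modulo the hypotheses.
-/
theorem derived_comm_fun {D f i u v x r s t : A} (hs : s = 1 ∨ s = -1) (ht : t = 1 ∨ t = -1)
    (hr : r = 1 ∨ r = -1) (h₁ : D * f = f * D + i) (h₂ : u * f = f * u) (h₃ : v * f = f * v)
    (h₄ : i * u = x + s * (u * i)) (h₅ : x * v = r * t * (v * x)) :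
    ((D * u - s * (u * D)) * v - r * t * (v * (D * u - s * (u * D)))) * f =
      f * ((D * u - s * (u * D)) * v - r * t * (v * (D * u - s * (u * D)))) := by
  have hT : (D * u - s * (u * D)) * f = f * (D * u - s * (u * D)) + x := by
    rcases hs with rfl | rfl
    · linear_combination (norm := noncomm_ring) D * h₂ + h₁ * u - u * h₁ - h₂ * D + h₄
    · linear_combination (norm := noncomm_ring) D * h₂ + h₁ * u + u * h₁ + h₂ * D + h₄
  generalize D * u - s * (u * D) = T at hT
  rcases hr with rfl | rfl <;> rcases ht with rfl | rfl
  · linear_combination (norm := noncomm_ring) T * h₃ + hT * v + h₅ - v * hT - h₃ * T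
  · linear_combination (norm := noncomm_ring) T * h₃ + hT * v + h₅ + v * hT + h₃ * T
  · linear_combination (norm := noncomm_ring) T * h₃ + hT * v + h₅ + v * hT + h₃ * T
  · linear_combination (norm := noncomm_ring) T * h₃ + hT * v + h₅ - v * hT - h₃ * T

theorem derived_comm_odd {D y K u v x r s t : A} (hs : s = 1 ∨ s = -1) (ht : t = 1 ∨ t = -1)
    (hr : r = 1 ∨ r = -1) (h₁ : D * y = K - y * D) (h₂ : u * y = s * (y * u))
    (h₃ : v * y = t * (y * v)) (h₄ : K * u = u * K + x) (h₅ : x * v = r * (v * x)) :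
    ((D * u - s * (u * D)) * v - r * t * (v * (D * u - s * (u * D)))) * y =
      -(s * t) * (y * ((D * u - s * (u * D)) * v - r * t * (v * (D * u - s * (u * D))))) := by
  have hT : (D * u - s * (u * D)) * y = - (s * (y * (D * u - s * (u * D)))) + s * x := by
    rcases hs with rfl | rfl
    · linear_combination (norm := noncomm_ring) D * h₂ + h₁ * u - u * h₁ + h₄ + h₂ * D
    · linear_combination (norm := noncomm_ring) D * h₂ - h₁ * u + u * h₁ - h₄ - h₂ * D
  generalize D * u - s * (u * D) = T at hT
  rcases hr with rfl | rfl <;> rcases hs with rfl | rfl <;> rcases ht with rfl | rfl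
  · linear_combination (norm := noncomm_ring) T * h₃ + hT * v + h₅ - v * hT + h₃ * T
  · linear_combination (norm := noncomm_ring) T * h₃ - hT * v - h₅ + v * hT - h₃ * T
  · linear_combination (norm := noncomm_ring) T * h₃ + hT * v - h₅ - v * hT - h₃ * T
  · linear_combination (norm := noncomm_ring) T * h₃ - hT * v + h₅ + v * hT + h₃ * T
  · linear_combination (norm := noncomm_ring) T * h₃ + hT * v + h₅ + v * hT - h₃ * T
  · linear_combination (norm := noncomm_ring) T * h₃ - hT * v - h₅ - v * hT + h₃ * T
  · linear_combination (norm := noncomm_ring) T * h₃ + hT * v - h₅ + v * hT + h₃ * T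
  · linear_combination (norm := noncomm_ring) T * h₃ - hT * v + h₅ - v * hT - h₃ * T

theorem derived_skew {D u v r s t : A} (hs : s = 1 ∨ s = -1) (ht : t = 1 ∨ t = -1)
    (hr : r = 1 ∨ r = -1) (h : u * v = r * (v * u)) :
    (D * u - s * (u * D)) * v - r * t * (v * (D * u - s * (u * D))) =
      r * ((D * v - t * (v * D)) * u - r * s * (u * (D * v - t * (v * D)))) := by
  rcases hr with rfl | rfl <;> rcases hs with rfl | rfl <;> rcases ht with rfl | rfl
  · linear_combination (norm := noncomm_ring) D * h - h * D
  · linear_combination (norm := noncomm_ring) D * h + h * D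
  · linear_combination (norm := noncomm_ring) D * h + h * D
  · linear_combination (norm := noncomm_ring) D * h - h * D
  · linear_combination (norm := noncomm_ring) D * h - h * D
  · linear_combination (norm := noncomm_ring) D * h + h * D
  · linear_combination (norm := noncomm_ring) D * h + h * D
  · linear_combination (norm := noncomm_ring) D * h - h * D

/-- The Jacobi identity for d and the double commutator [[D, u], v]. In general it contains a term
with [{d, D}, u], which is assumed to vanish. -/
theorem derived_derivation {d D u v u' v' r s t : A} (hs : s = 1 ∨ s = -1) (ht : t = 1 ∨ t = -1)
    (hr : r = 1 ∨ r = -1) (hu : d * u = u' + s * (u * d)) (hv : d * v = v' + t * (v * d))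
    (hΔ : (d * D + D * d) * u = u * (d * D + D * d)) :
    d * ((D * u - s * (u * D)) * v - r * t * (v * (D * u - s * (u * D)))) +
      s * t * (((D * u - s * (u * D)) * v - r * t * (v * (D * u - s * (u * D)))) * d) =
    -((D * u' + s * (u' * D)) * v - r * (v * (D * u' + s * (u' * D)))) -
      s * ((D * u - s * (u * D)) * v' + r * s * t * (v' * (D * u - s * (u * D)))) := by
  have hT : d * (D * u - s * (u * D)) + s * ((D * u - s * (u * D)) * d) =
      -(D * u' + s * (u' * D)) := by
    rcases hs with rfl | rfl
    · linear_combination (norm := noncomm_ring) hΔ - D * hu - hu * D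
    · linear_combination (norm := noncomm_ring) hΔ - D * hu + hu * D
  generalize D * u - s * (u * D) = T at hT
  generalize D * u' + s * (u' * D) = T' at hT
  rcases hr with rfl | rfl <;> rcases hs with rfl | rfl <;> rcases ht with rfl | rfl
  · linear_combination (norm := noncomm_ring) hT * v - T * hv - hv * T - v * hT
  · linear_combination (norm := noncomm_ring) hT * v - T * hv + hv * T - v * hT
  · linear_combination (norm := noncomm_ring) hT * v + T * hv - hv * T - v * hT
  · linear_combination (norm := noncomm_ring) hT * v + T * hv + hv * T - v * hT
  · linear_combination (norm := noncomm_ring) hT * v - T * hv + hv * T + v * hT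
  · linear_combination (norm := noncomm_ring) hT * v - T * hv - hv * T + v * hT
  · linear_combination (norm := noncomm_ring) hT * v + T * hv + hv * T + v * hT
  · linear_combination (norm := noncomm_ring) hT * v + T * hv - hv * T + v * hT

end RingIdentities

/-! ### Operators that are exterior products -/

section WedgeOperators
variable {R : Type*} [CommRing R] [Algebra ℝ R] {E E' : Type*} [AddCommGroup E] [Module R E]
  [AddCommGroup E'] [Module R E'] {p : E →ₗ[R] E' →ₗ[R] R}
  {I : Type*} {n m : ℕ} {𝒳 : I → Submonoid R} {L : Type*} [AddCommGroup L] [Module R L]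
  [p.IsPerfPair]

theorem wedgeAct_cst (u : Forms R E' R) (l : L) (j : ℕ) (v : Fin j → E') :
    wedgeAct u (cst R E' l) j v = u j v • l := by
  induction j generalizing u with
  | zero =>
    rw [wedgeAct_zero_apply, AlternatingMap.smul_apply, cst_zero_apply,
      Subsingleton.elim v Fin.elim0]
  | succ j ih =>
    have h := DFunLike.congr_fun (congrFun (inner_wedgeAct (v 0) u (cst R E' l)) j) (Fin.tail v)
    rw [inner_cst, map_zero, add_zero, ih, inner_apply, inner_apply] at h
    have hv : Matrix.vecCons (v 0) (Fin.tail v) = v := Fin.cons_self_tail v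
    rw [AlternatingMap.curryLeft_apply_apply, AlternatingMap.curryLeft_apply_apply, hv] at h
    exact h

theorem wedgeOp_homog_apply_eq_zero {k j : ℕ} (u : E' [⋀^Fin k]→ₗ[R] R) {w : Forms R E' L}
    (h : ∀ i, i + k = j → w i = 0) : wedgeOp (homog k u) w j = 0 := by
  rw [wedgeOp_apply, wedgeAct_apply]
  refine Finset.sum_eq_zero fun kl hkl => ?_
  rw [Finset.HasAntidiagonal.mem_antidiagonal] at hkl
  rcases eq_or_ne kl.1 k with hk | hk
  · rw [wedgePart, dif_pos hkl, h kl.2 (by omega)]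
    exact ((degCast R E' L hkl).toLinearMap ∘ₗ wedge R E' L kl.1 kl.2 _).map_zero
  · rw [wedgePart, dif_pos hkl, homog_of_ne hk]
    exact ((degCast R E' L hkl).toLinearMap ∘ₗ (wedge R E' L kl.1 kl.2).flip _).map_zero

/-- It is enough to test on sections of 𝓛, on which functions act faithfully. -/
theorem Regular.wedgeOp_injective (H : Regular p n m 𝒳 L) {u v : Forms R E' R}
    (h : (wedgeOp u : Op R E' L) = wedgeOp v) : u = v := by
  ext j θ
  refine H.line.eq_of_smul_eq H.sepFun fun l => ?_
  rw [← wedgeAct_cst, ← wedgeAct_cst]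
  exact DFunLike.congr_fun (congrFun (LinearMap.congr_fun h (cst R E' l)) j) θ

theorem wedgeOp_homog_mul_outer {k : ℕ} (u : E' [⋀^Fin k]→ₗ[R] R) (α : E' →ₗ[R] R) :
    (wedgeOp (homog k u) * outer α : Op R E' L) =
      (-1 : ℤ) ^ k • (outer α * wedgeOp (homog k u)) := by
  rw [← wedgeOp_ofCovec, ofCovec, wedgeOp_homog_comm, mul_one]

/-- An operator that is linear over functions and graded commutes with exterior products is itself
an exterior product. -/
theorem Regular.exists_wedgeOp (H : Regular p n m 𝒳 L) {S : Op R E' L} {c : ℕ}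
    (hlin : ∀ f : R, S * mulOp f = mulOp f * S)
    (hdeg : ∀ l j, j + 1 ≠ c → S (cst R E' l) j = 0)
    (hS : ∀ X, S * outer (p X) = (-1 : ℤ) ^ (c + 1) • (outer (p X) * S)) :
    ∃ w, (∀ j, j + 1 ≠ c → w j = 0) ∧ S = wedgeOp w := by
  have hSf (f : R) (w : Forms R E' L) : S (f • w) = f • S w := LinearMap.congr_fun (hlin f) w
  -- The coefficient l ↦ S(l)(v) is linear over functions, so it is multiplication by a function of
  -- v. This function is multilinear and alternating since functions act faithfully on 𝓛.
  have key (j : ℕ) (v : Fin j → E') : ∃ r : R, ∀ l, S (cst R E' l) j v = r • l :=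
    H.line.exists_smul H.sep H.absorbing H.sepFun H.glueFun (g := fun l => S (cst R E' l) j v)
      fun f l => by rw [cst_smul, hSf]; rfl
  choose r hr using key
  let w : Forms R E' R := fun j =>
    { toFun := r j
      map_update_add' := fun v i x y => by
        refine H.line.eq_of_smul_eq H.sepFun fun l => ?_
        rw [add_smul, ← hr, ← hr, ← hr, AlternatingMap.map_update_add]
      map_update_smul' := fun v i f x => by
        refine H.line.eq_of_smul_eq H.sepFun fun l => ?_
        rw [smul_eq_mul, mul_smul, ← hr, ← hr, AlternatingMap.map_update_smul]
      map_eq_zero_of_eq' := fun v i i' h hi => by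
        refine H.line.eq_of_smul_eq H.sepFun fun l => ?_
        rw [zero_smul, ← hr, AlternatingMap.map_eq_zero_of_eq _ _ h hi] }
  have hw : ∀ j, j + 1 ≠ c → w j = 0 := fun j hj => by
    ext v
    refine H.line.eq_of_smul_eq H.sepFun fun l => ?_
    change r j v • l = (0 : R) • l
    rw [zero_smul, ← hr, hdeg l j hj, AlternatingMap.zero_apply]
  have hwX (X : E) : wedgeOp w * outer (p X) =
      (-1 : ℤ) ^ (c + 1) • (outer (p X) * wedgeOp w : Op R E' L) := by
    -- The number c is the degree of S plus one. For c = 0 the degree would be −1, and w = 0.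
    cases c with
    | zero =>
      have h0 : w = 0 := funext fun j => hw j (by omega)
      rw [h0, wedgeOp_zero, zero_mul, mul_zero, smul_zero]
    | succ c =>
      have h0 : w = homog c (w c) := by
        ext j : 1
        rcases eq_or_ne j c with rfl | hj
        · rw [homog_same]
        · rw [homog_of_ne hj, hw j (by omega)]
      rw [h0, wedgeOp_homog_mul_outer, pow_succ, pow_succ, mul_neg_one, mul_neg_one, neg_neg]
  refine ⟨w, hw, ?_⟩
  rw [← sub_eq_zero]
  refine H.frames.op_eq_zero H.sep (fun f x => ?_) (fun u => ?_) ((-1) ^ (c + 1)) fun X => ?_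
  · change S (f • x) - wedgeOp w (f • x) = f • (S x - wedgeOp w x)
    rw [hSf, wedgeOp_apply_smul, smul_sub]
  · rw [homog_zero_eq_cst]
    ext j v
    change S (cst R E' _) j v - wedgeAct w (cst R E' _) j v = 0
    rw [wedgeAct_cst, hr]
    exact sub_self _
  · rw [sub_mul, hS, hwX, mul_sub, smul_sub]

end WedgeOperators

/-! ### The Schouten bracket as a derived bracket of ∂̄ -/

section DerivedBracket
variable {R : Type*} [CommRing R] [Algebra ℝ R] {E E' : Type*} [AddCommGroup E] [Module R E]
  [AddCommGroup E'] [Module R E'] {p : E →ₗ[R] E' →ₗ[R] R}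
  {I : Type*} {n m : ℕ} {𝒳 : I → Submonoid R} {L : Type*} [AddCommGroup L] [Module R L]
  [p.IsPerfPair] (H : Regular p n m 𝒳 L) (𝔞 : LieAlgebroid R E) {𝔟 : LieAlgebroid R E'}
  (q : L ⊗[R] L ≃ₗ[R] E [⋀^Fin n]→ₗ[R] TopForm R m)

theorem neg_one_pow_zsmul {A : Type*} [Ring A] (k : ℕ) (x : A) :
    (-1 : ℤ) ^ k • x = (-1) ^ k * x := by
  rw [zsmul_eq_mul, Int.cast_pow, Int.cast_neg, Int.cast_one]

theorem par_pow_homog (a l : ℕ) (v : E' [⋀^Fin l]→ₗ[R] L) :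
    (par ^ a : Op R E' L) (homog l v) = (-1 : ℤ) ^ (a * l) • homog l v := by
  induction a with
  | zero => rw [pow_zero, zero_mul, pow_zero, one_smul]; rfl
  | succ a ih =>
    rw [pow_succ, Module.End.mul_apply, par_homog, map_zsmul, ih, smul_smul, ← pow_add]
    congr 2
    ring

theorem par_pow_wedgeAct (a : ℕ) (u : Forms R E' R) (w : Forms R E' L) :
    (par ^ a : Op R E' L) (wedgeAct u w) =
      wedgeAct ((par ^ a : Op R E' R) u) ((par ^ a : Op R E' L) w) := by
  induction a generalizing u w with
  | zero => rfl
  | succ a ih =>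
    rw [pow_succ, pow_succ, Module.End.mul_apply, Module.End.mul_apply, Module.End.mul_apply,
      par_wedgeAct, ih]

/-- The graded commutator of `∂̄` and the exterior product with `u`. -/
def Regular.derOp {k : ℕ} (u : E' [⋀^Fin k]→ₗ[R] R) : Op R E' L :=
  H.delOp 𝔞 q * wedgeOp (homog k u) - (-1) ^ k * (wedgeOp (homog k u) * H.delOp 𝔞 q)

theorem Regular.derOp_add {k : ℕ} (u u' : E' [⋀^Fin k]→ₗ[R] R) :
    H.derOp 𝔞 q (u + u') = H.derOp 𝔞 q u + H.derOp 𝔞 q u' := by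
  rw [derOp, homog_add, wedgeOp_add, derOp, derOp]
  noncomm_ring

/-- The derived bracket of a form of degree `k` and a form, up to a sign the double graded
commutator of `∂̄` and the exterior products. -/
def Regular.derivedOp {k : ℕ} (u : E' [⋀^Fin k]→ₗ[R] R) (v : Forms R E' R) : Op R E' L :=
  (-1) ^ (k + 1) * (H.derOp 𝔞 q u * wedgeOp v -
    wedgeOp ((par ^ (k + 1) : Op R E' R) v) * H.derOp 𝔞 q u)

theorem Regular.derivedOp_homog {k l : ℕ} (u : E' [⋀^Fin k]→ₗ[R] R) (v : E' [⋀^Fin l]→ₗ[R] R) :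
    H.derivedOp 𝔞 q u (homog l v) = (-1) ^ (k + 1) * (H.derOp 𝔞 q u * wedgeOp (homog l v) -
      (-1) ^ (k * l) * (-1) ^ l * (wedgeOp (homog l v) * H.derOp 𝔞 q u)) := by
  rw [derivedOp, par_pow_homog, wedgeOp_zsmul, neg_one_pow_zsmul, add_mul, one_mul,
    pow_add _ (k * l) l, mul_assoc _ (wedgeOp (homog l v)) _]

theorem wedgeOp_comm_inner {k l : ℕ} (u : E' [⋀^Fin k]→ₗ[R] R) (v : E' [⋀^Fin l]→ₗ[R] R) (θ : E') :
    (wedgeOp (inner θ (homog k u)) * wedgeOp (homog l v) : Op R E' L) =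
      (-1) ^ (k * l) * (-1) ^ l * (wedgeOp (homog l v) * wedgeOp (inner θ (homog k u))) := by
  cases k with
  | zero => rw [inner_homog_zero, wedgeOp_zero, zero_mul, mul_zero, mul_zero]
  | succ k =>
    rw [inner_homog_succ, wedgeOp_homog_comm, neg_one_pow_zsmul, add_mul, one_mul, pow_add,
      mul_assoc ((-1) ^ (k * l)), ← pow_add, ← two_mul, pow_mul _ 2 l, neg_one_sq, one_pow, mul_one]

theorem wedgeOp_mul_mulOp (u : Forms R E' R) (f : R) :
    (wedgeOp u * mulOp f : Op R E' L) = mulOp f * wedgeOp u :=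
  LinearMap.ext fun w => wedgeOp_apply_smul f u w

/-- With respect to exterior products ∂̄ is an operator of second order: the double graded
commutator is linear over functions and graded commutes with all e_X, of degree k + l − 1. Hence it
is an exterior product. -/
theorem Regular.exists_derivedOp_homog {k l : ℕ} (u : E' [⋀^Fin k]→ₗ[R] R)
    (v : E' [⋀^Fin l]→ₗ[R] R) :
    ∃ w, (∀ j, j + 1 ≠ k + l → w j = 0) ∧ H.derivedOp 𝔞 q u (homog l v) = wedgeOp w := by
  suffices h : ∃ w, (∀ j, j + 1 ≠ k + l → w j = 0) ∧ H.derOp 𝔞 q u * wedgeOp (homog l v) -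
      (-1) ^ (k * l) * (-1) ^ l * (wedgeOp (homog l v) * H.derOp 𝔞 q u) = wedgeOp w by
    obtain ⟨w, hw, h⟩ := h
    refine ⟨(-1 : ℤ) ^ (k + 1) • w, fun j hj => ?_, ?_⟩
    · rw [Pi.smul_apply, hw j hj, smul_zero]
    · rw [H.derivedOp_homog, h, wedgeOp_zsmul, neg_one_pow_zsmul]
  refine H.exists_wedgeOp (fun f => ?_) (fun x j hj => ?_) fun X => ?_
  · have h1 := inner_mul_wedgeOp (W := L) (𝔞.grad p f) (homog k u)
    rw [par_homog, wedgeOp_zsmul, neg_one_pow_zsmul, mul_assoc] at h1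
    exact derived_comm_fun (neg_one_pow_eq_or _ k) (neg_one_pow_eq_or _ l)
      (neg_one_pow_eq_or _ (k * l)) (H.delOp_mul_mulOp 𝔞 q f) (wedgeOp_mul_mulOp _ f)
      (wedgeOp_mul_mulOp _ f) h1 (wedgeOp_comm_inner u v _)
  · have h2 (S : Op R E' L) (a : ℕ) (h : S (cst R E' x) j = 0) :
        ((-1) ^ a * S) (cst R E' x) j = 0 := by
      rw [← neg_one_pow_zsmul]
      change (-1 : ℤ) ^ a • S (cst R E' x) j = 0
      rw [h, smul_zero]
    have h0 (i : ℕ) (hi : i ≠ 0) : cst R E' x i = 0 := cst_of_ne hi x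
    have e1 : (H.delOp 𝔞 q * wedgeOp (homog k u) * wedgeOp (homog l v) : Op R E' L)
        (cst R E' x) j = 0 := by
      rw [Module.End.mul_apply, Module.End.mul_apply]
      refine H.delOp_eq_zero 𝔞 q (wedgeOp_homog_apply_eq_zero u fun i hi => ?_)
      exact wedgeOp_homog_apply_eq_zero v fun i' hi' => h0 i' (by omega)
    have e2 : ((wedgeOp (homog k u) * H.delOp 𝔞 q) * wedgeOp (homog l v) : Op R E' L)
        (cst R E' x) j = 0 := by
      rw [Module.End.mul_apply, Module.End.mul_apply]
      refine wedgeOp_homog_apply_eq_zero u fun i hi => H.delOp_eq_zero 𝔞 q ?_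
      exact wedgeOp_homog_apply_eq_zero v fun i' hi' => h0 i' (by omega)
    have e3 : (wedgeOp (homog l v) * (H.delOp 𝔞 q * wedgeOp (homog k u)) : Op R E' L)
        (cst R E' x) j = 0 := by
      rw [Module.End.mul_apply, Module.End.mul_apply]
      refine wedgeOp_homog_apply_eq_zero v fun i hi => H.delOp_eq_zero 𝔞 q ?_
      exact wedgeOp_homog_apply_eq_zero u fun i' hi' => h0 i' (by omega)
    have e4 : (wedgeOp (homog l v) * (wedgeOp (homog k u) * H.delOp 𝔞 q) : Op R E' L) (cst R E' x) j = 0 := by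
      change (wedgeOp (homog l v) (wedgeOp (homog k u) (H.delOp 𝔞 q (cst R E' x)))) j = 0
      rw [H.delOp_cst, map_zero, map_zero]
      rfl
    have e : H.derOp 𝔞 q u * wedgeOp (homog l v) -
        (-1) ^ (k * l) * (-1) ^ l * (wedgeOp (homog l v) * H.derOp 𝔞 q u) =
      H.delOp 𝔞 q * wedgeOp (homog k u) * wedgeOp (homog l v) -
        (-1) ^ k * ((wedgeOp (homog k u) * H.delOp 𝔞 q) * wedgeOp (homog l v)) -
        ((-1) ^ (k * l + l) * (wedgeOp (homog l v) * (H.delOp 𝔞 q * wedgeOp (homog k u))) -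
        (-1) ^ (k * l + l + k) *
          (wedgeOp (homog l v) * (wedgeOp (homog k u) * H.delOp 𝔞 q))) := by
      rw [derOp, pow_add, pow_add, pow_add]
      rcases neg_one_pow_eq_or (Op R E' L) k with hk | hk <;> rw [hk] <;> noncomm_ring
    rw [e]
    change (_ - _ - (_ - _) : E' [⋀^Fin j]→ₗ[R] L) = 0
    rw [e1, h2 _ _ e2, h2 _ _ e3, h2 _ _ e4]
    simp
  · have h1 := wedgeOp_homog_mul_outer (L := L) u (p X)
    have h2 := wedgeOp_homog_mul_outer (L := L) v (p X)
    rw [neg_one_pow_zsmul] at h1 h2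
    have h3 := wedgeOp_homog_comm (W := L) k l
      ((𝔞.coad p X).alt k (DerEnd.self (𝔞.anchor X)) u) v
    rw [← lieOp_homog, neg_one_pow_zsmul] at h3
    have h := derived_comm_odd (neg_one_pow_eq_or _ k) (neg_one_pow_eq_or _ l)
      (neg_one_pow_eq_or _ (k * l)) (H.delOp_mul_outer 𝔞 q X) h1 h2
      (lieOp_mul_wedgeOp (𝔞.coad p X) (H.halfLie 𝔞 q X) (homog k u)) h3
    rw [neg_one_pow_zsmul, pow_succ, pow_add, mul_neg_one]
    exact h

variable (L) in
/-- The exterior product, as a map from forms to operators. -/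
def wedgeHom : Forms R E' R →+ Op R E' L where
  toFun := wedgeOp
  map_zero' := wedgeOp_zero
  map_add' := wedgeOp_add

/-- The derived bracket as a biadditive map. -/
def Regular.derivedHom (k : ℕ) : (E' [⋀^Fin k]→ₗ[R] R) →+ Forms R E' R →+ Op R E' L :=
  AddMonoidHom.mk' (fun u => AddMonoidHom.mk' (H.derivedOp 𝔞 q u) fun v v' => by
    rw [derivedOp, map_add, wedgeOp_add, wedgeOp_add, derivedOp, derivedOp]
    noncomm_ring) fun u u' => by
    ext1 v
    change H.derivedOp 𝔞 q (u + u') v = H.derivedOp 𝔞 q u v + H.derivedOp 𝔞 q u' v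
    rw [derivedOp, derOp_add, derivedOp, derivedOp]
    noncomm_ring

theorem Regular.derivedHom_mem_range (k : ℕ) (u : E' [⋀^Fin k]→ₗ[R] R) (v : Forms R E' R) :
    H.derivedHom 𝔞 q k u v ∈ (wedgeHom L).range := by
  rw [H.frames.eq_sum_homog H.sepFun v, map_sum]
  refine sum_mem fun l _ => ?_
  obtain ⟨w, -, hw⟩ := H.exists_derivedOp_homog 𝔞 q u (v l)
  exact ⟨w, hw.symm⟩

/-- The derived bracket of two forms, as an operator. -/
def Regular.bracketHom : Forms R E' R →+ Forms R E' R →+ Op R E' L :=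
  ∑ k ∈ Finset.range (n + 1),
    (H.derivedHom 𝔞 q k).comp (Pi.evalAddMonoidHom (fun k => E' [⋀^Fin k]→ₗ[R] R) k)

theorem Regular.bracketHom_homog (k : ℕ) (u : E' [⋀^Fin k]→ₗ[R] R) (v : Forms R E' R) :
    H.bracketHom 𝔞 q (homog k u) v = H.derivedOp 𝔞 q u v := by
  have h : H.bracketHom 𝔞 q (homog k u) v =
      ∑ j ∈ Finset.range (n + 1), H.derivedHom 𝔞 q j (homog k u j) v := by
    rw [bracketHom, AddMonoidHom.finsetSum_apply, AddMonoidHom.finsetSum_apply]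
    rfl
  rw [h, Finset.sum_eq_single k]
  · rw [homog_same]
    rfl
  · intro j _ hj
    rw [homog_of_ne hj, map_zero, AddMonoidHom.zero_apply]
  · intro hk
    rw [Finset.mem_range] at hk
    rw [H.frames.alt_eq_zero H.sepFun (by omega) u, homog_zero, Pi.zero_apply, map_zero,
      AddMonoidHom.zero_apply]

theorem Regular.exists_bracket (u v : Forms R E' R) :
    ∃ w, wedgeOp w = H.bracketHom 𝔞 q u v := by
  have h : H.bracketHom 𝔞 q u v = ∑ k ∈ Finset.range (n + 1), H.derivedHom 𝔞 q k (u k) v := by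
    rw [bracketHom, AddMonoidHom.finsetSum_apply, AddMonoidHom.finsetSum_apply]
    rfl
  rw [h]
  exact AddSubgroup.sum_mem (wedgeHom L).range fun k _ => H.derivedHom_mem_range 𝔞 q k (u k) v

/-- The Schouten bracket, as a derived bracket. -/
def Regular.bracket : Forms R E' R →+ Forms R E' R →+ Forms R E' R :=
  AddMonoidHom.mk' (fun u => AddMonoidHom.mk' (fun v => (H.exists_bracket 𝔞 q u v).choose)
    fun v v' => H.wedgeOp_injective (by
      rw [wedgeOp_add, (H.exists_bracket 𝔞 q u _).choose_spec,
        (H.exists_bracket 𝔞 q u _).choose_spec, (H.exists_bracket 𝔞 q u _).choose_spec, map_add]))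
    fun u u' => by
      ext1 v
      exact H.wedgeOp_injective (by
        change wedgeOp (H.exists_bracket 𝔞 q (u + u') v).choose = wedgeOp
          ((H.exists_bracket 𝔞 q u v).choose + (H.exists_bracket 𝔞 q u' v).choose)
        rw [wedgeOp_add, (H.exists_bracket 𝔞 q _ _).choose_spec,
          (H.exists_bracket 𝔞 q _ _).choose_spec, (H.exists_bracket 𝔞 q _ _).choose_spec, map_add,
          AddMonoidHom.add_apply])

theorem Regular.wedgeOp_bracket (k : ℕ) (u : E' [⋀^Fin k]→ₗ[R] R) (v : Forms R E' R) :
    wedgeOp (H.bracket 𝔞 q (homog k u) v) = H.derivedOp 𝔞 q u v :=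
  (H.exists_bracket 𝔞 q (homog k u) v).choose_spec.trans (H.bracketHom_homog 𝔞 q k u v)

theorem Regular.derOp_sec (X : E) :
    H.derOp 𝔞 q (AlternatingMap.ofSubsingleton R E' R (0 : Fin 1) (p X)) = H.lieSec 𝔞 q X := by
  have h : (wedgeOp (homog 1 (AlternatingMap.ofSubsingleton R E' R (0 : Fin 1) (p X))) :
      Op R E' L) = outer (p X) := wedgeOp_ofCovec (p X)
  rw [derOp, h, H.delOp_mul_outer]
  noncomm_ring

/-- Forms act faithfully by exterior products, so the axioms can be verified for operators. On
sections, {∂̄, e_X} = L_X gives the given bracket and anchor. Skew symmetry is the Jacobi identity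
for exterior products, which commute up to sign, and the Leibniz rule is that of a commutator. -/
theorem Regular.isSchouten_bracket : IsSchouten p 𝔞 (H.bracket 𝔞 q) where
  degree k l j u v hj := by
    obtain ⟨w, hw, h⟩ := H.exists_derivedOp_homog 𝔞 q u v
    rw [← H.wedgeOp_bracket] at h
    rw [H.wedgeOp_injective h, hw j hj]
  sec_fun X f := by
    refine H.wedgeOp_injective ?_
    refine (H.wedgeOp_bracket 𝔞 q 1 _ _).trans ?_
    rw [ofFun, derivedOp_homog, derOp_sec]
    change (-1) ^ 2 * (H.lieSec 𝔞 q X * wedgeOp (ofFun E' f) - (-1) ^ (1 * 0) * (-1) ^ 0 *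
      (wedgeOp (ofFun E' f) * H.lieSec 𝔞 q X)) = _
    rw [wedgeOp_ofFun, wedgeOp_ofFun, lieOp_mul_mulOp]
    noncomm_ring
  sec_sec X Y := by
    refine H.wedgeOp_injective ?_
    refine (H.wedgeOp_bracket 𝔞 q 1 _ _).trans ?_
    rw [ofSec, derivedOp_homog, derOp_sec]
    change (-1) ^ 2 * (H.lieSec 𝔞 q X * wedgeOp (ofCovec (p Y)) - (-1) ^ (1 * 1) * (-1) ^ 1 *
      (wedgeOp (ofCovec (p Y)) * H.lieSec 𝔞 q X)) = wedgeOp (ofCovec (p (𝔞.bracket X Y)))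
    rw [wedgeOp_ofCovec, wedgeOp_ofCovec, H.lieSec_mul_outer]
    noncomm_ring
  skew k l u v := by
    refine H.wedgeOp_injective ?_
    have h := wedgeOp_homog_comm (W := L) k l u v
    rw [neg_one_pow_zsmul] at h
    have h1 := derived_skew (D := H.delOp 𝔞 q) (neg_one_pow_eq_or _ k) (neg_one_pow_eq_or _ l)
      (neg_one_pow_eq_or _ (k * l)) h
    rw [wedgeOp_neg, wedgeOp_zsmul, H.wedgeOp_bracket, H.wedgeOp_bracket, derivedOp_homog,
      derivedOp_homog, derOp, derOp, h1, neg_one_pow_zsmul, mul_comm l k]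
    have h2 : (-1 : Op R E' L) ^ ((k + 1) * (l + 1)) =
        -((-1) ^ (k * l) * (-1) ^ k * (-1) ^ l) := by
      rw [← pow_add, ← pow_add, ← mul_neg_one (_ ^ _), ← pow_succ]
      congr 1
      ring
    rw [h2, pow_succ, pow_succ]
    generalize (_ - _ : Op R E' L) = x
    rcases neg_one_pow_eq_or (Op R E' L) k with hk | hk <;>
      rcases neg_one_pow_eq_or (Op R E' L) l with hl | hl <;>
      rcases neg_one_pow_eq_or (Op R E' L) (k * l) with hkl | hkl <;>
      rw [hk, hl, hkl] <;> noncomm_ring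
  leibniz k l u v w := by
    refine H.wedgeOp_injective ?_
    rw [wedgeForms_eq, wedgeForms_eq, wedgeForms_eq, wedgeOp_add, wedgeOp_zsmul, ← wedgeOp_mul,
      ← wedgeOp_mul, H.wedgeOp_bracket, H.wedgeOp_bracket, H.wedgeOp_bracket, derivedOp, derivedOp,
      derivedOp, par_pow_wedgeAct, ← wedgeOp_mul, ← wedgeOp_mul, par_pow_homog, wedgeOp_zsmul,
      neg_one_pow_zsmul, neg_one_pow_zsmul]
    rcases neg_one_pow_eq_or (Op R E' L) (k + 1) with hk | hk <;>
      rcases neg_one_pow_eq_or (Op R E' L) ((k + 1) * l) with hl | hl <;>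
      rw [hk, hl] <;> noncomm_ring

theorem dOp_homog (nabla : 𝔟.Conn L) (k : ℕ) (u : E' [⋀^Fin k]→ₗ[R] L) :
    LieAlgebroid.dOp nabla (homog k u) = homog (k + 1) (LieAlgebroid.diff nabla u) := by
  ext j : 1
  cases j with
  | zero => rw [LieAlgebroid.dOp_zero_apply, homog_of_ne k.succ_ne_zero.symm]
  | succ j =>
    rw [LieAlgebroid.dOp_succ_apply]
    rcases eq_or_ne j k with rfl | hj
    · rw [homog_same, homog_same]
    · rw [homog_of_ne hj, homog_of_ne (by omega)]
      exact map_zero (LieAlgebroid.diffHom nabla)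

/-- If the square of the Dirac operator is a function, then the differential of the dual bundle is a
derivation of the Schouten bracket. -/
theorem Regular.isLieBialgebroid {nabla : 𝔟.Conn L} {φ : R}
    (hφ : H.laplace 𝔞 q nabla = mulOp φ) : IsLieBialgebroid p 𝔞 𝔟 := by
  refine ⟨H.bracket 𝔞 q, H.isSchouten_bracket 𝔞 q, fun k l u v => ?_⟩
  change LieAlgebroid.dOp 𝔟.trivialConn (H.bracket 𝔞 q (homog k u) (homog l v)) =
    H.bracket 𝔞 q (LieAlgebroid.dOp 𝔟.trivialConn (homog k u)) (homog l v) + (-1 : ℤ) ^ (k + 1) •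
      H.bracket 𝔞 q (homog k u) (LieAlgebroid.dOp 𝔟.trivialConn (homog l v))
  refine H.wedgeOp_injective ?_
  have hd {j : ℕ} (x : E' [⋀^Fin j]→ₗ[R] R) : LieAlgebroid.dOp nabla * wedgeOp (homog j x) =
      wedgeOp (LieAlgebroid.dOp 𝔟.trivialConn (homog j x)) +
        (-1) ^ j * (wedgeOp (homog j x) * LieAlgebroid.dOp nabla) := by
    rw [LieAlgebroid.dOp_mul_wedgeOp, par_homog, wedgeOp_zsmul, neg_one_pow_zsmul, mul_assoc]
  -- The bracket has degree k + l − 1, which has the parity of k + l + 1.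
  have hpar : par (H.bracket 𝔞 q (homog k u) (homog l v)) =
      (-1 : ℤ) ^ (k + l + 1) • H.bracket 𝔞 q (homog k u) (homog l v) := by
    ext j : 1
    rw [par_apply, Pi.smul_apply]
    by_cases hj : j + 1 = k + l
    · rw [← hj, pow_succ, pow_succ, mul_neg_one, mul_neg_one, neg_neg]
    · rw [(H.isSchouten_bracket 𝔞 q).degree k l j u v hj, smul_zero, smul_zero]
  have hb := LieAlgebroid.dOp_mul_wedgeOp nabla (H.bracket 𝔞 q (homog k u) (homog l v))
  rw [hpar, wedgeOp_zsmul, neg_one_pow_zsmul, H.wedgeOp_bracket] at hb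
  -- The only use of the hypothesis that Δ is a function.
  have hΔ : H.laplace 𝔞 q nabla * wedgeOp (homog k u) =
      wedgeOp (homog k u) * H.laplace 𝔞 q nabla := by
    rw [hφ, wedgeOp_mul_mulOp]
  have h := derived_derivation (neg_one_pow_eq_or _ k) (neg_one_pow_eq_or _ l)
    (neg_one_pow_eq_or _ (k * l)) (hd u) (hd v) hΔ
  rw [wedgeOp_add, wedgeOp_zsmul, eq_sub_of_add_eq hb.symm, neg_one_pow_zsmul]
  rw [dOp_homog, dOp_homog] at h ⊢
  rw [H.wedgeOp_bracket, H.wedgeOp_bracket, derivedOp_homog, derivedOp_homog, derivedOp_homog,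
    derOp, derOp]
  have e1 : (-1 : Op R E' L) ^ (k + l + 1) = -((-1) ^ k * (-1) ^ l) := by
    rw [pow_succ, pow_add, mul_neg_one]
  have e2 : (-1 : Op R E' L) ^ (k * (l + 1)) = (-1) ^ (k * l) * (-1) ^ k := by
    rw [← pow_add, mul_add, mul_one]
  have e3 : (-1 : Op R E' L) ^ ((k + 1) * l) = (-1) ^ (k * l) * (-1) ^ l := by
    rw [← pow_add, add_mul, one_mul]
  have e4 : (-1 : Op R E' L) ^ (k + 1) = -(-1) ^ k := by rw [pow_succ, mul_neg_one]
  have e5 : (-1 : Op R E' L) ^ (l + 1) = -(-1) ^ l := by rw [pow_succ, mul_neg_one]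
  rw [pow_succ (-1 : Op R E' L) (k + 1), e1, e2, e3, e4, e5]
  generalize (wedgeOp (homog k u) : Op R E' L) = x at *
  generalize (wedgeOp (homog l v) : Op R E' L) = y at *
  generalize (wedgeOp (homog (k + 1) (LieAlgebroid.diff 𝔟.trivialConn u)) : Op R E' L) = x' at *
  generalize (wedgeOp (homog (l + 1) (LieAlgebroid.diff 𝔟.trivialConn v)) : Op R E' L) = y' at *
  generalize H.delOp 𝔞 q = D at *
  generalize LieAlgebroid.dOp nabla = d at *
  clear hφ hd hpar hb hΔ e1 e2 e3 e4 e5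
  rcases neg_one_pow_eq_or (Op R E' L) k with hk | hk <;>
    rcases neg_one_pow_eq_or (Op R E' L) l with hl | hl <;>
    rcases neg_one_pow_eq_or (Op R E' L) (k * l) with hkl | hkl <;>
    rw [hk, hl, hkl] at h ⊢
  · linear_combination (norm := noncomm_ring) -h
  · linear_combination (norm := noncomm_ring) -h
  · linear_combination (norm := noncomm_ring) -h
  · linear_combination (norm := noncomm_ring) -h
  · linear_combination (norm := noncomm_ring) h
  · linear_combination (norm := noncomm_ring) h
  · linear_combination (norm := noncomm_ring) h
  · linear_combination (norm := noncomm_ring) h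

end DerivedBracket

/-! ### Jacobi identities for interior products -/

section RingIdentities
variable {A : Type*} [Ring A]

/-- The expansion of {[{d, D}, i], j} for two interior products i and j, which is zero when {d, D}
commutes with i. -/
theorem inner_anticomm {d D i j k Q T Q' T' K : A} (hQ : D * i + i * D = Q)
    (hT : d * i = T - i * d) (hQ' : D * j + j * D = Q') (hT' : d * j = T' - j * d)
    (hK : D * k + k * D = K) (hQj : Q * j = j * Q) (hTj : T * j = j * T + k)
    (hΔ : (d * D + D * d) * i = i * (d * D + D * d)) :
    K - (T * Q' - Q' * T) + (T' * Q - Q * T') = 0 := by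
  linear_combination (norm := noncomm_ring) hΔ * j + j * hΔ + (- d * hQ * j - j * d * hQ)
    + (-(D * hT) * j - j * D * hT) + hT * D * j + j * hT * D + hQ * d * j + j * hQ * d
    - d * hQj + Q * hT' - hT' * Q - D * hTj + T * hQ' - hQ' * T - hTj * D - hK - hQj * d

theorem comm_inner_comm_outer {T Q y z a b c : A} (hT : T * y = y * T + z)
    (hQ : Q * y = y * Q + a) (hQz : Q * z = z * Q + b) (hTa : T * a = a * T + c) :
    (T * Q - Q * T) * y = y * (T * Q - Q * T) + (c - b) := by
  linear_combination (norm := noncomm_ring) T * hQ + hT * Q + hTa - Q * hT - hQ * T - hQz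

theorem comm_inner_inner {Q i y c t : A} (h₁ : Q * y = y * Q + t) (h₂ : i * y = c - y * i)
    (h₃ : Q * c = c * Q) (h₄ : t * i = -(i * t)) :
    y * (Q * i - i * Q) = -((Q * i - i * Q) * y) := by
  linear_combination (norm := noncomm_ring) Q * h₂ + h₃ - h₁ * i - i * h₁ - h₂ * Q - h₄

end RingIdentities

/-! ### The compatibility conditions of the exchanged pair -/

section Duality
variable {R : Type*} [CommRing R] [Algebra ℝ R] {E E' : Type*} [AddCommGroup E] [Module R E]
  [AddCommGroup E'] [Module R E'] {p : E →ₗ[R] E' →ₗ[R] R}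
  {I : Type*} {n m : ℕ} {𝒳 : I → Submonoid R} {L : Type*} [AddCommGroup L] [Module R L]
  [p.IsPerfPair] (H : Regular p n m 𝒳 L) (𝔞 : LieAlgebroid R E) {𝔟 : LieAlgebroid R E'}
  {q : L ⊗[R] L ≃ₗ[R] E [⋀^Fin n]→ₗ[R] TopForm R m} {nabla : 𝔟.Conn L}
  (hn : IsHalfAction p 𝔟 q nabla)

/-- Up to sign {∂̄, ι_θ} is the contraction with a form of even degree, so it commutes with
contractions. The proof compares commutators with exterior products. -/
theorem Regular.contr_comm_inner (θ η : E') :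
    H.contr 𝔞 q θ * inner η = inner η * H.contr 𝔞 q θ := by
  rw [← sub_eq_zero]
  refine H.frames.op_eq_zero_of_outer H.sep (fun w j hj => ?_) (-1) fun X => ?_
  · have hz (k : ℕ) (hk : n < k) (x : Forms R E' L) : x k = 0 := H.frames.alt_eq_zero H.sep hk _
    have hi (x : Forms R E' L) (ζ : E') : inner ζ x j = 0 := by
      rw [inner_apply, hz (j + 1) (by omega) x]
      rfl
    change H.delOp 𝔞 q (inner θ (inner η w)) j + inner θ (H.delOp 𝔞 q (inner η w)) j -
      inner η (H.contr 𝔞 q θ w) j = 0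
    rw [H.delOp_of_le 𝔞 q hj, hi, hi]
    simp
  · rw [neg_one_smul]
    exact comm_inner_inner (H.contr_mul_outer 𝔞 θ X) (inner_outer η (p X))
      (H.contr_mul_mulOp 𝔞 θ _) (inner_inner _ _)

theorem Regular.inner_eq_zero (H : Regular p n m 𝒳 L) {θ : E'} (h : (inner θ : Op R E' L) = 0) : θ = 0 := by
  refine pairing_ext (p := p) fun X => ?_
  rw [map_zero]
  refine H.mulOp_eq_zero ?_
  have h1 := inner_outer (W := L) θ (p X)
  rw [h, zero_mul, mul_zero, sub_zero] at h1
  exact h1.symm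

theorem dSecInner_flip (θ : E') (X : E) : dSecInner p.flip 𝔞 θ X = - innerD p 𝔞 θ X := by
  rw [innerD, neg_sub]
  rfl

theorem lieOp_ofSec (X Y : E) : lieOp (𝔞.coad p X) (DerEnd.self (𝔞.anchor X)) (ofSec p Y) =
    ofSec p (𝔞.bracket X Y) :=
  (lieOp_ofCovec (𝔞.coad p X) (p Y)).trans (congrArg ofCovec (𝔞.covec_coad p X Y))

theorem ofSec_sub (X Y : E) : ofSec p (X - Y) = ofSec p X - ofSec p Y := by
  refine Eq.trans ?_ (ofCovec_sub (p X) (p Y))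
  rw [← map_sub]
  rfl

variable {φ : R} (hφ : H.laplace 𝔞 q nabla = mulOp φ)
include hφ

/-- As a function, Δ commutes with ι_θ and ι_η. The Jacobi identity then reads {∂̄, ι_{[θ,η]}} =
[L_θ, {∂̄, ι_η}] − [L_η, {∂̄, ι_θ}], and the commutator with e_X compares the contractions of
d[θ,η], dη and dθ with sections. -/
theorem Regular.bracket_innerD (θ η : E') (X : E) : innerD p 𝔞 (𝔟.bracket θ η) X =
    (𝔟.bracket θ (innerD p 𝔞 η X) - innerD p 𝔞 η (𝔟.coad p.flip θ X)) -
      (𝔟.bracket η (innerD p 𝔞 θ X) - innerD p 𝔞 θ (𝔟.coad p.flip η X)) := by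
  have h := inner_anticomm (d := LieAlgebroid.dOp nabla) (D := H.delOp 𝔞 q)
    (rfl : _ = H.contr 𝔞 q θ) (LieAlgebroid.dOp_mul_inner nabla θ) (rfl : _ = H.contr 𝔞 q η)
    (LieAlgebroid.dOp_mul_inner nabla η) (rfl : _ = H.contr 𝔞 q (𝔟.bracket θ η))
    (H.contr_comm_inner 𝔞 θ η) (lieOp_mul_inner η (𝔟.ad θ) (nabla.at θ)) (by
      change H.laplace 𝔞 q nabla * inner θ = inner θ * H.laplace 𝔞 q nabla
      rw [hφ, inner_mul_mulOp])
  have hL (ζ : E') : LieAlgebroid.lieConn nabla ζ * outer (p X) =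
      outer (p X) * LieAlgebroid.lieConn nabla ζ + outer (p (𝔟.coad p.flip ζ X)) := by
    rw [← covec_ad]
    exact lieOp_mul_outer _ _ _
  have hc (ζ ξ : E') := comm_inner_comm_outer (hL ζ) (H.contr_mul_outer 𝔞 (q := q) ξ X)
    (H.contr_mul_outer 𝔞 (q := q) ξ (𝔟.coad p.flip ζ X))
    (lieOp_mul_inner (innerD p 𝔞 ξ X) (𝔟.ad ζ) (nabla.at ζ))
  have h1 := H.contr_mul_outer 𝔞 (q := q) (𝔟.bracket θ η) X
  rw [← sub_eq_zero]
  refine H.inner_eq_zero ?_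
  rw [inner_sub_left, inner_sub_left, inner_sub_left, inner_sub_left]
  have h2 := hc θ η
  have h3 := hc η θ
  simp only [LieAlgebroid.ad_apply] at h2 h3
  linear_combination (norm := noncomm_ring) h * outer (p X) - outer (p X) * h - h1 + h2 - h3

include hn in
-- The condition on two functions is symmetric, and the one on a function and a section is dual to
-- that of the original pair; both come from [Δ, f] = 0. The condition on two sections of A* is
-- `bracket_innerD`, contraction by contraction.
theorem Regular.compatible_flip : Compatible p.flip 𝔟 𝔞 := by
  have hf (f : R) : (H.funAut 𝔞 hn f).op = 0 := by
    have h := H.laplace_mul_mulOp 𝔞 hn f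
    rw [hφ] at h
    have h1 : (mulOp φ * mulOp f : Op R E' L) = mulOp f * mulOp φ :=
      LinearMap.ext fun w => smul_comm φ f w
    linear_combination (norm := noncomm_ring) h1 - h
  have hff (f g : R) : 𝔞.anchor (𝔟.grad p.flip f) g + 𝔟.anchor (𝔞.grad p f) g = 0 := by
    refine H.mulOp_eq_zero ?_
    have h := (H.funAut 𝔞 hn f).op_mul_mulOp g
    rw [hf, zero_mul, mul_zero, zero_add] at h
    exact h.symm
  have hfs (f : R) (X : E) : 𝔞.bracket (𝔟.grad p.flip f) X + 𝔟.coad p.flip (𝔞.grad p f) X = 0 := by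
    refine H.sec_eq_zero ?_
    have h := (H.funAut 𝔞 hn f).op_mul_outer X
    rw [hf, zero_mul, mul_zero, zero_add] at h
    exact h.symm
  refine ⟨fun f g => ?_, fun f θ => ?_, fun θ η => ?_⟩
  · rw [add_comm]
    exact hff f g
  · change 𝔟.bracket (𝔞.grad p f) θ + 𝔞.coad p (𝔟.grad p.flip f) θ = 0
    refine pairing_ext (p := p) fun X => ?_
    rw [map_add, 𝔞.pairing_coad p, map_zero]
    have h1 : p (𝔟.coad p.flip (𝔞.grad p f) X) θ = 𝔟.anchor (𝔞.grad p f) (p X θ) -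
      p X (𝔟.bracket (𝔞.grad p f) θ) := 𝔟.pairing_coad p.flip (𝔞.grad p f) θ X
    have h2 := congrArg (fun Y => p Y θ) (hfs f X)
    simp only [map_add, LinearMap.add_apply, map_zero, LinearMap.zero_apply] at h2
    linear_combination hff f (p X θ) - h2 + h1
  · have h0 (ζ : E') : dSec p.flip 𝔞 ζ 0 = 0 := rfl
    have hl (ζ ξ : E') (X : E) : inner X (lieOp (𝔟.coad p.flip ζ) (DerEnd.self (𝔟.anchor ζ))
        (dSec p.flip 𝔞 ξ)) = ofSec p.flip (innerD p 𝔞 ξ (𝔟.coad p.flip ζ X) -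
          𝔟.bracket ζ (innerD p 𝔞 ξ X)) := by
      have h := LinearMap.congr_fun (inner_mul_lieOp X (𝔟.coad p.flip ζ)
        (DerEnd.self (𝔟.anchor ζ))) (dSec p.flip 𝔞 ξ)
      change _ = lieOp (𝔟.coad p.flip ζ) (DerEnd.self (𝔟.anchor ζ)) (inner X (dSec p.flip 𝔞 ξ)) -
        inner (𝔟.coad p.flip ζ X) (dSec p.flip 𝔞 ξ) at h
      refine h.trans ?_
      rw [inner_dSec, inner_dSec, lieOp_ofSec, ← ofSec_sub, dSecInner_flip, dSecInner_flip, map_neg]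
      congr 1
      abel
    refine forms_ext_inner ?_ fun X => ?_
    · rw [h0, Pi.sub_apply, lieOp_apply, lieOp_apply, h0, h0]
      simp
    · rw [map_sub, hl, hl, inner_dSec, ← ofSec_sub, dSecInner_flip, H.bracket_innerD 𝔞 hφ]
      congr 1
      abel

end Duality

/-! ### The Dirac operator and its square -/

section Dirac
variable {R : Type*} [CommRing R] [Algebra ℝ R] {E E' : Type*} [AddCommGroup E] [Module R E]
  [AddCommGroup E'] [Module R E'] {p : E →ₗ[R] E' →ₗ[R] R}
  {I : Type*} {n m : ℕ} {𝒳 : I → Submonoid R} {L : Type*} [AddCommGroup L] [Module R L]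
  [p.IsPerfPair] (H : Regular p n m 𝒳 L) (𝔞 : LieAlgebroid R E) {𝔟 : LieAlgebroid R E'}
  {q : L ⊗[R] L ≃ₗ[R] E [⋀^Fin n]→ₗ[R] TopForm R m} {nabla : 𝔟.Conn L}
  (hn : IsHalfAction p 𝔟 q nabla)
include hn

theorem Regular.dirac_apply (w : Forms R E' L) :
    dirac p 𝔞 𝔟 q w = LieAlgebroid.dOp nabla w + H.delOp 𝔞 q w := by
  have h : ∃ nabla : 𝔟.Conn L, IsHalfAction p 𝔟 q nabla := ⟨nabla, hn⟩
  rw [dirac, bdees, dif_pos h, H.halfConn_unique h.choose_spec hn]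
  rfl

theorem Regular.dirac_dirac (w : Forms R E' L) :
    dirac p 𝔞 𝔟 q (dirac p 𝔞 𝔟 q w) = H.laplace 𝔞 q nabla w := by
  have h1 := LinearMap.congr_fun (LieAlgebroid.dOp_dOp (H.halfConn_isFlat hn)) w
  have h2 := LinearMap.congr_fun (H.delOp_delOp 𝔞 q) w
  rw [Module.End.mul_apply, LinearMap.zero_apply] at h1 h2
  rw [H.dirac_apply 𝔞 hn, H.dirac_apply 𝔞 hn, map_add, map_add, h1, h2, laplace,
    LinearMap.add_apply, Module.End.mul_apply, Module.End.mul_apply]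
  abel

theorem Regular.dirac_dirac_eq_iff (φ : R) : (∀ w, dirac p 𝔞 𝔟 q (dirac p 𝔞 𝔟 q w) = φ • w) ↔
    H.laplace 𝔞 q nabla = mulOp φ := by
  simp only [H.dirac_dirac 𝔞 hn, LinearMap.ext_iff, mulOp_apply]

end Dirac

/-! ### Equality near a point -/

section Germs
variable {R : Type*} [CommRing R] {I : Type*} (𝒳 : I → Submonoid R) (i : I)
  (W : Type*) [AddCommGroup W] [Module R W]

/-- The elements of `W` that vanish near `i`. -/
def germ : Submodule R W where
  carrier := {w | ∃ c ∈ 𝒳 i, c • w = 0}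
  zero_mem' := ⟨1, one_mem _, smul_zero _⟩
  add_mem' := by
    rintro w w' ⟨c, hc, h⟩ ⟨c', hc', h'⟩
    refine ⟨c * c', mul_mem hc hc', ?_⟩
    rw [smul_add, mul_smul c c' w', h', mul_comm, mul_smul, h, smul_zero, smul_zero, add_zero]
  smul_mem' := by
    rintro f w ⟨c, hc, h⟩
    exact ⟨c, hc, by rw [smul_comm, h, smul_zero]⟩

variable {𝒳 i W} {V : Type*} [AddCommGroup V] [Module R V]

theorem mem_germ {w : W} : w ∈ germ 𝒳 i W ↔ ∃ c ∈ 𝒳 i, c • w = 0 := Iff.rfl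

theorem sub_mem_germ {w w' : W} : w - w' ∈ germ 𝒳 i W ↔ ∃ c ∈ 𝒳 i, c • w = c • w' := by
  simp only [mem_germ, smul_sub, sub_eq_zero]

theorem germ_map (f : W →ₗ[R] V) {w : W} (h : w ∈ germ 𝒳 i W) : f w ∈ germ 𝒳 i V := by
  obtain ⟨c, hc, h⟩ := h
  exact ⟨c, hc, by rw [← map_smul, h, map_zero]⟩

theorem germ_smul {f : R} (h : f ∈ germ 𝒳 i R) (w : W) : f • w ∈ germ 𝒳 i W :=
  germ_map (LinearMap.toSpanSingleton R W w) h

variable [Algebra ℝ R]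

theorem germ_of_two {w : W} (h : (2 : R) • w ∈ germ 𝒳 i W) : w ∈ germ 𝒳 i W := by
  obtain ⟨c, hc, h⟩ := h
  refine ⟨c, hc, LieAlgebroid.eq_of_two_smul_eq R ?_⟩
  rw [smul_zero, ← h, smul_comm c, ← Int.cast_smul_eq_zsmul R]
  norm_num

/-- Where c' does not vanish c equals one and has derivative zero. Algebraically, this is the
derivative of c' c = c' multiplied by c', hence the square. -/
theorem sq_mul_derivation_eq_zero {c c' : R} (h : c' * c = c') (D : Derivation ℝ R R) :
    c' * c' * D c = 0 := by
  have h1 := congrArg D h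
  rw [D.leibniz, smul_eq_mul, smul_eq_mul] at h1
  linear_combination c' * h1 - D c' * h

theorem germ_derEnd (h𝒳 : Absorbing 𝒳) {D : Derivation ℝ R R} (δ : DerEnd D W) {w : W}
    (h : w ∈ germ 𝒳 i W) : δ w ∈ germ 𝒳 i W := by
  obtain ⟨c, hc, h⟩ := h
  obtain ⟨c', hc', hcc⟩ := h𝒳 i c hc
  refine ⟨c' * c', mul_mem hc' hc', ?_⟩
  have h1 := congrArg δ h
  rw [δ.leibniz, map_zero] at h1
  have h2 : c' * c' = c' * c' * c := by rw [mul_assoc, hcc]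
  rw [h2, mul_smul _ c, eq_neg_of_add_eq_zero_right h1, smul_neg, smul_smul,
    sq_mul_derivation_eq_zero hcc, zero_smul, neg_zero]

variable {E E' : Type*} [AddCommGroup E] [Module R E] [AddCommGroup E'] [Module R E']
  {p : E →ₗ[R] E' →ₗ[R] R} {n : ℕ}

/-- A frame is finite, so the product of the cutoffs that work for its members works for all
sections at once. -/
theorem germ_hom (h : HasFrames p n 𝒳) {f : E →ₗ[R] W} (hf : ∀ X, f X ∈ germ 𝒳 i W) :
    ∃ c ∈ 𝒳 i, ∀ X, c • f X = 0 := by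
  obtain ⟨c, hc, e, ε, hF⟩ := h i
  choose c' hc' hz using fun a => hf (e a)
  refine ⟨(∏ a, c' a) * c, mul_mem (prod_mem fun a _ => hc' a) hc, fun X => ?_⟩
  rw [mul_smul, ← map_smul, hF.left, map_smul, map_sum, smul_smul, mul_comm, mul_smul,
    Finset.smul_sum]
  refine (congrArg _ (Finset.sum_eq_zero fun a _ => ?_)).trans (smul_zero c)
  rw [map_smul, smul_comm, ← Finset.prod_erase_mul _ _ (Finset.mem_univ a), mul_smul, hz,
    smul_zero, smul_zero]

theorem germ_of_apply_frame {c : R} (hc : c ∈ 𝒳 i) {e : Fin n → E} {ε : Fin n → E'}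
    (h : IsFrame p c e ε) {ρ : E' [⋀^Fin n]→ₗ[R] W} (hρ : ρ ε ∈ germ 𝒳 i W) :
    ρ ∈ germ 𝒳 i (E' [⋀^Fin n]→ₗ[R] W) := by
  obtain ⟨c', hc', h'⟩ := hρ
  refine ⟨c' * c ^ n, mul_mem hc' (pow_mem hc n), ?_⟩
  ext θ
  change (c' * c ^ n) • ρ θ = 0
  rw [mul_smul, h.alt_apply, smul_comm c', smul_comm c', h', smul_zero, smul_zero]

theorem germ_alt_update {c : R} (hc : c ∈ 𝒳 i) {e : Fin n → E} {ε : Fin n → E'}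
    (h : IsFrame p c e ε) (ρ : E' [⋀^Fin n]→ₗ[R] W) (j : Fin n) (θ : E') :
    ρ (Function.update ε j θ) - p (e j) θ • ρ ε ∈ germ 𝒳 i W := by
  rw [sub_mem_germ]
  refine ⟨c, hc, ?_⟩
  have h0 (a : Fin n) (ha : a ≠ j) : ρ (Function.update ε j (ε a)) = 0 :=
    ρ.map_eq_zero_of_eq _ (by rw [Function.update_self, Function.update_of_ne ha]) ha.symm
  rw [← ρ.map_update_smul, h.right, ρ.map_update_smul]
  have h1 := ρ.map_update_sum Finset.univ (i := j) (fun a => p (e a) θ • ε a) ε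
  rw [h1]
  congr 1
  rw [Finset.sum_eq_single j]
  · rw [ρ.map_update_smul, Function.update_eq_self]
  · intro a _ ha
    rw [ρ.map_update_smul, h0 a ha, smul_zero]
  · exact fun h => (h (Finset.mem_univ j)).elim

end Germs

/-! ### Δ in degree zero and in top degree -/

section LocalFormulas
variable {R : Type*} [CommRing R] [Algebra ℝ R] {E E' : Type*} [AddCommGroup E] [Module R E]
  [AddCommGroup E'] [Module R E'] {p : E →ₗ[R] E' →ₗ[R] R}
  {I : Type*} {n m : ℕ} {𝒳 : I → Submonoid R} {L : Type*} [AddCommGroup L] [Module R L]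
  {i : I}

/-- The form `l₀` is a frame of the line bundle near `i`, with dual frame `ev`. -/
structure IsLineFrame (𝒳 : I → Submonoid R) (i : I) (l₀ : L) (ev : L →ₗ[R] R) : Prop where
  expand : ∀ l, l - ev l • l₀ ∈ germ 𝒳 i L
  dual : ev l₀ - 1 ∈ germ 𝒳 i R

theorem IsLine.exists_isLineFrame (h : IsLine 𝒳 L) (i : I) :
    ∃ (l₀ : L) (ev : L →ₗ[R] R), IsLineFrame 𝒳 i l₀ ev := by
  obtain ⟨c, hc, l₀, ev, h1, h2⟩ := h i
  refine ⟨l₀, ev, fun l => sub_mem_germ.2 ⟨c, hc, h1 l⟩, sub_mem_germ.2 ⟨c, hc, ?_⟩⟩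
  rw [smul_eq_mul, smul_eq_mul, h2, mul_one]

variable {l₀ : L} {ev : L →ₗ[R] R}

theorem IsLineFrame.evTwo (hl : IsLineFrame 𝒳 i l₀ ev) (f : R) :
    LieBialgd.evTwo ev (f • (l₀ ⊗ₜ l₀)) - f ∈ germ 𝒳 i R := by
  rw [map_smul, evTwo_tmul, smul_eq_mul]
  have h : f * (ev l₀ * ev l₀) - f = (f * (ev l₀ + 1)) • (ev l₀ - 1) := by
    rw [smul_eq_mul]; ring
  rw [h]
  exact Submodule.smul_mem _ _ hl.dual

theorem IsLineFrame.of_smul (hl : IsLineFrame 𝒳 i l₀ ev) {f : R} (h : f • l₀ ∈ germ 𝒳 i L) :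
    f ∈ germ 𝒳 i R := by
  have h1 := germ_map ev h
  rw [map_smul, smul_eq_mul] at h1
  have h2 : f = f * ev l₀ - f • (ev l₀ - 1) := by rw [smul_eq_mul]; ring
  rw [h2]
  exact Submodule.sub_mem _ h1 (Submodule.smul_mem _ _ hl.dual)

variable (q : L ⊗[R] L ≃ₗ[R] E [⋀^Fin n]→ₗ[R] TopForm R m)

theorem IsLineFrame.of_smul_square (hl : IsLineFrame 𝒳 i l₀ ev) {f : R}
    (h : f • q (l₀ ⊗ₜ l₀) ∈ germ 𝒳 i (E [⋀^Fin n]→ₗ[R] TopForm R m)) : f ∈ germ 𝒳 i R := by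
  have h1 := germ_map (LieBialgd.evTwo ev ∘ₗ q.symm.toLinearMap) h
  rw [LinearMap.comp_apply, map_smul, LinearEquiv.coe_coe, LinearEquiv.symm_apply_apply] at h1
  have h2 := Submodule.sub_mem _ h1 (hl.evTwo f)
  rwa [sub_sub_cancel] at h2

/-- If the square of a frame is an eigenvector of a Lie derivative, then so is the frame, for half
of the eigenvalue. -/
theorem IsLineFrame.half (hl : IsLineFrame 𝒳 i l₀ ev) {δ : L → L} {f : R}
    {T : E [⋀^Fin n]→ₗ[R] TopForm R m} (hT : q (δ l₀ ⊗ₜ l₀ + l₀ ⊗ₜ δ l₀) = T)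
    (h : T - f • q (l₀ ⊗ₜ l₀) ∈ germ 𝒳 i (E [⋀^Fin n]→ₗ[R] TopForm R m)) :
    (2 : R) • δ l₀ - f • l₀ ∈ germ 𝒳 i L := by
  have h1 := germ_map (LieBialgd.evTwo ev ∘ₗ q.symm.toLinearMap) h
  rw [← hT, ← map_smul, alt_map_sub, LinearMap.comp_apply, LinearEquiv.coe_coe,
    LinearEquiv.symm_apply_apply, map_sub, map_add, evTwo_tmul, evTwo_tmul] at h1
  have h2 := Submodule.add_mem _ h1 (hl.evTwo f)
  have h3 : 2 * ev (δ l₀) - f ∈ germ 𝒳 i R := by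
    have h4 := Submodule.sub_mem _ h2 (Submodule.smul_mem _ (2 * ev (δ l₀)) hl.dual)
    rw [smul_eq_mul] at h4
    convert h4 using 1
    ring
  have h5 := Submodule.add_mem _ (germ_smul h3 l₀)
    (Submodule.smul_mem _ (2 : R) (hl.expand (δ l₀)))
  convert h5 using 1
  module

variable [p.IsPerfPair] (H : Regular p n m 𝒳 L) (𝔞 : LieAlgebroid R E) {𝔟 : LieAlgebroid R E'}
  {nabla : 𝔟.Conn L} {φ : R}

theorem dOp_cst (nabla : 𝔟.Conn L) (l : L) (θ : E') :
    inner θ (LieAlgebroid.dOp nabla (cst R E' l)) = cst R E' (nabla.act θ l) := by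
  have h := LinearMap.congr_fun (LieAlgebroid.inner_mul_dOp nabla θ) (cst R E' l)
  refine h.trans ?_
  change lieOp _ _ (cst R E' l) - LieAlgebroid.dOp nabla (inner θ (cst R E' l)) = _
  rw [inner_cst, map_zero, sub_zero, cst_op_lieOp]
  rfl

theorem grad_smul_eq_zero {c c' : R} (h : c' * c = c') : (c' * c') • 𝔞.grad p c = 0 := by
  refine pairing_ext (p := p) fun X => ?_
  rw [map_smul, 𝔞.pairing_grad p, smul_eq_mul, sq_mul_derivation_eq_zero h, map_zero]

theorem Regular.germ_delOp {w : Forms R E' L} (h : w ∈ germ 𝒳 i (Forms R E' L)) :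
    H.delOp 𝔞 q w ∈ germ 𝒳 i (Forms R E' L) := by
  obtain ⟨c, hc, h⟩ := h
  obtain ⟨c', hc', hcc⟩ := H.absorbing i c hc
  refine ⟨c' * c', mul_mem hc' hc', ?_⟩
  have h1 : H.delOp 𝔞 q (c • w) = c • H.delOp 𝔞 q w + inner (𝔞.grad p c) w :=
    LinearMap.congr_fun (H.delOp_mul_mulOp 𝔞 q c) w
  rw [h, map_zero] at h1
  have h2 : c' * c' = c' * c' * c := by rw [mul_assoc, hcc]
  rw [h2, mul_smul _ c, eq_neg_of_add_eq_zero_left h1.symm, smul_neg, ← inner_smul_left,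
    grad_smul_eq_zero 𝔞 hcc, inner_zero_left]
  exact neg_zero

theorem Regular.germ_dOp (H : Regular p n m 𝒳 L) (nabla : 𝔟.Conn L) {w : Forms R E' L}
    (h : w ∈ germ 𝒳 i (Forms R E' L)) :
    LieAlgebroid.dOp nabla w ∈ germ 𝒳 i (Forms R E' L) := by
  obtain ⟨c, hc, h⟩ := h
  obtain ⟨c', hc', hcc⟩ := H.absorbing i c hc
  refine ⟨c' * c', mul_mem hc' hc', ?_⟩
  have h1 : LieAlgebroid.dOp nabla (c • w) = c • LieAlgebroid.dOp nabla w +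
      outer (p (𝔟.grad p.flip c)) w := by
    rw [pairing_grad_flip]
    exact LinearMap.congr_fun (LieAlgebroid.dOp_mul_mulOp nabla c) w
  rw [h, map_zero] at h1
  have h2 : c' * c' = c' * c' * c := by rw [mul_assoc, hcc]
  rw [h2, mul_smul _ c, eq_neg_of_add_eq_zero_left h1.symm, smul_neg, ← outer_smul_left,
    ← map_smul, grad_smul_eq_zero 𝔟 hcc, map_zero, outer_zero_left]
  exact neg_zero

variable {q} (hφ : H.laplace 𝔞 q nabla = mulOp φ)
include hφ

/-- The square of the Dirac operator on a section of the line bundle. -/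
theorem Regular.laplace_cst_germ {X₀ : E} {l₀ : L}
    (h : ∀ θ, (2 : R) • nabla.act θ l₀ - p X₀ θ • l₀ ∈ germ 𝒳 i L) :
    (2 * φ) • l₀ - H.halfLie 𝔞 q X₀ l₀ ∈ germ 𝒳 i L := by
  let g : E' →ₗ[R] L :=
    { toFun := fun θ => (2 : R) • nabla.act θ l₀ - p X₀ θ • l₀
      map_add' := fun θ η => by
        rw [map_add, map_add, AddMonoidHom.add_apply]
        module
      map_smul' := fun f θ => by
        rw [map_smul, map_smul, RingHom.id_apply]
        change (2 : R) • f • nabla.act θ l₀ - (f * p X₀ θ) • l₀ = _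
        module }
  obtain ⟨c, hc, hz⟩ := germ_hom H.frames.flip (f := g) h
  -- Near i the hypothesis says 2 d l₀ = X₀ ⊗ l₀. One cutoff has to serve for all θ, which is what
  -- `hz` provides.
  have h1 : (2 : R) • LieAlgebroid.dOp nabla (cst R E' l₀) - outer (p X₀) (cst R E' l₀) ∈
      germ 𝒳 i (Forms R E' L) := by
    refine ⟨c, hc, forms_ext_inner ?_ fun θ => ?_⟩
    · change c • ((2 : R) • (0 : E' [⋀^Fin 0]→ₗ[R] L) - outer (p X₀) (cst R E' l₀) 0) = 0
      rw [outer_zero_apply, smul_zero, sub_zero, smul_zero]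
    · have h2 : (2 : R) • cst R E' (nabla.act θ l₀) - p X₀ θ • cst R E' l₀ = cst R E' (g θ) := by
        rw [← cst_smul, ← cst_smul, eq_comm, ← sub_eq_zero, sub_sub_eq_add_sub, ← cst_add,
          sub_eq_zero]
        congr 1
        change (2 : R) • nabla.act θ l₀ - p X₀ θ • l₀ + p X₀ θ • l₀ = _
        abel
      rw [inner_smul, map_sub, inner_smul, dOp_cst, inner_outer_cst, map_zero, h2, ← cst_smul, hz]
      exact homog_zero 0
  have h3 := H.germ_delOp q 𝔞 h1
  -- As ∂̄ l₀ = 0, Δ l₀ is ∂̄ d l₀, and ∂̄(X₀ ⊗ l₀) is L_{X₀} l₀. Hence 2φ l₀ = L_{X₀} l₀ near i.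
  have h4 : H.delOp 𝔞 q (LieAlgebroid.dOp nabla (cst R E' l₀)) = φ • cst R E' l₀ := by
    have := LinearMap.congr_fun hφ (cst R E' l₀)
    change LieAlgebroid.dOp nabla (H.delOp 𝔞 q (cst R E' l₀)) +
      H.delOp 𝔞 q (LieAlgebroid.dOp nabla (cst R E' l₀)) = φ • cst R E' l₀ at this
    rwa [H.delOp_cst, map_zero, zero_add] at this
  have h5 : H.delOp 𝔞 q (outer (p X₀) (cst R E' l₀)) = cst R E' (H.halfLie 𝔞 q X₀ l₀) := by
    have := LinearMap.congr_fun (H.delOp_mul_outer 𝔞 q X₀) (cst R E' l₀)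
    change _ = lieOp _ _ (cst R E' l₀) - outer (p X₀) (H.delOp 𝔞 q (cst R E' l₀)) at this
    rw [H.delOp_cst, map_zero, sub_zero, cst_op_lieOp] at this
    exact this
  have h6 : (2 : R) • LieAlgebroid.dOp nabla (cst R E' l₀) =
      (2 : ℤ) • LieAlgebroid.dOp nabla (cst R E' l₀) := by
    rw [← Int.cast_smul_eq_zsmul R]
    norm_num
  rw [map_sub, h6, map_zsmul, h4, h5] at h3
  obtain ⟨c', hc', h7⟩ := h3
  refine ⟨c', hc', ?_⟩
  have h8 := DFunLike.congr_fun (congrFun h7 0) Fin.elim0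
  change c' • ((2 : ℤ) • φ • cst R E' l₀ 0 Fin.elim0 -
    cst R E' (H.halfLie 𝔞 q X₀ l₀) 0 Fin.elim0) = 0 at h8
  rw [cst_zero_apply, cst_zero_apply] at h8
  rw [← h8]
  module

/-- The square of the Dirac operator on forms of top degree. -/
theorem Regular.laplace_top_germ {ξ₀ : E'} {ν : E' [⋀^Fin n]→ₗ[R] L}
    (h : ∀ X, (2 : R) • (H.coHalfConn 𝔞 q).act X ν - p X ξ₀ • ν ∈
      germ 𝒳 i (E' [⋀^Fin n]→ₗ[R] L)) :
    (2 * φ) • ν - (𝔟.ad ξ₀).alt n (nabla.at ξ₀) ν ∈ germ 𝒳 i (E' [⋀^Fin n]→ₗ[R] L) := by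
  let g : E →ₗ[R] (E' [⋀^Fin n]→ₗ[R] L) :=
    { toFun := fun X => (2 : R) • (H.coHalfConn 𝔞 q).act X ν - p X ξ₀ • ν
      map_add' := fun X Y => by
        rw [map_add, map_add, AddMonoidHom.add_apply, LinearMap.add_apply]
        module
      map_smul' := fun f X => by
        rw [map_smul, map_smul, RingHom.id_apply]
        change (2 : R) • f • (H.coHalfConn 𝔞 q).act X ν - (f * p X ξ₀) • ν = _
        module }
  obtain ⟨c, hc, hz⟩ := germ_hom H.frames (f := g) h
  have hN (w : Forms R E' L) {j : ℕ} (hj : n < j) : w j = 0 := H.frames.alt_eq_zero H.sep hj _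
  have houter (X : E) : outer (p X) (homog n ν) = 0 := by
    rw [outer_homog, hN (outer (p X) (homog n ν)) n.lt_succ_self, homog_zero]
  have hd : LieAlgebroid.dOp nabla (homog n ν) = 0 := by
    rw [dOp_homog, H.frames.alt_eq_zero H.sep n.lt_succ_self (LieAlgebroid.diff nabla ν),
      homog_zero]
  -- Near i, 2∂̄ν = ι_{ξ₀} ν. This is tested by exterior products with sections X: since X ∧ ν = 0,
  -- they turn ∂̄ν into the action of X on ν and the contraction into ⟨ξ₀, X⟩ν.
  have h1 : (2 : ℤ) • H.delOp 𝔞 q (homog n ν) - inner ξ₀ (homog n ν) ∈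
      germ 𝒳 i (Forms R E' L) := by
    refine ⟨c, hc, funext fun j => ?_⟩
    rcases lt_or_ge j n with hj | hj
    · refine H.frames.component_eq_zero H.sep hj fun X => ?_
      have e1 : outer (p X) (H.delOp 𝔞 q (homog n ν)) =
          homog n ((H.coHalfConn 𝔞 q).act X ν) := by
        have := LinearMap.congr_fun (H.outer_mul_delOp 𝔞 q X) (homog n ν)
        change _ = lieOp _ _ (homog n ν) - H.delOp 𝔞 q (outer (p X) (homog n ν)) at this
        rw [houter, map_zero, sub_zero, lieOp_homog] at this
        exact this
      have e2 : outer (p X) (inner ξ₀ (homog n ν)) = p X ξ₀ • homog n ν := by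
        have := LinearMap.congr_fun (inner_outer (W := L) ξ₀ (p X)) (homog n ν)
        change inner ξ₀ (outer (p X) (homog n ν)) = p X ξ₀ • homog n ν -
          outer (p X) (inner ξ₀ (homog n ν)) at this
        rw [houter, map_zero] at this
        exact (sub_eq_zero.1 this.symm).symm
      rw [outer_smul, map_sub, map_zsmul, e1, e2]
      rcases eq_or_ne (j + 1) n with hj' | hj'
      · rw [hj']
        change c • ((2 : ℤ) • homog n ((H.coHalfConn 𝔞 q).act X ν) n - p X ξ₀ • homog n ν n) = 0
        rw [homog_same, homog_same, ← hz X]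
        change _ = c • ((2 : R) • (H.coHalfConn 𝔞 q).act X ν - p X ξ₀ • ν)
        module
      · change c • ((2 : ℤ) • homog n ((H.coHalfConn 𝔞 q).act X ν) (j + 1) -
          p X ξ₀ • homog n ν (j + 1)) = 0
        rw [homog_of_ne hj', homog_of_ne hj', smul_zero, smul_zero, sub_zero, smul_zero]
    · change c • ((2 : ℤ) • H.delOp 𝔞 q (homog n ν) j - inner ξ₀ (homog n ν) j) = 0
      rw [H.delOp_of_le 𝔞 q hj, inner_apply, hN (homog n ν) (Nat.lt_succ_of_le hj),
        AlternatingMap.curryLeft_zero, LinearMap.zero_apply, smul_zero, sub_zero, smul_zero]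
  have h2 := H.germ_dOp nabla h1
  -- As dν = 0, Δν is d∂̄ν, and d ι_{ξ₀} ν is L_{ξ₀} ν. Hence 2φν = L_{ξ₀} ν near i.
  have h3 : LieAlgebroid.dOp nabla (H.delOp 𝔞 q (homog n ν)) = φ • homog n ν := by
    have := LinearMap.congr_fun hφ (homog n ν)
    change LieAlgebroid.dOp nabla (H.delOp 𝔞 q (homog n ν)) +
      H.delOp 𝔞 q (LieAlgebroid.dOp nabla (homog n ν)) = φ • homog n ν at this
    rwa [hd, map_zero, add_zero] at this
  have h4 : LieAlgebroid.dOp nabla (inner ξ₀ (homog n ν)) =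
      homog n ((𝔟.ad ξ₀).alt n (nabla.at ξ₀) ν) := by
    have := LinearMap.congr_fun (LieAlgebroid.dOp_mul_inner nabla ξ₀) (homog n ν)
    change _ = lieOp _ _ (homog n ν) - inner ξ₀ (LieAlgebroid.dOp nabla (homog n ν)) at this
    rw [hd, map_zero, sub_zero, lieOp_homog] at this
    exact this
  rw [map_sub, map_zsmul, h3, h4] at h2
  obtain ⟨c', hc', h7⟩ := h2
  refine ⟨c', hc', ?_⟩
  have h8 := congrFun h7 n
  change c' • ((2 : ℤ) • φ • homog n ν n - homog n ((𝔟.ad ξ₀).alt n (nabla.at ξ₀) ν) n) = 0 at h8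
  rw [homog_same, homog_same] at h8
  rw [← h8]
  module

end LocalFormulas

/-! ### Comparison of the two Dirac operators -/

section Comparison
variable {R : Type*} [CommRing R] [Algebra ℝ R] {E E' : Type*} [AddCommGroup E] [Module R E]
  [AddCommGroup E'] [Module R E'] {p : E →ₗ[R] E' →ₗ[R] R}
  {I : Type*} {n m : ℕ} {𝒳 : I → Submonoid R} {L : Type*} [AddCommGroup L] [Module R L]
  {L' : Type*} [AddCommGroup L'] [Module R L'] {i : I}

theorem germ_alt_apply {P W : Type*} [AddCommGroup P] [Module R P] [AddCommGroup W] [Module R W]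
    {k : ℕ} {ρ : P [⋀^Fin k]→ₗ[R] W} (h : ρ ∈ germ 𝒳 i (P [⋀^Fin k]→ₗ[R] W)) (v : Fin k → P) :
    ρ v ∈ germ 𝒳 i W := by
  obtain ⟨c, hc, h⟩ := h
  exact ⟨c, hc, DFunLike.congr_fun h v⟩

/-- The Lie derivative of a form of top degree, evaluated on a frame. -/
theorem germ_alt_frame {W : Type*} [AddCommGroup W] [Module R W] {D : Derivation ℝ R R}
    (δ : DerEnd D E') (ν : DerEnd D W) {c : R} (hc : c ∈ 𝒳 i) {e : Fin n → E} {ε : Fin n → E'}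
    (h : IsFrame p c e ε) (ρ : E' [⋀^Fin n]→ₗ[R] W) :
    δ.alt n ν ρ ε - (ν (ρ ε) - (∑ j, p (e j) (δ (ε j))) • ρ ε) ∈ germ 𝒳 i W := by
  rw [DerEnd.alt_apply, Finset.sum_smul, sub_sub_sub_cancel_left, ← Finset.sum_sub_distrib]
  refine Submodule.sum_mem _ fun j _ => ?_
  rw [← Submodule.neg_mem_iff, neg_sub]
  exact germ_alt_update hc h ρ j _

variable {l₀ : L} {ev : L →ₗ[R] R} {l₀' : L'} {ev' : L' →ₗ[R] R}
  {q : L ⊗[R] L ≃ₗ[R] E [⋀^Fin n]→ₗ[R] TopForm R m}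
  {q' : L' ⊗[R] L' ≃ₗ[R] E' [⋀^Fin n]→ₗ[R] TopForm R m}

/-- The Lie derivative of the square of a frame of the line bundle, evaluated on a frame. -/
theorem IsLineFrame.trace (hl : IsLineFrame 𝒳 i l₀' ev') {D : Derivation ℝ R R} (δ : DerEnd D E')
    (ν : DerEnd D L') (hν : ∀ l l', q' (ν l ⊗ₜ l' + l ⊗ₜ ν l') = δ.alt n (lieForm m D) (q' (l ⊗ₜ l')))
    {c : R} (hc : c ∈ 𝒳 i) {e : Fin n → E} {ε : Fin n → E'} (h : IsFrame p c e ε) :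
    (2 * ev' (ν l₀')) • q' (l₀' ⊗ₜ l₀') ε - (lieForm m D (q' (l₀' ⊗ₜ l₀') ε) -
      (∑ j, p (e j) (δ (ε j))) • q' (l₀' ⊗ₜ l₀') ε) ∈ germ 𝒳 i (TopForm R m) := by
  have h1 := germ_alt_frame δ (lieForm m D) hc h (q' (l₀' ⊗ₜ l₀'))
  rw [← hν] at h1
  let F : L' →ₗ[R] L' ⊗[R] L' :=
    { toFun := fun l => l ⊗ₜ l₀' + l₀' ⊗ₜ l
      map_add' := fun l l' => by
        rw [TensorProduct.add_tmul, TensorProduct.tmul_add]; abel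
      map_smul' := fun f l => by
        rw [← TensorProduct.smul_tmul', TensorProduct.tmul_smul, RingHom.id_apply, smul_add] }
  have h2 := germ_alt_apply (germ_map (q'.toLinearMap ∘ₗ F) (hl.expand (ν l₀'))) ε
  have h3 : (q'.toLinearMap ∘ₗ F) (ν l₀' - ev' (ν l₀') • l₀') ε =
      q' (ν l₀' ⊗ₜ l₀' + l₀' ⊗ₜ ν l₀') ε - (2 * ev' (ν l₀')) • q' (l₀' ⊗ₜ l₀') ε := by
    rw [LinearMap.comp_apply, LinearEquiv.coe_coe, map_sub, map_smul]
    change q' ((ν l₀' ⊗ₜ l₀' + l₀' ⊗ₜ ν l₀') - ev' (ν l₀') • (l₀' ⊗ₜ l₀' + l₀' ⊗ₜ l₀')) ε = _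
    rw [← alt_map_sub, map_smul, ← two_smul R (l₀' ⊗ₜ[R] l₀'), map_smul]
    change _ - ev' (ν l₀') • (2 : R) • q' (l₀' ⊗ₜ l₀') ε = _
    rw [smul_smul, mul_comm]
    rfl
  rw [h3] at h2
  have h4 := Submodule.sub_mem _ h1 h2
  convert h4 using 1
  abel

theorem IsLineFrame.of_smul_frame (hl : IsLineFrame 𝒳 i l₀' ev') {c : R} (hc : c ∈ 𝒳 i)
    {e : Fin n → E} {ε : Fin n → E'} (h : IsFrame p c e ε) {f : R}
    (hf : f • q' (l₀' ⊗ₜ l₀') ε ∈ germ 𝒳 i (TopForm R m)) : f ∈ germ 𝒳 i R :=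
  hl.of_smul_square q' (germ_of_apply_frame hc h (ρ := f • q' (l₀' ⊗ₜ l₀')) hf)

/-- The eigenvalues of an infinitesimal automorphism on the frames `l₀'` and `e₁ ∧ ⋯ ∧ eₙ ⊗ l₀`
agree. -/
theorem germ_alt_top (h𝒳 : Absorbing 𝒳) (hl : IsLineFrame 𝒳 i l₀ ev)
    (hl' : IsLineFrame 𝒳 i l₀' ev') {c : R} (hc : c ∈ 𝒳 i) {e : Fin n → E} {ε : Fin n → E'}
    (hf : IsFrame p c e ε) {D : Derivation ℝ R R} {κ κ' : R} (hκ : κ' * κ = 1) (hD : D κ = 0)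
    (hq : q' (l₀' ⊗ₜ l₀') ε - κ • q (l₀ ⊗ₜ l₀) e ∈ germ 𝒳 i (TopForm R m))
    (δ : DerEnd D E) (δ' : DerEnd D E') (hδ : ∀ X θ, D (p X θ) = p (δ X) θ + p X (δ' θ))
    (ν : DerEnd D L) (ν' : DerEnd D L')
    (hν : ∀ l l', q (ν l ⊗ₜ l' + l ⊗ₜ ν l') = δ.alt n (lieForm m D) (q (l ⊗ₜ l')))
    (hν' : ∀ l l', q' (ν' l ⊗ₜ l' + l ⊗ₜ ν' l') = δ'.alt n (lieForm m D) (q' (l ⊗ₜ l')))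
    {ρ : E' [⋀^Fin n]→ₗ[R] L} (hρ : ρ ε - l₀ ∈ germ 𝒳 i L) :
    δ'.alt n ν ρ - ev' (ν' l₀') • ρ ∈ germ 𝒳 i (E' [⋀^Fin n]→ₗ[R] L) := by
  have h1 := hl.trace δ ν hν hc hf.flip
  have h2 := hl'.trace δ' ν' hν' hc hf
  simp only [LinearMap.flip_apply] at h1
  set s := q (l₀ ⊗ₜ l₀) e with hs
  set s' := q' (l₀' ⊗ₜ l₀') ε with hs'
  set T := ∑ j, p (δ (e j)) (ε j) with hT
  set T' := ∑ j, p (e j) (δ' (ε j)) with hT'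
  set α := ev (ν l₀) with hα
  set α' := ev' (ν' l₀') with hα'
  -- The pairings ⟨e_j, ε_j⟩ are constant near i, so the traces on dual frames are opposite.
  have h3 : T + T' ∈ germ 𝒳 i R := by
    rw [hT, hT', ← Finset.sum_add_distrib]
    refine Submodule.sum_mem _ fun j _ => ?_
    have h4 : p (e j) (ε j) - 1 ∈ germ 𝒳 i R := by
      refine sub_mem_germ.2 ⟨c, hc, ?_⟩
      rw [smul_eq_mul, smul_eq_mul, hf.dual, if_pos rfl, mul_one]
    have h5 := germ_derEnd h𝒳 (DerEnd.self D) h4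
    change D (p (e j) (ε j) - 1) ∈ _ at h5
    rwa [map_sub, D.map_one_eq_zero, sub_zero, hδ] at h5
  have h4 := germ_derEnd h𝒳 (lieForm m D) hq
  rw [map_sub, (lieForm m D).leibniz, hD, zero_smul, zero_add] at h4
  -- With s' = κs and T' = −T near i, the two trace formulas say 2α' s = L s + T s and 2α s = L s −
  -- T s. So α' = α + T, which is the eigenvalue on e₁ ∧ ⋯ ∧ eₙ ⊗ l₀.
  have h5 : (α' - α - T) • s ∈ germ 𝒳 i (TopForm R m) := by
    refine germ_of_two ?_
    have h6 := Submodule.smul_mem _ κ' (Submodule.sub_mem _ (Submodule.add_mem _ h2 h4)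
      (Submodule.smul_mem _ (2 * α' + T') hq))
    have h7 := Submodule.sub_mem _ (Submodule.sub_mem _ h6 h1) (germ_smul h3 s)
    have e : κ' • ((2 * α') • s' - (lieForm m D s' - T' • s') +
        (lieForm m D s' - κ • lieForm m D s) - (2 * α' + T') • (s' - κ • s)) =
        (κ' * κ) • ((2 * α' + T') • s - lieForm m D s) := by module
    rw [e, hκ] at h7
    convert h7 using 1
    module
  have h6 := hl.of_smul_frame hc hf.flip h5
  refine germ_of_apply_frame hc hf ?_
  have h7 := germ_alt_frame δ' ν hc hf ρ
  have h8 := germ_derEnd h𝒳 ν hρ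
  rw [map_sub] at h8
  have h9 := hl.expand (ν l₀)
  change δ'.alt n ν ρ ε - α' • ρ ε ∈ germ 𝒳 i L
  have h10 := Submodule.smul_mem _ (T' + α') hρ
  have h11 := Submodule.sub_mem _ (Submodule.sub_mem _ (Submodule.sub_mem _ (Submodule.add_mem _
    (Submodule.add_mem _ h7 h8) h9) h10) (germ_smul h6 l₀)) (germ_smul h3 l₀)
  convert h11 using 1
  module

variable [p.IsPerfPair] (H : Regular p n m 𝒳 L) (H' : Regular p.flip n m 𝒳 L')
  {𝔞 : LieAlgebroid R E} {𝔟 : LieAlgebroid R E'} {nabla : 𝔟.Conn L} {nabla' : 𝔞.Conn L'}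
  (hn : IsHalfAction p 𝔟 q nabla) (hn' : IsHalfAction p.flip 𝔞 q' nabla') {φ φ' : R}

include H H' hn hn' in
/-- The squares of the two Dirac operators agree near `i`. -/
theorem Regular.laplace_germ_eq (hφ : H.laplace 𝔞 q nabla = mulOp φ)
    (hφ' : H'.laplace 𝔟 q' nabla' = mulOp φ') (hl : IsLineFrame 𝒳 i l₀ ev)
    (hl' : IsLineFrame 𝒳 i l₀' ev') {c : R} (hc : c ∈ 𝒳 i) {e : Fin n → E} {ε : Fin n → E'}
    (hf : IsFrame p c e ε) {κ κ' : R} (hκ : κ' * κ = 1)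
    (hD : ∀ D : Derivation ℝ R R, D κ = 0)
    (hq : q' (l₀' ⊗ₜ l₀') ε - κ • q (l₀ ⊗ₜ l₀) e ∈ germ 𝒳 i (TopForm R m)) :
    φ - φ' ∈ germ 𝒳 i R := by
  let g : E →ₗ[R] R :=
    { toFun := fun X => 2 * ev' (nabla'.act X l₀')
      map_add' := fun X Y => by rw [map_add, AddMonoidHom.add_apply, map_add, mul_add]
      map_smul' := fun f X => by
        rw [map_smul, RingHom.id_apply]
        change 2 * ev' (f • nabla'.act X l₀') = _
        rw [map_smul, smul_eq_mul, smul_eq_mul, mul_left_comm] }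
  -- Twice the connection form of the frame l₀'. It is the modular section of A* for the square of
  -- l₀'.
  obtain ⟨ξ₀, hξ₀⟩ := p.flip.toPerfPair.surjective g
  have hξ (X : E) : p X ξ₀ = 2 * ev' (nabla'.act X l₀') := LinearMap.congr_fun hξ₀ X
  -- The top form e₁ ∧ ⋯ ∧ eₙ ⊗ l₀.
  let ρ : E' [⋀^Fin n]→ₗ[R] L :=
    (LinearMap.toSpanSingleton R L l₀).compAlternatingMap (wedgeSec p n e)
  have hρ : ρ ε - l₀ ∈ germ 𝒳 i L := by
    change wedgeSec p n e ε • l₀ - l₀ ∈ _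
    refine sub_mem_germ.2 ⟨c ^ n, pow_mem hc n, ?_⟩
    rw [smul_smul, hf.wedgeSec_eq]
  have h1 := H'.laplace_cst_germ 𝔟 hφ' (X₀ := ξ₀) (l₀ := l₀') (i := i) fun X => by
    have h := Submodule.smul_mem _ (2 : R) (hl'.expand (nabla'.act X l₀'))
    rw [smul_sub, smul_smul, ← hξ] at h
    exact h
  have h2 := H.laplace_top_germ 𝔞 hφ (ξ₀ := ξ₀) (ν := ρ) (i := i) fun X => by
    have h := germ_alt_top H.absorbing hl hl' hc hf hκ (hD (𝔞.anchor X)) hq (𝔞.ad X)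
      (𝔞.coad p X) (H.secAut 𝔞 q X).pairing (H.halfLie 𝔞 q X) (nabla'.at X)
      (H.halfLie_spec 𝔞 q X) (hn' X) hρ
    have h := Submodule.smul_mem _ (2 : R) h
    rw [smul_sub, smul_smul] at h
    rw [hξ]
    exact h
  -- L_{ξ₀} has one and the same eigenvalue on ρ and on l₀'. It is 2φ by `h2` and 2φ' by `h1`.
  have h3 := germ_alt_top H.absorbing hl hl' hc hf hκ (hD (𝔟.anchor ξ₀)) hq (𝔟.coad p.flip ξ₀)
    (𝔟.ad ξ₀) (dualAut hn ξ₀).pairing (nabla.at ξ₀) (H'.halfLie 𝔟 q' ξ₀) (hn ξ₀)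
    (H'.halfLie_spec 𝔟 q' ξ₀) hρ
  have h4 := germ_alt_apply (Submodule.add_mem _ h2 h3) ε
  have h5 : (2 * φ - ev' (H'.halfLie 𝔟 q' ξ₀ l₀')) • ρ ε ∈ germ 𝒳 i L := by
    convert h4 using 1
    rw [sub_add_sub_cancel, sub_smul]
    rfl
  have h6 := hl.of_smul (f := 2 * φ - ev' (H'.halfLie 𝔟 q' ξ₀ l₀')) (by
    have := Submodule.sub_mem _ h5 (Submodule.smul_mem _
      (2 * φ - ev' (H'.halfLie 𝔟 q' ξ₀ l₀')) hρ)
    rwa [← smul_sub, sub_sub_cancel] at this)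
  have h7 := germ_map ev' h1
  rw [map_sub, map_smul, smul_eq_mul] at h7
  have h8 := Submodule.smul_mem _ (2 * φ') hl'.dual
  have h9 := Submodule.add_mem _ (Submodule.sub_mem _ h6 h7) h8
  refine germ_of_two ?_
  convert h9 using 1
  rw [smul_eq_mul, smul_eq_mul]
  ring

end Comparison

/-! ### Square roots of functions and adapted frames -/

section Roots
variable {R : Type*} [CommRing R] [Algebra ℝ R] {E E' : Type*} [AddCommGroup E] [Module R E]
  [AddCommGroup E'] [Module R E'] {p : E →ₗ[R] E' →ₗ[R] R}
  {I : Type*} {n m : ℕ} {𝒳 : I → Submonoid R} {L : Type*} [AddCommGroup L] [Module R L]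
  {L' : Type*} [AddCommGroup L'] [Module R L'] {i : I}

/-- Locally, an invertible function is a square, up to a constant. -/
def HasRoots (𝒳 : I → Submonoid R) : Prop :=
  ∀ i (f f' : R), f * f' - 1 ∈ germ 𝒳 i R → ∃ h κ κ' : R, κ' * κ = 1 ∧
    (∀ D : Derivation ℝ R R, D κ = 0) ∧ f - κ * (h * h) ∈ germ 𝒳 i R

theorem germ_smul_sub {W : Type*} [AddCommGroup W] [Module R W] {x y : W} {f κ κ' r : R}
    (hx : x - f • y ∈ germ 𝒳 i W) (hf : f - κ * r ∈ germ 𝒳 i R) (hκ : κ' * κ = 1) :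
    r • y - κ' • x ∈ germ 𝒳 i W := by
  have h1 := Submodule.neg_mem _ (Submodule.smul_mem _ κ' (Submodule.add_mem _ hx (germ_smul hf y)))
  have h2 : -(κ' • (x - f • y + (f - κ * r) • y)) = (κ' * κ) • r • y - κ' • x := by module
  rwa [h2, hκ, one_smul] at h1

theorem germ_derEnd_sub (h𝒳 : Absorbing 𝒳) {W : Type*} [AddCommGroup W] [Module R W]
    {D : Derivation ℝ R R} (T : DerEnd D W) {x y : W} {κ r : R} (hx : y - κ • x ∈ germ 𝒳 i W)
    (hD : D κ = 0) (hr : T x - r • x ∈ germ 𝒳 i W) : T y - r • y ∈ germ 𝒳 i W := by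
  have h1 := germ_derEnd h𝒳 T hx
  rw [map_sub, T.leibniz, hD, zero_smul, zero_add] at h1
  have h2 := Submodule.sub_mem _ (Submodule.add_mem _ h1 (Submodule.smul_mem _ κ hr))
    (Submodule.smul_mem _ r hx)
  convert h2 using 1
  module

variable {l₀ : L} {ev : L →ₗ[R] R} {l₀' : L'} {ev' : L' →ₗ[R] R}
  {q : L ⊗[R] L ≃ₗ[R] E [⋀^Fin n]→ₗ[R] TopForm R m}
  {q' : L' ⊗[R] L' ≃ₗ[R] E' [⋀^Fin n]→ₗ[R] TopForm R m}

theorem IsLineFrame.expand_square (hl : IsLineFrame 𝒳 i l₀ ev) (t : L ⊗[R] L) :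
    t - LieBialgd.evTwo ev t • (l₀ ⊗ₜ l₀) ∈ germ 𝒳 i (L ⊗[R] L) := by
  induction t using TensorProduct.induction_on with
  | zero => rw [map_zero, zero_smul, sub_zero]; exact Submodule.zero_mem _
  | add x y hx hy =>
    have h := Submodule.add_mem _ hx hy
    convert h using 1
    rw [map_add]
    module
  | tmul l l' =>
    have h1 := germ_map ((TensorProduct.mk R L L).flip l') (hl.expand l)
    have h2 := germ_map (TensorProduct.mk R L L (ev l • l₀)) (hl.expand l')
    have h := Submodule.add_mem _ h1 h2
    convert h using 1
    rw [map_sub, map_sub, evTwo_tmul, map_smul]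
    simp only [LinearMap.flip_apply, TensorProduct.mk_apply, ← TensorProduct.smul_tmul',
      TensorProduct.tmul_smul]
    rw [sub_add_sub_cancel, smul_smul, mul_comm]

theorem IsLineFrame.exists_smul_square (hl : IsLineFrame 𝒳 i l₀ ev)
    (ψ : E [⋀^Fin n]→ₗ[R] TopForm R m) :
    ∃ f : R, ψ - f • q (l₀ ⊗ₜ l₀) ∈ germ 𝒳 i (E [⋀^Fin n]→ₗ[R] TopForm R m) := by
  refine ⟨LieBialgd.evTwo ev (q.symm ψ), ?_⟩
  obtain ⟨c, hc, h⟩ := hl.expand_square (q.symm ψ)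
  refine ⟨c, hc, ?_⟩
  have h' := congrArg q h
  rwa [map_smul, ← alt_map_sub, LinearEquiv.apply_symm_apply, map_smul, map_zero] at h'

theorem IsLineFrame.exists_smul_frame (hl : IsLineFrame 𝒳 i l₀' ev') {c : R} (hc : c ∈ 𝒳 i)
    {e : Fin n → E} {ε : Fin n → E'} (hf : IsFrame p c e ε) (s : TopForm R m) :
    ∃ f : R, s - f • q' (l₀' ⊗ₜ l₀') ε ∈ germ 𝒳 i (TopForm R m) := by
  obtain ⟨f, hf'⟩ := hl.exists_smul_square (q := q') (tensorForm (wedgeSec p n e) s)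
  refine ⟨f, ?_⟩
  have h1 := germ_alt_apply hf' ε
  change wedgeSec p n e ε • s - f • q' (l₀' ⊗ₜ l₀') ε ∈ _ at h1
  have h2 : s - wedgeSec p n e ε • s ∈ germ 𝒳 i (TopForm R m) := by
    refine sub_mem_germ.2 ⟨c ^ n, pow_mem hc n, ?_⟩
    rw [smul_smul, hf.wedgeSec_eq]
  have h3 := Submodule.add_mem _ h2 h1
  rwa [sub_add_sub_cancel] at h3

theorem IsLineFrame.rescale (hl : IsLineFrame 𝒳 i l₀ ev) {f f' : R}
    (hff : f * f' - 1 ∈ germ 𝒳 i R) : IsLineFrame 𝒳 i (f • l₀) (f' • ev) := by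
  refine ⟨fun l => ?_, ?_⟩
  · have h := Submodule.sub_mem _ (hl.expand l) (germ_smul hff (ev l • l₀))
    convert h using 1
    rw [LinearMap.smul_apply, smul_eq_mul]
    module
  · have h := Submodule.add_mem _ (Submodule.smul_mem _ (f * f') hl.dual) hff
    convert h using 1
    rw [LinearMap.smul_apply, map_smul, smul_eq_mul, smul_eq_mul, smul_eq_mul]
    ring

theorem smul_square (f : R) (l : L) : q ((f • l) ⊗ₜ (f • l)) = (f * f) • q (l ⊗ₜ l) := by
  rw [TensorProduct.smul_tmul_smul, map_smul]

/-- There are local frames of the two square roots with squares that agree up to a constant. -/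
theorem exists_adapted_frames (hF : HasFrames p n 𝒳) (hL : IsLine 𝒳 L) (hL' : IsLine 𝒳 L')
    (hroots : HasRoots 𝒳) (i : I) :
    ∃ (l₀ : L) (ev : L →ₗ[R] R) (l₀' : L') (ev' : L' →ₗ[R] R) (c : R) (e : Fin n → E)
      (ε : Fin n → E') (κ κ' : R), IsLineFrame 𝒳 i l₀ ev ∧ IsLineFrame 𝒳 i l₀' ev' ∧ c ∈ 𝒳 i ∧
      IsFrame p c e ε ∧ κ' * κ = 1 ∧ (∀ D : Derivation ℝ R R, D κ = 0) ∧
      q' (l₀' ⊗ₜ l₀') ε - κ • q (l₀ ⊗ₜ l₀) e ∈ germ 𝒳 i (TopForm R m) := by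
  obtain ⟨c, hc, e, ε, hf⟩ := hF i
  obtain ⟨l₀, ev, hl⟩ := hL.exists_isLineFrame i
  obtain ⟨l₁, ev₁, hl₁⟩ := hL'.exists_isLineFrame i
  obtain ⟨f, h1⟩ := hl.exists_smul_frame (q' := q) hc hf.flip (q' (l₁ ⊗ₜ l₁) ε)
  obtain ⟨f', h2⟩ := hl₁.exists_smul_frame (q' := q') hc hf (q (l₀ ⊗ₜ l₀) e)
  set s := q (l₀ ⊗ₜ l₀) e with hs
  set s₁ := q' (l₁ ⊗ₜ l₁) ε with hs₁
  have h3 : f * f' - 1 ∈ germ 𝒳 i R := by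
    refine hl.of_smul_frame (q' := q) hc hf.flip ?_
    have h4 := Submodule.neg_mem _ (Submodule.add_mem _ h2 (Submodule.smul_mem _ f' h1))
    convert h4 using 1
    module
  obtain ⟨h, κ, κ', hκ, hD, hh⟩ := hroots i f f' h3
  have h4 : κ * h * f' * h - 1 ∈ germ 𝒳 i R := by
    have h5 := Submodule.sub_mem _ h3 (Submodule.smul_mem _ f' hh)
    convert h5 using 1
    rw [smul_eq_mul]
    ring
  -- Near i one has f f' = 1 and f = κh², so κ h f' is the inverse of h. The square of h⁻¹ l₁ is h⁻²
  -- s₁ = h⁻² f s = κ s.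
  refine ⟨l₀, ev, (κ * h * f') • l₁, h • ev₁, c, e, ε, κ, κ', hl, hl₁.rescale h4, hc, hf, hκ, hD, ?_⟩
  rw [smul_square, AlternatingMap.smul_apply, ← hs₁]
  have h5 := Submodule.sub_mem _ (germ_smul h4 ((κ * f') • s₁)) (Submodule.smul_mem _ κ h2)
  convert h5 using 1
  module

variable [p.IsPerfPair] (H : Regular p n m 𝒳 L) {𝔞 : LieAlgebroid R E} {𝔟 : LieAlgebroid R E'}
  {nabla : 𝔟.Conn L} (hn : IsHalfAction p 𝔟 q nabla) {φ : R}

include H hn in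
/-- The square of the Dirac operator in terms of a local section of `∧ⁿA* ⊗ ∧ᵐT*M`. -/
theorem Regular.laplace_germ_modular (hroots : HasRoots 𝒳) (hφ : H.laplace 𝔞 q nabla = mulOp φ)
    {ψ : E [⋀^Fin n]→ₗ[R] TopForm R m} {X₀ : E} {f₀ : R}
    (hψ : ∀ f ψ', ψ - f • ψ' ∈ germ 𝒳 i (E [⋀^Fin n]→ₗ[R] TopForm R m) →
      ∃ f', f * f' - 1 ∈ germ 𝒳 i R)
    (h₁ : ∀ θ, topAct p 𝔟 n m θ ψ - p X₀ θ • ψ ∈ germ 𝒳 i (E [⋀^Fin n]→ₗ[R] TopForm R m))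
    (h₂ : (𝔞.ad X₀).alt n (lieForm m (𝔞.anchor X₀)) ψ - f₀ • ψ ∈
      germ 𝒳 i (E [⋀^Fin n]→ₗ[R] TopForm R m)) : 4 * φ - f₀ ∈ germ 𝒳 i R := by
  obtain ⟨l₁, ev₁, hl₁⟩ := H.line.exists_isLineFrame i
  obtain ⟨f, h3⟩ := hl₁.exists_smul_square (q := q) ψ
  obtain ⟨f', hff⟩ := hψ _ _ h3
  -- Near i, ψ = κ h² times the square of l₁, so h l₁ has the square κ'ψ. Derivations do not see the
  -- constant, and the eigenvalues on h l₁ are half of those on ψ.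
  obtain ⟨h, κ, κ', hκ, hD, hh⟩ := hroots i f f' hff
  have h4 : h * (κ * h * f') - 1 ∈ germ 𝒳 i R := by
    have h5 := Submodule.sub_mem _ hff (Submodule.smul_mem _ f' hh)
    convert h5 using 1
    rw [smul_eq_mul]
    ring
  have hl := hl₁.rescale h4
  have hD' (D : Derivation ℝ R R) : D κ' = 0 := by
    have h5 := congrArg D hκ
    rw [D.leibniz, hD, smul_zero, zero_add, D.map_one_eq_zero, smul_eq_mul] at h5
    linear_combination κ' * h5 - D κ' * hκ
  have h5 : q ((h • l₁) ⊗ₜ (h • l₁)) - κ' • ψ ∈ germ 𝒳 i (E [⋀^Fin n]→ₗ[R] TopForm R m) := by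
    rw [smul_square]
    exact germ_smul_sub h3 hh hκ
  have h6 := H.laplace_cst_germ 𝔞 hφ (X₀ := X₀) (l₀ := h • l₁) (i := i) fun θ =>
    hl.half q (hn θ _ _) (germ_derEnd_sub H.absorbing _ h5 (hD' _) (h₁ θ))
  have h7 := hl.half q (H.halfLie_spec 𝔞 q X₀ _ _) (germ_derEnd_sub H.absorbing _ h5 (hD' _) h₂)
  refine hl.of_smul ?_
  have h8 := Submodule.add_mem _ (Submodule.smul_mem _ (2 : R) h6) h7
  convert h8 using 1
  module

/-- The Lie derivative of `Ω ⊗ s`, from that of `Ω` and that of `V ⊗ s`, where `V` is dual to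
`Ω`. -/
theorem germ_lie_tensorForm (h𝒳 : Absorbing 𝒳) (hF : HasFrames p n 𝒳)
    {Ω : E [⋀^Fin n]→ₗ[R] R} {V : E' [⋀^Fin n]→ₗ[R] R} {s : TopForm R m}
    (hΩV : ∀ X θ, V θ * Ω X - Matrix.det (.of fun i j => p (X j) (θ i)) ∈ germ 𝒳 i R)
    {D : Derivation ℝ R R} (δ : DerEnd D E) (δ' : DerEnd D E')
    (hδ : ∀ X θ, D (p X θ) = p (δ X) θ + p X (δ' θ)) {g ξ : R}
    (hΩ : δ.alt n (DerEnd.self D) Ω + g • Ω ∈ germ 𝒳 i (E [⋀^Fin n]→ₗ[R] R))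
    (hV : δ'.alt n (lieForm m D) (tensorForm V s) - ξ • tensorForm V s ∈
      germ 𝒳 i (E' [⋀^Fin n]→ₗ[R] TopForm R m)) :
    δ.alt n (lieForm m D) (tensorForm Ω s) - (ξ - 2 * g) • tensorForm Ω s ∈
      germ 𝒳 i (E [⋀^Fin n]→ₗ[R] TopForm R m) := by
  obtain ⟨c, hc, e, ε, hf⟩ := hF i
  have h1 := germ_alt_frame δ (DerEnd.self D) hc hf.flip Ω
  have h2 := germ_alt_frame δ' (lieForm m D) hc hf (tensorForm V s)
  have h3 := germ_alt_frame δ (lieForm m D) hc hf.flip (tensorForm Ω s)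
  have h4 := germ_alt_apply hΩ e
  have h5 := germ_alt_apply hV ε
  refine germ_of_apply_frame hc hf.flip ?_
  change δ.alt n (lieForm m D) (tensorForm Ω s) e - (ξ - 2 * g) • Ω e • s ∈ _
  change _ - (D (Ω e) - (∑ j, p (δ (e j)) (ε j)) * Ω e) ∈ _ at h1
  change _ - (lieForm m D (V ε • s) - (∑ j, p (e j) (δ' (ε j))) • V ε • s) ∈ _ at h2
  change _ - (lieForm m D (Ω e • s) - (∑ j, p (δ (e j)) (ε j)) • Ω e • s) ∈ _ at h3
  change δ.alt n (DerEnd.self D) Ω e + g * Ω e ∈ _ at h4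
  change δ'.alt n (lieForm m D) (tensorForm V s) ε - ξ • V ε • s ∈ _ at h5
  rw [(lieForm m D).leibniz] at h2 h3
  set T := ∑ j, p (δ (e j)) (ε j) with hT
  set T' := ∑ j, p (e j) (δ' (ε j)) with hT'
  have h6 : T + T' ∈ germ 𝒳 i R := by
    rw [hT, hT', ← Finset.sum_add_distrib]
    refine Submodule.sum_mem _ fun j _ => ?_
    have h4 : p (e j) (ε j) - 1 ∈ germ 𝒳 i R := by
      refine sub_mem_germ.2 ⟨c, hc, ?_⟩
      rw [smul_eq_mul, smul_eq_mul, hf.dual, if_pos rfl, mul_one]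
    have h5 := germ_derEnd h𝒳 (DerEnd.self D) h4
    change D (p (e j) (ε j) - 1) ∈ _ at h5
    rwa [map_sub, D.map_one_eq_zero, sub_zero, hδ] at h5
  -- Here ⟨Ω, V⟩ = 1 is used; it allows to divide by V ε and Ω e.
  have h7 : V ε * Ω e - 1 ∈ germ 𝒳 i R := by
    have h8 := hΩV e ε
    rw [← wedgeSec_apply] at h8
    have h9 : wedgeSec p n e ε - 1 ∈ germ 𝒳 i R := by
      refine sub_mem_germ.2 ⟨c ^ n, pow_mem hc n, ?_⟩
      rw [smul_eq_mul, smul_eq_mul, hf.wedgeSec_eq, mul_one]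
    have h10 := Submodule.add_mem _ h8 h9
    rwa [sub_add_sub_cancel] at h10
  have h8 := germ_derEnd h𝒳 (DerEnd.self D) h7
  change D (V ε * Ω e - 1) ∈ _ at h8
  rw [map_sub, D.map_one_eq_zero, sub_zero, D.leibniz, smul_eq_mul, smul_eq_mul] at h8
  set a := Ω e with ha
  set b := V ε with hb
  -- `D a = (T - g) a` and `(D b) s + b L s = (T' + ξ) b s` near `i`
  have h9 : D a - (T - g) * a ∈ germ 𝒳 i R := by
    have := Submodule.sub_mem _ h4 h1
    convert this using 1
    ring
  have h10 : D b • s + b • lieForm m D s - ((T' + ξ) * b) • s ∈ germ 𝒳 i (TopForm R m) := by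
    have := Submodule.sub_mem _ h5 h2
    convert this using 1
    module
  have h11 : (b * a) • lieForm m D s - ((ξ - g) * (b * a)) • s ∈ germ 𝒳 i (TopForm R m) := by
    have := Submodule.sub_mem _ (Submodule.add_mem _ (Submodule.add_mem _
      (Submodule.smul_mem _ a h10) (germ_smul h9 (b • s))) (germ_smul h6 ((a * b) • s)))
      (germ_smul h8 s)
    convert this using 1
    module
  -- The eigenvalue ξ on V ⊗ s is the sum of g on V, opposite to −g on Ω, and of that on s. So s has
  -- eigenvalue ξ − g and Ω ⊗ s has ξ − 2g.
  have h12 : lieForm m D s - (ξ - g) • s ∈ germ 𝒳 i (TopForm R m) := by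
    have := Submodule.sub_mem _ h11 (germ_smul h7 (lieForm m D s - (ξ - g) • s))
    convert this using 1
    module
  have h13 := Submodule.add_mem _ (Submodule.add_mem _ h3 (germ_smul h9 s))
    (Submodule.smul_mem _ a h12)
  convert h13 using 1
  module

end Roots

/-! ### The theorem over a ring with localizations -/

section Main
variable {R : Type*} [CommRing R] [Algebra ℝ R] {E E' : Type*} [AddCommGroup E] [Module R E]
  [AddCommGroup E'] [Module R E'] {p : E →ₗ[R] E' →ₗ[R] R} [p.IsPerfPair]
  {I : Type*} {n m : ℕ} {𝒳 : I → Submonoid R} {L : Type*} [AddCommGroup L] [Module R L]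
  {L' : Type*} [AddCommGroup L'] [Module R L']
  (H : Regular p n m 𝒳 L) (H' : Regular p.flip n m 𝒳 L') (𝔞 : LieAlgebroid R E)
  (𝔟 : LieAlgebroid R E')
  (q : L ⊗[R] L ≃ₗ[R] E [⋀^Fin n]→ₗ[R] TopForm R m)
  (q' : L' ⊗[R] L' ≃ₗ[R] E' [⋀^Fin n]→ₗ[R] TopForm R m)

include H in
theorem Regular.isLieBialgebroid_iff :
    IsLieBialgebroid p 𝔞 𝔟 ↔ ∃ φ : R, ∀ w, dirac p 𝔞 𝔟 q (dirac p 𝔞 𝔟 q w) = φ • w := by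
  obtain ⟨nabla, hn⟩ := H.exists_halfConn 𝔟 q
  refine ⟨fun h => ?_, fun ⟨φ, h⟩ => ?_⟩
  · obtain ⟨φ, hφ⟩ := H.laplace_eq_smul 𝔞 hn (compatible_of_isLieBialgebroid H.frames H.sepFun h)
    exact ⟨φ, (H.dirac_dirac_eq_iff 𝔞 hn φ).2 (LinearMap.ext hφ)⟩
  · exact H.isLieBialgebroid 𝔞 q ((H.dirac_dirac_eq_iff 𝔞 hn φ).1 h)

include H H' in
theorem Regular.dirac_flip (hroots : HasRoots 𝒳) {φ : R}
    (h : ∀ w, dirac p 𝔞 𝔟 q (dirac p 𝔞 𝔟 q w) = φ • w) (w : Forms R E L') :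
    dirac p.flip 𝔟 𝔞 q' (dirac p.flip 𝔟 𝔞 q' w) = φ • w := by
  obtain ⟨nabla, hn⟩ := H.exists_halfConn 𝔟 q
  obtain ⟨nabla', hn'⟩ := H'.exists_halfConn 𝔞 q'
  have hφ := (H.dirac_dirac_eq_iff 𝔞 hn φ).1 h
  obtain ⟨φ', h'⟩ := H'.laplace_eq_smul 𝔟 hn' (H.compatible_flip 𝔞 hn hφ)
  have hφ' : H'.laplace 𝔟 q' nabla' = mulOp φ' := LinearMap.ext h'
  have hφφ : φ = φ' := by
    refine sub_eq_zero.1 (H.sepFun _ fun i => ?_)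
    obtain ⟨l₀, ev, l₀', ev', c, e, ε, κ, κ', hl, hl', hc, hf, hκ, hD, hq⟩ :=
      exists_adapted_frames (q := q) (q' := q') H.frames H.line H'.line hroots i
    exact H.laplace_germ_eq H' hn hn' hφ hφ' hl hl' hc hf hκ hD hq
  rw [hφφ]
  exact (H'.dirac_dirac_eq_iff 𝔟 hn' φ').2 hφ' w

include H in
theorem Regular.dirac_modular (hroots : HasRoots 𝒳) {φ : R}
    (h : ∀ w, dirac p 𝔞 𝔟 q (dirac p 𝔞 𝔟 q w) = φ • w) {i : I}
    {Ω : E [⋀^Fin n]→ₗ[R] R} {V : E' [⋀^Fin n]→ₗ[R] R} {s : TopForm R m} {X₀ : E} {ξ₀ : E'} {g : R}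
    (hψ : ∀ f ψ', tensorForm Ω s - f • ψ' ∈ germ 𝒳 i (E [⋀^Fin n]→ₗ[R] TopForm R m) →
      ∃ f', f * f' - 1 ∈ germ 𝒳 i R)
    (hΩV : ∀ X θ, V θ * Ω X - Matrix.det (.of fun i j => p (X j) (θ i)) ∈ germ 𝒳 i R)
    (h₁ : ∀ θ, topAct p 𝔟 n m θ (tensorForm Ω s) - p X₀ θ • tensorForm Ω s ∈
      germ 𝒳 i (E [⋀^Fin n]→ₗ[R] TopForm R m))
    (h₂ : topAct p.flip 𝔞 n m X₀ (tensorForm V s) - p X₀ ξ₀ • tensorForm V s ∈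
      germ 𝒳 i (E' [⋀^Fin n]→ₗ[R] TopForm R m))
    (hΩ : (𝔞.ad X₀).alt n (DerEnd.self (𝔞.anchor X₀)) Ω + g • Ω ∈
      germ 𝒳 i (E [⋀^Fin n]→ₗ[R] R)) :
    4 * φ - (p X₀ ξ₀ - 2 * g) ∈ germ 𝒳 i R := by
  obtain ⟨nabla, hn⟩ := H.exists_halfConn 𝔟 q
  refine H.laplace_germ_modular hn hroots ((H.dirac_dirac_eq_iff 𝔞 hn φ).1 h) hψ h₁ ?_
  refine germ_lie_tensorForm H.absorbing H.frames hΩV (𝔞.ad X₀) ((𝔞.ad X₀).dual p.flip.flip)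
    (fun X θ => ?_) hΩ h₂
  have h3 := DerEnd.pairing_dual p.flip.flip (𝔞.ad X₀) X θ
  change p X _ = 𝔞.anchor X₀ (p X θ) - p _ θ at h3
  rw [h3, add_sub_cancel]

end Main

open scoped Topology

/-! ### Smooth functions and sections near a point -/

section NearOne
variable {𝕜 : Type*} [RCLike 𝕜] {m : ℕ} {M : Type*} [TopologicalSpace M]
  [ChartedSpace (EuclideanSpace ℝ (Fin m)) M]

variable (𝕜 m) in
/-- The smooth functions that are equal to `1` near `x`. -/
def nearOne (x : M) : Submonoid (Fn 𝕜 m M) where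
  carrier := {f | ∀ᶠ y in 𝓝 x, f y = 1}
  one_mem' := Filter.Eventually.of_forall fun _ => rfl
  mul_mem' {f g} hf hg := by
    filter_upwards [hf, hg] with y h1 h2
    change f y * g y = 1
    rw [h1, h2, one_mul]

theorem mem_nearOne {x : M} {f : Fn 𝕜 m M} : f ∈ nearOne 𝕜 m x ↔ ∀ᶠ y in 𝓝 x, f y = 1 := Iff.rfl

theorem nearOne_apply {x : M} {f : Fn 𝕜 m M} (hf : f ∈ nearOne 𝕜 m x) : f x = 1 :=
  (mem_nearOne.1 hf).self_of_nhds

/-- The smooth function `χ h`, for a function `h` that is smooth on the support of `χ`. -/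
def cutoff (χ : Fn 𝕜 m M) (h : M → 𝕜)
    (hh : ∀ y ∈ tsupport (fun y => χ y), ContMDiffAt (𝓡 m) 𝓘(ℝ, 𝕜) ∞ h y) : Fn 𝕜 m M :=
  ⟨fun y => χ y * h y, fun y => by
    by_cases hy : y ∈ tsupport (fun y => χ y)
    · exact (χ.contMDiff y).mul (hh y hy)
    · have h0 : ∀ᶠ z in 𝓝 y, χ z = 0 := notMem_tsupport_iff_eventuallyEq.1 hy
      refine (contMDiffAt_const (c := (0 : 𝕜))).congr_of_eventuallyEq ?_
      filter_upwards [h0] with z hz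
      rw [hz, zero_mul]⟩

theorem cutoff_apply (χ : Fn 𝕜 m M) (h : M → 𝕜)
    (hh : ∀ y ∈ tsupport (fun y => χ y), ContMDiffAt (𝓡 m) 𝓘(ℝ, 𝕜) ∞ h y) (y : M) :
    cutoff χ h hh y = χ y * h y := rfl

theorem mem_tsupport_of_ne {χ : Fn 𝕜 m M} {y : M} (h : χ y ≠ 0) : y ∈ tsupport (fun y => χ y) :=
  subset_tsupport _ h

variable [IsManifold (𝓡 m) ∞ M] [T2Space M]

theorem exists_nearOne {x : M} {P : M → Prop} (hP : ∀ᶠ y in 𝓝 x, P y) :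
    ∃ c ∈ nearOne 𝕜 m x, ∀ y ∈ tsupport (fun y => c y), P y := by
  obtain ⟨c, hc, h⟩ := exists_bump (𝕜 := 𝕜) (m := m) x hP
  exact ⟨c, hc, fun y hy => h hy⟩

theorem absorbing_nearOne : Absorbing (nearOne 𝕜 m : M → Submonoid (Fn 𝕜 m M)) := fun x c hc => by
  obtain ⟨c', hc', h⟩ := exists_nearOne (𝕜 := 𝕜) (m := m) (mem_nearOne.1 hc)
  refine ⟨c', hc', ContMDiffMap.ext fun y => ?_⟩
  change c' y * c y = c' y
  by_cases hy : c' y = 0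
  · rw [hy, zero_mul]
  · rw [h y (mem_tsupport_of_ne hy), mul_one]

theorem mem_germ_nearOne {x : M} {f : Fn 𝕜 m M} :
    f ∈ germ (nearOne 𝕜 m) x (Fn 𝕜 m M) ↔ ∀ᶠ y in 𝓝 x, f y = 0 := by
  refine ⟨fun ⟨c, hc, h⟩ => ?_, fun h => ?_⟩
  · filter_upwards [mem_nearOne.1 hc] with y hy
    have h1 : c y * f y = 0 := congrArg (fun g : Fn 𝕜 m M => g y) h
    rwa [hy, one_mul] at h1
  · obtain ⟨c, hc, h'⟩ := exists_nearOne (𝕜 := 𝕜) (m := m) h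
    refine ⟨c, hc, ContMDiffMap.ext fun y => ?_⟩
    change c y * f y = 0
    by_cases hy : c y = 0
    · rw [hy, zero_mul]
    · rw [h' y (mem_tsupport_of_ne hy), mul_zero]

theorem germ_apply_eq_zero {x : M} {f : Fn 𝕜 m M} (h : f ∈ germ (nearOne 𝕜 m) x (Fn 𝕜 m M)) :
    f x = 0 := (mem_germ_nearOne.1 h).self_of_nhds

theorem separated_fn : Separated (nearOne 𝕜 m : M → Submonoid (Fn 𝕜 m M)) (Fn 𝕜 m M) :=
  fun _ h => ContMDiffMap.ext fun x => germ_apply_eq_zero (h x)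

/-- The glued function has the value v y y at y. Near x it agrees with v x, where c x = 1, so it is
smooth. -/
theorem gluing_fn : Gluing (nearOne 𝕜 m : M → Submonoid (Fn 𝕜 m M)) (Fn 𝕜 m M) := by
  intro c v hc h
  have h1 (x y : M) : c x y * v y y = c x y * v x y := by
    have h2 : c x y * c y y * v x y = c x y * c y y * v y y :=
      congrArg (fun g : Fn 𝕜 m M => g y) (h x y)
    rw [nearOne_apply (hc y), mul_one] at h2
    exact h2.symm
  refine ⟨⟨fun y => v y y, fun x => ?_⟩, fun x => ContMDiffMap.ext (h1 x)⟩
  refine ((v x).contMDiff x).congr_of_eventuallyEq ?_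
  filter_upwards [mem_nearOne.1 (hc x)] with y hy
  simpa only [hy, one_mul] using h1 x y

variable {F : Type*} [NormedAddCommGroup F] [NormedSpace ℝ F] [NormedSpace 𝕜 F]
  [IsScalarTower ℝ 𝕜 F] {A : M → Type*} [TopologicalSpace (TotalSpace F A)]
  [∀ x, TopologicalSpace (A x)] [FiberBundle F A] [∀ x, AddCommGroup (A x)]
  [∀ x, Module ℝ (A x)] [∀ x, Module 𝕜 (A x)] [VectorBundle ℝ F A] [VectorBundle 𝕜 F A]
  [ContMDiffVectorBundle ∞ F A (𝓡 m)]

theorem separated_section :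
    Separated (nearOne 𝕜 m : M → Submonoid (Fn 𝕜 m M)) Cₛ^∞⟮𝓡 m; F, A⟯ := by
  intro s h
  ext x
  obtain ⟨c, hc, h⟩ := h x
  have h1 : c x • s x = 0 := congrArg (fun r : Cₛ^∞⟮𝓡 m; F, A⟯ => r x) h
  rwa [nearOne_apply hc, one_smul] at h1

theorem gluing_section : Gluing (nearOne 𝕜 m : M → Submonoid (Fn 𝕜 m M)) Cₛ^∞⟮𝓡 m; F, A⟯ := by
  intro c v hc h
  have h1 (x y : M) : c x y • v y y = c x y • v x y := by
    have h2 : (c x y * c y y) • v x y = (c x y * c y y) • v y y :=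
      congrArg (fun r : Cₛ^∞⟮𝓡 m; F, A⟯ => r y) (h x y)
    rw [nearOne_apply (hc y), mul_one] at h2
    exact h2.symm
  refine ⟨⟨fun y => v y y, fun x => ?_⟩, fun x => ContMDiffSection.ext (h1 x)⟩
  refine ((v x).contMDiff x).congr_of_eventuallyEq ?_
  filter_upwards [mem_nearOne.1 (hc x)] with y hy
  have h3 := h1 x y
  rw [hy, one_smul, one_smul] at h3
  rw [h3]

variable (t : Trivialization F (TotalSpace.proj : TotalSpace F A → M)) [MemTrivializationAtlas t]
  (χ : Fn 𝕜 m M) (hχ : tsupport (fun y => χ y) ⊆ t.baseSet)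

/-- A constant section in a local trivialization, cut off by `χ`. -/
def constSection (v : F) : Cₛ^∞⟮𝓡 m; F, A⟯ :=
  ⟨fun y => χ y • t.symm y v, contMDiff_bump_section t χ hχ v⟩

/-- A coordinate of sections in a local trivialization, cut off by `χ`. -/
def coordDual (g : F →L[𝕜] 𝕜) : Module.Dual (Fn 𝕜 m M) Cₛ^∞⟮𝓡 m; F, A⟯ where
  toFun s := cutoff χ (fun y => g (t ⟨y, s y⟩).2) fun y hy =>
    (g.restrictScalars ℝ).contDiff.contMDiff.contMDiffAt.comp y
      ((t.contMDiffAt_section_iff (hχ hy)).1 (s.contMDiff y))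
  map_add' s s' := ContMDiffMap.ext fun y => by
    change χ y * g (t ⟨y, s y + s' y⟩).2 = χ y * g (t ⟨y, s y⟩).2 + χ y * g (t ⟨y, s' y⟩).2
    by_cases hy : χ y = 0
    · simp [hy]
    · rw [triv_add t (hχ (mem_tsupport_of_ne hy)), map_add, mul_add]
  map_smul' f s := ContMDiffMap.ext fun y => by
    change χ y * g (t ⟨y, f y • s y⟩).2 = f y * (χ y * g (t ⟨y, s y⟩).2)
    by_cases hy : χ y = 0
    · simp [hy]
    · rw [triv_smul 𝕜 t (hχ (mem_tsupport_of_ne hy)), map_smul, smul_eq_mul, mul_left_comm]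

theorem constSection_apply (v : F) (y : M) : constSection t χ hχ v y = χ y • t.symm y v := rfl

theorem coordDual_apply (g : F →L[𝕜] 𝕜) (s : Cₛ^∞⟮𝓡 m; F, A⟯) (y : M) :
    coordDual t χ hχ g s y = χ y * g (t ⟨y, s y⟩).2 := rfl

theorem coordDual_constSection (g : F →L[𝕜] 𝕜) (v : F) {y : M} (hy : χ y = 1) :
    coordDual t χ hχ g (constSection t χ hχ v) y = g v := by
  rw [coordDual_apply, constSection_apply, hy, one_mul, one_smul,
    t.apply_mk_symm (hχ (mem_tsupport_of_ne (by rw [hy]; exact one_ne_zero)))]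

end NearOne

/-! ### Local frames from trivializations -/

section Frames
variable {𝕜 : Type*} [RCLike 𝕜] {m n : ℕ} {M : Type*} [TopologicalSpace M]
  [ChartedSpace (EuclideanSpace ℝ (Fin m)) M] [IsManifold (𝓡 m) ∞ M] [T2Space M]

theorem hasFrames_section {A : M → Type*} [TopologicalSpace (TotalSpace (Fin n → 𝕜) A)]
    [∀ x, TopologicalSpace (A x)] [FiberBundle (Fin n → 𝕜) A] [∀ x, AddCommGroup (A x)]
    [∀ x, Module ℝ (A x)] [∀ x, Module 𝕜 (A x)] [VectorBundle ℝ (Fin n → 𝕜) A]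
    [VectorBundle 𝕜 (Fin n → 𝕜) A] [ContMDiffVectorBundle ∞ (Fin n → 𝕜) A (𝓡 m)] :
    HasFrames (Module.Dual.eval (Fn 𝕜 m M) Cₛ^∞⟮𝓡 m; Fin n → 𝕜, A⟯) n (nearOne 𝕜 m) := by
  intro x
  let t := trivializationAt (Fin n → 𝕜) A x
  obtain ⟨χ, hχ1, hχ⟩ : ∃ χ ∈ nearOne 𝕜 m x, tsupport (fun y => χ y) ⊆ t.baseSet :=
    exists_nearOne (t.open_baseSet.mem_nhds (mem_baseSet_trivializationAt (Fin n → 𝕜) A x))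
  -- Two cutoffs: χ extends the frame of the trivialization by zero, and χ = 1 on the support of c,
  -- so that the relations of a frame hold after multiplication by c.
  obtain ⟨c, hc, hcχ⟩ := exists_nearOne (𝕜 := 𝕜) (m := m) (mem_nearOne.1 hχ1)
  have hsum (u : Fin n → Cₛ^∞⟮𝓡 m; Fin n → 𝕜, A⟯) (y : M) : (∑ i, u i) y = ∑ i, u i y :=
    sum_section_apply u y
  have left (X : Cₛ^∞⟮𝓡 m; Fin n → 𝕜, A⟯) :
      c • X = c • ∑ a, coordDual t χ hχ (ContinuousLinearMap.proj a) X •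
        constSection t χ hχ (Pi.single a 1) := by
    ext y
    rw [section_smul_apply, section_smul_apply, hsum]
    by_cases hy : c y = 0
    · rw [hy, zero_smul, zero_smul]
    have h1 := hcχ y (mem_tsupport_of_ne hy)
    have h2 : y ∈ t.baseSet := hχ (mem_tsupport_of_ne (by rw [h1]; exact one_ne_zero))
    congr 1
    apply (t.linearEquivAt 𝕜 y h2).injective
    rw [map_sum]
    have h3 (a : Fin n) : t.linearEquivAt 𝕜 y h2 ((coordDual t χ hχ (ContinuousLinearMap.proj a) X •
        constSection t χ hχ (Pi.single a 1)) y) = (t ⟨y, X y⟩).2 a • Pi.single a (1 : 𝕜) := by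
      rw [section_smul_apply, coordDual_apply, constSection_apply, h1, one_mul, one_smul, map_smul]
      congr 1
      exact congrArg Prod.snd (t.apply_mk_symm h2 _)
    simp only [h3]
    exact (pi_eq_sum_univ' _)
  refine ⟨c, hc, fun a => constSection t χ hχ (Pi.single a 1),
    fun a => coordDual t χ hχ (ContinuousLinearMap.proj a), left, fun θ => ?_, fun a b => ?_⟩
  · refine LinearMap.ext fun X => ?_
    rw [LinearMap.smul_apply, LinearMap.smul_apply, ← map_smul, left, map_smul, map_sum,
      LinearMap.sum_apply]
    simp only [map_smul, LinearMap.smul_apply, smul_eq_mul, mul_comm, Module.Dual.eval_apply]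
  · refine ContMDiffMap.ext fun y => ?_
    change c y * coordDual t χ hχ (ContinuousLinearMap.proj b)
      (constSection t χ hχ (Pi.single a 1)) y = _
    by_cases hy : c y = 0
    · rw [hy, zero_mul]
      split_ifs <;> simp [hy]
    rw [coordDual_constSection t χ hχ _ _ (hcχ y (mem_tsupport_of_ne hy)),
      ContinuousLinearMap.proj_apply, Pi.single_apply]
    by_cases h : a = b
    · rw [if_pos h.symm, if_pos h, mul_one]
    · rw [if_neg (Ne.symm h), if_neg h, mul_zero]; rfl

theorem isLine_section {S : M → Type*} [TopologicalSpace (TotalSpace 𝕜 S)]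
    [∀ x, TopologicalSpace (S x)] [FiberBundle 𝕜 S] [∀ x, AddCommGroup (S x)]
    [∀ x, Module ℝ (S x)] [∀ x, Module 𝕜 (S x)] [VectorBundle ℝ 𝕜 S]
    [VectorBundle 𝕜 𝕜 S] [ContMDiffVectorBundle ∞ 𝕜 S (𝓡 m)] :
    IsLine (nearOne 𝕜 m : M → Submonoid (Fn 𝕜 m M)) Cₛ^∞⟮𝓡 m; 𝕜, S⟯ := by
  intro x
  let t := trivializationAt 𝕜 S x
  obtain ⟨χ, hχ1, hχ⟩ : ∃ χ ∈ nearOne 𝕜 m x, tsupport (fun y => χ y) ⊆ t.baseSet :=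
    exists_nearOne (t.open_baseSet.mem_nhds (mem_baseSet_trivializationAt 𝕜 S x))
  obtain ⟨c, hc, hcχ⟩ := exists_nearOne (𝕜 := 𝕜) (m := m) (mem_nearOne.1 hχ1)
  refine ⟨c, hc, constSection t χ hχ 1, coordDual t χ hχ (ContinuousLinearMap.id 𝕜 𝕜),
    fun X => ?_, ContMDiffMap.ext fun y => ?_⟩
  · ext y
    rw [section_smul_apply, section_smul_apply]
    by_cases hy : c y = 0
    · rw [hy, zero_smul, zero_smul]
    have h1 := hcχ y (mem_tsupport_of_ne hy)
    have h2 : y ∈ t.baseSet := hχ (mem_tsupport_of_ne (by rw [h1]; exact one_ne_zero))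
    congr 1
    apply (t.linearEquivAt 𝕜 y h2).injective
    rw [section_smul_apply, coordDual_apply, constSection_apply, h1, one_mul, one_smul, map_smul]
    have h3 : t.linearEquivAt 𝕜 y h2 (t.symm y 1) = 1 := congrArg Prod.snd (t.apply_mk_symm h2 _)
    rw [h3]
    exact (mul_one _).symm
  · change c y * coordDual t χ hχ (ContinuousLinearMap.id 𝕜 𝕜) (constSection t χ hχ 1) y = c y
    by_cases hy : c y = 0
    · rw [hy, zero_mul]
    rw [coordDual_constSection t χ hχ _ _ (hcχ y (mem_tsupport_of_ne hy))]
    exact mul_one _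

end Frames

/-! ### Hadamard's lemma and local square roots -/

section Analysis

/-- Hadamard's lemma. -/
theorem exists_eq_add_of_contDiff {V W : Type*} [NormedAddCommGroup V] [NormedSpace ℝ V]
    [NormedAddCommGroup W] [NormedSpace ℝ W] [CompleteSpace W] {F : V → W} (hF : ContDiff ℝ ∞ F)
    (z₀ : V) : ∃ G : V → V →L[ℝ] W, ContDiff ℝ ∞ G ∧ (∀ z, F z = F z₀ + G z (z - z₀)) ∧
      G z₀ = fderiv ℝ F z₀ := by
  have hF' : ContDiff ℝ ∞ (fderiv ℝ F) := hF.fderiv_right (by norm_num)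
  have hc (z : V) : Continuous fun t : ℝ => fderiv ℝ F (z₀ + t • (z - z₀)) :=
    hF'.continuous.comp (by fun_prop)
  refine ⟨fun z => ∫ t in (0 : ℝ)..1, fderiv ℝ F (z₀ + t • (z - z₀)), ?_, fun z => ?_, ?_⟩
  · let b : ContDiffBump (0 : ℝ) := ⟨1, 2, one_pos, one_lt_two⟩
    -- The integral is written as the convolution, evaluated at 0, of the indicator of [0, 1] with a
    -- function of compact support; convolutions with parameters are smooth. The bump is 1 on [−1,
    -- 1], and the minus sign undoes the reflection in the convolution.
    let g : V → ℝ → V →L[ℝ] W := fun z t => b t • fderiv ℝ F (z₀ - t • (z - z₀))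
    have h1 : ContDiffOn ℝ ((⊤ : ℕ∞) : WithTop ℕ∞) (fun q : V × ℝ => (MeasureTheory.convolution
        ((Set.Icc (0 : ℝ) 1).indicator fun _ => (1 : ℝ)) (g q.1)
        (ContinuousLinearMap.lsmul ℝ ℝ) MeasureTheory.volume) q.2) (Set.univ ×ˢ Set.univ) := by
      refine MeasureTheory.contDiffOn_convolution_right_with_param _ isOpen_univ
        (isCompact_closedBall (0 : ℝ) 2) (fun z t _ ht => ?_) ?_ ?_
      · have : b t = 0 := b.zero_of_le_dist (le_of_lt (not_le.1 ht))
        simp only [g, this, zero_smul]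
      · exact ((MeasureTheory.locallyIntegrable_const (1 : ℝ)).indicator measurableSet_Icc)
      · refine ContDiff.contDiffOn ?_
        refine ContDiff.smul (b.contDiff.comp contDiff_snd) (hF'.comp ?_)
        exact contDiff_const.sub (contDiff_snd.smul (contDiff_fst.sub contDiff_const))
    have h2 : ContDiff ℝ ∞ fun z : V => (MeasureTheory.convolution
        ((Set.Icc (0 : ℝ) 1).indicator fun _ => (1 : ℝ)) (g z)
        (ContinuousLinearMap.lsmul ℝ ℝ) MeasureTheory.volume) 0 := by
      rw [Set.univ_prod_univ, contDiffOn_univ] at h1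
      exact h1.comp (contDiff_id.prodMk contDiff_const)
    convert h2 using 2 with z
    rw [MeasureTheory.convolution_def, intervalIntegral.integral_of_le zero_le_one,
      ← MeasureTheory.integral_Icc_eq_integral_Ioc,
      ← MeasureTheory.integral_indicator measurableSet_Icc]
    refine MeasureTheory.integral_congr_ae (Filter.Eventually.of_forall fun t => Eq.symm ?_)
    simp only [ContinuousLinearMap.lsmul_apply, g]
    by_cases ht : t ∈ Set.Icc (0 : ℝ) 1
    · have hb : b (0 - t) = 1 := by
        refine b.one_of_mem_closedBall ?_
        rw [mem_closedBall_zero_iff, zero_sub, norm_neg, Real.norm_of_nonneg ht.1]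
        exact ht.2
      rw [Set.indicator_of_mem ht, Set.indicator_of_mem ht, hb, one_smul, one_smul, zero_sub,
        neg_smul, sub_neg_eq_add]
    · rw [Set.indicator_of_notMem ht, Set.indicator_of_notMem ht, zero_smul]
  · rw [ContinuousLinearMap.intervalIntegral_apply ((hc z).intervalIntegrable _ _)]
    have h1 : ∀ t ∈ Set.uIcc (0 : ℝ) 1, HasDerivAt (fun t : ℝ => F (z₀ + t • (z - z₀)))
        (fderiv ℝ F (z₀ + t • (z - z₀)) (z - z₀)) t := fun t _ => by
      have h2 : HasDerivAt (fun t : ℝ => z₀ + t • (z - z₀)) (z - z₀) t := by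
        simpa using ((hasDerivAt_id t).smul_const (z - z₀)).const_add z₀
      exact ((hF.differentiable (by norm_num)) _).hasFDerivAt.comp_hasDerivAt t h2
    rw [intervalIntegral.integral_eq_sub_of_hasDerivAt h1
      (((hc z).clm_apply continuous_const).intervalIntegrable _ _)]
    simp
  · simp

variable {𝕜 : Type*} [RCLike 𝕜]

/-- The square root near `1`. -/
theorem exists_contDiffAt_sqrt : ∃ σ : 𝕜 → 𝕜, ∀ᶠ z in 𝓝 (1 : 𝕜),
    ContDiffAt ℝ ∞ σ z ∧ σ z * σ z = z := by
  -- The inverse function theorem for z ↦ z² at 1, where the derivative is 2, over 𝕜; scalars are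
  -- restricted to ℝ at the end.
  have h1 : ContDiffAt 𝕜 ω (fun z : 𝕜 => z * z) 1 := contDiffAt_id.mul contDiffAt_id
  let u : 𝕜 ≃L[𝕜] 𝕜 := ContinuousLinearEquiv.unitsEquivAut 𝕜 (Units.mk0 2 two_ne_zero)
  have h2 : HasFDerivAt (fun z : 𝕜 => z * z) (u : 𝕜 →L[𝕜] 𝕜) 1 := by
    have h3 := (hasFDerivAt_id (𝕜 := 𝕜) (1 : 𝕜)).mul (hasFDerivAt_id (𝕜 := 𝕜) (1 : 𝕜))
    refine h3.congr_fderiv ?_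
    ext
    simp [u]
    norm_num
  have hω : (ω : WithTop ℕ∞) ≠ 0 := by simp
  have h3 := h1.to_localInverse h2 hω
  refine ⟨h1.localInverse h2 hω, ?_⟩
  simp only [mul_one] at h3
  have h4 := (h1.hasStrictFDerivAt' h2 hω).eventually_right_inverse
  simp only [mul_one] at h4
  filter_upwards [h3.eventually (by simp), h4] with z h5 h6
  exact ⟨(h5.restrict_scalars ℝ).of_le le_top, h6⟩

end Analysis

/-! ### Square roots of smooth functions -/

section Roots
variable {𝕜 : Type*} [RCLike 𝕜] {m : ℕ} {M : Type*} [TopologicalSpace M]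
  [ChartedSpace (EuclideanSpace ℝ (Fin m)) M]

variable (m M) in
/-- The constant functions. -/
def constFn : 𝕜 →+* Fn 𝕜 m M where
  toFun z := ⟨fun _ => z, contMDiff_const⟩
  map_zero' := rfl
  map_one' := rfl
  map_add' _ _ := rfl
  map_mul' _ _ := rfl

/-- Derivations are only assumed linear over ℝ. In the complex case the derivative of I² = −1 is 2 I
D(I) = 0, and I is invertible. -/
theorem derivation_constFn (D : Derivation ℝ (Fn 𝕜 m M) (Fn 𝕜 m M)) (z : 𝕜) :
    D (constFn m M z) = 0 := by
  have hr (r : ℝ) : D (constFn m M (r : 𝕜)) = 0 := by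
    have h : constFn m M (r : 𝕜) = algebraMap ℝ (Fn 𝕜 m M) r :=
      ContMDiffMap.ext fun x => (RCLike.algebraMap_eq_ofReal (K := 𝕜) ▸ rfl)
    rw [h, D.map_algebraMap]
  have hI : D (constFn m M (RCLike.I : 𝕜)) = 0 := by
    rcases RCLike.I_mul_I (K := 𝕜) with h | h
    · rw [h, map_zero, map_zero]
    · have h1 : constFn m M (RCLike.I : 𝕜) * constFn m M (RCLike.I : 𝕜) = -1 := by
        rw [← map_mul, h, map_neg, map_one]
      have h2 := congrArg D h1
      rw [D.leibniz, map_neg, D.map_one_eq_zero, neg_zero, smul_eq_mul] at h2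
      have h3 : (2 : ℤ) • D (constFn m M (RCLike.I : 𝕜)) = (2 : ℤ) • 0 := by
        rw [smul_zero, zsmul_eq_mul]
        push_cast
        linear_combination -constFn m M (RCLike.I : 𝕜) * h2 +
          2 * D (constFn m M (RCLike.I : 𝕜)) * h1
      exact LieAlgebroid.eq_of_two_smul_eq (Fn 𝕜 m M) h3
  rw [← RCLike.re_add_im z, map_add, map_mul, map_add, D.leibniz, hr, hr, hI, smul_zero, smul_zero,
    add_zero, add_zero]

variable [IsManifold (𝓡 m) ∞ M] [T2Space M]

/-- A function that is smooth near `x` agrees near `x` with a smooth function. -/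
theorem exists_eventuallyEq {x : M} {h : M → 𝕜}
    (hh : ∀ᶠ y in 𝓝 x, ContMDiffAt (𝓡 m) 𝓘(ℝ, 𝕜) ∞ h y) :
    ∃ f : Fn 𝕜 m M, ∀ᶠ y in 𝓝 x, f y = h y := by
  obtain ⟨χ, hχ, hsupp⟩ := exists_nearOne (𝕜 := 𝕜) (m := m) hh
  refine ⟨cutoff χ h hsupp, ?_⟩
  filter_upwards [mem_nearOne.1 hχ] with y hy
  rw [cutoff_apply, hy, one_mul]

theorem exists_mul_sub_one_mem_germ {x : M} {f : Fn 𝕜 m M} (hf : f x ≠ 0) :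
    ∃ f' : Fn 𝕜 m M, f * f' - 1 ∈ germ (nearOne 𝕜 m) x (Fn 𝕜 m M) := by
  have h0 : ∀ᶠ y in 𝓝 x, f y ≠ 0 := f.contMDiff.continuous.continuousAt.eventually_ne hf
  obtain ⟨f', h⟩ := exists_eventuallyEq (𝕜 := 𝕜) (m := m) (x := x) (h := fun y => (f y)⁻¹) (by
    filter_upwards [h0] with y hy
    have h1 : ContDiffAt ℝ ∞ (fun z : 𝕜 => z⁻¹) (f y) := contDiffAt_inv ℝ hy
    exact h1.contMDiffAt.comp y (f.contMDiff y))
  refine ⟨f', mem_germ_nearOne.2 ?_⟩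
  filter_upwards [h0, h] with y h1 h2
  change f y * f' y - 1 = 0
  rw [h2, mul_inv_cancel₀ h1, sub_self]

/-- The function f / f(x) is 1 at x and has a smooth root near x. The constant f(x) has to be split
off because a negative real number has no real root. -/
theorem hasRoots_nearOne : HasRoots (nearOne 𝕜 m : M → Submonoid (Fn 𝕜 m M)) := by
  intro x f f' hff
  have h0 : f x ≠ 0 := by
    have h1 : f x * f' x - 1 = 0 := germ_apply_eq_zero hff
    exact left_ne_zero_of_mul_eq_one (sub_eq_zero.1 h1)
  obtain ⟨σ, hσ⟩ := exists_contDiffAt_sqrt (𝕜 := 𝕜)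
  let r : M → 𝕜 := fun y => (f x)⁻¹ * f y
  have hr : ContMDiff (𝓡 m) 𝓘(ℝ, 𝕜) ∞ r := contMDiff_const.mul f.contMDiff
  have hr1 : r x = 1 := inv_mul_cancel₀ h0
  have h1 : ∀ᶠ y in 𝓝 x, ContDiffAt ℝ ∞ σ (r y) ∧ σ (r y) * σ (r y) = r y :=
    hr.continuous.continuousAt.eventually (by rw [hr1]; exact hσ)
  obtain ⟨h, hh⟩ := exists_eventuallyEq (𝕜 := 𝕜) (m := m) (x := x) (h := fun y => σ (r y)) (by
    filter_upwards [h1] with y hy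
    exact hy.1.contMDiffAt.comp y (hr y))
  refine ⟨h, constFn m M (f x), constFn m M (f x)⁻¹, ?_, fun D => derivation_constFn D _,
    mem_germ_nearOne.2 ?_⟩
  · rw [← map_mul, inv_mul_cancel₀ h0, map_one]
  · filter_upwards [h1, hh] with y h2 h3
    change f y - f x * (h y * h y) = 0
    rw [h3, h2.2, mul_inv_cancel_left₀ h0, sub_self]

end Roots

theorem exists_contDiff_eventuallyEq {V W : Type*} [NormedAddCommGroup V] [NormedSpace ℝ V]
    [HasContDiffBump V] [NormedAddCommGroup W] [NormedSpace ℝ W] {h : V → W} {T : Set V} {z₀ : V}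
    (hT : IsOpen T) (hz : z₀ ∈ T) (hh : ContDiffOn ℝ ∞ h T) :
    ∃ F : V → W, ContDiff ℝ ∞ F ∧ F =ᶠ[𝓝 z₀] h := by
  obtain ⟨ε, hε, hball⟩ := Metric.isOpen_iff.1 hT z₀ hz
  let b : ContDiffBump z₀ := ⟨ε / 4, ε / 2, by positivity, by linarith⟩
  have hb : tsupport b ⊆ T := by
    rw [b.tsupport_eq]
    exact (Metric.closedBall_subset_ball (by change ε / 2 < ε; linarith)).trans hball
  refine ⟨fun z => b z • h z, contDiff_iff_contDiffAt.2 fun z => ?_, ?_⟩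
  · by_cases hz : z ∈ tsupport b
    · exact b.contDiff.contDiffAt.smul (hh.contDiffAt (hT.mem_nhds (hb hz)))
    · have h0 : ∀ᶠ y in 𝓝 z, b y = 0 := notMem_tsupport_iff_eventuallyEq.1 hz
      refine (contDiffAt_const (c := (0 : W))).congr_of_eventuallyEq ?_
      filter_upwards [h0] with y hy
      rw [hy, zero_smul]
  · filter_upwards [b.eventuallyEq_one] with y hy
    rw [hy, Pi.one_apply, one_smul]

/-! ### Vector fields as derivations of the ring of functions -/

section Derivations
variable {𝕜 : Type*} [RCLike 𝕜] {m : ℕ} {M : Type*} [TopologicalSpace M]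
  [ChartedSpace (EuclideanSpace ℝ (Fin m)) M] [IsManifold (𝓡 m) ∞ M]

theorem contDiffAt_chart (f : Fn 𝕜 m M) {x y : M}
    (hy : y ∈ (chartAt (EuclideanSpace ℝ (Fin m)) x).source) :
    ContDiffAt ℝ ∞ (fun z => f ((extChartAt (𝓡 m) x).symm z)) (extChartAt (𝓡 m) x y) := by
  have h : ContDiffOn ℝ ∞ (fun z => f ((extChartAt (𝓡 m) x).symm z)) (extChartAt (𝓡 m) x).target :=
    contMDiffOn_iff_contDiffOn.1 (f.contMDiff.comp_contMDiffOn (contMDiffOn_extChartAt_symm x))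
  refine h.contDiffAt ((isOpen_extChartAt_target x).mem_nhds ?_)
  exact (extChartAt (𝓡 m) x).map_source (by rwa [extChartAt_source])

variable (x : M) (χ : Fn 𝕜 m M)
  (hχ : tsupport (fun y => χ y) ⊆ (chartAt (EuclideanSpace ℝ (Fin m)) x).source)

/-- The function `h` of the coordinates of the chart at `x`, cut off by `χ`. -/
def chartFn (h : EuclideanSpace ℝ (Fin m) → 𝕜) (hh : ContDiff ℝ ∞ h) : Fn 𝕜 m M :=
  cutoff χ (fun y => h (extChartAt (𝓡 m) x y)) fun y hy =>
    hh.contMDiff.contMDiffAt.comp y (contMDiffAt_extChartAt' (hχ hy))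

/-- The derivative in the direction `v` in the chart at `x`, cut off by `χ`. -/
def chartDer (v : EuclideanSpace ℝ (Fin m)) : Derivation ℝ (Fn 𝕜 m M) (Fn 𝕜 m M) :=
  Derivation.mk'
    { toFun := fun f => cutoff χ (fun y =>
        fderiv ℝ (fun z => f ((extChartAt (𝓡 m) x).symm z)) (extChartAt (𝓡 m) x y) v) fun y hy => by
          have h1 : ContDiffAt ℝ ∞ (fun z => fderiv ℝ
              (fun z => f ((extChartAt (𝓡 m) x).symm z)) z v) (extChartAt (𝓡 m) x y) :=
            ((contDiffAt_chart f (hχ hy)).fderiv_right (by norm_num)).clm_apply contDiffAt_const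
          exact h1.contMDiffAt.comp y (contMDiffAt_extChartAt' (hχ hy))
      map_add' := fun f g => ContMDiffMap.ext fun y => by
        by_cases hy : χ y = 0
        · change χ y * _ = χ y * _ + χ y * _
          simp [hy]
        have hs := hχ (mem_tsupport_of_ne hy)
        have h1 := fderiv_fun_add ((contDiffAt_chart f hs).differentiableAt (by norm_num))
          ((contDiffAt_chart g hs).differentiableAt (by norm_num))
        exact (congrArg (fun T : EuclideanSpace ℝ (Fin m) →L[ℝ] 𝕜 => χ y * T v) h1).trans
          (mul_add _ _ _)
      map_smul' := fun r f => ContMDiffMap.ext fun y => by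
        by_cases hy : χ y = 0
        · change χ y * _ = r • (χ y * _)
          simp [hy]
        have hs := hχ (mem_tsupport_of_ne hy)
        have h1 := fderiv_fun_const_smul ((contDiffAt_chart f hs).differentiableAt (by norm_num)) r
        exact (congrArg (fun T : EuclideanSpace ℝ (Fin m) →L[ℝ] 𝕜 => χ y * T v) h1).trans
          (mul_smul_comm _ _ _) }
    fun f g => ContMDiffMap.ext fun y => by
      by_cases hy : χ y = 0
      · change χ y * _ = f y * (χ y * _) + g y * (χ y * _)
        simp [hy]
      have hs := hχ (mem_tsupport_of_ne hy)
      have h1 := fderiv_fun_mul ((contDiffAt_chart f hs).differentiableAt (by norm_num))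
        ((contDiffAt_chart g hs).differentiableAt (by norm_num))
      have h2 := (extChartAt (𝓡 m) x).left_inv (by rwa [extChartAt_source])
      refine (congrArg (fun T : EuclideanSpace ℝ (Fin m) →L[ℝ] 𝕜 => χ y * T v) h1).trans ?_
      rw [h2]
      exact (mul_add _ _ _).trans (congrArg₂ _ (mul_left_comm _ _ _) (mul_left_comm _ _ _))

theorem chartDer_apply (v : EuclideanSpace ℝ (Fin m)) (f : Fn 𝕜 m M) (y : M) :
    chartDer x χ hχ v f y = χ y *
      fderiv ℝ (fun z => f ((extChartAt (𝓡 m) x).symm z)) (extChartAt (𝓡 m) x y) v := rfl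

/-- The coordinates of the chart at `x`, cut off by `χ`. -/
def coordFn (a : Fin m) : Fn 𝕜 m M :=
  chartFn x χ hχ (fun z => ((z a : ℝ) : 𝕜))
    ((RCLike.ofRealCLM (K := 𝕜)).contDiff.comp (EuclideanSpace.proj (𝕜 := ℝ) a).contDiff)

variable [T2Space M]

theorem derivation_apply_congr (D : Derivation ℝ (Fn 𝕜 m M) (Fn 𝕜 m M)) {f g : Fn 𝕜 m M} {y : M}
    (h : ∀ᶠ z in 𝓝 y, f z = g z) : D f y = D g y := by
  have h1 : f - g ∈ germ (nearOne 𝕜 m) y (Fn 𝕜 m M) := mem_germ_nearOne.2 (by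
    filter_upwards [h] with z hz
    exact sub_eq_zero.2 hz)
  have h2 : D (f - g) ∈ germ (nearOne 𝕜 m) y (Fn 𝕜 m M) :=
    germ_derEnd absorbing_nearOne (DerEnd.self D) h1
  rw [map_sub] at h2
  exact sub_eq_zero.1 (germ_apply_eq_zero h2)

/-- By Hadamard's lemma f = f(y) + ∑ (x_a − x_a(y)) G_a near y, with G_a(y) the partial derivatives
of f at y. Applying D and evaluating at y kills all terms but D x_a · G_a. -/
theorem derivation_apply (D : Derivation ℝ (Fn 𝕜 m M) (Fn 𝕜 m M)) (f : Fn 𝕜 m M) {y : M}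
    (hy : ∀ᶠ z in 𝓝 y, χ z = 1) :
    D f y = ∑ a, D (coordFn x χ hχ a) y * chartDer x χ hχ (EuclideanSpace.basisFun _ ℝ a) f y := by
  have hs : y ∈ (chartAt (EuclideanSpace ℝ (Fin m)) x).source :=
    hχ (mem_tsupport_of_ne (by rw [hy.self_of_nhds]; exact one_ne_zero))
  have hs' : y ∈ (extChartAt (𝓡 m) x).source := by rwa [extChartAt_source]
  -- Hadamard's lemma needs a function on the whole model space, so f in the chart is first cut off
  -- near y; derivations are local and do not notice this.
  obtain ⟨F, hF, hFf⟩ := exists_contDiff_eventuallyEq (isOpen_extChartAt_target x)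
    ((extChartAt (𝓡 m) x).map_source hs') (contMDiffOn_iff_contDiffOn.1
      (f.contMDiff.comp_contMDiffOn (contMDiffOn_extChartAt_symm x)))
  obtain ⟨G, hG, hFG, hG0⟩ := exists_eq_add_of_contDiff hF (extChartAt (𝓡 m) x y)
  let G' (a : Fin m) : Fn 𝕜 m M := chartFn x χ hχ (fun z => G z (EuclideanSpace.basisFun _ ℝ a))
    (hG.clm_apply contDiff_const)
  have hfy : F (extChartAt (𝓡 m) x y) = f y := by
    rw [hFf.self_of_nhds]
    exact congrArg f ((extChartAt (𝓡 m) x).left_inv hs')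
  have h1 : ∀ᶠ z in 𝓝 y, f z = (constFn m M (f y) + ∑ a, (coordFn x χ hχ a -
      constFn m M ((extChartAt (𝓡 m) x y a : ℝ) : 𝕜)) * G' a : Fn 𝕜 m M) z := by
    filter_upwards [hy, (chartAt (EuclideanSpace ℝ (Fin m)) x).open_source.mem_nhds hs,
      (continuousAt_extChartAt' hs').eventually hFf] with z h2 h3 h4
    have h5 : f z = F (extChartAt (𝓡 m) x z) := by
      rw [h4]
      exact congrArg f ((extChartAt (𝓡 m) x).left_inv (by rwa [extChartAt_source])).symm
    rw [h5, hFG, hfy]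
    change _ = f y + (∑ a, (coordFn x χ hχ a -
      constFn m M ((extChartAt (𝓡 m) x y a : ℝ) : 𝕜)) * G' a : Fn 𝕜 m M) z
    rw [sum_fn_apply]
    congr 1
    set w := extChartAt (𝓡 m) x z
    set w₀ := extChartAt (𝓡 m) x y
    have h6 := congrArg (G w) ((EuclideanSpace.basisFun (Fin m) ℝ).sum_repr (w - w₀))
    rw [← h6, map_sum]
    refine Finset.sum_congr rfl fun a _ => ?_
    change _ = (χ z * ((w a : ℝ) : 𝕜) - ((w₀ a : ℝ) : 𝕜)) * (χ z * _)
    rw [h2, one_mul, one_mul, map_smul, RCLike.real_smul_eq_coe_mul, EuclideanSpace.basisFun_repr,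
      ← RCLike.ofReal_sub]
    rfl
  rw [derivation_apply_congr D h1, map_add, derivation_constFn, zero_add, map_sum, sum_fn_apply]
  refine Finset.sum_congr rfl fun a _ => ?_
  rw [D.leibniz, map_sub, derivation_constFn, sub_zero]
  change (χ y * ((extChartAt (𝓡 m) x y a : ℝ) : 𝕜) - ((extChartAt (𝓡 m) x y a : ℝ) : 𝕜)) * _ +
    χ y * G (extChartAt (𝓡 m) x y) (EuclideanSpace.basisFun _ ℝ a) * _ = _
  rw [chartDer_apply, hy.self_of_nhds, one_mul, one_mul, one_mul, sub_self, zero_mul, zero_add, hG0,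
    hFf.fderiv_eq, mul_comm]
  rfl

/-- The m cut off coordinate derivations generate all derivations locally, so there are no forms of
degree m + 1, and df ∧ μ = 0. -/
theorem top_form_identity (μ : TopForm (Fn 𝕜 m M) m) (D : Derivation ℝ (Fn 𝕜 m M) (Fn 𝕜 m M))
    (f : Fn 𝕜 m M) (Y : Fin m → Derivation ℝ (Fn 𝕜 m M) (Fn 𝕜 m M)) :
    D f • μ Y = ∑ j, Y j f • μ (Function.update Y j D) := by
  let α : Derivation ℝ (Fn 𝕜 m M) (Fn 𝕜 m M) →ₗ[Fn 𝕜 m M] Fn 𝕜 m M :=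
    { toFun := fun D => D f
      map_add' := fun _ _ => rfl
      map_smul' := fun _ _ => rfl }
  refine top_identity (fun ρ => ?_) μ α D Y
  refine alt_eq_zero_of_generators (separated_fn (𝕜 := 𝕜) (m := m) (M := M)) m.lt_succ_self
    (fun x => ?_) ρ
  obtain ⟨χ, hχ1, hχ⟩ : ∃ χ ∈ nearOne 𝕜 m x, tsupport (fun y => χ y) ⊆
      (chartAt (EuclideanSpace ℝ (Fin m)) x).source :=
    exists_nearOne ((chartAt (EuclideanSpace ℝ (Fin m)) x).open_source.mem_nhds
      (mem_chart_source _ x))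
  obtain ⟨c, hc, hcχ⟩ := exists_nearOne (𝕜 := 𝕜) (m := m)
    (eventually_eventually_nhds.2 (mem_nearOne.1 hχ1))
  refine ⟨c, hc, fun a => chartDer x χ hχ (EuclideanSpace.basisFun _ ℝ a), fun D =>
    ⟨fun a => c * D (coordFn x χ hχ a), Derivation.ext fun g => ContMDiffMap.ext fun y => ?_⟩⟩
  have h1 : (∑ a, (c * D (coordFn x χ hχ a)) • chartDer x χ hχ (EuclideanSpace.basisFun _ ℝ a)) g =
      ∑ a, (c * D (coordFn x χ hχ a)) * chartDer x χ hχ (EuclideanSpace.basisFun _ ℝ a) g := by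
    rw [← Derivation.coeFnAddMonoidHom_apply, map_sum, Finset.sum_apply]
    rfl
  rw [h1, sum_fn_apply]
  change c y * D g y = ∑ a, c y * D (coordFn x χ hχ a) y * _
  by_cases hy : c y = 0
  · simp [hy]
  rw [derivation_apply x χ hχ D g (hcχ y (mem_tsupport_of_ne hy)), Finset.mul_sum]
  simp only [mul_assoc]

end Derivations

/-! ### From the manifold to the algebra -/

section Sections
variable {𝕜 : Type*} [RCLike 𝕜] {m n : ℕ} {M : Type*} [TopologicalSpace M]
  [ChartedSpace (EuclideanSpace ℝ (Fin m)) M] [IsManifold (𝓡 m) ∞ M] [T2Space M]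

theorem regular_of_hasFrames {E E' : Type*} [AddCommGroup E] [Module (Fn 𝕜 m M) E]
    [AddCommGroup E'] [Module (Fn 𝕜 m M) E'] {p : E →ₗ[Fn 𝕜 m M] E' →ₗ[Fn 𝕜 m M] Fn 𝕜 m M}
    (hp : HasFrames p n (nearOne 𝕜 m)) (S : M → Type*) [TopologicalSpace (TotalSpace 𝕜 S)]
    [∀ x, TopologicalSpace (S x)] [FiberBundle 𝕜 S] [∀ x, AddCommGroup (S x)]
    [∀ x, Module ℝ (S x)] [∀ x, Module 𝕜 (S x)] [VectorBundle ℝ 𝕜 S]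
    [VectorBundle 𝕜 𝕜 S] [ContMDiffVectorBundle ∞ 𝕜 S (𝓡 m)] :
    Regular p n m (nearOne 𝕜 m) Cₛ^∞⟮𝓡 m; 𝕜, S⟯ where
  absorbing := absorbing_nearOne
  frames := hp
  sepFun := separated_fn
  glueFun := gluing_fn
  sep := separated_section
  glue := gluing_section
  line := isLine_section
  top := top_form_identity

variable {E E' : Type*} [AddCommGroup E] [Module (Fn 𝕜 m M) E] [AddCommGroup E']
  [Module (Fn 𝕜 m M) E'] {p : E →ₗ[Fn 𝕜 m M] E' →ₗ[Fn 𝕜 m M] Fn 𝕜 m M}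

theorem mem_germ_of_eq_zero {P : Type*} [AddCommGroup P] [Module (Fn 𝕜 m M) P] {U : Set M}
    (hU : IsOpen U) {x : M} (hx : x ∈ U) {k : ℕ} {ρ : P [⋀^Fin k]→ₗ[Fn 𝕜 m M] Fn 𝕜 m M}
    (h : ∀ y ∈ U, ∀ X, ρ X y = 0) : ρ ∈ germ (nearOne 𝕜 m) x (P [⋀^Fin k]→ₗ[Fn 𝕜 m M] Fn 𝕜 m M) := by
  obtain ⟨c, hc, hcU⟩ := exists_nearOne (𝕜 := 𝕜) (m := m) (hU.mem_nhds hx)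
  refine ⟨c, hc, AlternatingMap.ext fun X => ContMDiffMap.ext fun y => ?_⟩
  change c y * ρ X y = 0
  by_cases hy : c y = 0
  · rw [hy, zero_mul]
  · rw [h y (hcU y (mem_tsupport_of_ne hy)), mul_zero]

theorem mem_germ_top_of_eq {P : Type*} [AddCommGroup P] [Module (Fn 𝕜 m M) P] {U : Set M}
    (hU : IsOpen U) {x : M} (hx : x ∈ U) {k : ℕ}
    {ρ ρ' : P [⋀^Fin k]→ₗ[Fn 𝕜 m M] TopForm (Fn 𝕜 m M) m}
    (h : ∀ y ∈ U, ∀ X D, ρ X D y = ρ' X D y) :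
    ρ - ρ' ∈ germ (nearOne 𝕜 m) x (P [⋀^Fin k]→ₗ[Fn 𝕜 m M] TopForm (Fn 𝕜 m M) m) := by
  obtain ⟨c, hc, hcU⟩ := exists_nearOne (𝕜 := 𝕜) (m := m) (hU.mem_nhds hx)
  refine sub_mem_germ.2 ⟨c, hc, AlternatingMap.ext fun X => AlternatingMap.ext fun D =>
    ContMDiffMap.ext fun y => ?_⟩
  change c y * ρ X D y = c y * ρ' X D y
  by_cases hy : c y = 0
  · rw [hy, zero_mul, zero_mul]
  · rw [h y (hcU y (mem_tsupport_of_ne hy))]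

theorem IsModularData.eq_apply [p.IsPerfPair] (hp : HasFrames p n (nearOne 𝕜 m)) {L : Type*}
    [AddCommGroup L] [Module (Fn 𝕜 m M) L] (H : Regular p n m (nearOne 𝕜 m) L)
    {𝔞 : LieAlgebroid (Fn 𝕜 m M) E} {𝔟 : LieAlgebroid (Fn 𝕜 m M) E'}
    (q : L ⊗[Fn 𝕜 m M] L ≃ₗ[Fn 𝕜 m M] E [⋀^Fin n]→ₗ[Fn 𝕜 m M] TopForm (Fn 𝕜 m M) m)
    {φ : Fn 𝕜 m M} (h : ∀ w, dirac p 𝔞 𝔟 q (dirac p 𝔞 𝔟 q w) = φ • w)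
    {U : Set M} {Ω : E [⋀^Fin n]→ₗ[Fn 𝕜 m M] Fn 𝕜 m M} {V : E' [⋀^Fin n]→ₗ[Fn 𝕜 m M] Fn 𝕜 m M}
    {s : TopForm (Fn 𝕜 m M) m} {X₀ : E} {ξ₀ : E'} {g : Fn 𝕜 m M}
    (hm : IsModularData p 𝔞 𝔟 U Ω V s X₀ ξ₀ g) {x : M} (hx : x ∈ U) :
    φ x = 1 / 2 * (1 / 2 * p X₀ ξ₀ x - g x) := by
  have hU : ∀ᶠ y in 𝓝 x, y ∈ U := hm.isOpen.mem_nhds hx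
  have key : 4 * φ - (p X₀ ξ₀ - 2 * g) ∈ germ (nearOne 𝕜 m) x (Fn 𝕜 m M) := by
    refine H.dirac_modular 𝔞 𝔟 q hasRoots_nearOne h (Ω := Ω) (V := V) (s := s)
      (fun f ψ hψ => ?_) (fun X θ => ?_) (fun θ => ?_) ?_ ?_
    -- If f(x) = 0, then Ω ⊗ s = f ψ vanishes at x, although Ω e is nonzero there by ⟨Ω, V⟩ = 1 and
    -- s is a volume form. So f is invertible near x.
    · refine exists_mul_sub_one_mem_germ fun hf => ?_
      obtain ⟨D, hD⟩ := hm.volume x hx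
      obtain ⟨c, hc, e, ε, hfr⟩ := hp x
      have h1 : V ε x * Ω e x = 1 := by
        have h2 : V ε x * Ω e x = wedgeSec p n e ε x := by
          rw [wedgeSec_apply]
          exact hm.dual x hx e ε
        have h3 := congrArg (fun f : Fn 𝕜 m M => f x) hfr.wedgeSec_eq
        have h4 : (c ^ n) x * wedgeSec p n e ε x = (c ^ n) x := h3
        rwa [nearOne_apply (pow_mem hc n), one_mul, ← h2] at h4
      obtain ⟨c', hc', h2⟩ := sub_mem_germ.1 hψ
      have h3 : c' x * (Ω e x * s D x) = c' x * (f x * ψ e D x) :=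
        congrArg (fun r : E [⋀^Fin n]→ₗ[Fn 𝕜 m M] TopForm (Fn 𝕜 m M) m => r e D x) h2
      rw [nearOne_apply hc', one_mul, one_mul, hf, zero_mul] at h3
      exact mul_ne_zero (right_ne_zero_of_mul_eq_one h1) hD h3
    · refine mem_germ_nearOne.2 ?_
      filter_upwards [hU] with y hy
      exact sub_eq_zero.2 (hm.dual y hy X θ)
    · exact mem_germ_top_of_eq hm.isOpen hx fun y hy X D => hm.modular y hy θ X D
    · exact mem_germ_top_of_eq hm.isOpen hx fun y hy θ D => hm.modular_star y hy X₀ θ D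
    · refine mem_germ_of_eq_zero hm.isOpen hx fun y hy X => ?_
      have h1 := hm.del y hy X
      change _ = -(g y * Ω X y) at h1
      exact (congrArg (· + g y * Ω X y) h1).trans (neg_add_cancel _)
  -- The numerals are expanded into sums, whose evaluation at x is termwise.
  have h0 : 4 * φ - (p X₀ ξ₀ - 2 * g) = φ + φ + φ + φ - (p X₀ ξ₀ - (g + g)) := by ring
  rw [h0] at key
  have h1 : φ x + φ x + φ x + φ x - (p X₀ ξ₀ x - (g x + g x)) = 0 := germ_apply_eq_zero key
  linear_combination (1 / 4 : 𝕜) * h1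

end Sections

end
end LieBialgd

theorem theorem2p1 {𝕜 : Type*} [RCLike 𝕜] {m n : ℕ}
    -- a smooth manifold `M` of dimension `m`
    {M : Type*} [TopologicalSpace M] [ChartedSpace (EuclideanSpace ℝ (Fin m)) M]
    [IsManifold (𝓡 m) ∞ M] [T2Space M] [SecondCountableTopology M]
    -- a smooth real or complex vector bundle `A` of rank `n`
    {A : M → Type*} [TopologicalSpace (TotalSpace (Fin n → 𝕜) A)]
    [∀ x, TopologicalSpace (A x)] [FiberBundle (Fin n → 𝕜) A] [∀ x, AddCommGroup (A x)]
    [∀ x, Module ℝ (A x)] [∀ x, Module 𝕜 (A x)] [VectorBundle ℝ (Fin n → 𝕜) A]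
    [VectorBundle 𝕜 (Fin n → 𝕜) A] [ContMDiffVectorBundle ∞ (Fin n → 𝕜) A (𝓡 m)]
    -- a line bundle `S`, the square root of `∧ⁿA* ⊗ ∧ᵐT*M`
    {S : M → Type*} [TopologicalSpace (TotalSpace 𝕜 S)]
    [∀ x, TopologicalSpace (S x)] [FiberBundle 𝕜 S] [∀ x, AddCommGroup (S x)]
    [∀ x, Module ℝ (S x)] [∀ x, Module 𝕜 (S x)] [VectorBundle ℝ 𝕜 S]
    [VectorBundle 𝕜 𝕜 S] [ContMDiffVectorBundle ∞ 𝕜 S (𝓡 m)]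
    -- a line bundle `S'`, the square root of `∧ⁿA ⊗ ∧ᵐT*M`
    {S' : M → Type*} [TopologicalSpace (TotalSpace 𝕜 S')]
    [∀ x, TopologicalSpace (S' x)] [FiberBundle 𝕜 S'] [∀ x, AddCommGroup (S' x)]
    [∀ x, Module ℝ (S' x)] [∀ x, Module 𝕜 (S' x)] [VectorBundle ℝ 𝕜 S']
    [VectorBundle 𝕜 𝕜 S'] [ContMDiffVectorBundle ∞ 𝕜 S' (𝓡 m)]
    (𝔞 : LieAlgebroid (Fn 𝕜 m M) Cₛ^∞⟮𝓡 m; Fin n → 𝕜, A⟯)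
    (𝔟 : LieAlgebroid (Fn 𝕜 m M) (Module.Dual (Fn 𝕜 m M) Cₛ^∞⟮𝓡 m; Fin n → 𝕜, A⟯))
    (q : Cₛ^∞⟮𝓡 m; 𝕜, S⟯ ⊗[Fn 𝕜 m M] Cₛ^∞⟮𝓡 m; 𝕜, S⟯ ≃ₗ[Fn 𝕜 m M]
      Cₛ^∞⟮𝓡 m; Fin n → 𝕜, A⟯ [⋀^Fin n]→ₗ[Fn 𝕜 m M] TopForm (Fn 𝕜 m M) m)
    (q' : Cₛ^∞⟮𝓡 m; 𝕜, S'⟯ ⊗[Fn 𝕜 m M] Cₛ^∞⟮𝓡 m; 𝕜, S'⟯ ≃ₗ[Fn 𝕜 m M]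
      Module.Dual (Fn 𝕜 m M) Cₛ^∞⟮𝓡 m; Fin n → 𝕜, A⟯
        [⋀^Fin n]→ₗ[Fn 𝕜 m M] TopForm (Fn 𝕜 m M) m) :
    let p := (Module.Dual.eval (Fn 𝕜 m M) Cₛ^∞⟮𝓡 m; Fin n → 𝕜, A⟯)
    (IsLieBialgebroid p 𝔞 𝔟 ↔
      ∃ φ : Fn 𝕜 m M, ∀ w, dirac p 𝔞 𝔟 q (dirac p 𝔞 𝔟 q w) = φ • w) ∧
    ∀ φ : Fn 𝕜 m M, (∀ w, dirac p 𝔞 𝔟 q (dirac p 𝔞 𝔟 q w) = φ • w) →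
      (∀ w, dirac p.flip 𝔟 𝔞 q' (dirac p.flip 𝔟 𝔞 q' w) = φ • w) ∧
      ∀ U Ω V s X₀ ξ₀ g, IsModularData (n := n) p 𝔞 𝔟 U Ω V s X₀ ξ₀ g →
        ∀ x ∈ U, φ x = 1 / 2 * (1 / 2 * ξ₀ X₀ x - g x) := by
  intro p
  have hp : HasFrames p n (nearOne 𝕜 m) := hasFrames_section
  have H : Regular p n m (nearOne 𝕜 m) Cₛ^∞⟮𝓡 m; 𝕜, S⟯ := regular_of_hasFrames hp S
  have H' : Regular p.flip n m (nearOne 𝕜 m) Cₛ^∞⟮𝓡 m; 𝕜, S'⟯ := regular_of_hasFrames hp.flip S'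
  refine ⟨H.isLieBialgebroid_iff 𝔞 𝔟 q, fun φ h => ⟨?_, ?_⟩⟩
  · exact H.dirac_flip H' 𝔞 𝔟 q q' hasRoots_nearOne h
  · intro U Ω V s X₀ ξ₀ g hm x hx
    exact hm.eq_apply hp H q h hx
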